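/- **The operad $RL_2$.** Let $RL_2$ be the following symmetric coloured operad in sets. Its colours are the natural numbers $n\ge 0$ (closed colours) and the underlined natural numbers $\underline n$ (open colours); write $\tilde n$ for $n$ or $\underline n$. An element of $RL_2(\tilde n_1,\dots,\tilde n_k;\tilde n)$ is a word that contains each letter $i\in\{1,\dots,k\}$ exactly $n_i+1$ times and exactly $n$ vertical bars (that is, a lattice path, a bi-pointed functor $[n+1]\to[n_1+1]\otimes\cdots\otimes[n_k+1]$ into the free category on the grid), subject to the conditions below; if $\tilde n$ is closed and some $\tilde n_i$ is open, there are no elements. For $i\neq j$ let $c_{ij}$ be the number of changes of letter in the subword of the letters $i,j$. It is required that $c_{ij}\le 2$ if $\tilde n_i,\tilde n_j$ are closed, that $c_{ij}\le 1$ if both are open, and, if $\tilde n_i$ is closed and $\tilde n_j$ is open, that $c_{ij}\le 2$ if the first $i$ precedes the first $j$, and $c_{ij}+1\le 2$ otherwise. The partial composition $x\circ_i y$ replaces the successive occurrences of $i$ in $x$ with the successive subwords of $y$ between its bars (with the usual renumbering of letters), symmetric groups permute the letters, and the unit of colour $\tilde n$ is $1|1|\cdots|1$ with $n$ bars. **Algebras.**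 Let $\mathcal C$ be a cocomplete closed symmetric monoidal category with a zero object and unit object $1$. A set $E$ is regarded as the object $\coprod_{e\in E}1$ of $\mathcal C$. An $RL_2$-algebra in $\mathcal C$ is a family of objects $X(\tilde n)$ with action maps $RL_2(\tilde n_1,\dots,\tilde n_k;\tilde n)\otimes X(\tilde n_1)\otimes\cdots\otimes X(\tilde n_k)\to X(\tilde n)$ that satisfy the unit, associativity and equivariance axioms. **The category $\mathcal E$.** Let $As$ be the non-symmetric operad in $\mathcal C$ with $As(n)=1$ for all $n\ge 0$. Objects of $\mathcal E$ are pairs $(M,Z)$ with the following structure. 1. $M$ is a multiplicative operad: a non-symmetric operad $M=(M(n))_{n\ge0}$ in $\mathcal C$ with a morphism of operads $u:As\to M$. 2. $Z=(Z(n))_{n\ge 0}$ is a stable wide left $M$-module. *Wide left module* means: for finite ordered sets $A'\subseteq A$ (equality allowed) and an order preserving map $\alpha:B\to A\setminus A'$ there is a map $\lambda'_\alpha:M(A)\otimes\bigotimes_{a\in A\setminus A'}Z(\alpha^{-1}(a))\to Z(B\sqcup A')$ (inputs in $A\setminus A'$ are filled, inputs in $A'$ remain), where objects are indexed by cardinality,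 such that the unit of $M(1)$ acts as the identity of $Z(n)$ and $\lambda'(x;\dots,\lambda'(y;\dots),\dots)=\lambda'(x\circ_a y;\dots)$, where $\lambda'(y;\dots)$ fills the input $a$ of $x$. *Stable* means: there are maps $\iota_n:M(n)\to Z(n)$ with $\lambda'_\alpha(x;\iota(y_1),\dots,\iota(y_s))=\iota(x\circ_\alpha(y_1,\dots,y_s))$, where $\circ_\alpha$ is the operadic composition at the inputs in $A\setminus A'$. 3. $Z$ is a right $As$-module, and this right action is compatible with the wide left action of $M$: for $x\in M(A)$ and $a\in As(l)$, $\lambda'(x;\dots,z,\dots)\circ a=\lambda'(x;\dots,z\circ a,\dots)$ if $a$ is inserted into an input of $z$, and $\lambda'(x;\dots)\circ_j a=\lambda'(x\circ_j u(a);\dots)$ if $a$ is inserted into a remaining input $j\in A'$. (In particular $Z$, with the left action restricted along $u$, is a wide bimodule over $As$: a wide left and right $As$-module whose two actions are compatible in this sense.) Morphisms $(M,Z)\to(M',Z')$ are pairs $(f,g)$ of a morphism of multiplicative operads $f:M\to M'$ and a family of maps $g_n:Z(n)\to Z'(n)$ compatible with the maps $\lambda'$ and $\iota$ (over $f$) and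 with the right $As$-actions. **Claim.** The category of $RL_2$-algebras in $\mathcal C$ is isomorphic to $\mathcal E$. More precisely there is an isomorphism of categories that takes an algebra $X$ to a pair $(M,Z)$ with $M(n)=X(n)$ and $Z(n)=X(\underline n)$ and that is the identity on the underlying families of maps. -/

import Mathlib

open CategoryTheory MonoidalCategory Limits

universe v u

namespace SwissCheese

/-! ### Colours and integer-strings -/

/-- The colours: a natural number `n` (closed), or an underlined natural number (open). -/
inductive Colour : Type
  | closed (n : ℕ)
  | opened (n : ℕ)

/-- The underlying natural number of a colour. -/
def Colour.arity : Colour → ℕ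
  | closed n => n
  | opened n => n

/-- Whether a colour is underlined. -/
def Colour.isOpen : Colour → Bool
  | closed _ => false
  | opened _ => true

/-- Integer-strings with vertical bars: `some i` is an edge of a lattice path in the direction of
the `i`-th axis (directions are numbered from `0`), and `none` is a vertical bar, which marks the
position on the path of one of the objects `x(1), …, x(n)`. -/
abbrev Word : Type := List (Option ℕ)

/-- Auxiliary to `proj`. -/
def side (i j : ℕ) : Option ℕ → Option Bool
  | none => none
  | some a => if a = i then some true else if a = j then some false else none

/-- The projection of a lattice path to the plane of the directions `i` and `j`: the sequence of
its edges, where `true` is an edge in direction `i` and `false` an edge in direction `j`. -/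
def proj (i j : ℕ) (w : Word) : List Bool := w.filterMap (side i j)

/-- The number of changes of direction of a plane lattice path, after a first edge `b`. -/
def turnsFrom : Bool → List Bool → ℕ
  | _, [] => 0
  | b, a :: l => (if a = b then 0 else 1) + turnsFrom a l

/-- The number of changes of direction of a plane lattice path. -/
def turns : List Bool → ℕ
  | [] => 0
  | a :: l => turnsFrom a l

/-- The number `c_{ij}` of changes of direction of the projection to the directions `i` and `j`. -/
def complexity (i j : ℕ) (w : Word) : ℕ := turns (proj i j w)

/-- The number `c'_{ij}`, for a closed direction `i` and an open direction `j`: it is `c_{ij}` if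
the first edge in direction `i` precedes the first edge in direction `j`, and `c_{ij} + 1` if the
first edge in direction `j` comes first. -/
def complexity' (i j : ℕ) (w : Word) : ℕ :=
  complexity i j w + if (proj i j w).head? = some false then 1 else 0

/-- The integer-string `w` represents an element of `RL(n₀, …, n_{k-1}; n)`, that is, a bi-pointed
functor from `[n + 1]` to the tensor product of the categories `[n_i + 1]`: a path in the grid made
of `n_i + 1` edges in each direction `i`, with `n` marked points. If the output is closed, then
there are no such elements unless all inputs are closed. -/
structure IsRL (cs : List Colour) (d : Colour) (w : Word) : Prop where
  colour : d.isOpen = false → ∀ c ∈ cs, c.isOpen = false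
  bars : w.count none = d.arity
  letters : ∀ i, w.count (some i) = (cs[i]?).elim 0 fun c => c.arity + 1

/-- The `m`-th stage of the filtration of `RL` (for `m ≥ 1`). The first two conditions are
symmetric in `i` and `j`; the third one covers the two mixed cases. -/
structure IsRLStage (m : ℕ) (cs : List Colour) (d : Colour) (w : Word) : Prop
    extends IsRL cs d w where
  closed_closed : ∀ i j a b, i ≠ j → cs[i]? = some a → cs[j]? = some b →
    a.isOpen = false → b.isOpen = false → complexity i j w ≤ m
  open_open : ∀ i j a b, i ≠ j → cs[i]? = some a → cs[j]? = some b →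
    a.isOpen = true → b.isOpen = true → complexity i j w + 1 ≤ m
  closed_open : ∀ i j a b, i ≠ j → cs[i]? = some a → cs[j]? = some b →
    a.isOpen = false → b.isOpen = true → complexity' i j w ≤ m

/-- The string `0|0|⋯|0` with `n` bars. -/
def idWord : ℕ → Word
  | 0 => [some 0]
  | n + 1 => some 0 :: none :: idWord n

/-- The subsequences of letters of a string that are separated by its bars. -/
def blocks : Word → List (List ℕ)
  | [] => [[]]
  | none :: w => [] :: blocks w
  | some a :: w => (blocks w).modifyHead (List.cons a)

/-- Renumbering of the directions other than `p`, when the direction `p` is replaced with `l`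
directions `p, …, p + l - 1`. -/
def shiftOuter (p l j : ℕ) : ℕ := if j < p then j else j - 1 + l

/-- Substitute the successive blocks of letters (renumbered by `· + p`) for the successive
occurrences of the letter `p`, and renumber the other letters. -/
def graft (p l : ℕ) : Word → List (List ℕ) → Word
  | [], _ => []
  | none :: w, bs => none :: graft p l w bs
  | some j :: w, bs =>
    if j = p then
      (bs.headD []).map (fun k => some (k + p)) ++ graft p l w bs.tail
    else some (shiftOuter p l j) :: graft p l w bs

/-- The composition `x ∘_p y` of integer-strings, where `y` has `l` inputs: the successive
occurrences of `p` in `x` are replaced with the subsequences of `y` between its bars. -/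
def substWord (p l : ℕ) (x y : Word) : Word := graft p l x (blocks y)

/-- The exchange of the letters `p` and `p + 1`. -/
def swapWord (p : ℕ) (w : Word) : Word := w.map (Option.map (Equiv.swap p (p + 1)))

/-! #### The stages of the filtration are closed under the operations -/

theorem isRLStage_idWord (m : ℕ) (c : Colour) : IsRLStage m [c] c (idWord c.arity) := by
  have h1 : ∀ n, (idWord n).count none = n := by
    intro n
    induction n with
    | zero => simp [idWord]
    | succ n ih => simp [idWord, ih]
  have h2 : ∀ n i, (idWord n).count (some i) = if i = 0 then n + 1 else 0 := by
    intro n i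
    induction n with
    | zero =>
      by_cases h : i = 0
      · simp [idWord, h]
      · simp [idWord, h, Ne.symm h]
    | succ n ih =>
      simp only [idWord, List.count_cons, ih]
      by_cases h : i = 0
      · simp [h]
      · simp [h, Ne.symm h]
  refine ⟨⟨by simp, h1 _, ?_⟩, ?_, ?_, ?_⟩
  · intro i
    rw [h2]
    cases i <;> simp
  all_goals
    intro i j a b hij hi hj
    exfalso
    rcases i with _ | i <;> rcases j with _ | j <;> simp_all

theorem turnsFrom_not (b : Bool) (l : List Bool) :
    turnsFrom (!b) (l.map not) = turnsFrom b l := by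
  induction l generalizing b with
  | nil => rfl
  | cons a l ih =>
    simp only [List.map_cons, turnsFrom, ih]
    cases a <;> cases b <;> rfl

theorem turns_not (l : List Bool) : turns (l.map not) = turns l := by
  cases l with
  | nil => rfl
  | cons a l => exact turnsFrom_not a l

theorem side_symm {i j : ℕ} (h : i ≠ j) (o : Option ℕ) : side j i o = (side i j o).map not := by
  cases o with
  | none => rfl
  | some a =>
    simp only [side]
    split_ifs <;> simp_all

theorem proj_symm {i j : ℕ} (h : i ≠ j) (w : Word) : proj j i w = (proj i j w).map not := by
  induction w with
  | nil => rfl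
  | cons o w ih =>
    simp only [proj] at ih ⊢
    rw [List.filterMap_cons, List.filterMap_cons, side_symm h, ih]
    cases side i j o <;> rfl

theorem complexity_symm {i j : ℕ} (h : i ≠ j) (w : Word) :
    complexity j i w = complexity i j w := by
  rw [complexity, proj_symm h, turns_not, complexity]

theorem count_swapWord (p i : ℕ) (w : Word) :
    (swapWord p w).count (some i) = w.count (some (Equiv.swap p (p + 1) i)) := by
  have h := List.count_map_of_injective w _
    (Option.map_injective (Equiv.swap p (p + 1)).injective) (some (Equiv.swap p (p + 1) i))
  simpa [swapWord] using h

theorem proj_swapWord (p i j : ℕ) (w : Word) :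
    proj i j (swapWord p w) =
      proj (Equiv.swap p (p + 1) i) (Equiv.swap p (p + 1) j) w := by
  simp only [proj, swapWord, List.filterMap_map]
  congr 1
  funext o
  cases o with
  | none => rfl
  | some a =>
    simp only [side, Function.comp, Option.map, Equiv.swap_apply_eq_iff]

theorem getElem?_swap (pre post : List Colour) (a b : Colour) (i : ℕ) :
    (pre ++ b :: a :: post)[i]? =
      (pre ++ a :: b :: post)[Equiv.swap pre.length (pre.length + 1) i]? := by
  rcases lt_trichotomy i pre.length with h | h | h
  · rw [Equiv.swap_apply_of_ne_of_ne (by omega) (by omega)]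
    simp [List.getElem?_append_left h]
  · subst h
    simp
  · obtain ⟨k, rfl⟩ := Nat.exists_eq_add_of_lt h
    rcases k with _ | k
    · simp
    · rw [Equiv.swap_apply_of_ne_of_ne (by omega) (by omega)]
      rw [List.getElem?_append_right (by omega), List.getElem?_append_right (by omega)]
      have : pre.length + (k + 1) + 1 - pre.length = k + 2 := by omega
      simp [this]

theorem IsRLStage.swap {m : ℕ} {pre post : List Colour} {a b d : Colour} {w : Word}
    (h : IsRLStage m (pre ++ a :: b :: post) d w) :
    IsRLStage m (pre ++ b :: a :: post) d (swapWord pre.length w) := by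
  refine ⟨⟨fun hd c hc => h.colour hd c ?_, ?_, fun i => ?_⟩, ?_, ?_, ?_⟩
  · simp only [List.mem_append, List.mem_cons] at hc ⊢
    tauto
  · rw [← h.bars]
    have := List.count_map_of_injective w _
      (Option.map_injective (Equiv.swap pre.length (pre.length + 1)).injective) none
    simpa [swapWord] using this
  · rw [count_swapWord, h.letters, ← getElem?_swap]
  · intro i j a' b' hij hi hj
    rw [getElem?_swap] at hi hj
    simp only [complexity, proj_swapWord]
    exact h.closed_closed _ _ _ _ (by simpa using hij) hi hj
  · intro i j a' b' hij hi hj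
    rw [getElem?_swap] at hi hj
    simp only [complexity, proj_swapWord]
    exact h.open_open _ _ _ _ (by simpa using hij) hi hj
  · intro i j a' b' hij hi hj
    rw [getElem?_swap] at hi hj
    simp only [complexity', complexity, proj_swapWord]
    exact h.closed_open _ _ _ _ (by simpa using hij) hi hj

theorem blocks_ne_nil (w : Word) : blocks w ≠ [] := by
  induction w with
  | nil => simp [blocks]
  | cons o w ih =>
    cases o with
    | none => simp [blocks]
    | some a =>
      simp only [blocks]
      cases h : blocks w with
      | nil => exact absurd h ih
      | cons => simp

theorem length_blocks (w : Word) : (blocks w).length = w.count none + 1 := by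
  induction w with
  | nil => simp [blocks]
  | cons o w ih => cases o <;> simp [blocks, ih]

theorem flatten_blocks (w : Word) : (blocks w).flatten = w.reduceOption := by
  induction w with
  | nil => simp [blocks]
  | cons o w ih =>
    cases o with
    | none => simpa [blocks] using ih
    | some a =>
      simp only [blocks, List.reduceOption_cons_of_some]
      rw [← ih]
      cases h : blocks w with
      | nil => exact absurd h (blocks_ne_nil w)
      | cons => simp

theorem shiftOuter_inj {p l i j : ℕ} (hi : i ≠ p) (hj : j ≠ p) :
    shiftOuter p l i = shiftOuter p l j ↔ i = j := by
  unfold shiftOuter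
  split_ifs <;> omega

theorem shiftOuter_ne {p l i k : ℕ} (hi : i ≠ p) (hk : k < l) : k + p ≠ shiftOuter p l i := by
  unfold shiftOuter
  split_ifs <;> omega

theorem count_none_graft (p l : ℕ) (w : Word) (bs : List (List ℕ)) :
    (graft p l w bs).count none = w.count none := by
  induction w generalizing bs with
  | nil => rfl
  | cons o w ih =>
    cases o with
    | none => simp [graft, ih]
    | some j =>
      simp only [graft]
      split_ifs
      · simp [ih, List.count_eq_zero]
      · simp [ih]

theorem mem_headD {bs : List (List ℕ)} {P : ℕ → Prop} (hbs : ∀ b ∈ bs, ∀ k ∈ b, P k) :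
    (∀ k ∈ bs.headD [], P k) ∧ ∀ b ∈ bs.tail, ∀ k ∈ b, P k := by
  cases bs with
  | nil => simp
  | cons b bs => exact ⟨hbs b (by simp), fun b' hb' => hbs b' (by simp at hb' ⊢; tauto)⟩

theorem count_outer_graft {p l i : ℕ} (hi : i ≠ p) (w : Word) (bs : List (List ℕ))
    (hbs : ∀ b ∈ bs, ∀ k ∈ b, k < l) :
    (graft p l w bs).count (some (shiftOuter p l i)) = w.count (some i) := by
  induction w generalizing bs with
  | nil => rfl
  | cons o w ih =>
    cases o with
    | none => simpa [graft] using ih bs hbs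
    | some j =>
      obtain ⟨h1, h2⟩ := mem_headD hbs
      simp only [graft]
      split_ifs with hj
      · rw [List.count_append, ih _ h2, List.count_eq_zero.2, List.count_cons_of_ne]
        · simp
        · simpa [hj] using Ne.symm hi
        · simp only [List.mem_map, not_exists, not_and, Option.some.injEq]
          exact fun k hk => shiftOuter_ne hi (h1 k hk)
      · simp only [List.count_cons, ih _ hbs]
        simp [shiftOuter_inj hj hi]

theorem count_inner_graft {p l k : ℕ} (hk : k < l) (w : Word) (bs : List (List ℕ))
    (hw : w.count (some p) = bs.length) :
    (graft p l w bs).count (some (k + p)) = bs.flatten.count k := by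
  induction w generalizing bs with
  | nil =>
    have : bs = [] := by simpa using hw.symm
    simp [this, graft]
  | cons o w ih =>
    cases o with
    | none => simpa [graft] using ih bs (by simpa using hw)
    | some j =>
      simp only [graft]
      split_ifs with hj
      · subst hj
        cases bs with
        | nil => simp at hw
        | cons b bs =>
          rw [List.count_append, List.tail_cons, ih bs (by simpa using hw)]
          simp only [List.headD_cons, List.flatten_cons, List.count_append]
          congr 1
          exact List.count_map_of_injective b (fun k => some (k + j))
            (fun a b h => by simpa using h) k
      · rw [List.count_cons_of_ne, ih bs]
        · rwa [List.count_cons_of_ne (by simpa using hj)] at hw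
        · simpa using (shiftOuter_ne hj hk).symm

theorem proj_outer_graft {p l i j : ℕ} (hi : i ≠ p) (hj : j ≠ p) (w : Word)
    (bs : List (List ℕ)) (hbs : ∀ b ∈ bs, ∀ k ∈ b, k < l) :
    proj (shiftOuter p l i) (shiftOuter p l j) (graft p l w bs) = proj i j w := by
  induction w generalizing bs with
  | nil => rfl
  | cons o w ih =>
    simp only [proj] at ih ⊢
    cases o with
    | none => simpa [graft, side, List.filterMap_cons] using ih bs hbs
    | some a =>
      obtain ⟨h1, h2⟩ := mem_headD hbs
      simp only [graft]
      split_ifs with ha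
      · rw [List.filterMap_append, ih _ h2, List.filterMap_cons]
        rw [List.filterMap_eq_nil_iff.2]
        · simp [side, ha, hi.symm, hj.symm]
        · simp only [List.mem_map, forall_exists_index, and_imp]
          rintro _ k hk rfl
          simp [side, shiftOuter_ne hi (h1 k hk), shiftOuter_ne hj (h1 k hk)]
      · rw [List.filterMap_cons, List.filterMap_cons, ih _ hbs]
        simp [side, shiftOuter_inj ha hi, shiftOuter_inj ha hj]

theorem proj_inner_graft {p l i j : ℕ} (hi : i < l) (hj : j < l) (w : Word)
    (bs : List (List ℕ)) (hw : w.count (some p) = bs.length) :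
    proj (i + p) (j + p) (graft p l w bs) = proj i j (bs.flatten.map some) := by
  induction w generalizing bs with
  | nil =>
    have : bs = [] := by simpa using hw.symm
    simp [this, graft, proj]
  | cons o w ih =>
    simp only [proj] at ih ⊢
    cases o with
    | none => simpa [graft, side, List.filterMap_cons] using ih bs (by simpa using hw)
    | some a =>
      simp only [graft]
      split_ifs with ha
      · subst ha
        cases bs with
        | nil => simp at hw
        | cons b bs =>
          rw [List.filterMap_append, List.tail_cons, ih bs (by simpa using hw)]
          simp only [List.headD_cons, List.flatten_cons, List.map_append, List.filterMap_append]
          congr 1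
          rw [List.filterMap_map, List.filterMap_map]
          congr 1
          funext k
          simp [side]
      · rw [List.filterMap_cons, ih bs]
        · simp [side, (shiftOuter_ne ha hi).symm, (shiftOuter_ne ha hj).symm]
        · rwa [List.count_cons_of_ne (by simpa using ha)] at hw

/-- `Blow l r`: the list `r` is obtained from `l` by replacing each `false` with some number of
copies of `false`. -/
inductive Blow : List Bool → List Bool → Prop
  | nil : Blow [] []
  | keep {l r} : Blow l r → Blow (true :: l) (true :: r)
  | blow {l r} (n : ℕ) : Blow l r → Blow (false :: l) (List.replicate n false ++ r)

theorem Blow.turnsFrom_le {l r : List Bool} (h : Blow l r) (b : Bool) :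
    turnsFrom b r ≤ turnsFrom b l := by
  induction h generalizing b with
  | nil => rfl
  | keep _ ih => simpa [turnsFrom] using ih true
  | @blow l r n h ih =>
    have key : ∀ n, turnsFrom false (List.replicate n false ++ r) = turnsFrom false r := by
      intro n
      induction n with
      | zero => rfl
      | succ n ih => simpa [List.replicate_succ, turnsFrom] using ih
    cases n with
    | succ n => simpa [List.replicate_succ, turnsFrom, key] using ih false
    | zero =>
      have h2 : turnsFrom b r ≤ (if false = b then 0 else 1) + turnsFrom false r := by
        cases r with
        | nil => simp [turnsFrom]
        | cons a r => cases a <;> cases b <;> (simp [turnsFrom]; try omega)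
      have h3 := ih false
      simp only [List.replicate_zero, List.nil_append, turnsFrom] at h2 ⊢
      omega

/-- If the first `false` becomes preceded by a `true`, then a change of direction is lost. -/
theorem Blow.turns_le {l r : List Bool} (h : Blow l r) :
    turns r + (if l.head? = some false ∧ r.head? = some true then 1 else 0) ≤ turns l := by
  cases h with
  | nil => simp [turns]
  | keep h => simpa [turns] using h.turnsFrom_le true
  | @blow l r n h =>
    have h1 := (Blow.blow n h).turnsFrom_le false
    simp only [turnsFrom, if_true, zero_add] at h1
    change _ ≤ turnsFrom false l
    cases hr : List.replicate n false ++ r with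
    | nil => simp [turns]
    | cons a t =>
      rw [hr] at h1
      cases a
      · simpa [turns, turnsFrom] using h1
      · simp only [turnsFrom] at h1
        simp only [turns, List.head?_cons, and_self, if_true]
        simp at h1
        omega

theorem Blow.head?_true {l r : List Bool} (h : Blow l r) (hr : r.head? = some false) :
    l.head? = some false := by
  cases h <;> simp_all

theorem Blow.head?_cases {l r : List Bool} (h : Blow l r) (hr : r.head? = some true) :
    l.head? = some true ∨ l.head? = some false := by
  cases h <;> simp_all

theorem Blow.turns_true_le {l r : List Bool} (h : Blow l r) :
    turns r + (if r.head? = some true then 1 else 0) ≤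
      turns l + (if l.head? = some true then 1 else 0) := by
  have h1 := h.turns_le
  by_cases h5 : r.head? = some true
  · rcases h.head?_cases h5 with h6 | h6 <;> simp_all
  · rw [if_neg h5]
    omega

theorem Blow.turns_false_le {l r : List Bool} (h : Blow l r) :
    turns r + (if r.head? = some false then 1 else 0) ≤
      turns l + (if l.head? = some false then 1 else 0) := by
  have h1 := h.turns_le
  by_cases h5 : r.head? = some false
  · rw [if_pos h5, if_pos (h.head?_true h5)]
    omega
  · rw [if_neg h5]
    omega

theorem complexity'_symm {i j : ℕ} (h : i ≠ j) (w : Word) : complexity' j i w =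
    turns (proj i j w) + (if (proj i j w).head? = some true then 1 else 0) := by
  have h3 : ∀ t : List Bool, (t.map not).head? = some false ↔ t.head? = some true := by
    intro t
    cases t <;> simp
  rw [complexity', complexity_symm h, proj_symm h, complexity]
  simp only [h3]

theorem blow_proj_graft {p l i k : ℕ} (hi : i ≠ p) (hk : k < l) (w : Word)
    (bs : List (List ℕ)) (hbs : ∀ b ∈ bs, ∀ k ∈ b, k < l) :
    Blow (proj i p w) (proj (shiftOuter p l i) (k + p) (graft p l w bs)) := by
  induction w generalizing bs with
  | nil => exact Blow.nil
  | cons o w ih =>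
    simp only [proj] at ih ⊢
    cases o with
    | none => simpa [graft, side, List.filterMap_cons] using ih bs hbs
    | some a =>
      obtain ⟨h1, h2⟩ := mem_headD hbs
      simp only [graft]
      split_ifs with ha
      · have hside : side i p (some a) = some false := by simp [side, ha, hi.symm]
        rw [List.filterMap_cons_some hside, List.filterMap_append]
        have hrep : ∀ b : List ℕ, (∀ k ∈ b, k < l) → ∃ n,
            List.filterMap (side (shiftOuter p l i) (k + p)) (b.map fun k => some (k + p)) =
              List.replicate n false := by
          intro b hb
          induction b with
          | nil => exact ⟨0, rfl⟩
          | cons c b ihb =>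
            obtain ⟨n, hn⟩ := ihb fun k hk => hb k (by simp [hk])
            have hc := shiftOuter_ne hi (hb c (by simp))
            rw [List.map_cons, List.filterMap_cons, hn]
            by_cases hck : c = k
            · refine ⟨n + 1, ?_⟩
              subst hck
              simp [side, hc, List.replicate_succ]
            · exact ⟨n, by simp [side, hc, hck]⟩
        obtain ⟨n, hn⟩ := hrep _ h1
        rw [hn]
        exact Blow.blow n (ih _ h2)
      · rw [List.filterMap_cons, List.filterMap_cons]
        by_cases hai : a = i
        · subst hai
          simpa [side] using Blow.keep (ih bs hbs)
        · simpa [side, shiftOuter_inj ha hi, hai, (shiftOuter_ne ha hk).symm, ha] using ih bs hbs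

theorem proj_reduceOption (i j : ℕ) (w : Word) :
    proj i j (w.reduceOption.map some) = proj i j w := by
  induction w with
  | nil => rfl
  | cons o w ih => cases o <;> simp_all [proj, side, List.filterMap_cons]

theorem count_reduceOption (k : ℕ) (w : Word) :
    w.reduceOption.count k = w.count (some k) := by
  induction w with
  | nil => rfl
  | cons o w ih => cases o <;> simp_all [List.count_cons]

/-- Every input of a composite is an input of one of the two factors. -/
theorem getElem?_subst (pre mid post : List Colour) (c : Colour) (a : ℕ) :
    (∃ k, k < mid.length ∧ a = k + pre.length ∧
        (pre ++ (mid ++ post))[a]? = mid[k]?) ∨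
      ∃ i, i ≠ pre.length ∧ a = shiftOuter pre.length mid.length i ∧
        (pre ++ (mid ++ post))[a]? = (pre ++ c :: post)[i]? := by
  by_cases h1 : a < pre.length
  · refine Or.inr ⟨a, by omega, by simp [shiftOuter, h1], ?_⟩
    rw [List.getElem?_append_left h1, List.getElem?_append_left h1]
  by_cases h2 : a < pre.length + mid.length
  · refine Or.inl ⟨a - pre.length, by omega, by omega, ?_⟩
    rw [List.getElem?_append_right (by omega), List.getElem?_append_left (by omega)]
  · refine Or.inr ⟨a - mid.length + 1, by omega, ?_, ?_⟩
    · unfold shiftOuter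
      split_ifs <;> omega
    · rw [List.getElem?_append_right (by omega), List.getElem?_append_right (by omega),
        List.getElem?_append_right (by omega)]
      have : a - mid.length + 1 - pre.length = a - pre.length - mid.length + 1 := by omega
      rw [this, List.getElem?_cons_succ]

theorem IsRLStage.subst {m : ℕ} {pre mid post : List Colour} {c d : Colour} {x y : Word}
    (hx : IsRLStage m (pre ++ c :: post) d x) (hy : IsRLStage m mid c y) :
    IsRLStage m (pre ++ (mid ++ post)) d (substWord pre.length mid.length x y) := by
  have hc : (pre ++ c :: post)[pre.length]? = some c := by simp
  have hbs : ∀ b ∈ blocks y, ∀ k ∈ b, k < mid.length := by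
    intro b hb k hk
    have h1 : k ∈ y.reduceOption := by
      rw [← flatten_blocks]
      exact List.mem_flatten.2 ⟨b, hb, hk⟩
    have h2 : 0 < y.count (some k) := by
      rw [← count_reduceOption]
      exact List.count_pos_iff.2 h1
    rw [hy.letters] at h2
    by_contra h3
    rw [List.getElem?_eq_none (by omega)] at h2
    simp at h2
  have hlen : x.count (some pre.length) = (blocks y).length := by
    rw [length_blocks, hx.letters, hc, hy.bars]
    rfl
  have hmid : c.isOpen = false → ∀ (k : ℕ) (b : Colour), mid[k]? = some b → b.isOpen = false :=
    fun h k b hb => hy.colour h b (List.mem_of_getElem? hb)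
  have hblow : ∀ {i k}, i ≠ pre.length → k < mid.length → _ :=
    fun {i k} hi hk => blow_proj_graft hi hk x (blocks y) hbs
  refine ⟨⟨?_, ?_, ?_⟩, ?_, ?_, ?_⟩
  · intro hd e he
    simp only [List.mem_append] at he
    rcases he with he | he | he
    · exact hx.colour hd e (by simp [he])
    · exact hy.colour (hx.colour hd c (by simp)) e he
    · exact hx.colour hd e (by simp [he])
  · rw [substWord, count_none_graft, hx.bars]
  · intro a
    rcases getElem?_subst pre mid post c a with ⟨k, hk, rfl, h⟩ | ⟨i, hi, rfl, h⟩
    · rw [h, substWord, count_inner_graft hk x _ hlen, flatten_blocks, count_reduceOption,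
        hy.letters]
    · rw [h, substWord, count_outer_graft hi x _ hbs, hx.letters]
  · intro a b e f hab ha hb he hf
    rcases getElem?_subst pre mid post c a with ⟨k, hk, rfl, h⟩ | ⟨i, hi, rfl, h⟩ <;>
    rcases getElem?_subst pre mid post c b with ⟨k', hk', rfl, h'⟩ | ⟨i', hi', rfl, h'⟩ <;>
    rw [h] at ha <;> rw [h'] at hb
    · rw [substWord, complexity, proj_inner_graft hk hk' x _ hlen, flatten_blocks,
        proj_reduceOption]
      exact hy.closed_closed _ _ _ _ (by omega) ha hb he hf
    · rw [complexity_symm hab.symm]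
      have h1 := (hblow hi' hk).turns_le
      rcases hco : c.isOpen with _ | _
      · have := hx.closed_closed _ _ _ _ hi' hb hc hf hco
        simp only [complexity, substWord] at this ⊢
        omega
      · have := hx.closed_open _ _ _ _ hi' hb hc hf hco
        simp only [complexity', complexity, substWord] at this ⊢
        omega
    · have h1 := (hblow hi hk').turns_le
      rcases hco : c.isOpen with _ | _
      · have := hx.closed_closed _ _ _ _ hi ha hc he hco
        simp only [complexity, substWord] at this ⊢
        omega
      · have := hx.closed_open _ _ _ _ hi ha hc he hco
        simp only [complexity', complexity, substWord] at this ⊢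
        omega
    · rw [substWord, complexity, proj_outer_graft hi hi' x _ hbs]
      exact hx.closed_closed _ _ _ _ (fun h => hab (by rw [h])) ha hb he hf
  · intro a b e f hab ha hb he hf
    rcases getElem?_subst pre mid post c a with ⟨k, hk, rfl, h⟩ | ⟨i, hi, rfl, h⟩ <;>
    rcases getElem?_subst pre mid post c b with ⟨k', hk', rfl, h'⟩ | ⟨i', hi', rfl, h'⟩ <;>
    rw [h] at ha <;> rw [h'] at hb
    · rw [substWord, complexity, proj_inner_graft hk hk' x _ hlen, flatten_blocks,
        proj_reduceOption]
      exact hy.open_open _ _ _ _ (by omega) ha hb he hf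
    · rw [complexity_symm hab.symm]
      have h1 := (hblow hi' hk).turns_le
      rcases hco : c.isOpen with _ | _
      · exact absurd (hmid hco _ _ ha) (by simp [he])
      · have := hx.open_open _ _ _ _ hi' hb hc hf hco
        simp only [complexity, substWord] at this ⊢
        omega
    · have h1 := (hblow hi hk').turns_le
      rcases hco : c.isOpen with _ | _
      · exact absurd (hmid hco _ _ hb) (by simp [hf])
      · have := hx.open_open _ _ _ _ hi ha hc he hco
        simp only [complexity, substWord] at this ⊢
        omega
    · rw [substWord, complexity, proj_outer_graft hi hi' x _ hbs]
      exact hx.open_open _ _ _ _ (fun h => hab (by rw [h])) ha hb he hf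
  · intro a b e f hab ha hb he hf
    rcases getElem?_subst pre mid post c a with ⟨k, hk, rfl, h⟩ | ⟨i, hi, rfl, h⟩ <;>
    rcases getElem?_subst pre mid post c b with ⟨k', hk', rfl, h'⟩ | ⟨i', hi', rfl, h'⟩ <;>
    rw [h] at ha <;> rw [h'] at hb
    · rw [substWord, complexity', complexity, proj_inner_graft hk hk' x _ hlen, flatten_blocks,
        proj_reduceOption]
      exact hy.closed_open _ _ _ _ (by omega) ha hb he hf
    · rw [complexity'_symm hab.symm]
      rcases hco : c.isOpen with _ | _
      · have h4 := hx.closed_open _ _ _ _ hi'.symm hc hb hco hf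
        rw [complexity'_symm hi'] at h4
        exact (hblow hi' hk).turns_true_le.trans h4
      · have h4 := hx.open_open _ _ _ _ hi' hb hc hf hco
        have h1 := (hblow hi' hk).turns_le
        have h2 : ∀ (P : Prop) [Decidable P], (if P then 1 else 0) ≤ 1 := by
          intro P _
          split_ifs <;> simp
        exact (Nat.add_le_add (le_of_add_le_left h1) (h2 _)).trans h4
    · rcases hco : c.isOpen with _ | _
      · exact absurd (hmid hco _ _ hb) (by simp [hf])
      · exact (hblow hi hk').turns_false_le.trans (hx.closed_open _ _ _ _ hi ha hc he hco)
    · rw [substWord, complexity', complexity, proj_outer_graft hi hi' x _ hbs]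
      exact hx.closed_open _ _ _ _ (fun h => hab (by rw [h])) ha hb he hf

/-- The sets `RL_2(n₀, …, n_{k-1}; n)` of the coloured operad `RL_2`. -/
def RL2 (cs : List Colour) (d : Colour) : Type := {w : Word // IsRLStage 2 cs d w}

/-- The units of the operad `RL_2`. -/
def RL2.id (c : Colour) : RL2 [c] c := ⟨idWord c.arity, isRLStage_idWord 2 c⟩

/-- The substitution maps of the operad `RL_2`. -/
def RL2.subst {pre mid post : List Colour} {c d : Colour} (x : RL2 (pre ++ c :: post) d)
    (y : RL2 mid c) : RL2 (pre ++ (mid ++ post)) d :=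
  ⟨substWord pre.length mid.length x.1 y.1, x.2.subst y.2⟩

/-- The action on `RL_2` of the transposition of two neighbouring inputs. -/
def RL2.swap {pre post : List Colour} {a b d : Colour} (x : RL2 (pre ++ a :: b :: post) d) :
    RL2 (pre ++ b :: a :: post) d :=
  ⟨swapWord pre.length x.1, x.2.swap⟩

/-! ### Iterated tensor products -/

section Tensor

variable {C : Type u} [Category.{v} C] [MonoidalCategory C] {κ : Type}

/-- The tensor product `X a₁ ⊗ (X a₂ ⊗ ⋯ (X a_k ⊗ 𝟙_ C))` of a list of objects of a family. -/
@[reducible]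
def tensorList (X : κ → C) : List κ → C
  | [] => 𝟙_ C
  | a :: l => X a ⊗ tensorList X l

/-- The canonical isomorphism from the tensor product of a concatenation of two lists. -/
def tensorAppend (X : κ → C) :
    ∀ l l' : List κ, tensorList X (l ++ l') ≅ tensorList X l ⊗ tensorList X l'
  | [], _ => (λ_ _).symm
  | a :: l, l' => whiskerLeftIso (X a) (tensorAppend X l l') ≪≫ (α_ _ _ _).symm

/-- The tensor product of a family of morphisms. -/
def tensorMap {X Y : κ → C} (f : ∀ a, X a ⟶ Y a) : ∀ l, tensorList X l ⟶ tensorList Y l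
  | [] => 𝟙 _
  | a :: l => f a ⊗ₘ tensorMap f l

theorem tensorMap_id (X : κ → C) (l : List κ) : tensorMap (fun a => 𝟙 (X a)) l = 𝟙 _ := by
  induction l with
  | nil => rfl
  | cons a l ih =>
    simp only [tensorMap, ih, tensorList]
    simp

theorem tensorMap_comp {X Y Z : κ → C} (f : ∀ a, X a ⟶ Y a) (g : ∀ a, Y a ⟶ Z a) (l : List κ) :
    tensorMap (fun a => f a ≫ g a) l = tensorMap f l ≫ tensorMap g l := by
  induction l with
  | nil => exact (Category.comp_id _).symm
  | cons a l ih =>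
    simp only [tensorMap, ih]
    exact (tensorHom_comp_tensorHom _ _ _ _).symm

/-- Apply a morphism `f` to a sublist of the factors of a tensor product. -/
def tensorAt (X : κ → C) (pre mid post : List κ) (c : κ) (f : tensorList X mid ⟶ X c) :
    tensorList X (pre ++ (mid ++ post)) ⟶ tensorList X (pre ++ c :: post) :=
  (tensorAppend X pre (mid ++ post)).hom ≫
    tensorList X pre ◁ ((tensorAppend X mid post).hom ≫ f ▷ tensorList X post) ≫
      (tensorAppend X pre (c :: post)).inv

/-- Exchange two neighbouring factors of a tensor product. -/
def tensorSwap [BraidedCategory C] (X : κ → C) (pre post : List κ) (a b : κ) :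
    tensorList X (pre ++ b :: a :: post) ⟶ tensorList X (pre ++ a :: b :: post) :=
  (tensorAppend X pre (b :: a :: post)).hom ≫
    tensorList X pre ◁ ((α_ (X b) (X a) (tensorList X post)).inv ≫
      (β_ (X b) (X a)).hom ▷ tensorList X post ≫ (α_ (X a) (X b) (tensorList X post)).hom) ≫
      (tensorAppend X pre (a :: b :: post)).inv

/-- Apply a morphism `f` to an object `W` and a sublist of the factors of a tensor product, after
having moved `W` next to these factors. -/
def plugAt [BraidedCategory C] (X : κ → C) (pre mid post : List κ) (c : κ) (W : C)
    (f : W ⊗ tensorList X mid ⟶ X c) :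
    W ⊗ tensorList X (pre ++ (mid ++ post)) ⟶ tensorList X (pre ++ c :: post) :=
  W ◁ (tensorAppend X pre (mid ++ post)).hom ≫
    (α_ W (tensorList X pre) (tensorList X (mid ++ post))).inv ≫
      (β_ W (tensorList X pre)).hom ▷ tensorList X (mid ++ post) ≫
        (α_ (tensorList X pre) W (tensorList X (mid ++ post))).hom ≫
          tensorList X pre ◁ (W ◁ (tensorAppend X mid post).hom ≫
            (α_ W (tensorList X mid) (tensorList X post)).inv ≫ f ▷ tensorList X post) ≫
            (tensorAppend X pre (c :: post)).inv

theorem plugAt_whiskerRight [BraidedCategory C] (X : κ → C) (pre mid post : List κ) (c : κ)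
    {V W : C} (g : V ⟶ W) (f : W ⊗ tensorList X mid ⟶ X c) :
    plugAt X pre mid post c V (g ▷ tensorList X mid ≫ f) =
      g ▷ tensorList X (pre ++ (mid ++ post)) ≫ plugAt X pre mid post c W f := by
  simp only [plugAt, comp_whiskerRight, Category.assoc, MonoidalCategory.whiskerLeft_comp]
  have h1 : g ▷ tensorList X pre ≫ (β_ W (tensorList X pre)).hom =
      (β_ V (tensorList X pre)).hom ≫ tensorList X pre ◁ g := by simp
  have h2 : g ▷ tensorList X (mid ++ post) ≫ W ◁ (tensorAppend X mid post).hom ≫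
      (α_ W (tensorList X mid) (tensorList X post)).inv =
        V ◁ (tensorAppend X mid post).hom ≫
          (α_ V (tensorList X mid) (tensorList X post)).inv ≫
            g ▷ tensorList X mid ▷ tensorList X post := by
    rw [← whisker_exchange_assoc, associator_inv_naturality_left]
  have h3 := congrArg (fun h => tensorList X pre ◁ h) h2
  simp only [MonoidalCategory.whiskerLeft_comp] at h3
  rw [← whisker_exchange_assoc, associator_inv_naturality_left_assoc,
    ← comp_whiskerRight_assoc, h1, comp_whiskerRight_assoc, associator_naturality_middle_assoc,
    reassoc_of% h3]

end Tensor

/-! ### Algebras over `RL_2` -/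

section Families

variable {C : Type u} [Category.{v} C]

/-- The family indexed by the colours that consists of a closed part and an open part. -/
@[reducible]
def colourFamily (X Y : ℕ → C) : Colour → C
  | .closed n => X n
  | .opened n => Y n

/-- A family of morphisms indexed by the colours. -/
def colourMap {X Y X' Y' : ℕ → C} (f : ∀ n, X n ⟶ X' n) (g : ∀ n, Y n ⟶ Y' n) :
    ∀ c, colourFamily X Y c ⟶ colourFamily X' Y' c
  | .closed n => f n
  | .opened n => g n

theorem colourMap_id (X Y : ℕ → C) :
    colourMap (fun n => 𝟙 (X n)) (fun n => 𝟙 (Y n)) = fun c => 𝟙 (colourFamily X Y c) := by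
  funext c
  cases c <;> rfl

theorem colourMap_comp {X Y X' Y' X'' Y'' : ℕ → C} (f : ∀ n, X n ⟶ X' n) (g : ∀ n, Y n ⟶ Y' n)
    (f' : ∀ n, X' n ⟶ X'' n) (g' : ∀ n, Y' n ⟶ Y'' n) :
    colourMap (fun n => f n ≫ f' n) (fun n => g n ≫ g' n) =
      fun c => colourMap f g c ≫ colourMap f' g' c := by
  funext c
  cases c <;> rfl

end Families

section Algebras

variable (C : Type u) [Category.{v} C] [MonoidalCategory C] [SymmetricCategory C] [HasColimits C]

/-- The object of operations `∐_{x ∈ RL_2(n₀, …, n_{k-1}; n)} 𝟙_ C`. -/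
noncomputable def RL2Obj (cs : List Colour) (d : Colour) : C := ∐ fun _ : RL2 cs d => 𝟙_ C

variable {C} in
/-- The operation on a family of objects that is given by an element of `RL_2(n₀, …; n)`. -/
noncomputable def actionAt {X : Colour → C} {cs : List Colour} {d : Colour}
    (act : RL2Obj C cs d ⊗ tensorList X cs ⟶ X d) (x : RL2 cs d) : tensorList X cs ⟶ X d :=
  (λ_ _).inv ≫ Sigma.ι (fun _ : RL2 cs d => 𝟙_ C) x ▷ tensorList X cs ≫ act

/-- An algebra over the operad `RL_2` in `C`. The axioms are stated on the components of the
actions at the elements of `RL_2(n₀, …; n)`. As neighbouring transpositions generate the symmetric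
groups, `act_swap` is the equivariance. -/
structure RL2Algebra where
  /-- the objects of closed colours -/
  closedPart : ℕ → C
  /-- the objects of open colours -/
  openPart : ℕ → C
  /-- the action maps -/
  act : ∀ (cs : List Colour) (d : Colour),
    RL2Obj C cs d ⊗ tensorList (colourFamily closedPart openPart) cs ⟶
      colourFamily closedPart openPart d
  act_id : ∀ c, actionAt (act [c] c) (RL2.id c) = (ρ_ _).hom
  act_subst : ∀ (pre mid post : List Colour) (c d : Colour) (x : RL2 (pre ++ c :: post) d)
    (y : RL2 mid c), actionAt (act (pre ++ (mid ++ post)) d) (x.subst y) =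
      tensorAt _ pre mid post c (actionAt (act mid c) y) ≫ actionAt (act (pre ++ c :: post) d) x
  act_swap : ∀ (pre post : List Colour) (a b d : Colour) (x : RL2 (pre ++ a :: b :: post) d),
    actionAt (act (pre ++ b :: a :: post) d) x.swap =
      tensorSwap _ pre post a b ≫ actionAt (act (pre ++ a :: b :: post) d) x

namespace RL2Algebra

variable {C}

/-- A morphism of algebras over `RL_2`. -/
@[ext]
structure Hom (X Y : RL2Algebra C) where
  closedMap : ∀ n, X.closedPart n ⟶ Y.closedPart n
  openMap : ∀ n, X.openPart n ⟶ Y.openPart n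
  act_comp : ∀ (cs : List Colour) (d : Colour),
    X.act cs d ≫ colourMap closedMap openMap d =
      RL2Obj C cs d ◁ tensorMap (colourMap closedMap openMap) cs ≫ Y.act cs d

instance : Category (RL2Algebra C) where
  Hom := Hom
  id X :=
    { closedMap := fun _ => 𝟙 _
      openMap := fun _ => 𝟙 _
      act_comp := fun cs d => by
        rw [colourMap_id, tensorMap_id]
        simp }
  comp f g :=
    { closedMap := fun n => f.closedMap n ≫ g.closedMap n
      openMap := fun n => f.openMap n ≫ g.openMap n
      act_comp := fun cs d => by
        rw [colourMap_comp, tensorMap_comp, ← Category.assoc, f.act_comp, Category.assoc,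
          g.act_comp]
        simp }
  id_comp f := Hom.ext (funext fun _ => Category.id_comp _) (funext fun _ => Category.id_comp _)
  comp_id f := Hom.ext (funext fun _ => Category.comp_id _) (funext fun _ => Category.comp_id _)
  assoc f g h :=
    Hom.ext (funext fun _ => Category.assoc _ _ _) (funext fun _ => Category.assoc _ _ _)

variable (C) in
/-- The functor that forgets the action. -/
def forget : RL2Algebra C ⥤ (ℕ → C) × (ℕ → C) where
  obj X := (X.closedPart, X.openPart)
  map f := (f.closedMap, f.openMap)

end RL2Algebra

end Algebras

/-! ### Non-symmetric operads and their wide modules -/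

section Slots

variable {C : Type u} [Category.{v} C] [MonoidalCategory C]

/-- The inputs of a wide action, in their order: `none` is an input that remains (an element of
`A'`), and `some l` is an input (an element of `A ∖ A'`) into which an element of arity `l` is
inserted. -/
abbrev Slots : Type := List (Option ℕ)

/-- The arity of the result of an insertion. -/
def Slots.total : Slots → ℕ
  | [] => 0
  | none :: s => 1 + Slots.total s
  | some l :: s => l + Slots.total s

/-- The factors of an insertion: `Z l` for an input of type `some l`, and the tensor unit (that is,
no factor) for an input that remains. -/
@[reducible]
def slotFamily (Z : ℕ → C) : Option ℕ → C
  | none => 𝟙_ C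
  | some l => Z l

/-- A family of morphisms between the factors of insertions. -/
def slotMap {Z Z' : ℕ → C} (g : ∀ n, Z n ⟶ Z' n) : ∀ o, slotFamily Z o ⟶ slotFamily Z' o
  | none => 𝟙 _
  | some l => g l

theorem slotMap_id (Z : ℕ → C) : slotMap (fun n => 𝟙 (Z n)) = fun o => 𝟙 (slotFamily Z o) := by
  funext o
  cases o <;> rfl

theorem slotMap_comp {Z Z' Z'' : ℕ → C} (f : ∀ n, Z n ⟶ Z' n) (g : ∀ n, Z' n ⟶ Z'' n) :
    slotMap (fun n => f n ≫ g n) = fun o => slotMap f o ≫ slotMap g o := by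
  funext o
  cases o with
  | none => exact (Category.comp_id _).symm
  | some l => rfl

end Slots

section Operads

variable (C : Type u) [Category.{v} C] [MonoidalCategory C] [SymmetricCategory C]

/-- A non-symmetric operad in `C`, given by its partial compositions `x ∘ y`, where `y` is inserted
into the input of `x` that has `p` inputs on its left and `q` inputs on its right. The arities are
related by equations, which may be proved in any way. -/
structure NSOperad where
  /-- the objects of operations -/
  obj : ℕ → C
  /-- the unit -/
  one : 𝟙_ C ⟶ obj 1
  /-- the partial compositions -/
  comp : ∀ (p q : ℕ) {n l r : ℕ}, n = p + 1 + q → r = p + l + q → (obj n ⊗ obj l ⟶ obj r)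
  one_comp : ∀ (l : ℕ) (h : 1 = 0 + 1 + 0) (h' : l = 0 + l + 0),
    one ▷ obj l ≫ comp 0 0 h h' = (λ_ (obj l)).hom
  comp_one : ∀ (p q n : ℕ) (h : n = p + 1 + q) (h' : n = p + 1 + q),
    obj n ◁ one ≫ comp p q h h' = (ρ_ (obj n)).hom
  /-- `(x ∘ y) ∘ z = x ∘ (y ∘ z)` if `z` is inserted into an input of `y` -/
  comp_assoc : ∀ (p q p' q' n l k s t r : ℕ) (h₁ : n = p + 1 + q) (h₂ : s = p + l + q)
    (h₃ : s = p + p' + 1 + (q' + q)) (h₄ : r = p + p' + k + (q' + q)) (h₅ : l = p' + 1 + q')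
    (h₆ : t = p' + k + q') (h₇ : r = p + t + q),
    comp p q h₁ h₂ ▷ obj k ≫ comp (p + p') (q' + q) h₃ h₄ =
      (α_ (obj n) (obj l) (obj k)).hom ≫ obj n ◁ comp p' q' h₅ h₆ ≫ comp p q h₁ h₇
  /-- `(x ∘ y) ∘ z = (x ∘ z) ∘ y` if `y` and `z` are inserted into two different inputs of `x` -/
  comp_comm : ∀ (p m q n l k s t r : ℕ) (h₁ : n = p + 1 + (m + 1 + q))
    (h₂ : s = p + l + (m + 1 + q)) (h₃ : s = p + l + m + 1 + q) (h₄ : r = p + l + m + k + q)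
    (h₅ : n = p + 1 + m + 1 + q) (h₆ : t = p + 1 + m + k + q) (h₇ : t = p + 1 + (m + k + q))
    (h₈ : r = p + l + (m + k + q)),
    comp p (m + 1 + q) h₁ h₂ ▷ obj k ≫ comp (p + l + m) q h₃ h₄ =
      (α_ (obj n) (obj l) (obj k)).hom ≫ obj n ◁ (β_ (obj l) (obj k)).hom ≫
        (α_ (obj n) (obj k) (obj l)).inv ≫ comp (p + 1 + m) q h₅ h₆ ▷ obj l ≫
          comp p (m + k + q) h₇ h₈

variable {C}

/-- A morphism of non-symmetric operads. -/
@[ext]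
structure NSOperad.Hom (P M : NSOperad C) where
  map : ∀ n, P.obj n ⟶ M.obj n
  one_map : P.one ≫ map 1 = M.one
  comp_map : ∀ (p q n l r : ℕ) (h : n = p + 1 + q) (h' : r = p + l + q),
    P.comp p q h h' ≫ map r = (map n ⊗ₘ map l) ≫ M.comp p q h h'

instance : Category (NSOperad C) where
  Hom := NSOperad.Hom
  id P :=
    { map := fun _ => 𝟙 _
      one_map := by simp
      comp_map := by intros; simp }
  comp f g :=
    { map := fun n => f.map n ≫ g.map n
      one_map := by rw [← Category.assoc, f.one_map, g.one_map]
      comp_map := fun p q n l r h h' => by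
        rw [← Category.assoc, f.comp_map, Category.assoc, g.comp_map]
        simp }
  id_comp f := NSOperad.Hom.ext (funext fun _ => Category.id_comp _)
  comp_id f := NSOperad.Hom.ext (funext fun _ => Category.comp_id _)
  assoc f g h := NSOperad.Hom.ext (funext fun _ => Category.assoc _ _ _)

theorem NSOperad.id_map (P : NSOperad C) (n : ℕ) : NSOperad.Hom.map (𝟙 P) n = 𝟙 (P.obj n) := rfl

theorem NSOperad.comp_map' {P Q M : NSOperad C} (f : P ⟶ Q) (g : Q ⟶ M) (n : ℕ) :
    (f ≫ g).map n = f.map n ≫ g.map n := rfl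

variable (C) in
/-- The operad `As`, with `As(n) = 𝟙_ C` for all `n ≥ 0`. -/
def assocOperad : NSOperad C where
  obj _ := 𝟙_ C
  one := 𝟙 _
  comp _ _ _ _ _ _ _ := (λ_ (𝟙_ C)).hom
  one_comp := by intros; simp
  comp_one := by intros; simp [unitors_equal]
  comp_assoc := by intros; simp [unitors_equal]
  comp_comm := by intros; rw [braiding_tensorUnit_left]; monoidal

/-- The tensor product of the factors of an insertion. -/
abbrev slotTensor (Z : ℕ → C) (s : Slots) : C := tensorList (slotFamily Z) s

/-- The composition `M(A) ⊗ ⨂_{a ∈ A ∖ A'} M(α⁻¹(a)) ⟶ M(B ⊔ A')` of an operad, at the inputs of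
the first factor that come after the first `p` inputs. -/
def NSOperad.multiComp (M : NSOperad C) : ∀ (s : Slots) (p : ℕ) {k n : ℕ},
    k = p + s.length → n = p + s.total → (M.obj k ⊗ slotTensor M.obj s ⟶ M.obj n)
  | [], _, _, _, hk, hn => (ρ_ _).hom ≫ eqToHom (congrArg M.obj (hk.trans hn.symm))
  | none :: s, p, k, _, hk, hn =>
    M.obj k ◁ (λ_ (slotTensor M.obj s)).hom ≫
      M.multiComp s (p + 1) (by rw [hk, List.length_cons]; omega)
        (by rw [hn, Slots.total]; omega)
  | some l :: s, p, k, _, hk, hn =>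
    (α_ (M.obj k) (M.obj l) (slotTensor M.obj s)).inv ≫
      M.comp p s.length (r := p + l + s.length) (by rw [hk, List.length_cons]; omega) rfl ▷ _ ≫
        M.multiComp s (p + l) rfl (by rw [hn, Slots.total]; omega)

/-- A wide left module over a non-symmetric operad `M`: for `A' ⊆ A` (where possibly `A' = A`) and
an order preserving map `α : B → A ∖ A'`, maps
`M(A) ⊗ ⨂_{a ∈ A ∖ A'} Z(α⁻¹(a)) ⟶ Z(B ⊔ A')`. -/
structure WideLeftModule (M : NSOperad C) (Z : ℕ → C) where
  /-- the action maps `λ'_α` -/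
  act : ∀ (s : Slots) {k n : ℕ}, k = s.length → n = s.total →
    (M.obj k ⊗ slotTensor Z s ⟶ Z n)
  one_act : ∀ (n : ℕ) (h : 1 = [some n].length) (h' : n = Slots.total [some n]),
    (ρ_ (Z n)).inv ≫ (λ_ (Z n ⊗ 𝟙_ C)).inv ≫ M.one ▷ (Z n ⊗ 𝟙_ C) ≫ act [some n] h h' = 𝟙 (Z n)
  act_act : ∀ (pre mid post : Slots) (k j t n m : ℕ) (h₁ : j = mid.length) (h₂ : t = mid.total)
    (h₃ : k = (pre ++ some t :: post).length) (h₄ : n = (pre ++ some t :: post).total)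
    (h₅ : k = pre.length + 1 + post.length) (h₆ : m = pre.length + j + post.length)
    (h₇ : m = (pre ++ (mid ++ post)).length) (h₈ : n = (pre ++ (mid ++ post)).total),
    M.obj k ◁ plugAt (slotFamily Z) pre mid post (some t) (M.obj j) (act mid h₁ h₂) ≫
        act (pre ++ some t :: post) h₃ h₄ =
      (α_ (M.obj k) (M.obj j) (slotTensor Z (pre ++ (mid ++ post)))).inv ≫
        M.comp pre.length post.length h₅ h₆ ▷ slotTensor Z (pre ++ (mid ++ post)) ≫
          act (pre ++ (mid ++ post)) h₇ h₈

/-- A stable wide left module over `M`. -/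
structure StableWideLeftModule (M : NSOperad C) (Z : ℕ → C) extends WideLeftModule M Z where
  /-- the maps `ι : M(A) ⟶ Z(A)` -/
  incl : ∀ n, M.obj n ⟶ Z n
  multiComp_incl : ∀ (s : Slots) (k n : ℕ) (h₁ : k = s.length) (h₂ : n = s.total)
    (h₃ : k = 0 + s.length) (h₄ : n = 0 + s.total),
    M.multiComp s 0 h₃ h₄ ≫ incl n =
      M.obj k ◁ tensorMap (slotMap incl) s ≫ act s h₁ h₂

/-- A right module over a non-symmetric operad `P`. -/
structure RightModule (P : NSOperad C) (Z : ℕ → C) where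
  /-- the partial actions -/
  act : ∀ (p q : ℕ) {n l r : ℕ}, n = p + 1 + q → r = p + l + q → (Z n ⊗ P.obj l ⟶ Z r)
  act_one : ∀ (p q n : ℕ) (h : n = p + 1 + q) (h' : n = p + 1 + q),
    Z n ◁ P.one ≫ act p q h h' = (ρ_ (Z n)).hom
  act_assoc : ∀ (p q p' q' n l k s t r : ℕ) (h₁ : n = p + 1 + q) (h₂ : s = p + l + q)
    (h₃ : s = p + p' + 1 + (q' + q)) (h₄ : r = p + p' + k + (q' + q)) (h₅ : l = p' + 1 + q')
    (h₆ : t = p' + k + q') (h₇ : r = p + t + q),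
    act p q h₁ h₂ ▷ P.obj k ≫ act (p + p') (q' + q) h₃ h₄ =
      (α_ (Z n) (P.obj l) (P.obj k)).hom ≫ Z n ◁ P.comp p' q' h₅ h₆ ≫ act p q h₁ h₇
  act_comm : ∀ (p m q n l k s t r : ℕ) (h₁ : n = p + 1 + (m + 1 + q))
    (h₂ : s = p + l + (m + 1 + q)) (h₃ : s = p + l + m + 1 + q) (h₄ : r = p + l + m + k + q)
    (h₅ : n = p + 1 + m + 1 + q) (h₆ : t = p + 1 + m + k + q) (h₇ : t = p + 1 + (m + k + q))
    (h₈ : r = p + l + (m + k + q)),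
    act p (m + 1 + q) h₁ h₂ ▷ P.obj k ≫ act (p + l + m) q h₃ h₄ =
      (α_ (Z n) (P.obj l) (P.obj k)).hom ≫ Z n ◁ (β_ (P.obj l) (P.obj k)).hom ≫
        (α_ (Z n) (P.obj k) (P.obj l)).inv ≫ act (p + 1 + m) q h₅ h₆ ▷ P.obj l ≫
          act p (m + k + q) h₇ h₈

/-- The canonical isomorphism from the tensor unit to the tensor product of `l` tensor units. -/
def unitSlots (Z : ℕ → C) : ∀ l : ℕ, 𝟙_ C ⟶ slotTensor Z (List.replicate l none)
  | 0 => 𝟙 _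
  | l + 1 => (λ_ (𝟙_ C)).inv ≫ 𝟙_ C ◁ unitSlots Z l

/-- The canonical isomorphism that replaces an input that remains with `l` such inputs. -/
def expandSlot (Z : ℕ → C) (pre post : Slots) (l : ℕ) : slotTensor Z (pre ++ none :: post) ⟶
    slotTensor Z (pre ++ (List.replicate l none ++ post)) :=
  (tensorAppend (slotFamily Z) pre (none :: post)).hom ≫
    slotTensor Z pre ◁ (unitSlots Z l ▷ slotTensor Z post ≫
      (tensorAppend (slotFamily Z) (List.replicate l none) post).inv) ≫
      (tensorAppend (slotFamily Z) pre (List.replicate l none ++ post)).inv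

/-- The compatibility of a wide left action of `M` and a right action of `P` on `Z`, where `P` acts
on `M` from the right through a morphism of operads `u : P ⟶ M`. With `x ∈ M(A)` and `a ∈ P(l)`, it
says that `(x · (…, z, …)) ∘ a` is `x · (…, z ∘ a, …)` if `a` is inserted into an input of a factor
`z`, and that it is `(x ∘ u(a)) · (…)` if `a` is inserted into an input that remains. -/
structure WideCompatible {P M : NSOperad C} (u : P ⟶ M) {Z : ℕ → C} (L : WideLeftModule M Z)
    (R : RightModule P Z) : Prop where
  inner : ∀ (pre post : Slots) (p q k l t t' n r : ℕ) (h₁ : t = p + 1 + q) (h₂ : t' = p + l + q)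
    (h₃ : k = (pre ++ some t :: post).length) (h₄ : n = (pre ++ some t :: post).total)
    (h₅ : k = (pre ++ some t' :: post).length) (h₆ : r = (pre ++ some t' :: post).total)
    (h₇ : n = pre.total + p + 1 + (q + post.total))
    (h₈ : r = pre.total + p + l + (q + post.total)),
    M.obj k ◁ (β_ (P.obj l) (slotTensor Z (pre ++ some t :: post))).hom ≫
        (α_ (M.obj k) (slotTensor Z (pre ++ some t :: post)) (P.obj l)).inv ≫
          L.act (pre ++ some t :: post) h₃ h₄ ▷ P.obj l ≫
            R.act (pre.total + p) (q + post.total) h₇ h₈ =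
      M.obj k ◁ plugAt (slotFamily Z) pre [some t] post (some t') (P.obj l)
          (P.obj l ◁ (ρ_ (Z t)).hom ≫ (β_ (P.obj l) (Z t)).hom ≫ R.act p q h₁ h₂) ≫
        L.act (pre ++ some t' :: post) h₅ h₆
  outer : ∀ (pre post : Slots) (k l m n r : ℕ)
    (h₁ : k = (pre ++ none :: post).length) (h₂ : n = (pre ++ none :: post).total)
    (h₃ : n = pre.total + 1 + post.total) (h₄ : r = pre.total + l + post.total)
    (h₅ : k = pre.length + 1 + post.length) (h₆ : m = pre.length + l + post.length)
    (h₇ : m = (pre ++ (List.replicate l none ++ post)).length)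
    (h₈ : r = (pre ++ (List.replicate l none ++ post)).total),
    M.obj k ◁ (β_ (P.obj l) (slotTensor Z (pre ++ none :: post))).hom ≫
        (α_ (M.obj k) (slotTensor Z (pre ++ none :: post)) (P.obj l)).inv ≫
          L.act (pre ++ none :: post) h₁ h₂ ▷ P.obj l ≫ R.act pre.total post.total h₃ h₄ =
      (α_ (M.obj k) (P.obj l) (slotTensor Z (pre ++ none :: post))).inv ≫
        (M.obj k ◁ u.map l ≫ M.comp pre.length post.length h₅ h₆) ▷
            slotTensor Z (pre ++ none :: post) ≫
          M.obj m ◁ expandSlot Z pre post l ≫ L.act (pre ++ (List.replicate l none ++ post)) h₇ h₈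


/-- The restriction of a wide left action along a morphism of operads. -/
def WideLeftModule.restrict {P M : NSOperad C} {Z : ℕ → C} (L : WideLeftModule M Z)
    (u : P ⟶ M) : WideLeftModule P Z where
  act s {k n} h h' := u.map k ▷ slotTensor Z s ≫ L.act s h h'
  one_act n h h' := by
    rw [← L.one_act n h h', ← u.one_map, comp_whiskerRight, Category.assoc]
  act_act pre mid post k j t n m h₁ h₂ h₃ h₄ h₅ h₆ h₇ h₈ := by
    rw [plugAt_whiskerRight, MonoidalCategory.whiskerLeft_comp, Category.assoc,
      whisker_exchange_assoc, L.act_act pre mid post k j t n m h₁ h₂ h₃ h₄ h₅ h₆ h₇ h₈,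
      ← comp_whiskerRight_assoc, u.comp_map, tensorHom_def']
    simp

/-- A wide bimodule over a non-symmetric operad `P`. -/
structure WideBimodule (P : NSOperad C) (Z : ℕ → C) where
  /-- the wide left action -/
  left : WideLeftModule P Z
  /-- the right action -/
  right : RightModule P Z
  compatible : WideCompatible (𝟙 P) left right

theorem WideCompatible.restrict {P M : NSOperad C} {u : P ⟶ M} {Z : ℕ → C}
    {L : WideLeftModule M Z} {R : RightModule P Z} (h : WideCompatible u L R) :
    WideCompatible (𝟙 P) (L.restrict u) R where
  inner pre post p q k l t t' n r h₁ h₂ h₃ h₄ h₅ h₆ h₇ h₈ := by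
    have := h.inner pre post p q k l t t' n r h₁ h₂ h₃ h₄ h₅ h₆ h₇ h₈
    simp only [WideLeftModule.restrict]
    rw [whisker_exchange_assoc, ← this, ← whisker_exchange_assoc,
      associator_inv_naturality_left_assoc, comp_whiskerRight, Category.assoc]
  outer pre post k l m n r h₁ h₂ h₃ h₄ h₅ h₆ h₇ h₈ := by
    have := h.outer pre post k l m n r h₁ h₂ h₃ h₄ h₅ h₆ h₇ h₈
    have hc := u.comp_map pre.length post.length k l m h₅ h₆
    simp only [WideLeftModule.restrict]
    rw [whisker_exchange_assoc, NSOperad.id_map, MonoidalCategory.whiskerLeft_id,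
      Category.id_comp, ← comp_whiskerRight_assoc, hc, MonoidalCategory.tensorHom_def,
      Category.assoc, comp_whiskerRight_assoc (u.map k ▷ P.obj l),
      ← associator_inv_naturality_left_assoc, ← this, ← whisker_exchange_assoc,
      associator_inv_naturality_left_assoc, comp_whiskerRight, Category.assoc]

/-! ### The category of pairs -/

variable (C)

/-- The objects `(M, Z)` of the category `E`: `M` is a multiplicative operad, `Z` is a stable wide
left module over `M` and a right module over `As`, and the two actions on `Z` are compatible, so
that `Z` is a wide bimodule over `As`, see `PairE.wideBimodule`. -/
structure PairE where
  /-- the operad `M` -/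
  operad : NSOperad C
  /-- the morphism `As ⟶ M` -/
  mult : assocOperad C ⟶ operad
  /-- the family `Z` -/
  family : ℕ → C
  /-- the wide left action of `M` on `Z`, and the maps `ι` -/
  left : StableWideLeftModule operad family
  /-- the right action of `As` on `Z` -/
  right : RightModule (assocOperad C) family
  compatible : WideCompatible mult left.toWideLeftModule right

namespace PairE

variable {C}

/-- The wide bimodule over `As` that underlies a pair. -/
def wideBimodule (X : PairE C) : WideBimodule (assocOperad C) X.family where
  left := X.left.toWideLeftModule.restrict X.mult
  right := X.right
  compatible := X.compatible.restrict

/-- A morphism of pairs: a morphism `f` of multiplicative operads and a family `g` of maps that is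
compatible (over `f`) with the wide left actions and the maps `ι`, and with the right actions. -/
@[ext]
structure Hom (X Y : PairE C) where
  operadMap : X.operad ⟶ Y.operad
  familyMap : ∀ n, X.family n ⟶ Y.family n
  mult_comp : X.mult ≫ operadMap = Y.mult
  left_comp : ∀ (s : Slots) (k n : ℕ) (h : k = s.length) (h' : n = s.total),
    X.left.act s h h' ≫ familyMap n =
      (operadMap.map k ⊗ₘ tensorMap (slotMap familyMap) s) ≫ Y.left.act s h h'
  incl_comp : ∀ n, X.left.incl n ≫ familyMap n = operadMap.map n ≫ Y.left.incl n
  right_comp : ∀ (p q n l r : ℕ) (h : n = p + 1 + q) (h' : r = p + l + q),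
    X.right.act p q h h' ≫ familyMap r =
      familyMap n ▷ (assocOperad C).obj l ≫ Y.right.act p q h h'

instance : Category (PairE C) where
  Hom := Hom
  id X :=
    { operadMap := 𝟙 _
      familyMap := fun _ => 𝟙 _
      mult_comp := Category.comp_id _
      left_comp := fun s k n h h' => by
        rw [slotMap_id, tensorMap_id, NSOperad.id_map]
        simp
      incl_comp := fun n => by
        rw [NSOperad.id_map]
        simp
      right_comp := by intros; simp }
  comp f g :=
    { operadMap := f.operadMap ≫ g.operadMap
      familyMap := fun n => f.familyMap n ≫ g.familyMap n
      mult_comp := by rw [← Category.assoc, f.mult_comp, g.mult_comp]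
      left_comp := fun s k n h h' => by
        rw [slotMap_comp, tensorMap_comp, NSOperad.comp_map', ← Category.assoc, f.left_comp,
          Category.assoc, g.left_comp, tensorHom_comp_tensorHom_assoc]
      incl_comp := fun n => by
        rw [NSOperad.comp_map', ← Category.assoc, f.incl_comp, Category.assoc, g.incl_comp,
          Category.assoc]
      right_comp := fun p q n l r h h' => by
        rw [← Category.assoc, f.right_comp, Category.assoc, g.right_comp]
        simp }
  id_comp f := Hom.ext (Category.id_comp _) (funext fun _ => Category.id_comp _)
  comp_id f := Hom.ext (Category.comp_id _) (funext fun _ => Category.comp_id _)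
  assoc f g h := Hom.ext (Category.assoc _ _ _) (funext fun _ => Category.assoc _ _ _)

variable (C) in
/-- The functor that forgets everything but the two underlying families of objects. -/
def forget : PairE C ⥤ (ℕ → C) × (ℕ → C) where
  obj X := (X.operad.obj, X.family)
  map f := (f.operadMap.map, f.familyMap)

end PairE

end Operads

end SwissCheese

/-!
The theorem holds because `RL_2` is generated by a few words, with exactly the relations of a pair
`(M, Z)`: the words `|⋯|` (the multiplication `As → M`), the partial compositions of `M`, the wide
actions of `M` on `Z`, and the insertions of elements of `As` into `Z`. The maps `ι` are no
further structure, since `ι x` is the action of `x` on no elements (`PairE.incl_eq`).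

*Reduction to sets.* An equality of morphisms out of a tensor product may be checked on elements.
Here the elements of the objects of `C` are given by a lax symmetric monoidal functor to sets
(`Realization`). Such functors are corepresented by comonoidal families (`Support`), and every
object `A` has a generic element, in a family whose powers of degree at least two are initial, so
that no diagonal of `A` is needed (`Support.var`). Products of these families give generic
elements of tensor products (`Dense`, `hom_ext_tensorList`). A pair in `C` thus becomes a pair in
sets for each realization, and the axioms may be verified there.

*Words.* The bounds on complexities say that two letters are nested or disjoint and that nothing
but bars lies between two occurrences of an open letter (`Nested`, `isRLStage_iff`). Hence a
nested word has a letter with only bars between its occurrences, which can be split off; this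
shows that the operad is generated by the words above (`Valid.generated`).

*From pairs to algebras.* A word with elements of a pair assigned to its letters is evaluated by
reading it from left to right (`SetPair.tok`). The evaluation keeps an element of `M` with a
current input; a bar doubles this input by the multiplication, the first occurrence of a closed
letter inserts its element, and its later occurrences close an input by the unit of the
multiplication (`SetPair.step`). A chunk of an open letter is read as a bar, and its element is
inserted at the end by the wide action (`SetPair.evalZ`). The evaluation does not depend on
whether a part of the word is evaluated first, which is compatibility with the composition of the
operad (`SetPair.eval_substLetter`). By generation, the value of each word is given by a morphism
of `C` (`RawPair.Laws.exists_represents`), and as `C` is closed these morphisms are the components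
of unique action maps (`hom_ext_components`).

*From algebras to pairs.* The structure maps are the operations of the generating words, and each
axiom of a pair equates two ways to compose one word (`RawPair.laws_of_wordAlgebra`).

Two algebras with the same pair agree, because the operad is generated by the words of the
structure maps (`WordAlgebra.ev_eq`), and likewise a morphism of pairs respects all operations
(`WordAlgebra.map_ev`). Therefore the two constructions are inverse to each other. They are the
identity on underlying families, and the forgetful functors are faithful, so the equality on
objects gives the equality of functors.
-/

universe w

namespace SwissCheese

/-! ### Realizations in sets -/

section Realizations

variable (C : Type u) [Category.{v} C] [MonoidalCategory C] [SymmetricCategory C]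

/-- A lax symmetric monoidal functor from `C` to sets. -/
structure Realization where
  /-- the elements of an object -/
  el : C → Type v
  /-- the action of a morphism on elements -/
  map : ∀ {A B : C}, (A ⟶ B) → el A → el B
  map_id : ∀ {A : C} (a : el A), map (𝟙 A) a = a
  map_comp : ∀ {A B D : C} (f : A ⟶ B) (g : B ⟶ D) (a : el A), map (f ≫ g) a = map g (map f a)
  /-- the element of the tensor unit -/
  unit : el (𝟙_ C)
  /-- the element of a tensor product that is given by elements of the factors -/
  pair : ∀ {A B : C}, el A → el B → el (A ⊗ B)
  map_tensor : ∀ {A B A' B' : C} (f : A ⟶ A') (g : B ⟶ B') (a : el A) (b : el B),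
    map (f ⊗ₘ g) (pair a b) = pair (map f a) (map g b)
  map_assoc : ∀ {A B D : C} (a : el A) (b : el B) (d : el D),
    map (α_ A B D).hom (pair (pair a b) d) = pair a (pair b d)
  map_braid : ∀ {A B : C} (a : el A) (b : el B), map (β_ A B).hom (pair a b) = pair b a
  map_rightUnitor : ∀ {A : C} (a : el A), map (ρ_ A).hom (pair a unit) = a

namespace Realization

variable {C} (Φ : Realization C)

theorem map_hom_inv {A B : C} (e : A ≅ B) {a : Φ.el A} {b : Φ.el B} (h : Φ.map e.hom a = b) :
    Φ.map e.inv b = a := by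
  rw [← h, ← Φ.map_comp, e.hom_inv_id, Φ.map_id]

theorem map_whiskerLeft {A B B' : C} (g : B ⟶ B') (a : Φ.el A) (b : Φ.el B) :
    Φ.map (A ◁ g) (Φ.pair a b) = Φ.pair a (Φ.map g b) := by
  rw [← id_tensorHom, Φ.map_tensor, Φ.map_id]

theorem map_whiskerRight {A A' B : C} (f : A ⟶ A') (a : Φ.el A) (b : Φ.el B) :
    Φ.map (f ▷ B) (Φ.pair a b) = Φ.pair (Φ.map f a) b := by
  rw [← tensorHom_id, Φ.map_tensor, Φ.map_id]

theorem map_assoc_inv {A B D : C} (a : Φ.el A) (b : Φ.el B) (d : Φ.el D) :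
    Φ.map (α_ A B D).inv (Φ.pair a (Φ.pair b d)) = Φ.pair (Φ.pair a b) d :=
  Φ.map_hom_inv _ (Φ.map_assoc a b d)

theorem map_rightUnitor_inv {A : C} (a : Φ.el A) : Φ.map (ρ_ A).inv a = Φ.pair a Φ.unit :=
  Φ.map_hom_inv _ (Φ.map_rightUnitor a)

theorem map_leftUnitor {A : C} (a : Φ.el A) : Φ.map (λ_ A).hom (Φ.pair Φ.unit a) = a := by
  have h := Φ.map_comp (β_ (𝟙_ C) A).hom (ρ_ A).hom (Φ.pair Φ.unit a)
  rwa [braiding_rightUnitor, Φ.map_braid, Φ.map_rightUnitor] at h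

theorem map_leftUnitor_inv {A : C} (a : Φ.el A) : Φ.map (λ_ A).inv a = Φ.pair Φ.unit a :=
  Φ.map_hom_inv _ (Φ.map_leftUnitor a)

end Realization

/-- A cocommutative comonoidal family of objects, indexed by a commutative monoid. Its corepresented
functor is a realization. The index records which of the generic elements occur. -/
structure Support where
  R : Type
  [monoid : AddCommMonoid R]
  T : R → C
  counit : T 0 ⟶ 𝟙_ C
  /-- the comultiplication -/
  split : ∀ (a b : R) {c : R}, a + b = c → (T c ⟶ T a ⊗ T b)
  coassoc : ∀ (a b d : R) {ab bd abd : R} (h₁ : a + b = ab) (h₂ : ab + d = abd) (h₃ : b + d = bd)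
    (h₄ : a + bd = abd),
    split ab d h₂ ≫ split a b h₁ ▷ T d ≫ (α_ _ _ _).hom = split a bd h₄ ≫ T a ◁ split b d h₃
  cocomm : ∀ (a b : R) {c : R} (h : a + b = c) (h' : b + a = c),
    split a b h ≫ (β_ _ _).hom = split b a h'
  counit_right : ∀ (a : R) (h : a + 0 = a), split a 0 h ≫ T a ◁ counit ≫ (ρ_ _).hom = 𝟙 _

attribute [instance] Support.monoid

namespace Support

variable {C}

/-- The realization that is corepresented by a comonoidal family. -/
def realization (𝒮 : Support C) : Realization C where
  el A := Σ a : 𝒮.R, (𝒮.T a ⟶ A)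
  map f x := ⟨x.1, x.2 ≫ f⟩
  map_id x := by simp
  map_comp f g x := by simp
  unit := ⟨0, 𝒮.counit⟩
  pair x y := ⟨x.1 + y.1, 𝒮.split x.1 y.1 rfl ≫ (x.2 ⊗ₘ y.2)⟩
  map_tensor f g x y := by simp
  map_assoc := by
    rintro A B D ⟨a, f⟩ ⟨b, g⟩ ⟨d, k⟩
    have key : ∀ r (h : a + (b + d) = r),
        (⟨a + (b + d), 𝒮.split a (b + d) rfl ≫ (f ⊗ₘ 𝒮.split b d rfl ≫ (g ⊗ₘ k))⟩ :
          Σ a : 𝒮.R, (𝒮.T a ⟶ A ⊗ (B ⊗ D))) =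
        ⟨r, 𝒮.split a (b + d) h ≫ (f ⊗ₘ 𝒮.split b d rfl ≫ (g ⊗ₘ k))⟩ := by
      rintro _ rfl
      rfl
    rw [key (a + b + d) (add_assoc a b d).symm]
    congr 1
    have := 𝒮.coassoc a b d rfl rfl rfl (add_assoc a b d).symm
    rw [show (f ⊗ₘ 𝒮.split b d rfl ≫ (g ⊗ₘ k)) = 𝒮.T a ◁ 𝒮.split b d rfl ≫ (f ⊗ₘ (g ⊗ₘ k)) by
      simp [← id_tensorHom], ← reassoc_of% this]
    rw [← associator_naturality, ← tensorHom_id, tensorHom_comp_tensorHom_assoc]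
    simp
  map_braid := by
    rintro A B ⟨a, f⟩ ⟨b, g⟩
    have key : ∀ r (h : b + a = r),
        (⟨b + a, 𝒮.split b a rfl ≫ (g ⊗ₘ f)⟩ : Σ a : 𝒮.R, (𝒮.T a ⟶ B ⊗ A)) =
        ⟨r, 𝒮.split b a h ≫ (g ⊗ₘ f)⟩ := by
      rintro _ rfl
      rfl
    rw [key (a + b) (add_comm b a)]
    congr 1
    rw [← 𝒮.cocomm a b rfl]
    simp
  map_rightUnitor := by
    rintro A ⟨a, f⟩
    have key : ∀ r (h : a + 0 = r),
        (⟨a + 0, 𝒮.split a 0 rfl ≫ (f ⊗ₘ 𝒮.counit) ≫ (ρ_ A).hom⟩ : Σ a : 𝒮.R, (𝒮.T a ⟶ A)) =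
        ⟨r, 𝒮.split a 0 h ≫ (f ⊗ₘ 𝒮.counit) ≫ (ρ_ A).hom⟩ := by
      rintro _ rfl
      rfl
    simp only [Category.assoc]
    rw [key a (add_zero a)]
    congr 1
    rw [tensorHom_def', Category.assoc, rightUnitor_naturality]
    have := 𝒮.counit_right a (add_zero a)
    rw [reassoc_of% this]

/-- The comonoidal family without generic elements. -/
def trivial : Support C where
  R := PUnit
  T _ := 𝟙_ C
  counit := 𝟙 _
  split _ _ _ _ := (λ_ _).inv
  coassoc := by intros; simp [unitors_inv_equal]
  cocomm := by intros; simp [unitors_inv_equal]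
  counit_right := by intros; simp [← unitors_equal]

theorem tensorμ_braiding (W X Y Z : C) :
    tensorμ W X Y Z ≫ (β_ (W ⊗ Y) (X ⊗ Z)).hom =
      ((β_ W X).hom ⊗ₘ (β_ Y Z).hom) ≫ tensorμ X W Z Y := by
  simp [tensorμ, SymmetricCategory.braiding_swap_eq_inv_braiding Y X,
    MonoidalCategory.tensorHom_def]

theorem tensorμ_whiskerRight {X X' Y Y' : C} (f : X ⟶ X') (g : Y ⟶ Y') (W Z : C) :
    tensorμ X W Y Z ≫ (f ⊗ₘ g) ▷ (W ⊗ Z) = (f ▷ W ⊗ₘ g ▷ Z) ≫ tensorμ X' W Y' Z := by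
  have := tensorμ_natural f (𝟙 W) g (𝟙 Z)
  rw [id_tensorHom_id, tensorHom_id, tensorHom_id, tensorHom_id] at this
  rw [this]

theorem tensorμ_whiskerLeft {X X' Y Y' : C} (f : X ⟶ X') (g : Y ⟶ Y') (W Z : C) :
    tensorμ W X Z Y ≫ (W ⊗ Z) ◁ (f ⊗ₘ g) = (W ◁ f ⊗ₘ Z ◁ g) ≫ tensorμ W X' Z Y' := by
  have := tensorμ_natural (𝟙 W) f (𝟙 Z) g
  rw [id_tensorHom_id, id_tensorHom, id_tensorHom, id_tensorHom] at this
  rw [this]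

/-- The product of two comonoidal families. -/
def prod (𝒮 𝒮' : Support C) : Support C where
  R := 𝒮.R × 𝒮'.R
  T r := 𝒮.T r.1 ⊗ 𝒮'.T r.2
  counit := (𝒮.counit ⊗ₘ 𝒮'.counit) ≫ (λ_ _).hom
  split a b _ h := (𝒮.split a.1 b.1 (congrArg Prod.fst h) ⊗ₘ
    𝒮'.split a.2 b.2 (congrArg Prod.snd h)) ≫ tensorμ _ _ _ _
  coassoc a b d ab bd abd h₁ h₂ h₃ h₄ := by
    have e1 := 𝒮.coassoc a.1 b.1 d.1 (congrArg Prod.fst h₁) (congrArg Prod.fst h₂)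
      (congrArg Prod.fst h₃) (congrArg Prod.fst h₄)
    have e2 := 𝒮'.coassoc a.2 b.2 d.2 (congrArg Prod.snd h₁) (congrArg Prod.snd h₂)
      (congrArg Prod.snd h₃) (congrArg Prod.snd h₄)
    simp only [comp_whiskerRight, MonoidalCategory.whiskerLeft_comp, Category.assoc]
    rw [reassoc_of% (tensorμ_whiskerRight (𝒮.split a.1 b.1 (congrArg Prod.fst h₁))
        (𝒮'.split a.2 b.2 (congrArg Prod.snd h₁)) (𝒮.T d.1) (𝒮'.T d.2)),
      reassoc_of% (tensorμ_whiskerLeft (𝒮.split b.1 d.1 (congrArg Prod.fst h₃))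
        (𝒮'.split b.2 d.2 (congrArg Prod.snd h₃)) (𝒮.T a.1) (𝒮'.T a.2)),
      associator_monoidal]
    simp only [tensorHom_comp_tensorHom_assoc]
    rw [e1, e2]
  cocomm a b c h h' := by
    rw [Category.assoc, tensorμ_braiding, tensorHom_comp_tensorHom_assoc, 𝒮.cocomm, 𝒮'.cocomm]
  counit_right a h := by
    have e1 := 𝒮.counit_right a.1 (add_zero _)
    have e2 := 𝒮'.counit_right a.2 (add_zero _)
    simp only [MonoidalCategory.whiskerLeft_comp, Category.assoc]
    change (𝒮.split a.1 0 _ ⊗ₘ 𝒮'.split a.2 0 _) ≫ tensorμ (𝒮.T a.1) (𝒮.T 0) (𝒮'.T a.2) (𝒮'.T 0) ≫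
      (𝒮.T a.1 ⊗ 𝒮'.T a.2) ◁ (𝒮.counit ⊗ₘ 𝒮'.counit) ≫ _ ≫ _ = 𝟙 (𝒮.T a.1 ⊗ 𝒮'.T a.2)
    rw [reassoc_of% (tensorμ_whiskerLeft 𝒮.counit 𝒮'.counit (𝒮.T a.1) (𝒮'.T a.2)),
      ← rightUnitor_monoidal]
    simp only [tensorHom_comp_tensorHom]
    rw [e1, e2]
    simp

section Variable

variable [HasInitial C]

/-- The powers of a generic element of `A`. The higher ones are initial, which makes the axioms of a
comultiplication hold for trivial reasons if the element occurs more than once; so `A` needs no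
diagonal. -/
noncomputable def varObj (A : C) : ℕ → C
  | 0 => 𝟙_ C
  | 1 => A
  | _ + 2 => ⊥_ C

/-- The comultiplication of `varObj A`. -/
noncomputable def varSplit (A : C) : ∀ (a b : ℕ) {c : ℕ}, a + b = c →
    (varObj A c ⟶ varObj A a ⊗ varObj A b)
  | 0, 0, 0, _ => (λ_ (𝟙_ C)).inv
  | 0, 1, 1, _ => (λ_ A).inv
  | 1, 0, 1, _ => (ρ_ A).inv
  | _, _, _ + 2, _ => initial.to _
  | _ + 1, _, 0, h => absurd h (by omega)
  | _, _ + 1, 0, h => absurd h (by omega)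
  | _ + 2, _, 1, h => absurd h (by omega)
  | _, _ + 2, 1, h => absurd h (by omega)
  | 0, 0, 1, h => absurd h (by omega)
  | 1, 1, 1, h => absurd h (by omega)

/-- The comonoidal family of a generic element that may occur at most once. -/
noncomputable def var (A : C) : Support C where
  R := ℕ
  T := varObj A
  counit := 𝟙 _
  split := varSplit A
  coassoc a b d ab bd abd h₁ h₂ h₃ h₄ := by
    match abd, h₂, h₄ with
    | _ + 2, _, _ => exact initialIsInitial.hom_ext _ _
    | 0, h₂, h₄ =>
      obtain ⟨rfl, rfl, rfl, rfl, rfl⟩ : ab = 0 ∧ bd = 0 ∧ a = 0 ∧ b = 0 ∧ d = 0 := by omega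
      simp [varSplit, varObj, unitors_inv_equal]
    | 1, h₂, h₄ =>
      obtain ⟨rfl, rfl, rfl, rfl, rfl⟩ | ⟨rfl, rfl, rfl, rfl, rfl⟩ | ⟨rfl, rfl, rfl, rfl, rfl⟩ :
        (ab = 1 ∧ bd = 0 ∧ a = 1 ∧ b = 0 ∧ d = 0) ∨ (ab = 1 ∧ bd = 1 ∧ a = 0 ∧ b = 1 ∧ d = 0) ∨
          (ab = 0 ∧ bd = 1 ∧ a = 0 ∧ b = 0 ∧ d = 1) := by omega
      all_goals simp [varSplit, varObj, unitors_inv_equal]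
  cocomm a b c h h' := by
    match c, h, h' with
    | _ + 2, _, _ => exact initialIsInitial.hom_ext _ _
    | 0, h, h' =>
      obtain ⟨rfl, rfl⟩ : a = 0 ∧ b = 0 := by omega
      simp [varSplit, varObj, unitors_inv_equal]
    | 1, h, h' =>
      obtain ⟨rfl, rfl⟩ | ⟨rfl, rfl⟩ : (a = 1 ∧ b = 0) ∨ (a = 0 ∧ b = 1) := by omega
      all_goals simp [varSplit, varObj]
  counit_right a h := by
    match a, h with
    | _ + 2, _ => exact initialIsInitial.hom_ext _ _
    | 0, _ => simp [varSplit, varObj, ← unitors_equal]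
    | 1, _ => simp [varSplit, varObj]

end Variable

/-- The elements of the first factor of a product of comonoidal families. -/
def inl (𝒮 𝒮' : Support C) {A : C} (x : 𝒮.realization.el A) : (𝒮.prod 𝒮').realization.el A :=
  ⟨(x.1, 0), 𝒮.T x.1 ◁ 𝒮'.counit ≫ (ρ_ _).hom ≫ x.2⟩

/-- The elements of the second factor of a product of comonoidal families. -/
def inr (𝒮 𝒮' : Support C) {A : C} (x : 𝒮'.realization.el A) : (𝒮.prod 𝒮').realization.el A :=
  ⟨(0, x.1), 𝒮.counit ▷ 𝒮'.T x.1 ≫ (λ_ _).hom ≫ x.2⟩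

theorem split_counit (𝒮 : Support C) (h : (0 : 𝒮.R) + 0 = 0) :
    𝒮.split 0 0 h ≫ (𝒮.counit ⊗ₘ 𝒮.counit) = 𝒮.counit ≫ (λ_ _).inv := by
  have := 𝒮.counit_right 0 (add_zero 0)
  have h2 : 𝒮.split 0 0 h ≫ 𝒮.T 0 ◁ 𝒮.counit = (ρ_ _).inv := by
    rw [← Category.comp_id (𝒮.T 0 ◁ 𝒮.counit), ← Iso.hom_inv_id (ρ_ (𝒮.T 0)), reassoc_of% this]
  rw [tensorHom_def', reassoc_of% h2, ← rightUnitor_inv_naturality, unitors_inv_equal]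

theorem counit_left (𝒮 : Support C) (a : 𝒮.R) (h : 0 + a = a) :
    𝒮.split 0 a h ≫ 𝒮.counit ▷ 𝒮.T a ≫ (λ_ _).hom = 𝟙 _ := by
  rw [← 𝒮.counit_right a (add_zero a), ← 𝒮.cocomm a 0 (add_zero a) h, Category.assoc,
    ← BraidedCategory.braiding_naturality_right_assoc, braiding_leftUnitor]

theorem inr_unit (𝒮 𝒮' : Support C) :
    inr 𝒮 𝒮' 𝒮'.realization.unit = (𝒮.prod 𝒮').realization.unit := by
  have : 𝒮.counit ▷ 𝒮'.T 0 ≫ (λ_ (𝒮'.T 0)).hom ≫ 𝒮'.counit =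
      (𝒮.counit ⊗ₘ 𝒮'.counit) ≫ (λ_ (𝟙_ C)).hom := by
    rw [MonoidalCategory.tensorHom_def, Category.assoc, leftUnitor_naturality]
  exact congrArg (fun f => (⟨(0, 0), f⟩ : (𝒮.prod 𝒮').realization.el _)) this

theorem split_inr (𝒮 𝒮' : Support C) {A B : C} (a b : 𝒮'.R) (f : 𝒮'.T a ⟶ A) (g : 𝒮'.T b ⟶ B) :
    𝒮.counit ▷ 𝒮'.T (a + b) ≫ (λ_ (𝒮'.T (a + b))).hom ≫ 𝒮'.split a b rfl ≫ (f ⊗ₘ g) =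
      (𝒮.split 0 0 (add_zero 0) ⊗ₘ 𝒮'.split a b rfl) ≫ tensorμ _ _ _ _ ≫
        ((𝒮.counit ▷ 𝒮'.T a ≫ (λ_ _).hom ≫ f) ⊗ₘ (𝒮.counit ▷ 𝒮'.T b ≫ (λ_ _).hom ≫ g)) := by
  have h2 := tensorμ_natural 𝒮.counit 𝒮.counit (𝟙 (𝒮'.T a)) (𝟙 (𝒮'.T b))
  simp only [tensorHom_id] at h2
  have h3 := tensor_left_unitality (𝒮'.T a) (𝒮'.T b)
  have h4 : ((𝒮.counit ≫ (λ_ (𝟙_ C)).inv) ⊗ₘ 𝒮'.split a b rfl) =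
      (𝒮.counit ⊗ₘ 𝒮'.split a b rfl) ≫ (λ_ (𝟙_ C)).inv ▷ (𝒮'.T a ⊗ 𝒮'.T b) := by
    simp [← tensorHom_id]
  rw [← tensorHom_comp_tensorHom (𝒮.counit ▷ 𝒮'.T a), ← tensorHom_comp_tensorHom (λ_ _).hom,
    ← reassoc_of% h2, tensorHom_comp_tensorHom_assoc, split_counit, id_whiskerRight,
    Category.comp_id, h4, Category.assoc, ← reassoc_of% h3,
    MonoidalCategory.tensorHom_def 𝒮.counit, Category.assoc, leftUnitor_naturality_assoc]

theorem inr_pair (𝒮 𝒮' : Support C) {A B : C} (x : 𝒮'.realization.el A)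
    (y : 𝒮'.realization.el B) : inr 𝒮 𝒮' (𝒮'.realization.pair x y) =
      (𝒮.prod 𝒮').realization.pair (inr 𝒮 𝒮' x) (inr 𝒮 𝒮' y) := by
  obtain ⟨a, f⟩ := x
  obtain ⟨b, g⟩ := y
  have key : ∀ r (h : (0 : 𝒮.R) + 0 = r),
      (𝒮.prod 𝒮').realization.pair (inr 𝒮 𝒮' ⟨a, f⟩) (inr 𝒮 𝒮' ⟨b, g⟩) =
        ⟨(r, a + b), (𝒮.split 0 0 h ⊗ₘ 𝒮'.split a b rfl) ≫ tensorμ _ _ _ _ ≫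
          ((𝒮.counit ▷ 𝒮'.T a ≫ (λ_ _).hom ≫ f) ⊗ₘ (𝒮.counit ▷ 𝒮'.T b ≫ (λ_ _).hom ≫ g))⟩ := by
    rintro _ rfl
    simp [realization, prod, inr]
  rw [key 0 (add_zero 0)]
  exact congrArg (fun f => (⟨(0, a + b), f⟩ : (𝒮.prod 𝒮').realization.el _))
    (split_inr 𝒮 𝒮' a b f g)

theorem split_inl_inr (𝒮 𝒮' : Support C) {A B : C} (a : 𝒮.R) (b : 𝒮'.R) (f : 𝒮.T a ⟶ A)
    (g : 𝒮'.T b ⟶ B) :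
    (𝒮.split a 0 (add_zero a) ⊗ₘ 𝒮'.split 0 b (zero_add b)) ≫ tensorμ _ _ _ _ ≫
      ((𝒮.T a ◁ 𝒮'.counit ≫ (ρ_ _).hom ≫ f) ⊗ₘ (𝒮.counit ▷ 𝒮'.T b ≫ (λ_ _).hom ≫ g)) =
    f ⊗ₘ g := by
  have h2 := tensorμ_natural (𝟙 (𝒮.T a)) 𝒮.counit 𝒮'.counit (𝟙 (𝒮'.T b))
  simp only [tensorHom_id, id_tensorHom] at h2
  have h3 : tensorμ (𝒮.T a) (𝟙_ C) (𝟙_ C) (𝒮'.T b) ≫ ((ρ_ _).hom ⊗ₘ (λ_ _).hom) =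
      ((ρ_ _).hom ⊗ₘ (λ_ _).hom) := by
    simp only [tensorμ, braiding_tensorUnit_left]
    monoidal
  have h4 := 𝒮.counit_right a (add_zero a)
  have h5 := 𝒮'.counit_left b (zero_add b)
  rw [← tensorHom_comp_tensorHom (𝒮.T a ◁ 𝒮'.counit), ← tensorHom_comp_tensorHom (ρ_ _).hom,
    ← reassoc_of% h2, reassoc_of% h3, tensorHom_comp_tensorHom_assoc,
    tensorHom_comp_tensorHom_assoc, tensorHom_comp_tensorHom, Category.assoc, Category.assoc,
    Category.assoc, Category.assoc, reassoc_of% h4, reassoc_of% h5]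

/-- A generic element of a tensor product is the pair of generic elements of the factors. -/
theorem inl_pair_inr (𝒮 𝒮' : Support C) {A B : C} (a : 𝒮.R) (b : 𝒮'.R) (f : 𝒮.T a ⟶ A)
    (g : 𝒮'.T b ⟶ B) :
    (𝒮.prod 𝒮').realization.pair (inl 𝒮 𝒮' ⟨a, f⟩) (inr 𝒮 𝒮' ⟨b, g⟩) = ⟨(a, b), f ⊗ₘ g⟩ := by
  have key : ∀ r r' (h : a + 0 = r) (h' : 0 + b = r'),
      (𝒮.prod 𝒮').realization.pair (inl 𝒮 𝒮' ⟨a, f⟩) (inr 𝒮 𝒮' ⟨b, g⟩) =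
        ⟨(r, r'), (𝒮.split a 0 h ⊗ₘ 𝒮'.split 0 b h') ≫ tensorμ _ _ _ _ ≫
          ((𝒮.T a ◁ 𝒮'.counit ≫ (ρ_ _).hom ≫ f) ⊗ₘ (𝒮.counit ▷ 𝒮'.T b ≫ (λ_ _).hom ≫ g))⟩ := by
    rintro _ _ rfl rfl
    simp [realization, prod, inl, inr]
  rw [key a b (add_zero a) (zero_add b)]
  exact congrArg (fun f => (⟨(a, b), f⟩ : (𝒮.prod 𝒮').realization.el _))
    (split_inl_inr 𝒮 𝒮' a b f g)

end Support

variable {C}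

/-- Lists of elements, one of each object of a list. -/
inductive ElList (Φ : Realization C) {κ : Type} (X : κ → C) : List κ → Type v
  | nil : ElList Φ X []
  | cons {a : κ} {l : List κ} : Φ.el (X a) → ElList Φ X l → ElList Φ X (a :: l)

namespace ElList

variable {Φ : Realization C} {κ : Type} {X : κ → C}

/-- The concatenation of lists of elements. -/
def append : ∀ {l l' : List κ}, ElList Φ X l → ElList Φ X l' → ElList Φ X (l ++ l')
  | _, _, nil, t' => t'
  | _, _, cons x t, t' => cons x (append t t')

/-- The element of the tensor product that is given by elements of the factors. -/
def pure : ∀ {l : List κ}, ElList Φ X l → Φ.el (tensorList X l)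
  | _, nil => Φ.unit
  | _, cons x t => Φ.pair x (pure t)

/-- The image of a list of elements under a family of morphisms. -/
def map {Y : κ → C} (f : ∀ a, X a ⟶ Y a) : ∀ {l : List κ}, ElList Φ X l → ElList Φ Y l
  | _, nil => nil
  | a :: _, cons x t => cons (Φ.map (f a) x) (map f t)

theorem tensorAppend_pure : ∀ {l l' : List κ} (t : ElList Φ X l) (t' : ElList Φ X l'),
    Φ.map (tensorAppend X l l').hom (append t t').pure = Φ.pair t.pure t'.pure
  | _, _, nil, _ => Φ.map_leftUnitor_inv _
  | _ :: l, l', cons x t, t' => by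
    simp only [tensorAppend, Iso.trans_hom, whiskerLeftIso_hom, Iso.symm_hom, Φ.map_comp]
    rw [append, pure, pure, Φ.map_whiskerLeft, tensorAppend_pure t t', Φ.map_assoc_inv]

theorem tensorAppend_inv_pure {l l' : List κ} (t : ElList Φ X l) (t' : ElList Φ X l') :
    Φ.map (tensorAppend X l l').inv (Φ.pair t.pure t'.pure) = (append t t').pure :=
  Φ.map_hom_inv _ (tensorAppend_pure t t')

theorem tensorMap_pure {Y : κ → C} (f : ∀ a, X a ⟶ Y a) : ∀ {l : List κ} (t : ElList Φ X l),
    Φ.map (tensorMap f l) t.pure = (t.map f).pure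
  | _, nil => Φ.map_id _
  | a :: l, cons x t => by
    simp only [tensorMap, pure, map, Φ.map_tensor, tensorMap_pure f t]

theorem tensorAt_pure {pre mid post : List κ} {c : κ} (f : tensorList X mid ⟶ X c)
    (t₁ : ElList Φ X pre) (t₂ : ElList Φ X mid) (t₃ : ElList Φ X post) :
    Φ.map (tensorAt X pre mid post c f) (append t₁ (append t₂ t₃)).pure =
      (append t₁ (cons (Φ.map f t₂.pure) t₃)).pure := by
  simp only [tensorAt, Φ.map_comp, tensorAppend_pure, Φ.map_whiskerLeft, Φ.map_whiskerRight]
  exact tensorAppend_inv_pure t₁ (cons (Φ.map f t₂.pure) t₃)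

theorem tensorSwap_pure {pre post : List κ} {a b : κ} (t₁ : ElList Φ X pre) (x : Φ.el (X a))
    (y : Φ.el (X b)) (t₂ : ElList Φ X post) :
    Φ.map (tensorSwap X pre post a b) (append t₁ (cons y (cons x t₂))).pure =
      (append t₁ (cons x (cons y t₂))).pure := by
  simp only [tensorSwap, Φ.map_comp, tensorAppend_pure, Φ.map_whiskerLeft]
  simp only [pure, Φ.map_assoc_inv, Φ.map_whiskerRight, Φ.map_braid, Φ.map_assoc]
  exact tensorAppend_inv_pure t₁ (cons x (cons y t₂))

theorem plugAt_pure {pre mid post : List κ} {c : κ} {W : C} (f : W ⊗ tensorList X mid ⟶ X c)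
    (w : Φ.el W) (t₁ : ElList Φ X pre) (t₂ : ElList Φ X mid) (t₃ : ElList Φ X post) :
    Φ.map (plugAt X pre mid post c W f) (Φ.pair w (append t₁ (append t₂ t₃)).pure) =
      (append t₁ (cons (Φ.map f (Φ.pair w t₂.pure)) t₃)).pure := by
  simp only [plugAt, Φ.map_comp, tensorAppend_pure, Φ.map_whiskerLeft, Φ.map_assoc_inv,
    Φ.map_whiskerRight, Φ.map_braid, Φ.map_assoc]
  exact tensorAppend_inv_pure t₁ (cons (Φ.map f (Φ.pair w t₂.pure)) t₃)

end ElList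

end Realizations

/-! ### Pairs in sets and the evaluation of token lists -/

/-- The arity of the result of an insertion of elements of `Z` into the inputs of an operation. -/
def totalArity {Z : Type w} (arZ : Z → ℕ) : List (Option Z) → ℕ
  | [] => 0
  | none :: s => 1 + totalArity arZ s
  | some z :: s => arZ z + totalArity arZ s

/-- The data of a pair `(M, Z)` in sets, with all arities put together. Inputs are numbered
from `0`, and `comp x p y` and `ract z p l` have no meaning if `p` is not an input. -/
structure PairData where
  M : Type w
  Z : Type w
  /-- the arity of an element of `M` -/
  ar : M → ℕ
  /-- the arity of an element of `Z` -/
  arZ : Z → ℕ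
  one : M
  /-- the image of the element of `As` of arity `l` -/
  mu : ℕ → M
  comp : M → ℕ → M → M
  /-- the wide left action -/
  act : M → List (Option Z) → Z
  /-- the right action: `ract z p l` inserts the element of `As` of arity `l` into the input `p` -/
  ract : Z → ℕ → ℕ → Z

/-- A pair `(M, Z)` in sets. -/
structure SetPair extends PairData.{w} where
  ar_one : ar one = 1
  ar_mu : ∀ l, ar (mu l) = l
  ar_comp : ∀ x p y, p < ar x → ar (comp x p y) + 1 = ar x + ar y
  one_comp : ∀ y, comp one 0 y = y
  comp_one : ∀ x p, p < ar x → comp x p one = x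
  comp_assoc : ∀ x p y p' z, p < ar x → p' < ar y →
    comp (comp x p y) (p + p') z = comp x p (comp y p' z)
  comp_comm : ∀ x p m y z, p + 1 + m < ar x →
    comp (comp x p y) (p + ar y + m) z = comp (comp x (p + 1 + m) z) p y
  mu_one : mu 1 = one
  mu_comp : ∀ p q l, comp (mu (p + 1 + q)) p (mu l) = mu (p + l + q)
  arZ_act : ∀ x s, s.length = ar x → arZ (act x s) = totalArity arZ s
  one_act : ∀ z, act one [some z] = z
  act_act : ∀ x y pre mid post, pre.length + 1 + post.length = ar x → mid.length = ar y →
    act x (pre ++ some (act y mid) :: post) = act (comp x pre.length y) (pre ++ (mid ++ post))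
  arZ_ract : ∀ z p l, p < arZ z → arZ (ract z p l) + 1 = arZ z + l
  ract_one : ∀ z p, p < arZ z → ract z p 1 = z
  ract_assoc : ∀ z p a b c, p < arZ z → ract (ract z p (a + 1 + b)) (p + a) c = ract z p (a + c + b)
  ract_comm : ∀ z p m l k, p + 1 + m < arZ z →
    ract (ract z p l) (p + l + m) k = ract (ract z (p + 1 + m) k) p l
  ract_inner : ∀ x pre z post p l, pre.length + 1 + post.length = ar x → p < arZ z →
    ract (act x (pre ++ some z :: post)) (totalArity arZ pre + p) l =
      act x (pre ++ some (ract z p l) :: post)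
  ract_outer : ∀ x pre post l, pre.length + 1 + post.length = ar x →
    ract (act x (pre ++ none :: post)) (totalArity arZ pre) l =
      act (comp x pre.length (mu l)) (pre ++ (List.replicate l none ++ post))

namespace SetPair

variable (P : SetPair.{w})

/-- The symbols of a normal form: a bar, an inserted element of `Z`, the beginning of an operation,
and the end of an input of an operation. -/
inductive Tok
  | bar
  | leaf (z : P.Z)
  | op (t : P.M)
  | close

variable {P}

/-- One step of the evaluation. The state `(m, p)` is an operation `m` whose first `p` inputs are
the bars that have been read, and whose input `p` receives what is read next. -/
def step : P.Tok → P.M × ℕ → P.M × ℕ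
  | .bar, s => (P.comp s.1 s.2 (P.mu 2), s.2 + 1)
  | .leaf _, s => (P.comp s.1 s.2 (P.mu 2), s.2 + 1)
  | .op t, s => (P.comp (P.comp s.1 s.2 (P.mu 2)) s.2 t, s.2)
  | .close, s => (P.comp s.1 s.2 (P.mu 0), s.2)

/-- The evaluation of a list of symbols, from left to right. -/
def run : List P.Tok → P.M × ℕ → P.M × ℕ
  | [], s => s
  | t :: τ, s => run τ (step t s)

theorem run_append (τ τ' : List P.Tok) (s : P.M × ℕ) : run (τ ++ τ') s = run τ' (run τ s) := by
  induction τ generalizing s with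
  | nil => rfl
  | cons t τ ih => exact ih _

/-- `Depth τ r r'`: if `r` inputs of operations are open before `τ`, then `r'` inputs are open after
`τ`, and `τ` never closes an input when none is open. -/
def Depth : List P.Tok → ℕ → ℕ → Prop
  | [], r, r' => r = r'
  | .bar :: τ, r, r' => Depth τ r r'
  | .leaf _ :: τ, r, r' => Depth τ r r'
  | .op t :: τ, r, r' => Depth τ (r + P.ar t) r'
  | .close :: τ, r, r' => ∃ s, r = s + 1 ∧ Depth τ s r'

theorem Depth.append {τ τ' : List P.Tok} {r s r' : ℕ} (h : Depth τ r s) (h' : Depth τ' s r') :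
    Depth (τ ++ τ') r r' := by
  induction τ generalizing r with
  | nil =>
    cases h
    exact h'
  | cons t τ ih =>
    cases t with
    | bar => exact ih h
    | leaf z => exact ih h
    | op t => exact ih (r := r + P.ar t) h
    | close =>
      obtain ⟨k, hk, h⟩ := h
      exact ⟨k, hk, ih h⟩

theorem Depth.split {τ τ' : List P.Tok} {r r' : ℕ} (h : Depth (τ ++ τ') r r') :
    ∃ s, Depth τ r s ∧ Depth τ' s r' := by
  induction τ generalizing r with
  | nil => exact ⟨r, rfl, h⟩
  | cons t τ ih =>
    cases t with
    | bar => exact ih (r := r) h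
    | leaf z => exact ih (r := r) h
    | op t => exact ih (r := r + P.ar t) h
    | close =>
      obtain ⟨k, hk, h⟩ := h
      obtain ⟨s, h1, h2⟩ := ih h
      exact ⟨s, ⟨k, hk, h1⟩, h2⟩

theorem Depth.add {τ : List P.Tok} {r r' : ℕ} (h : Depth τ r r') (k : ℕ) :
    Depth τ (r + k) (r' + k) := by
  induction τ generalizing r with
  | nil => exact congrArg (· + k) h
  | cons t τ ih =>
    cases t with
    | bar => exact ih (r := r) h
    | leaf z => exact ih (r := r) h
    | op t =>
      have := ih (r := r + P.ar t) h
      rwa [add_right_comm] at this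
    | close =>
      obtain ⟨s, rfl, h⟩ := h
      exact ⟨s + k, by omega, ih h⟩

/-- The inputs of the result: bars remain inputs, and elements of `Z` are inserted. -/
def slots : List P.Tok → List (Option P.Z)
  | [] => []
  | .bar :: τ => none :: slots τ
  | .leaf z :: τ => some z :: slots τ
  | .op _ :: τ => slots τ
  | .close :: τ => slots τ

theorem slots_append (τ τ' : List P.Tok) : slots (τ ++ τ') = slots τ ++ slots τ' := by
  induction τ with
  | nil => rfl
  | cons t τ ih => cases t <;> simp [slots, ih]

/-- The operation that is denoted by a list of symbols, where elements of `Z` are read as bars. -/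
def evalM (τ : List P.Tok) : P.M :=
  P.comp (run τ (P.one, 0)).1 (run τ (P.one, 0)).2 (P.mu 0)

/-- The element of `Z` that is denoted by a list of symbols. -/
def evalZ (τ : List P.Tok) : P.Z := P.act (evalM τ) (slots τ)

theorem comp_comm' {x y z : P.M} {p q : ℕ} (h : p < q) (hq : q < P.ar x) :
    P.comp (P.comp x p y) (q - 1 + P.ar y) z = P.comp (P.comp x q z) p y := by
  obtain ⟨m, rfl⟩ := Nat.exists_eq_add_of_lt h
  have := P.comp_comm x p m y z (by omega)
  rw [show p + m + 1 - 1 + P.ar y = p + P.ar y + m by omega, this,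
    show p + 1 + m = p + m + 1 by omega]

theorem mu2_left (x : P.M) (p : ℕ) (h : p < P.ar x) :
    P.comp (P.comp x p (P.mu 2)) p (P.mu 0) = x := by
  have h1 := P.comp_assoc x p (P.mu 2) 0 (P.mu 0) h (by rw [P.ar_mu]; omega)
  have h2 := P.mu_comp 0 1 0
  rw [add_zero] at h1
  rw [h1]
  simp only [zero_add] at h2
  rw [h2, P.mu_one, P.comp_one x p h]

theorem mu2_right (x : P.M) (p : ℕ) (h : p < P.ar x) :
    P.comp (P.comp x p (P.mu 2)) (p + 1) (P.mu 0) = x := by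
  have h1 := P.comp_assoc x p (P.mu 2) 1 (P.mu 0) h (by rw [P.ar_mu]; omega)
  have h2 := P.mu_comp 1 0 0
  rw [h1]
  simp only [add_zero] at h2
  rw [h2, P.mu_one, P.comp_one x p h]

theorem mu2_assoc (x : P.M) (p : ℕ) (h : p < P.ar x) :
    P.comp (P.comp x p (P.mu 2)) p (P.mu 2) = P.comp (P.comp x p (P.mu 2)) (p + 1) (P.mu 2) := by
  have h1 := P.comp_assoc x p (P.mu 2) 0 (P.mu 2) h (by rw [P.ar_mu]; omega)
  have h2 := P.comp_assoc x p (P.mu 2) 1 (P.mu 2) h (by rw [P.ar_mu]; omega)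
  have h3 := P.mu_comp 0 1 2
  have h4 := P.mu_comp 1 0 2
  simp only [zero_add, add_zero] at h1 h3 h4
  rw [h1, h2, h3, h4]

/-- The arities of the states of the evaluation. -/
theorem run_arity {τ : List P.Tok} {r r' : ℕ} (h : Depth τ r r') (m : P.M) (p : ℕ)
    (hm : p + r < P.ar m) :
    P.ar (run τ (m, p)).1 + (p + r) = P.ar m + ((run τ (m, p)).2 + r') ∧
      (run τ (m, p)).2 = p + (slots τ).length := by
  induction τ generalizing r m p with
  | nil =>
    cases h
    simp [run, slots]
  | cons t τ ih =>
    have h0 := P.ar_mu 0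
    have h2 := P.ar_mu 2
    have h3 := P.ar_comp m p (P.mu 2) (by omega)
    have h4 := P.ar_comp m p (P.mu 0) (by omega)
    cases t with
    | bar =>
      have := ih (r := r) h (P.comp m p (P.mu 2)) (p + 1) (by omega)
      simp only [run, step, slots, List.length_cons] at this ⊢
      omega
    | leaf z =>
      have := ih (r := r) h (P.comp m p (P.mu 2)) (p + 1) (by omega)
      simp only [run, step, slots, List.length_cons] at this ⊢
      omega
    | op t =>
      have h5 := P.ar_comp (P.comp m p (P.mu 2)) p t (by omega)
      have := ih (r := r + P.ar t) h (P.comp (P.comp m p (P.mu 2)) p t) p (by omega)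
      simp only [run, step, slots] at this ⊢
      omega
    | close =>
      obtain ⟨s, rfl, h⟩ := h
      have := ih (r := s) h (P.comp m p (P.mu 0)) p (by omega)
      simp only [run, step, slots] at this ⊢
      omega

/-- Insertions on the left of the current input commute with the evaluation. -/
theorem run_comm {τ : List P.Tok} {r r' : ℕ} (h : Depth τ r r') (m t : P.M) (p q : ℕ) (hq : q < p)
    (hm : p + r < P.ar m) :
    run τ (P.comp m q t, p - 1 + P.ar t) =
      (P.comp (run τ (m, p)).1 q t, (run τ (m, p)).2 - 1 + P.ar t) := by
  induction τ generalizing r m p with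
  | nil => rfl
  | cons a τ ih =>
    have h0 := P.ar_mu 0
    have h2 := P.ar_mu 2
    have h3 := P.ar_comp m p (P.mu 2) (by omega)
    have h4 := P.ar_comp m p (P.mu 0) (by omega)
    have h5 : p - 1 + P.ar t + 1 = p + 1 - 1 + P.ar t := by omega
    cases a with
    | bar =>
      have := ih (r := r) h (P.comp m p (P.mu 2)) (p + 1) (by omega) (by omega)
      simp only [run, step]
      rw [comp_comm' hq (by omega), h5, this]
    | leaf z =>
      have := ih (r := r) h (P.comp m p (P.mu 2)) (p + 1) (by omega) (by omega)
      simp only [run, step]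
      rw [comp_comm' hq (by omega), h5, this]
    | op b =>
      have h6 := P.ar_comp (P.comp m p (P.mu 2)) p b (by omega)
      have := ih (r := r + P.ar b) h (P.comp (P.comp m p (P.mu 2)) p b) p (by omega) (by omega)
      simp only [run, step]
      rw [comp_comm' hq (by omega), comp_comm' hq (by omega), this]
    | close =>
      obtain ⟨s, rfl, h⟩ := h
      have := ih (r := s) h (P.comp m p (P.mu 0)) p (by omega) (by omega)
      simp only [run, step]
      rw [comp_comm' hq (by omega), this]

/-- The evaluation inside an inserted operation. -/
theorem run_assoc {τ : List P.Tok} {r r' : ℕ} (h : Depth τ r r') (m t : P.M) (p q : ℕ)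
    (hq : q < P.ar m) (ht : p + r < P.ar t) :
    run τ (P.comp m q t, q + p) = (P.comp m q (run τ (t, p)).1, q + (run τ (t, p)).2) := by
  induction τ generalizing r t p with
  | nil => rfl
  | cons a τ ih =>
    have h0 := P.ar_mu 0
    have h2 := P.ar_mu 2
    have h3 := P.ar_comp t p (P.mu 2) (by omega)
    have h4 := P.ar_comp t p (P.mu 0) (by omega)
    cases a with
    | bar =>
      have := ih (r := r) h (P.comp t p (P.mu 2)) (p + 1) (by omega)
      simp only [run, step]
      rw [P.comp_assoc _ _ _ _ _ hq (by omega), add_assoc, this]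
    | leaf z =>
      have := ih (r := r) h (P.comp t p (P.mu 2)) (p + 1) (by omega)
      simp only [run, step]
      rw [P.comp_assoc _ _ _ _ _ hq (by omega), add_assoc, this]
    | op b =>
      have h6 := P.ar_comp (P.comp t p (P.mu 2)) p b (by omega)
      have := ih (r := r + P.ar b) h (P.comp (P.comp t p (P.mu 2)) p b) p (by omega)
      simp only [run, step]
      rw [P.comp_assoc _ _ _ _ _ hq (by omega), P.comp_assoc _ _ _ _ _ hq (by omega), this]
    | close =>
      obtain ⟨s, rfl, h⟩ := h
      have := ih (r := s) h (P.comp t p (P.mu 0)) p (by omega)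
      simp only [run, step]
      rw [P.comp_assoc _ _ _ _ _ hq (by omega), this]

/-- The input that is the outer end of what is read may be doubled before or after the
evaluation. -/
theorem run_mu2 {τ : List P.Tok} {r r' : ℕ} (h : Depth τ r r') (m : P.M) (p : ℕ)
    (hm : p + r < P.ar m) :
    run τ (P.comp m (p + r) (P.mu 2), p) =
      (P.comp (run τ (m, p)).1 ((run τ (m, p)).2 + r') (P.mu 2), (run τ (m, p)).2) := by
  induction τ generalizing r m p with
  | nil =>
    cases h
    rfl
  | cons a τ ih =>
    have h0 := P.ar_mu 0
    have h2 := P.ar_mu 2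
    have h3 := P.ar_comp m p (P.mu 2) (by omega)
    have h4 := P.ar_comp m p (P.mu 0) (by omega)
    have h5 : P.comp (P.comp m (p + r) (P.mu 2)) p (P.mu 2) =
        P.comp (P.comp m p (P.mu 2)) (p + 1 + r) (P.mu 2) := by
      -- the two inputs coincide if and only if `r = 0`
      rcases Nat.eq_zero_or_pos r with rfl | hr
      · exact mu2_assoc m p (by omega)
      · rw [← comp_comm' (show p < p + r by omega) (by omega), h2]
        congr 1
        omega
    cases a with
    | bar =>
      have := ih (r := r) h (P.comp m p (P.mu 2)) (p + 1) (by omega)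
      simp only [run, step]
      rw [h5, this]
    | leaf z =>
      have := ih (r := r) h (P.comp m p (P.mu 2)) (p + 1) (by omega)
      simp only [run, step]
      rw [h5, this]
    | op b =>
      have h6 := P.ar_comp (P.comp m p (P.mu 2)) p b (by omega)
      have := ih (r := r + P.ar b) h (P.comp (P.comp m p (P.mu 2)) p b) p (by omega)
      simp only [run, step]
      rw [h5, ← comp_comm' (show p < p + 1 + r by omega) (by omega), ← this]
      congr 3
      omega
    | close =>
      obtain ⟨s, rfl, h⟩ := h
      have := ih (r := s) h (P.comp m p (P.mu 0)) p (by omega)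
      simp only [run, step]
      rw [← comp_comm' (show p < p + (s + 1) by omega) (by omega), ← this, h0]
      congr 3

theorem ar_evalM {τ : List P.Tok} (h : Depth τ 0 0) : P.ar (evalM τ) = (slots τ).length := by
  have h1 := run_arity h P.one 0 (by rw [P.ar_one]; omega)
  rw [P.ar_one] at h1
  have h2 := P.ar_comp (run τ (P.one, 0)).1 (run τ (P.one, 0)).2 (P.mu 0) (by omega)
  rw [P.ar_mu] at h2
  unfold evalM
  omega

/-- Reading a complete list of symbols inserts the operation that it denotes. -/
theorem run_complete {τ : List P.Tok} (h : Depth τ 0 0) (m : P.M) (p : ℕ) (hm : p < P.ar m) :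
    run τ (m, p) = (P.comp (P.comp m p (P.mu 2)) p (evalM τ), p + (slots τ).length) := by
  have h1 := P.ar_one
  have h2 := P.ar_mu 2
  have hτ := run_arity h P.one 0 (by omega)
  have e1 := run_assoc h m P.one 0 p hm (by omega)
  have e2 := run_assoc h (P.mu 2) P.one 0 0 (by omega) (by omega)
  have e3 := run_mu2 h P.one 0 (by omega)
  -- the state after `τ` has one input more than `evalM τ`, its last one
  have key : (run τ (P.one, 0)).1 = P.comp (P.mu 2) 0 (evalM τ) := by
    rw [evalM, ← P.comp_assoc _ _ _ _ _ (by omega) (by omega), zero_add]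
    rw [P.comp_one _ _ (by omega)] at e2
    rw [add_zero, P.one_comp] at e3
    rw [add_zero] at e2 e3
    have e4 : P.comp (P.mu 2) 0 (run τ (P.one, 0)).1 =
        P.comp (run τ (P.one, 0)).1 (run τ (P.one, 0)).2 (P.mu 2) :=
      congrArg Prod.fst (e2.symm.trans e3)
    rw [e4, mu2_left _ _ (by omega)]
  rw [P.comp_one _ _ hm, add_zero] at e1
  have e5 := P.comp_assoc m p (P.mu 2) 0 (evalM τ) hm (by omega)
  rw [add_zero] at e5
  rw [e1, key, e5, hτ.2, zero_add]

/-- A complete part of a list of symbols may be evaluated first, and inserted into a bar. -/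
theorem evalM_insert {τ₁ τ τ₂ : List P.Tok} {r : ℕ} (h₁ : Depth τ₁ 0 r) (h : Depth τ 0 0)
    (h₂ : Depth τ₂ r 0) :
    evalM (τ₁ ++ (τ ++ τ₂)) =
      P.comp (evalM (τ₁ ++ .bar :: τ₂)) (slots τ₁).length (evalM τ) := by
  have a1 := P.ar_one
  have a2 := P.ar_mu 2
  have a3 := run_arity h₁ P.one 0 (by omega)
  have a4 := ar_evalM h
  rcases hs : run τ₁ (P.one, 0) with ⟨m, p⟩
  rw [hs] at a3
  simp only at a3
  have a5 := P.ar_comp m p (P.mu 2) (by omega)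
  have a6 := run_arity h₂ (P.comp m p (P.mu 2)) (p + 1) (by omega)
  have e1 := run_comm h₂ (P.comp m p (P.mu 2)) (evalM τ) (p + 1) p (by omega) (by omega)
  rw [a4] at e1
  rw [evalM, evalM, run_append, run_append, run_append, hs, run_complete h m p (by omega), run,
    step, ← show p + 1 - 1 + (slots τ).length = p + (slots τ).length by omega, e1, ← a4,
    comp_comm' (by omega) (by omega)]
  congr 1
  omega

/-- The symbols of an operation whose inputs receive given lists of symbols. -/
def gaps : List (List P.Tok) → List P.Tok
  | [] => []
  | g :: gs => g ++ .close :: gaps gs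

/-- Replace the bars and the elements of `Z` with lists of symbols. -/
def fill : List P.Tok → List (List P.Tok) → List P.Tok
  | [], _ => []
  | .op t :: τ, gs => .op t :: fill τ gs
  | .close :: τ, gs => .close :: fill τ gs
  | .bar :: τ, [] => .bar :: fill τ []
  | .leaf z :: τ, [] => .leaf z :: fill τ []
  | .bar :: τ, g :: gs => g ++ fill τ gs
  | .leaf _ :: τ, g :: gs => g ++ fill τ gs

/-- Insert operations into the inputs from the `p`-th one on. -/
def insertAll (m : P.M) (p : ℕ) : List P.M → P.M
  | [] => m
  | t :: ts => insertAll (P.comp m p t) (p + P.ar t) ts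

theorem evalM_leaf (τ₁ τ₂ : List P.Tok) (z : P.Z) :
    evalM (τ₁ ++ .leaf z :: τ₂) = evalM (τ₁ ++ .bar :: τ₂) := by
  simp only [evalM, run_append]
  rfl

/-- If the bars of a list `τ` of symbols are replaced with complete lists, then these lists may be
evaluated first, and inserted into the inputs that belong to the bars. -/
theorem evalM_fill {τ₁ τ τ₂ : List P.Tok} {r s : ℕ} (h₁ : Depth τ₁ 0 r) (h : Depth τ r s)
    (h₂ : Depth τ₂ s 0) (gs : List (List P.Tok)) (hgs : ∀ g ∈ gs, Depth g 0 0)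
    (hl : gs.length = (slots τ).length) :
    evalM (τ₁ ++ (fill τ gs ++ τ₂)) =
      insertAll (evalM (τ₁ ++ (τ ++ τ₂))) (slots τ₁).length (gs.map evalM) := by
  have h0 : ∀ g ∈ gs, ∀ r, Depth g r r := fun g hg r => by simpa using (hgs g hg).add r
  induction τ generalizing τ₁ gs r with
  | nil =>
    obtain rfl : gs = [] := by simpa [slots] using hl
    rfl
  | cons t τ ih =>
    cases t with
    | bar =>
      cases gs with
      | nil => simp [slots] at hl
      | cons g gs =>
        have hg := hgs g (by simp)
        have := ih (τ₁ := τ₁ ++ g) (r := r) (h₁.append (h0 g (by simp) r)) h gs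
          (fun g hg => hgs g (by simp [hg])) (by simpa [slots] using hl)
          (fun g hg => h0 g (by simp [hg]))
        simp only [List.append_assoc] at this
        simp only [fill, List.append_assoc, this, List.cons_append, List.map_cons, insertAll]
        rw [evalM_insert h₁ hg (Depth.append (τ := τ) h h₂), slots_append, List.length_append,
          ar_evalM hg]
    | leaf z =>
      cases gs with
      | nil => simp [slots] at hl
      | cons g gs =>
        have hg := hgs g (by simp)
        have := ih (τ₁ := τ₁ ++ g) (r := r) (h₁.append (h0 g (by simp) r)) h gs
          (fun g hg => hgs g (by simp [hg])) (by simpa [slots] using hl)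
          (fun g hg => h0 g (by simp [hg]))
        simp only [List.append_assoc] at this
        simp only [fill, List.append_assoc, this, List.cons_append, List.map_cons, insertAll]
        rw [evalM_leaf, evalM_insert h₁ hg (Depth.append (τ := τ) h h₂), slots_append,
          List.length_append, ar_evalM hg]
    | op t =>
      have := ih (τ₁ := τ₁ ++ [.op t]) (r := r + P.ar t)
        (h₁.append (show Depth [.op t] r _ from rfl)) h gs hgs (by simpa [slots] using hl) h0
      simpa [fill, slots_append, slots] using this
    | close =>
      obtain ⟨k, rfl, h⟩ := h
      have := ih (τ₁ := τ₁ ++ [.close]) (r := k)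
        (h₁.append (show Depth [.close] (k + 1) k from ⟨k, rfl, rfl⟩)) h gs hgs
        (by simpa [slots] using hl) h0
      simpa [fill, slots_append, slots] using this

/-- A list that consists of a bar or of an inserted element of `Z`. -/
def IsSlot (g : List P.Tok) : Prop := g = [.bar] ∨ ∃ z, g = [.leaf z]

theorem IsSlot.depth {g : List P.Tok} (h : IsSlot g) : Depth g 0 0 := by
  rcases h with rfl | ⟨z, rfl⟩ <;> rfl

theorem run_gaps (gs : List (List P.Tok)) (hgs : ∀ g ∈ gs, IsSlot g) (m : P.M) (p : ℕ)
    (h : p + gs.length < P.ar m) : run (gaps gs) (m, p) = (m, p + gs.length) := by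
  induction gs generalizing p with
  | nil => rfl
  | cons g gs ih =>
    have h1 : run (g ++ [.close]) (m, p) = (m, p + 1) := by
      rw [List.length_cons] at h
      rcases hgs g (by simp) with rfl | ⟨z, rfl⟩ <;>
      · simp only [List.cons_append, List.nil_append, run, step]
        rw [mu2_right _ _ (by omega)]
    have h2 : gaps (g :: gs) = (g ++ [.close]) ++ gaps gs := by simp [gaps]
    rw [List.length_cons] at h
    rw [h2, run_append, h1, ih (fun g hg => hgs g (by simp [hg])) _ (by omega), List.length_cons]
    congr 1
    omega

/-- An operation whose inputs remain, or receive elements of `Z`, denotes itself. -/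
theorem evalM_op (t : P.M) (gs : List (List P.Tok)) (hgs : ∀ g ∈ gs, IsSlot g)
    (h : gs.length = P.ar t) : evalM (.op t :: gaps gs) = t := by
  have h1 := P.ar_one
  have h2 := P.ar_mu 2
  have h3 := P.ar_comp (P.mu 2) 0 t (by omega)
  rw [evalM, run, step]
  simp only [P.one_comp]
  rw [run_gaps gs hgs _ _ (by omega), zero_add, h]
  have h4 := comp_comm' (P := P) (x := P.mu 2) (y := t) (z := P.mu 0) (p := 0) (q := 1) (by omega)
    (by omega)
  have h5 := P.mu_comp 1 0 0
  simp only [Nat.sub_self, zero_add, add_zero] at h4 h5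
  rw [h4, h5, P.mu_one, P.one_comp]

theorem gaps_depth (gs : List (List P.Tok)) (hgs : ∀ g ∈ gs, Depth g 0 0) :
    Depth (gaps gs) gs.length 0 := by
  induction gs with
  | nil => rfl
  | cons g gs ih =>
    have := (hgs g (by simp)).add (gs.length + 1)
    rw [zero_add] at this
    exact this.append ⟨gs.length, rfl, ih fun g hg => hgs g (by simp [hg])⟩

theorem op_depth (t : P.M) (gs : List (List P.Tok)) (hgs : ∀ g ∈ gs, Depth g 0 0)
    (h : gs.length = P.ar t) : Depth (.op t :: gaps gs) 0 0 := by
  have := gaps_depth gs hgs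
  rw [h] at this
  simpa [Depth] using this

theorem slots_gaps (gs : List (List P.Tok)) : slots (gaps gs) = (gs.map slots).flatten := by
  induction gs with
  | nil => rfl
  | cons g gs ih => simp [gaps, slots_append, slots, ih]

theorem slots_fill (τ : List P.Tok) (gs : List (List P.Tok)) (h : gs.length = (slots τ).length) :
    slots (fill τ gs) = (gs.map slots).flatten := by
  induction τ generalizing gs with
  | nil =>
    obtain rfl : gs = [] := by simpa [slots] using h
    rfl
  | cons t τ ih =>
    cases t with
    | bar =>
      cases gs with
      | nil => simp [slots] at h
      | cons g gs => simp [fill, slots_append, ih gs (by simpa [slots] using h)]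
    | leaf z =>
      cases gs with
      | nil => simp [slots] at h
      | cons g gs => simp [fill, slots_append, ih gs (by simpa [slots] using h)]
    | op t => simpa [fill, slots] using ih gs (by simpa [slots] using h)
    | close => simpa [fill, slots] using ih gs (by simpa [slots] using h)

/-- The list of `n` bars, as inputs of an operation. -/
abbrev bars (n : ℕ) : List (List P.Tok) := List.replicate n [.bar]

theorem bars_isSlot (n : ℕ) : ∀ g ∈ bars (P := P) n, IsSlot g := fun _ hg =>
  Or.inl (List.eq_of_mem_replicate hg)

theorem bars_depth (n : ℕ) : ∀ g ∈ bars (P := P) n, Depth g 0 0 := fun g hg =>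
  (bars_isSlot n g hg).depth

theorem length_slots_bars (n : ℕ) : (slots (gaps (bars (P := P) n))).length = n := by
  rw [slots_gaps]
  simp [slots]

theorem fill_gaps_bars (gs : List (List P.Tok)) : fill (gaps (bars gs.length)) gs = gaps gs := by
  induction gs with
  | nil => rfl
  | cons g gs ih => simpa [gaps, bars, List.replicate_succ, fill] using ih

/-- If the bars of a complete list `τ` of symbols are replaced with complete lists, then these lists
may as well be inserted into the operation that is denoted by `τ`. -/
theorem evalM_subst {τ₁ τ τ₂ : List P.Tok} {r : ℕ} (h₁ : Depth τ₁ 0 r) (h : Depth τ 0 0)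
    (h₂ : Depth τ₂ r 0) (gs : List (List P.Tok)) (hgs : ∀ g ∈ gs, Depth g 0 0)
    (hl : gs.length = (slots τ).length) :
    evalM (τ₁ ++ (fill τ gs ++ τ₂)) = evalM (τ₁ ++ (.op (evalM τ) :: gaps gs ++ τ₂)) := by
  have e : gs.length = P.ar (evalM τ) := by rw [ar_evalM h, hl]
  have h3 : Depth τ r r := by simpa using h.add r
  have hb := op_depth (evalM τ) (bars gs.length) (bars_depth _) (by simpa using e)
  have h4 : Depth (.op (evalM τ) :: gaps (bars gs.length)) r r := by simpa using hb.add r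
  have h5 : .op (evalM τ) :: gaps gs = fill (.op (evalM τ) :: gaps (bars gs.length)) gs := by
    rw [fill, fill_gaps_bars]
  rw [evalM_fill h₁ h3 h₂ gs hgs hl, h5, evalM_fill h₁ h4 h₂ gs hgs, evalM_insert h₁ h h₂,
    evalM_insert h₁ hb h₂, evalM_op _ _ (bars_isSlot _) (by simpa using e)]
  rw [slots, length_slots_bars]

theorem evalM_gaps (t : P.M) (gs : List (List P.Tok)) (hgs : ∀ g ∈ gs, Depth g 0 0)
    (h : gs.length = P.ar t) : evalM (.op t :: gaps gs) = insertAll t 0 (gs.map evalM) := by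
  have hb := op_depth t (bars gs.length) (bars_depth _) (by simpa using h)
  have h5 : .op t :: gaps gs = [] ++ (fill (.op t :: gaps (bars gs.length)) gs ++ []) := by
    rw [fill, fill_gaps_bars]
    simp
  rw [h5, evalM_fill (τ₁ := []) (r := 0) rfl hb (τ₂ := []) rfl gs hgs, List.append_nil,
    List.nil_append, evalM_op _ _ (bars_isSlot _) (by simpa using h)]
  · rfl
  · rw [slots, length_slots_bars]

/-- A complete part of a list of symbols denotes an element of `Z`, which may be inserted into a
bar. -/
theorem evalZ_insert {τ₁ τ τ₂ : List P.Tok} {r : ℕ} (h₁ : Depth τ₁ 0 r) (h : Depth τ 0 0)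
    (h₂ : Depth τ₂ r 0) : evalZ (τ₁ ++ (τ ++ τ₂)) = evalZ (τ₁ ++ .leaf (evalZ τ) :: τ₂) := by
  have h3 : Depth (τ₁ ++ .bar :: τ₂) 0 0 := h₁.append h₂
  have h4 := ar_evalM h3
  have h5 := ar_evalM h
  simp only [slots_append, slots, List.length_append, List.length_cons] at h4
  rw [evalZ, evalZ, evalZ, evalM_insert h₁ h h₂, evalM_leaf, slots_append, slots_append,
    slots_append, slots, P.act_act _ _ _ _ _ (by omega) h5.symm]

theorem run_bars (k n : ℕ) : run (List.replicate n .bar) (P.mu (k + 1), k) =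
    (P.mu (k + n + 1), k + n) := by
  induction n generalizing k with
  | zero => rfl
  | succ n ih =>
    have h := P.mu_comp k 0 2
    simp only [add_zero] at h
    rw [List.replicate_succ, run, step]
    simp only [h]
    rw [ih (k + 1)]
    rw [show k + 1 + n = k + (n + 1) by omega]

theorem evalM_bars (n : ℕ) : evalM (P := P) (List.replicate n .bar) = P.mu n := by
  have h := P.mu_comp n 0 0
  simp only [add_zero] at h
  have h2 := run_bars (P := P) 0 n
  rw [zero_add, P.mu_one] at h2
  rw [evalM, h2]
  simpa using h

theorem slots_bars (n : ℕ) :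
    slots (P := P) (List.replicate n .bar) = List.replicate n none := by
  induction n with
  | zero => rfl
  | succ n ih => simp [List.replicate_succ, slots, ih]

theorem bars_depth' (n r : ℕ) : Depth (P := P) (List.replicate n .bar) r r := by
  induction n with
  | zero => rfl
  | succ n ih => exact ih

theorem insertAll_one (m : P.M) (p k : ℕ) (ts : List P.M) (h : p + k ≤ P.ar m) :
    insertAll m p (List.replicate k P.one ++ ts) = insertAll m (p + k) ts := by
  induction k generalizing p with
  | zero => rfl
  | succ k ih =>
    rw [List.replicate_succ, List.cons_append, insertAll, P.comp_one _ _ (by omega), P.ar_one,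
      ih _ (by omega)]
    congr 1
    omega

theorem insertAll_single (m t : P.M) (p q : ℕ) (h : P.ar m = p + 1 + q) :
    insertAll m 0 (List.replicate p P.one ++ (t :: List.replicate q P.one)) = P.comp m p t := by
  have h1 := P.ar_comp m p t (by omega)
  have h2 := insertAll_one (P.comp m p t) (p + P.ar t) q [] (by omega)
  rw [List.append_nil] at h2
  rw [insertAll_one _ _ _ _ (by omega), zero_add, insertAll, h2]
  rfl

end SetPair

/-! ### Lattice paths with labelled directions -/

theorem cons_sublist_cons_of_ne {α : Type*} {a b : α} (h : a ≠ b) {l l' : List α} :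
    (a :: l).Sublist (b :: l') ↔ (a :: l).Sublist l' := by
  constructor
  · intro h'
    cases h' with
    | cons _ h' => exact h'
    | cons_cons _ h' => exact absurd rfl h
  · exact fun h' => h'.cons _

/-- The alternating list of length `n` that starts with `b`. -/
def alternating : Bool → ℕ → List Bool
  | _, 0 => []
  | b, n + 1 => b :: alternating (!b) n

theorem le_turnsFrom_iff (b : Bool) (l : List Bool) (n : ℕ) :
    n ≤ turnsFrom b l ↔ (alternating (!b) n).Sublist l := by
  induction l generalizing b n with
  | nil => cases n <;> simp [turnsFrom, alternating]
  | cons a l ih =>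
    cases n with
    | zero => simp [alternating]
    | succ n =>
      by_cases h : a = b
      · subst h
        rw [alternating, cons_sublist_cons_of_ne (by simp), turnsFrom, if_pos rfl, zero_add, ih,
          alternating]
      · obtain rfl : a = !b := by
          cases a <;> cases b <;> simp_all
        rw [alternating, List.cons_sublist_cons, turnsFrom, if_neg h, ← ih]
        omega

theorem succ_le_turns_iff (l : List Bool) (n : ℕ) : n + 1 ≤ turns l ↔
    (alternating true (n + 2)).Sublist l ∨ (alternating false (n + 2)).Sublist l := by
  cases l with
  | nil => simp [turns, alternating]
  | cons a l =>
    rw [turns, le_turnsFrom_iff]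
    have key : ∀ c, (alternating c (n + 2)).Sublist (a :: l) →
        (alternating (!a) (n + 1)).Sublist l := by
      intro c h
      by_cases hc : c = a
      · subst hc
        rwa [alternating, List.cons_sublist_cons] at h
      · obtain rfl : c = !a := by
          cases a <;> cases c <;> simp_all
        rw [alternating, cons_sublist_cons_of_ne hc] at h
        refine List.Sublist.trans ?_ h
        have : ∀ b m, (alternating b m).Sublist (alternating b (m + 1)) := by
          intro b m
          induction m generalizing b with
          | zero => simp [alternating]
          | succ m ih => exact (ih (!b)).cons_cons b
        exact this _ (n + 1)
    constructor
    · intro h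
      cases a
      · exact Or.inr (h.cons_cons _)
      · exact Or.inl (h.cons_cons _)
    · rintro (h | h) <;> exact key _ h

/-- The letter of a plane lattice path. -/
def letter (i j : ℕ) (b : Bool) : Option ℕ := if b then some i else some j

theorem sublist_proj_iff {i j : ℕ} (hij : i ≠ j) (L : List Bool) (w : Word) :
    L.Sublist (proj i j w) ↔ (L.map (letter i j)).Sublist w := by
  induction w generalizing L with
  | nil => cases L <;> simp [proj]
  | cons o w ih =>
    simp only [proj] at ih ⊢
    cases L with
    | nil => simp
    | cons b L =>
      cases hs : side i j o with
      | none =>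
        have : letter i j b ≠ o := by
          rintro rfl
          cases b <;> simp [letter, side, hij.symm] at hs
        rw [List.filterMap_cons_none hs, ih, List.map_cons, cons_sublist_cons_of_ne this]
      | some a =>
        have ho : o = letter i j a := by
          cases o with
          | none => simp [side] at hs
          | some k =>
            simp only [side] at hs
            split_ifs at hs with h1 h2
            · cases hs
              simp [letter, h1]
            · cases hs
              simp [letter, h2]
        rw [List.filterMap_cons_some hs]
        by_cases hab : b = a
        · subst hab
          rw [ho, List.map_cons, List.cons_sublist_cons, List.cons_sublist_cons, ih]
        · have : letter i j b ≠ o := by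
            rw [ho]
            cases a <;> cases b <;> simp_all [letter]
            exact fun h => hij h.symm
          rw [cons_sublist_cons_of_ne hab, ih, List.map_cons, cons_sublist_cons_of_ne this]

/-- Two closed letters are nested or disjoint. -/
theorem complexity_le_two_iff {i j : ℕ} (hij : i ≠ j) (w : Word) : complexity i j w ≤ 2 ↔
    ¬ [some i, some j, some i, some j].Sublist w ∧
      ¬ [some j, some i, some j, some i].Sublist w := by
  have := succ_le_turns_iff (proj i j w) 2
  rw [sublist_proj_iff hij, sublist_proj_iff hij] at this
  simp only [alternating, List.map_cons, List.map_nil, letter] at this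
  rw [complexity, ← not_lt, Nat.lt_iff_add_one_le, this, not_or]
  rfl

/-- Two open letters are disjoint. -/
theorem complexity_le_one_iff {i j : ℕ} (hij : i ≠ j) (w : Word) : complexity i j w ≤ 1 ↔
    ¬ [some i, some j, some i].Sublist w ∧ ¬ [some j, some i, some j].Sublist w := by
  have := succ_le_turns_iff (proj i j w) 1
  rw [sublist_proj_iff hij, sublist_proj_iff hij] at this
  simp only [alternating, List.map_cons, List.map_nil, letter] at this
  rw [complexity, ← not_lt, Nat.lt_iff_add_one_le, this, not_or]
  rfl

/-- An open letter `j` may lie in a gap of a closed letter `i`, but not the other way round. -/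
theorem complexity'_le_two_iff {i j : ℕ} (hij : i ≠ j) (w : Word) : complexity' i j w ≤ 2 ↔
    ¬ [some j, some i, some j].Sublist w := by
  have h := sublist_proj_iff hij (alternating false 3) w
  simp only [alternating, List.map_cons, List.map_nil, letter] at h
  change _ ↔ ¬ ([some j, some i, some j].Sublist w)
  rw [show [some j, some i, some j].Sublist w ↔ _ from h.symm, complexity', complexity]
  cases proj i j w with
  | nil => simp [turns]
  | cons a l =>
    have h1 := le_turnsFrom_iff a l
    cases a
    · have := h1 2
      simp only [alternating, Bool.not_false, Bool.not_true] at this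
      simp only [turns, List.head?_cons, if_true, Bool.not_false, Bool.not_true,
        List.cons_sublist_cons]
      rw [← this]
      omega
    · have := h1 3
      simp only [alternating, Bool.not_false, Bool.not_true] at this
      simp only [turns, List.head?_cons, Bool.not_false, Bool.not_true]
      rw [cons_sublist_cons_of_ne (by simp), ← this]
      simp
      omega

/-- The conditions on a word `w` with letters of colours `col` to represent an operation of `RL_2`
that concern its letters: every letter that occurs in `w` occurs as often as it has to, two letters
are nested or disjoint, and nothing but bars occurs between two occurrences of an open letter. -/
structure Nested (col : ℕ → Colour) (w : Word) : Prop where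
  count : ∀ i, some i ∈ w → w.count (some i) = (col i).arity + 1
  nest : ∀ i j, i ≠ j → ¬ [some i, some j, some i, some j].Sublist w
  leaf : ∀ i j, i ≠ j → (col j).isOpen = true → ¬ [some j, some i, some j].Sublist w

/-- `w` represents an operation of `RL_2` with output of colour `d`, whose inputs are labelled by
the letters that occur in `w` and have the colours `col`. -/
structure Valid (col : ℕ → Colour) (d : Colour) (w : Word) : Prop extends Nested col w where
  bars : w.count none = d.arity
  colour : d.isOpen = false → ∀ i, some i ∈ w → (col i).isOpen = false

/-- The colours of the inputs of an operation, when the inputs are labelled by their positions. -/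
def colourAt (cs : List Colour) (i : ℕ) : Colour := (cs[i]?).getD (.closed 0)

/-- The bounds on the complexities of the pairs of letters, as conditions on nesting. -/
theorem isRLStage_iff {cs : List Colour} {d : Colour} {w : Word} :
    IsRLStage 2 cs d w ↔ Valid (colourAt cs) d w ∧ ∀ i, some i ∈ w ↔ i < cs.length := by
  constructor
  · intro h
    have hm : ∀ {i : ℕ} {l : Word}, some i ∈ l → l.Sublist w → cs[i]? = some (colourAt cs i) := by
      intro i l hi hl
      have h1 := List.count_pos_iff.2 (hl.subset hi)
      rw [h.letters] at h1
      cases hc : cs[i]? with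
      | none => simp [hc] at h1
      | some c => simp [colourAt, hc]
    have hlen : ∀ i, some i ∈ w ↔ i < cs.length := by
      intro i
      rw [← List.count_pos_iff, h.letters]
      cases hc : cs[i]? with
      | none => simpa using hc
      | some c =>
        have := (List.getElem?_eq_some_iff.1 hc).1
        simpa using this
    refine ⟨⟨⟨fun i hi => ?_, ?_, ?_⟩, h.bars, fun hd i hi =>
      h.colour hd _ (List.mem_of_getElem? (hm hi (List.Sublist.refl w)))⟩, hlen⟩
    · rw [h.letters, hm hi (List.Sublist.refl w)]
      rfl
    · intro i j hij hs
      have ha := hm (i := i) (by simp) hs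
      have hb := hm (i := j) (by simp) hs
      have s1 : [some i, some j, some i].Sublist w := List.Sublist.trans (by simp) hs
      have s2 : [some j, some i, some j].Sublist w := List.Sublist.trans (by simp) hs
      cases hao : (colourAt cs i).isOpen <;> cases hbo : (colourAt cs j).isOpen
      · exact ((complexity_le_two_iff hij w).1 (h.closed_closed i j _ _ hij ha hb hao hbo)).1 hs
      · exact (complexity'_le_two_iff hij w).1 (h.closed_open i j _ _ hij ha hb hao hbo) s2
      · exact (complexity'_le_two_iff hij.symm w).1
          (h.closed_open j i _ _ hij.symm hb ha hbo hao) s1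
      · have := h.open_open i j _ _ hij ha hb hao hbo
        exact ((complexity_le_one_iff hij w).1 (by omega)).1 s1
    · intro i j hij hbo hs
      have ha := hm (i := i) (by simp) hs
      have hb := hm (i := j) (by simp) hs
      cases hao : (colourAt cs i).isOpen
      · exact (complexity'_le_two_iff hij w).1 (h.closed_open i j _ _ hij ha hb hao hbo) hs
      · have := h.open_open i j _ _ hij ha hb hao hbo
        exact ((complexity_le_one_iff hij w).1 (by omega)).2 hs
  · rintro ⟨h, hlen⟩
    have hc : ∀ {i a}, cs[i]? = some a → colourAt cs i = a := fun ha => by simp [colourAt, ha]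
    refine ⟨⟨fun hd c hc => ?_, h.bars, fun i => ?_⟩, ?_, ?_, ?_⟩
    · obtain ⟨i, hi⟩ := List.mem_iff_getElem?.1 hc
      have := h.colour hd i ((hlen i).2 (List.getElem?_eq_some_iff.1 hi).1)
      rwa [colourAt, hi] at this
    · by_cases hi : i < cs.length
      · rw [h.count i ((hlen i).2 hi)]
        simp [colourAt, List.getElem?_eq_getElem hi]
      · rw [List.count_eq_zero.2 fun hm => hi ((hlen i).1 hm), List.getElem?_eq_none (by omega)]
        rfl
    · intro i j a b hij _ _ _ _
      exact (complexity_le_two_iff hij w).2 ⟨h.nest i j hij, h.nest j i hij.symm⟩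
    · intro i j a b hij ha hb hao hbo
      have := (complexity_le_one_iff hij w).2
        ⟨h.leaf j i hij.symm (by rwa [hc ha]), h.leaf i j hij (by rwa [hc hb])⟩
      omega
    · intro i j a b hij _ hb _ hbo
      exact (complexity'_le_two_iff hij w).2 (h.leaf i j hij (by rwa [hc hb]))

/-- The renaming of the letters of a word. -/
def renameWord (f : ℕ → ℕ) (w : Word) : Word := w.map (Option.map f)

theorem mem_renameWord {f : ℕ → ℕ} {w : Word} {k : ℕ} :
    some k ∈ renameWord f w ↔ ∃ i, some i ∈ w ∧ f i = k := by
  simp [renameWord]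

theorem renameWord_congr {f g : ℕ → ℕ} {w : Word} (h : ∀ i, some i ∈ w → f i = g i) :
    renameWord f w = renameWord g w := by
  refine List.map_congr_left fun o ho => ?_
  cases o with
  | none => rfl
  | some i => simp [h i ho]

theorem renameWord_comp (f g : ℕ → ℕ) (w : Word) :
    renameWord f (renameWord g w) = renameWord (f ∘ g) w := by
  simp [renameWord]

theorem renameWord_id {f : ℕ → ℕ} {w : Word} (h : ∀ i, some i ∈ w → f i = i) :
    renameWord f w = w := by
  rw [renameWord_congr (g := id) h]
  simp [renameWord]

theorem count_none_renameWord (f : ℕ → ℕ) (w : Word) :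
    (renameWord f w).count none = w.count none := by
  induction w with
  | nil => rfl
  | cons o w ih =>
    simp only [renameWord, List.map_cons] at ih ⊢
    rw [List.count_cons, List.count_cons, ih]
    cases o <;> simp

theorem count_renameWord {f : ℕ → ℕ} {w : Word} {i : ℕ}
    (h : ∀ j, some j ∈ w → f j = f i → j = i) :
    (renameWord f w).count (some (f i)) = w.count (some i) := by
  induction w with
  | nil => rfl
  | cons o w ih =>
    have ih' := ih fun j hj => h j (by simp [hj])
    simp only [renameWord, List.map_cons] at ih' ⊢
    rw [List.count_cons, List.count_cons, ih']
    congr 1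
    cases o with
    | none => simp
    | some j =>
      have : f j = f i ↔ j = i := ⟨fun e => h j (by simp) e, fun e => by rw [e]⟩
      simp [this]

/-- The function `f` is injective on the letters of `w`. -/
def InjLetters (f : ℕ → ℕ) (w : Word) : Prop :=
  ∀ i j, some i ∈ w → some j ∈ w → f i = f j → i = j

theorem Nested.rename {col col' : ℕ → Colour} {w : Word} (h : Nested col w) {f : ℕ → ℕ}
    (hf : InjLetters f w) (hc : ∀ i, some i ∈ w → col' (f i) = col i) :
    Nested col' (renameWord f w) := by
  have hpre : ∀ {l : List (Option ℕ)}, l.Sublist (renameWord f w) → ∃ l' : List (Option ℕ),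
      l'.Sublist w ∧ l = l'.map (Option.map f) := fun hl => List.sublist_map_iff.1 hl
  refine ⟨fun k hk => ?_, ?_, ?_⟩
  · obtain ⟨i, hi, rfl⟩ := mem_renameWord.1 hk
    rw [count_renameWord fun j hj e => hf j i hj hi e, h.count i hi, hc i hi]
  · intro i j hij hs
    obtain ⟨l', hl', e⟩ := hpre hs
    rcases l' with _ | ⟨a, _ | ⟨b, _ | ⟨c, _ | ⟨d, _ | ⟨e', l'⟩⟩⟩⟩⟩ <;> simp at e
    rcases a with _ | a <;> rcases b with _ | b <;> rcases c with _ | c <;> rcases d with _ | d <;>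
      simp at e
    obtain ⟨e1, e2, e3, e4⟩ := e
    obtain rfl := hf a c (hl'.subset (by simp)) (hl'.subset (by simp)) (by omega)
    obtain rfl := hf b d (hl'.subset (by simp)) (hl'.subset (by simp)) (by omega)
    exact h.nest a b (fun e => hij (by rw [← e1, ← e2, e])) hl'
  · intro i j hij hj hs
    obtain ⟨l', hl', e⟩ := hpre hs
    rcases l' with _ | ⟨a, _ | ⟨b, _ | ⟨c', _ | ⟨e', l'⟩⟩⟩⟩ <;> simp at e
    rcases a with _ | a <;> rcases b with _ | b <;> rcases c' with _ | c' <;> simp at e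
    obtain ⟨e1, e2, e3⟩ := e
    obtain rfl := hf a c' (hl'.subset (by simp)) (hl'.subset (by simp)) (by omega)
    refine h.leaf b a (fun e => hij (by rw [← e1, ← e2, e])) ?_ hl'
    rw [← hc a (hl'.subset (by simp)), e1, hj]

theorem Valid.rename {col col' : ℕ → Colour} {d : Colour} {w : Word} (h : Valid col d w)
    {f : ℕ → ℕ} (hf : InjLetters f w) (hc : ∀ i, some i ∈ w → col' (f i) = col i) :
    Valid col' d (renameWord f w) := by
  refine ⟨h.toNested.rename hf hc, ?_, fun hd k hk => ?_⟩
  · rw [count_none_renameWord, h.bars]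
  · obtain ⟨i, hi, rfl⟩ := mem_renameWord.1 hk
    rw [hc i hi, h.colour hd i hi]

theorem Nested.congr {col col' : ℕ → Colour} {w : Word} (h : Nested col w)
    (hc : ∀ i, some i ∈ w → col' i = col i) : Nested col' w := by
  have := h.rename (f := id) (fun _ _ _ _ e => e) hc
  rwa [renameWord_id (f := id) fun _ _ => rfl] at this

theorem Valid.congr {col col' : ℕ → Colour} {d : Colour} {w : Word} (h : Valid col d w)
    (hc : ∀ i, some i ∈ w → col' i = col i) : Valid col' d w := by
  have := h.rename (f := id) (fun _ _ _ _ e => e) hc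
  rwa [renameWord_id (f := id) fun _ _ => rfl] at this

theorem valid_renameWord_iff {col col' : ℕ → Colour} {d : Colour} {w : Word} {f : ℕ → ℕ}
    (hf : InjLetters f w) (hc : ∀ i, some i ∈ w → col' (f i) = col i) :
    Valid col' d (renameWord f w) ↔ Valid col d w := by
  refine ⟨fun h => ?_, fun h => h.rename hf hc⟩
  classical
  -- an inverse of `f` on the letters of `w`
  let g : ℕ → ℕ := fun k => if h : ∃ i, some i ∈ w ∧ f i = k then h.choose else 0
  have hg : ∀ i, some i ∈ w → g (f i) = i := fun i hi => by
    have hex : ∃ j, some j ∈ w ∧ f j = f i := ⟨i, hi, rfl⟩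
    simp only [g, dif_pos hex]
    exact hf _ _ hex.choose_spec.1 hi hex.choose_spec.2
  have := h.rename (f := g) (col' := col) ?_ ?_
  · rwa [renameWord_comp, renameWord_id (f := g ∘ f) hg] at this
  · intro k l hk hl e
    obtain ⟨i, hi, rfl⟩ := mem_renameWord.1 hk
    obtain ⟨j, hj, rfl⟩ := mem_renameWord.1 hl
    rw [hg i hi, hg j hj] at e
    rw [e]
  · intro k hk
    obtain ⟨i, hi, rfl⟩ := mem_renameWord.1 hk
    rw [hg i hi, hc i hi]

theorem injLetters_idxOf {w : Word} {N : List ℕ} (hN : ∀ i, some i ∈ w ↔ i ∈ N) :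
    InjLetters N.idxOf w := fun i _ hi _ e =>
  (List.idxOf_inj ((hN i).1 hi)).1 e

/-- Operations whose inputs are labelled by the letters that occur in a word correspond to
operations whose inputs are numbered. -/
theorem valid_iff_isRLStage {col : ℕ → Colour} {d : Colour} {w : Word} {N : List ℕ}
    (hN : ∀ i, some i ∈ w ↔ i ∈ N) (hd : N.Nodup) :
    IsRLStage 2 (N.map col) d (renameWord N.idxOf w) ↔ Valid col d w := by
  have hc : ∀ i, some i ∈ w → colourAt (N.map col) (N.idxOf i) = col i := by
    intro i hi
    have := List.getElem?_idxOf ((hN i).1 hi)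
    simp [colourAt, this]
  rw [isRLStage_iff, valid_renameWord_iff (injLetters_idxOf hN) hc, and_iff_left]
  intro i
  rw [mem_renameWord, List.length_map]
  constructor
  · rintro ⟨j, hj, rfl⟩
    exact List.idxOf_lt_length_of_mem ((hN j).1 hj)
  · intro hi
    exact ⟨N[i], (hN _).2 (List.getElem_mem hi), hd.idxOf_getElem i hi⟩

/-! ### Chunks of a word, and substitution -/

/-- The word `i g₁ i g₂ ⋯ i`. -/
def weave (i : ℕ) : List Word → Word
  | [] => [some i]
  | g :: gs => some i :: (g ++ weave i gs)

theorem weave_append (i : ℕ) (gs : List Word) (g : Word) (gs' : List Word) :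
    weave i (gs ++ g :: gs') = weave i gs ++ (g ++ weave i gs') := by
  induction gs with
  | nil => rfl
  | cons g' gs ih => simp [weave, ih]

theorem exists_weave_eq_cons (i : ℕ) (gs : List Word) : ∃ v, weave i gs = some i :: v := by
  cases gs with
  | nil => exact ⟨_, rfl⟩
  | cons g gs => exact ⟨_, rfl⟩

theorem exists_weave_eq_append (i : ℕ) (gs : List Word) : ∃ u, weave i gs = u ++ [some i] := by
  induction gs with
  | nil => exact ⟨[], rfl⟩
  | cons g gs ih =>
    obtain ⟨u, hu⟩ := ih
    exact ⟨some i :: (g ++ u), by simp [weave, hu]⟩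

theorem mem_weave {i : ℕ} {gs : List Word} {o : Option ℕ} :
    o ∈ weave i gs ↔ o = some i ∨ ∃ g ∈ gs, o ∈ g := by
  induction gs with
  | nil => simp [weave]
  | cons g gs ih =>
    simp only [weave, List.mem_cons, List.mem_append, ih, exists_eq_or_imp]
    tauto

theorem count_weave_self {i : ℕ} {gs : List Word} (h : ∀ g ∈ gs, some i ∉ g) :
    (weave i gs).count (some i) = gs.length + 1 := by
  induction gs with
  | nil => simp [weave]
  | cons g gs ih =>
    rw [weave, List.count_cons_self, List.count_append, List.count_eq_zero.2 (h g (by simp)),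
      ih fun g hg => h g (by simp [hg]), List.length_cons]
    omega

/-- Replace the successive bars of a word with given words. -/
def fillWord : Word → List Word → Word
  | [], _ => []
  | some i :: w, gs => some i :: fillWord w gs
  | none :: w, [] => none :: fillWord w []
  | none :: w, g :: gs => g ++ fillWord w gs

theorem fillWord_nil (w : Word) : fillWord w [] = w := by
  induction w with
  | nil => rfl
  | cons o w ih => cases o <;> simp [fillWord, ih]

theorem fillWord_append (u v : Word) (gs gs' : List Word) (h : u.count none = gs.length) :
    fillWord (u ++ v) (gs ++ gs') = fillWord u gs ++ fillWord v gs' := by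
  induction u generalizing gs with
  | nil =>
    obtain rfl : gs = [] := by simpa using h.symm
    rfl
  | cons o u ih =>
    cases o with
    | some i => simpa [fillWord] using ih gs (by simpa using h)
    | none =>
      cases gs with
      | nil => simp at h
      | cons g gs => simpa [fillWord] using ih gs (by simpa using h)

theorem fillWord_bars (w : Word) : fillWord w (List.replicate (w.count none) [none]) = w := by
  induction w with
  | nil => rfl
  | cons o w ih =>
    cases o with
    | some i => simpa [fillWord] using ih
    | none => simpa [fillWord, List.replicate_succ] using ih

/-- Replacing one bar with a word. -/
theorem fillWord_single {u v : Word} {p q : ℕ} (g : Word) (hu : u.count none = p)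
    (hv : v.count none = q) :
    fillWord (u ++ none :: v) (List.replicate p [none] ++ g :: List.replicate q [none]) =
      u ++ (g ++ v) := by
  subst hu hv
  rw [fillWord_append _ _ _ _ (by simp), fillWord_bars, fillWord, fillWord_bars]

/-- The substitution of blocks of letters for the occurrences of `p`, where the other letters are
renamed by `g`, and the substituted letters are renamed by `h`. -/
def graftWith (p : ℕ) (g h : ℕ → ℕ) : Word → List (List ℕ) → Word
  | [], _ => []
  | none :: w, bs => none :: graftWith p g h w bs
  | some j :: w, bs =>
    if j = p then (bs.headD []).map (fun k => some (h k)) ++ graftWith p g h w bs.tail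
    else some (g j) :: graftWith p g h w bs

theorem graft_eq_graftWith (p l : ℕ) (w : Word) (bs : List (List ℕ)) :
    graft p l w bs = graftWith p (shiftOuter p l) (· + p) w bs := by
  induction w generalizing bs with
  | nil => rfl
  | cons o w ih =>
    cases o with
    | none => simp [graft, graftWith, ih]
    | some j => simp [graft, graftWith, ih]

theorem renameWord_graftWith (f : ℕ → ℕ) (p : ℕ) (g h : ℕ → ℕ) (w : Word) (bs : List (List ℕ)) :
    renameWord f (graftWith p g h w bs) = graftWith p (f ∘ g) (f ∘ h) w bs := by
  induction w generalizing bs with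
  | nil => rfl
  | cons o w ih =>
    simp only [renameWord] at ih ⊢
    cases o with
    | none => simp [graftWith, ih]
    | some j =>
      simp only [graftWith]
      split_ifs with hj
      · simp [ih]
      · simp [ih]

theorem graftWith_rename {p p' : ℕ} (g h e e' : ℕ → ℕ) (w : Word) (bs : List (List ℕ))
    (he : ∀ j, some j ∈ w → (e j = p ↔ j = p')) :
    graftWith p g h (renameWord e w) (bs.map (List.map e')) =
      graftWith p' (g ∘ e) (h ∘ e') w bs := by
  induction w generalizing bs with
  | nil => rfl
  | cons o w ih =>
    have ih' := fun bs => ih bs fun j hj => he j (by simp [hj])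
    simp only [renameWord] at ih' ⊢
    cases o with
    | none => simp [graftWith, ih']
    | some j =>
      have hj := he j (by simp)
      simp only [List.map_cons, Option.map_some, graftWith, hj]
      split_ifs
      · rw [← List.map_tail, ih']
        cases bs <;> simp
      · rw [ih']
        rfl

theorem graftWith_congr {p : ℕ} {g g' h h' : ℕ → ℕ} (w : Word) (bs : List (List ℕ))
    (hg : ∀ j, some j ∈ w → j ≠ p → g j = g' j) (hh : ∀ b ∈ bs, ∀ k ∈ b, h k = h' k) :
    graftWith p g h w bs = graftWith p g' h' w bs := by
  induction w generalizing bs with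
  | nil => rfl
  | cons o w ih =>
    have ih' := fun bs hh => ih bs (fun j hj => hg j (by simp [hj])) hh
    cases o with
    | none => simp [graftWith, ih' bs hh]
    | some j =>
      simp only [graftWith]
      split_ifs with hj
      · rw [ih' _ fun b hb => hh b (List.mem_of_mem_tail hb)]
        congr 1
        cases bs with
        | nil => rfl
        | cons b bs => exact List.map_congr_left fun k hk => by rw [hh b (by simp) k hk]
      · rw [ih' bs hh, hg j (by simp) hj]

theorem blocks_renameWord (f : ℕ → ℕ) (w : Word) :
    blocks (renameWord f w) = (blocks w).map (List.map f) := by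
  induction w with
  | nil => rfl
  | cons o w ih =>
    simp only [renameWord] at ih ⊢
    cases o with
    | none => simp [blocks, ih]
    | some j =>
      simp only [List.map_cons, Option.map_some, blocks, ih]
      cases blocks w <;> simp

theorem mem_of_mem_blocks {w : Word} {b : List ℕ} {k : ℕ} (hb : b ∈ blocks w) (hk : k ∈ b) :
    some k ∈ w := by
  have h1 : k ∈ w.reduceOption := by
    rw [← flatten_blocks]
    exact List.mem_flatten.2 ⟨b, hb, hk⟩
  exact List.reduceOption_mem_iff.1 h1

/-- The substitution of a word `y` for the letter `p` of a word, without a renaming of letters. -/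
def substLetter (p : ℕ) (x y : Word) : Word := graftWith p id id x (blocks y)

theorem graftWith_append_of_notMem {p : ℕ} {a : Word} (h : some p ∉ a) (v : Word)
    (bs : List (List ℕ)) :
    graftWith p id id (a ++ v) bs = a ++ graftWith p id id v bs := by
  induction a with
  | nil => rfl
  | cons o a ih =>
    have ih' := ih fun hm => h (by simp [hm])
    cases o with
    | none => simp [graftWith, ih']
    | some j =>
      have : j ≠ p := fun e => h (by simp [e])
      simp [graftWith, ih', this]

theorem graftWith_weave {p : ℕ} (y : Word) (gs : List Word) (b : Word)
    (hgs : ∀ g ∈ gs, some p ∉ g) (hb : some p ∉ b) (hy : y.count none = gs.length) :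
    graftWith p id id (weave p gs ++ b) (blocks y) = fillWord y gs ++ b := by
  have key : graftWith p id id b [] = b := by
    have := graftWith_append_of_notMem hb [] []
    simpa [graftWith] using this
  induction y generalizing gs with
  | nil =>
    obtain rfl : gs = [] := by simpa using hy.symm
    simp [weave, graftWith, blocks, fillWord, key]
  | cons o y ih =>
    cases o with
    | some k =>
      have ih' := ih gs hgs (by simpa using hy)
      obtain ⟨v, hv⟩ := exists_weave_eq_cons p gs
      rw [hv] at ih' ⊢
      simp only [List.cons_append, graftWith, if_true, blocks, fillWord] at ih' ⊢
      rw [← ih']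
      cases hbl : blocks y with
      | nil => exact absurd hbl (blocks_ne_nil y)
      | cons => simp
    | none =>
      cases gs with
      | nil => simp at hy
      | cons g gs =>
        have ih' := ih gs (fun g hg => hgs g (by simp [hg])) (by simpa using hy)
        simp only [weave, List.cons_append, graftWith, if_true, blocks, List.headD_cons,
          List.map_nil, List.nil_append, List.tail_cons, List.append_assoc, fillWord]
        rw [graftWith_append_of_notMem (hgs g (by simp)), ih']

theorem substLetter_weave {p : ℕ} {a b y : Word} {gs : List Word} (ha : some p ∉ a)
    (hgs : ∀ g ∈ gs, some p ∉ g) (hb : some p ∉ b) (hy : y.count none = gs.length) :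
    substLetter p (a ++ (weave p gs ++ b)) y = a ++ (fillWord y gs ++ b) := by
  rw [substLetter, graftWith_append_of_notMem ha, graftWith_weave y gs b hgs hb hy]

/-- The occurrences of a letter split a word. -/
theorem exists_weave {p n : ℕ} {w : Word} (h : w.count (some p) = n + 1) :
    ∃ (a : Word) (gs : List Word) (b : Word), w = a ++ (weave p gs ++ b) ∧ gs.length = n ∧
      some p ∉ a ∧ (∀ g ∈ gs, some p ∉ g) ∧ some p ∉ b := by
  induction n generalizing w with
  | zero =>
    have hm : some p ∈ w := List.count_pos_iff.1 (by omega)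
    obtain ⟨a, b, rfl, ha⟩ := List.eq_append_cons_of_mem hm
    rw [List.count_append, List.count_eq_zero.2 ha, List.count_cons_self] at h
    exact ⟨a, [], b, rfl, rfl, ha, by simp, List.count_eq_zero.1 (by omega)⟩
  | succ n ih =>
    have hm : some p ∈ w := List.count_pos_iff.1 (by omega)
    obtain ⟨a, b, rfl, ha⟩ := List.eq_append_cons_of_mem hm
    rw [List.count_append, List.count_eq_zero.2 ha, List.count_cons_self] at h
    obtain ⟨a', gs, b', rfl, hn, h1, h2, h3⟩ := ih (w := b) (by omega)
    refine ⟨a, a' :: gs, b', by simp [weave], by simp [hn], ha, ?_, h3⟩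
    simpa using ⟨h1, h2⟩

/-! ### The structure of nested words -/

theorem map_some_sublist_iff (L : List ℕ) (w : Word) :
    (L.map some).Sublist w ↔ L.Sublist w.reduceOption := by
  induction w generalizing L with
  | nil => simp
  | cons o w ih =>
    cases o with
    | none =>
      rw [List.reduceOption_cons_of_none, ← ih]
      cases L with
      | nil => simp
      | cons k L => exact cons_sublist_cons_of_ne (by simp)
    | some i =>
      rw [List.reduceOption_cons_of_some]
      cases L with
      | nil => simp
      | cons k L =>
        by_cases h : k = i
        · subst h
          rw [List.map_cons, List.cons_sublist_cons, List.cons_sublist_cons, ih]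
        · rw [List.map_cons, cons_sublist_cons_of_ne (by simpa using h),
            cons_sublist_cons_of_ne h, ← ih, List.map_cons]

theorem mem_reduceOption {i : ℕ} {w : Word} : i ∈ w.reduceOption ↔ some i ∈ w :=
  List.reduceOption_mem_iff

/-- The bars of a word play no role for the nesting of its letters. -/
theorem Nested.of_reduceOption {col : ℕ → Colour} {w w' : Word} (h : Nested col w)
    (e : w'.reduceOption = w.reduceOption) : Nested col w' := by
  refine ⟨fun i hi => ?_, fun i j hij hs => ?_, fun i j hij hj hs => ?_⟩
  · rw [← mem_reduceOption, e, mem_reduceOption] at hi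
    rw [← count_reduceOption, e, count_reduceOption, h.count i hi]
  · refine h.nest i j hij ((map_some_sublist_iff [i, j, i, j] w).2 ?_)
    rw [← e]
    exact (map_some_sublist_iff [i, j, i, j] w').1 hs
  · refine h.leaf i j hij hj ((map_some_sublist_iff [j, i, j] w).2 ?_)
    rw [← e]
    exact (map_some_sublist_iff [j, i, j] w').1 hs

theorem Nested.of_sublist {col : ℕ → Colour} {w w' : Word} (h : Nested col w)
    (hs : w'.Sublist w) (hc : ∀ i, some i ∈ w' → w'.count (some i) = w.count (some i)) :
    Nested col w' :=
  ⟨fun i hi => by rw [hc i hi, h.count i (hs.subset hi)],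
    fun i j hij hl => h.nest i j hij (hl.trans hs),
    fun i j hij hj hl => h.leaf i j hij hj (hl.trans hs)⟩

/-- A part of a nested word is nested if it contains all occurrences of its letters. -/
theorem Nested.part {col : ℕ → Colour} {u g v : Word} (h : Nested col (u ++ (g ++ v)))
    (hu : ∀ i, some i ∈ g → some i ∉ u) (hv : ∀ i, some i ∈ g → some i ∉ v) : Nested col g := by
  refine h.of_sublist ((List.sublist_append_left g v).trans (List.sublist_append_right u _)) ?_
  intro i hi
  rw [List.count_append, List.count_append, List.count_eq_zero.2 (hu i hi),
    List.count_eq_zero.2 (hv i hi)]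
  simp

/-- The letters between two consecutive occurrences of `p` do not occur elsewhere. -/
theorem Nested.gap {col : ℕ → Colour} {u g v : Word} {p : ℕ}
    (h : Nested col (u ++ (some p :: (g ++ some p :: v)))) (hp : some p ∉ g) {i : ℕ}
    (hi : some i ∈ g) : some i ∉ u ++ [some p] ∧ some i ∉ some p :: v := by
  have hne : i ≠ p := fun e => hp (e ▸ hi)
  have hg : [some i].Sublist g := List.singleton_sublist.2 hi
  simp only [List.mem_append, List.mem_cons, List.not_mem_nil, or_false, not_or,
    Option.some.injEq]
  refine ⟨⟨fun hu => ?_, hne⟩, hne, fun hv => ?_⟩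
  · refine h.nest i p hne ?_
    exact (List.singleton_sublist.2 hu).append
      (List.Sublist.cons_cons _ (hg.append (List.Sublist.cons_cons _ (List.nil_sublist v))))
  · refine h.nest p i hne.symm ?_
    refine List.Sublist.trans ?_ (List.sublist_append_right u _)
    exact List.Sublist.cons_cons _ (hg.append
      (List.Sublist.cons_cons _ (List.singleton_sublist.2 hv)))

theorem Nested.gap_weave {col : ℕ → Colour} {a b g : Word} {gs gs' : List Word} {p : ℕ}
    (h : Nested col (a ++ (weave p (gs ++ g :: gs') ++ b))) (hp : some p ∉ g) {i : ℕ}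
    (hi : some i ∈ g) : some i ∉ a ++ weave p gs ∧ some i ∉ weave p gs' ++ b := by
  obtain ⟨u, hu⟩ := exists_weave_eq_append p gs
  obtain ⟨v, hv⟩ := exists_weave_eq_cons p gs'
  have e : a ++ (weave p (gs ++ g :: gs') ++ b) =
      (a ++ u) ++ (some p :: (g ++ some p :: (v ++ b))) := by
    rw [weave_append, hu, hv]
    simp
  rw [e] at h
  have := h.gap hp hi
  rw [hu, hv]
  simpa using this

/-- The word `i|^{c₁}i|^{c₂}i⋯i`. -/
def chunk (i : ℕ) (cs : List ℕ) : Word := weave i (cs.map fun c => List.replicate c none)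

theorem mem_chunk {i k : ℕ} {cs : List ℕ} : some k ∈ chunk i cs ↔ k = i := by
  simp [chunk, mem_weave, List.mem_replicate]

theorem count_chunk_self (i : ℕ) (cs : List ℕ) : (chunk i cs).count (some i) = cs.length + 1 := by
  rw [chunk, count_weave_self, List.length_map]
  simp [List.mem_replicate]

theorem count_none_chunk (i : ℕ) (cs : List ℕ) : (chunk i cs).count none = cs.sum := by
  induction cs with
  | nil => simp [chunk, weave]
  | cons c cs ih =>
    simp only [chunk, List.map_cons, weave] at ih ⊢
    simp [ih]

theorem reduceOption_replicate_none (c : ℕ) :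
    (List.replicate c (none : Option ℕ)).reduceOption = [] := by
  induction c with
  | zero => rfl
  | succ c ih => rw [List.replicate_succ, List.reduceOption_cons_of_none, ih]

theorem reduceOption_chunk (i : ℕ) (cs : List ℕ) :
    (chunk i cs).reduceOption = List.replicate (cs.length + 1) i := by
  induction cs with
  | nil => rfl
  | cons c cs ih =>
    simp only [chunk, List.map_cons, weave] at ih ⊢
    rw [List.reduceOption_cons_of_some, List.reduceOption_append, ih,
      reduceOption_replicate_none]
    rfl

theorem eq_replicate_none {g : Word} (h : ∀ i, some i ∉ g) : ∃ c, g = List.replicate c none := by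
  refine ⟨g.length, List.eq_replicate_iff.2 ⟨rfl, fun o ho => ?_⟩⟩
  cases o with
  | none => rfl
  | some i => exact absurd ho (h i)

theorem exists_map_replicate {gs : List Word} (h : ∀ g ∈ gs, ∀ i, some i ∉ g) :
    ∃ cs : List ℕ, gs = cs.map fun c => List.replicate c none := by
  induction gs with
  | nil => exact ⟨[], rfl⟩
  | cons g gs ih =>
    obtain ⟨c, rfl⟩ := eq_replicate_none (h g (by simp))
    obtain ⟨cs, rfl⟩ := ih fun g hg => h g (by simp [hg])
    exact ⟨c :: cs, rfl⟩

theorem weave_eq_chunk {i : ℕ} {gs : List Word} (h : ∀ g ∈ gs, ∀ i, some i ∉ g) :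
    ∃ cs : List ℕ, weave i gs = chunk i cs ∧ cs.length = gs.length := by
  obtain ⟨cs, rfl⟩ := exists_map_replicate h
  exact ⟨cs, rfl, by simp⟩

/-- A word that contains letters has a letter whose first occurrence is the last one among the first
occurrences of letters. -/
theorem exists_last_letter {w : Word} (h : ∃ i, some i ∈ w) : ∃ (a : Word) (r : ℕ) (b : Word),
    w = a ++ some r :: b ∧ some r ∉ a ∧ ∀ s, some s ∈ b → s = r ∨ some s ∈ a := by
  induction w using List.reverseRecOn with
  | nil => simp at h
  | append_singleton w o ih =>
    cases o with
    | none =>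
      obtain ⟨a, r, b, rfl, h1, h2⟩ := ih (by simpa using h)
      exact ⟨a, r, b ++ [none], by simp, h1, fun s hs => h2 s (by simpa using hs)⟩
    | some i =>
      by_cases hi : some i ∈ w
      · obtain ⟨a, r, b, rfl, h1, h2⟩ := ih ⟨i, hi⟩
        refine ⟨a, r, b ++ [some i], by simp, h1, fun s hs => ?_⟩
        simp only [List.mem_append, List.mem_cons, List.not_mem_nil, or_false,
          Option.some.injEq] at hs hi
        rcases hs with hs | rfl
        · exact h2 s hs
        · rcases hi with hi | hi | hi
          · exact Or.inr hi
          · exact Or.inl hi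
          · exact h2 s hi
      · exact ⟨w, i, [], rfl, hi, by simp⟩

/-- A nested word that contains letters has a letter with nothing but bars between its occurrences:
the letter whose first occurrence is the last one among all letters. -/
theorem Nested.exists_chunk {col : ℕ → Colour} {w : Word} (hw : Nested col w)
    (h : ∃ i, some i ∈ w) : ∃ (a : Word) (r : ℕ) (cs : List ℕ) (b : Word),
      w = a ++ (chunk r cs ++ b) ∧ some r ∉ a ∧ some r ∉ b ∧ cs.length = (col r).arity := by
  obtain ⟨a, r, b, rfl, ha, hb⟩ := exists_last_letter h
  have hc := hw.count r (by simp)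
  rw [List.count_append, List.count_eq_zero.2 ha, zero_add] at hc
  obtain ⟨a', gs, b', e, hn, ha', hgs, hb'⟩ := exists_weave hc
  obtain rfl : a' = [] := by
    obtain ⟨v, hv⟩ := exists_weave_eq_cons r gs
    cases a' with
    | nil => rfl
    | cons o a' =>
      rw [List.cons_append, List.cons.injEq] at e
      rw [← e.1] at ha'
      simp at ha'
  -- by nesting, a letter in a gap of `r` would occur for the first time after the first `r`
  have hempty : ∀ g ∈ gs, ∀ i, some i ∉ g := by
    intro g hg i hi
    obtain ⟨gs₁, gs₂, rfl⟩ := List.append_of_mem hg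
    rw [e, List.nil_append] at hw
    have h1 := (hw.gap_weave (hgs g hg) hi).1
    have h2 : i ≠ r := fun er => hgs g hg (er ▸ hi)
    have h3 : some i ∈ some r :: b := by
      rw [e, List.nil_append, List.mem_append, mem_weave]
      exact Or.inl (Or.inr ⟨g, hg, hi⟩)
    rw [List.mem_cons, Option.some.injEq] at h3
    rcases h3 with h3 | h3
    · exact h2 h3
    · rcases hb i h3 with h4 | h4
      · exact h2 h4
      · exact h1 (List.mem_append_left _ h4)
  obtain ⟨cs, hcs, hl⟩ := weave_eq_chunk (i := r) hempty
  exact ⟨a, r, cs, b', by rw [e, hcs, List.nil_append], ha, hb', by omega⟩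

/-- A chunk of a nested word may be removed. -/
theorem Nested.remove_chunk {col : ℕ → Colour} {a b : Word} {r : ℕ} {cs : List ℕ}
    (h : Nested col (a ++ (chunk r cs ++ b))) (ha : some r ∉ a) (hb : some r ∉ b) (u : Word)
    (hu : u.reduceOption = []) : Nested col (a ++ (u ++ b)) := by
  have h1 : Nested col (a ++ b) := by
    refine h.of_sublist (List.Sublist.append_left (List.sublist_append_right _ _) _) ?_
    intro i hi
    have hne : i ≠ r := by
      rintro rfl
      simp [ha, hb] at hi
    rw [List.count_append, List.count_append, List.count_append,
      List.count_eq_zero.2 (mt mem_chunk.1 hne), zero_add]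
  refine h1.of_reduceOption ?_
  simp [List.reduceOption_append, hu]

theorem sublist_of_append_left {α : Type*} {x : α} {L a b : List α} (hx : x ∉ a)
    (h : (x :: L).Sublist (a ++ b)) : (x :: L).Sublist b := by
  induction a with
  | nil => exact h
  | cons y a ih =>
    rw [List.cons_append, cons_sublist_cons_of_ne (fun e => hx (by simp [e]))] at h
    exact ih (fun hm => hx (by simp [hm])) h

theorem sublist_of_append_right {α : Type*} {x : α} {L a b : List α} (hx : x ∉ b)
    (h : (L ++ [x]).Sublist (a ++ b)) : (L ++ [x]).Sublist a := by
  rw [← List.reverse_sublist, List.reverse_append, List.reverse_append, List.reverse_singleton,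
    List.singleton_append] at h
  have := sublist_of_append_left (by simpa using hx) h
  rw [← List.reverse_sublist]
  simpa using this

/-- A chunk may be inserted into a nested word, but not between two occurrences of an open
letter. -/
theorem Nested.insert_chunk {col : ℕ → Colour} {a b u : Word} {r : ℕ} {cs : List ℕ}
    (h : Nested col (a ++ (u ++ b))) (hu : u.reduceOption = []) (ha : some r ∉ a) (hb : some r ∉ b)
    (hcs : cs.length = (col r).arity)
    (hopen : ∀ j, (col j).isOpen = true → some j ∈ a → some j ∉ b) :
    Nested col (a ++ (chunk r cs ++ b)) := by
  have h0 : Nested col (a ++ b) := h.of_reduceOption (by simp [List.reduceOption_append, hu])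
  have hr : ∀ j, j ≠ r → ¬ [some r, some j, some r].Sublist (a ++ (chunk r cs ++ b)) := by
    intro j hj hs
    have h1 := sublist_of_append_right (L := [some r, some j]) hb (sublist_of_append_left ha hs)
    exact hj (mem_chunk.1 (h1.subset (show some j ∈ _ by simp)))
  have key : ∀ L : List ℕ, (∀ i ∈ L, i ≠ r) →
      (L.map some).Sublist (a ++ (chunk r cs ++ b)) → (L.map some).Sublist (a ++ b) := by
    intro L hL hs
    have h1 := hs.filter (fun o => decide (o ≠ some r) && o.isSome)
    have h2 : ∀ w : Word, (w.filter (fun o => decide (o ≠ some r) && o.isSome)).Sublist w :=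
      fun w => List.filter_sublist
    rw [List.filter_append, List.filter_append,
      List.filter_eq_nil_iff (l := chunk r cs) |>.2 (fun o ho => ?_), List.nil_append,
      ← List.filter_append] at h1
    · rw [List.filter_eq_self.2 (fun o ho => ?_)] at h1
      · exact h1.trans (h2 _)
      · obtain ⟨i, hi, rfl⟩ := List.mem_map.1 ho
        simpa using hL i hi
    · cases o with
      | none => simp
      | some k => simp [mem_chunk.1 ho]
  refine ⟨fun i hi => ?_, fun i j hij hs => ?_, fun i j hij hj hs => ?_⟩
  · by_cases hir : i = r
    · subst hir
      rw [List.count_append, List.count_append, List.count_eq_zero.2 ha, List.count_eq_zero.2 hb,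
        count_chunk_self, hcs]
      omega
    · have hi' : some i ∈ a ++ b := by
        simp only [List.mem_append, mem_chunk] at hi ⊢
        tauto
      rw [← h0.count i hi', List.count_append, List.count_append, List.count_append,
        List.count_eq_zero.2 (mt mem_chunk.1 hir), zero_add]
  · by_cases hir : i = r
    · subst hir
      exact hr j hij.symm (List.Sublist.trans (by simp) hs)
    · by_cases hjr : j = r
      · subst hjr
        exact hr i hij (List.Sublist.trans (by simp) hs)
      · exact h0.nest i j hij (key [i, j, i, j] (by simp [hir, hjr]) hs)
  · by_cases hjr : j = r
    · subst hjr
      exact hr i hij hs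
    · by_cases hir : i = r
      · subst hir
        -- `j` occurs before and after the chunk
        obtain ⟨l₁, l₂, e, h1, h2⟩ := List.sublist_append_iff.1 hs
        obtain ⟨l₃, l₄, rfl, h3, h4⟩ := List.sublist_append_iff.1 h2
        have hja : some j ∈ a := by
          cases l₁ with
          | nil =>
            exfalso
            have h5 := sublist_of_append_left (mt mem_chunk.1 hjr) (e ▸ h2 :
              [some j, some i, some j].Sublist (chunk i cs ++ b))
            exact hb (h5.subset (by simp))
          | cons o l₁ =>
            rw [List.cons_append, List.cons.injEq] at e
            exact h1.subset (by simp [e.1])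
        have hjb : some j ∈ b := by
          have h5 : some j ∈ chunk i cs ++ b ∨ False := by
            by_contra h6
            have h7 : [some j, some i] ++ [some j] = [some j, some i, some j] := rfl
            rw [← h7] at hs
            have h8 := sublist_of_append_right (fun hm => h6 (Or.inl hm)) hs
            exact ha (h8.subset (by simp))
          rcases h5 with h5 | h5
          · rcases List.mem_append.1 h5 with h6 | h6
            · exact absurd (mem_chunk.1 h6) hjr
            · exact h6
          · exact h5.elim
        exact hopen j hj hja hjb
      · exact h0.leaf i j hij hj (key [j, i, j] (by simp [hir, hjr]) hs)

theorem nested_of_no_letters {col : ℕ → Colour} {w : Word} (h : ∀ i, some i ∉ w) :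
    Nested col w := by
  obtain ⟨c, rfl⟩ := eq_replicate_none h
  refine ⟨fun i hi => absurd hi (h i), fun i j _ hs => ?_, fun i j _ _ hs => ?_⟩
  · exact h i (hs.subset (by simp))
  · exact h i (hs.subset (by simp))

/-- The conditions of `Nested` that concern the open letters. -/
structure Leafy (col : ℕ → Colour) (w : Word) : Prop where
  count : ∀ i, (col i).isOpen = true → some i ∈ w → w.count (some i) = (col i).arity + 1
  leaf : ∀ i j, i ≠ j → (col j).isOpen = true → ¬ [some j, some i, some j].Sublist w

theorem Nested.leafy {col : ℕ → Colour} {w : Word} (h : Nested col w) : Leafy col w :=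
  ⟨fun i _ hi => h.count i hi, h.leaf⟩

theorem Leafy.part {col : ℕ → Colour} {u g v : Word} (h : Leafy col (u ++ (g ++ v)))
    (hu : ∀ i, (col i).isOpen = true → some i ∈ g → some i ∉ u)
    (hv : ∀ i, (col i).isOpen = true → some i ∈ g → some i ∉ v) : Leafy col g := by
  refine ⟨fun i ho hi => ?_, fun i j hij hj hs => h.leaf i j hij hj (hs.trans
    ((List.sublist_append_left g v).trans (List.sublist_append_right u _)))⟩
  rw [← h.count i ho (by simp [hi]), List.count_append, List.count_append,
    List.count_eq_zero.2 (hu i ho hi), List.count_eq_zero.2 (hv i ho hi)]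
  simp

/-- An open letter cannot occur on both sides of another letter. -/
theorem Leafy.split {col : ℕ → Colour} {u m v : Word} {p : ℕ} (h : Leafy col (u ++ (m ++ v)))
    (hp : some p ∈ m) (hm : ∀ i, some i ∈ m → i = p)
    (hc : (col p).isOpen = true → some p ∉ u ∧ some p ∉ v) : Leafy col u ∧ Leafy col v := by
  have key : ∀ j, (col j).isOpen = true → some j ∈ u → some j ∉ v := by
    intro j hj h1 h2
    by_cases e : p = j
    · exact (hc (e ▸ hj)).1 (e ▸ h1)
    · exact h.leaf p j e hj ((List.singleton_sublist.2 h1).append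
        ((List.singleton_sublist.2 hp).append (List.singleton_sublist.2 h2)))
  have key2 : ∀ j, (col j).isOpen = true → (some j ∈ u ∨ some j ∈ v) → some j ∉ m := by
    intro j hj h1 h2
    obtain rfl := hm j h2
    have := hc hj
    tauto
  constructor
  · refine Leafy.part (u := []) (v := m ++ v) h (fun _ _ _ => by simp) fun i ho hi => ?_
    rw [List.mem_append, not_or]
    exact ⟨key2 i ho (Or.inl hi), key i ho hi⟩
  · refine Leafy.part (u := u ++ m) (v := []) (by simpa using h) (fun i ho hi => ?_)
      fun _ _ _ => by simp
    rw [List.mem_append, not_or]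
    exact ⟨fun h1 => key i ho h1 hi, key2 i ho (Or.inr hi)⟩

/-- Words that are concatenations of bars, closed letters, and chunks of open letters. -/
inductive Segmented (col : ℕ → Colour) : Word → Prop
  | nil : Segmented col []
  | bar {w : Word} : Segmented col w → Segmented col (none :: w)
  | letter {w : Word} (i : ℕ) : (col i).isOpen = false → Segmented col w →
      Segmented col (some i :: w)
  | chunk {w : Word} (i : ℕ) (cs : List ℕ) : (col i).isOpen = true →
      cs.length = (col i).arity → some i ∉ w → Segmented col w → Segmented col (chunk i cs ++ w)

/-- As nothing but bars lies between the occurrences of an open letter, the occurrences of such a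
letter form one segment of the word. -/
theorem Leafy.segmented {col : ℕ → Colour} {w : Word} (h : Leafy col w) : Segmented col w := by
  induction hn : w.length using Nat.strong_induction_on generalizing w with
  | _ n ih =>
    subst hn
    cases w with
    | nil => exact .nil
    | cons o w =>
      cases o with
      | none =>
        refine .bar (ih w.length (by simp) ?_ rfl)
        exact Leafy.part (u := [none]) (v := []) (by simpa using h) (by simp) (by simp)
      | some j =>
        cases hj : (col j).isOpen with
        | false =>
          refine .letter j hj (ih w.length (by simp) ?_ rfl)
          exact (Leafy.split (u := []) (m := [some j]) (p := j) h (by simp) (by simp)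
            (by simp [hj])).2
        | true =>
          obtain ⟨a, gs, b, e, hn, ha, hgs, hb⟩ := exists_weave (h.count j hj (by simp))
          obtain rfl : a = [] := by
            cases a with
            | nil => rfl
            | cons o a =>
              rw [List.cons_append, List.cons.injEq] at e
              rw [← e.1] at ha
              simp at ha
          rw [List.nil_append] at e
          have hempty : ∀ g ∈ gs, ∀ i, some i ∉ g := by
            intro g hg i hi
            have h2 : i ≠ j := fun er => hgs g hg (er ▸ hi)
            obtain ⟨gs₁, gs₂, rfl⟩ := List.append_of_mem hg
            refine h.leaf i j h2 hj ?_
            obtain ⟨u, hu⟩ := exists_weave_eq_append j gs₁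
            obtain ⟨v, hv⟩ := exists_weave_eq_cons j gs₂
            rw [e, weave_append, hu, hv]
            have h3 : [some j, some i, some j].Sublist
                ([some j] ++ (g ++ [some j])) :=
              List.Sublist.cons_cons _ ((List.singleton_sublist.2 hi).append
                (List.Sublist.refl _))
            refine h3.trans ?_
            rw [List.append_assoc u, List.append_assoc u]
            refine List.Sublist.trans ?_ (List.sublist_append_right u _)
            simp
          obtain ⟨cs, hcs, hl⟩ := weave_eq_chunk (i := j) hempty
          rw [hcs] at e
          rw [e] at h ⊢
          refine .chunk j cs hj (by omega) hb (ih b.length ?_ ?_ rfl)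
          · rw [e, List.length_append]
            obtain ⟨v, hv⟩ := exists_weave_eq_cons j (cs.map fun c => List.replicate c none)
            rw [chunk, hv]
            simp
          · refine (Leafy.split (u := []) (m := chunk j cs) (p := j) h (by simp [mem_chunk])
              (fun i hi => mem_chunk.1 hi) fun _ => ⟨by simp, hb⟩).2

/-- Words without common letters. -/
def DisjointLetters (u v : Word) : Prop := ∀ i, some i ∈ u → some i ∉ v

theorem DisjointLetters.symm {u v : Word} (h : DisjointLetters u v) : DisjointLetters v u :=
  fun i hi hi' => h i hi' hi

theorem pairwise_disjoint_bars (cs : List ℕ) :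
    (cs.map fun c => List.replicate c (none : Option ℕ)).Pairwise DisjointLetters := by
  rw [List.pairwise_map, List.pairwise_iff_getElem]
  intro _ _ _ _ _ i hi
  simp [List.mem_replicate] at hi

theorem leafy_bars (c : ℕ) {col : ℕ → Colour} : Leafy col (List.replicate c none) :=
  (nested_of_no_letters (by simp [List.mem_replicate])).leafy

theorem forall_bars {cs : List ℕ} {Q : Word → Prop} (h : ∀ c, Q (List.replicate c none)) :
    ∀ g ∈ cs.map fun c => List.replicate c (none : Option ℕ), Q g := by
  intro g hg
  obtain ⟨c, _, rfl⟩ := List.mem_map.1 hg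
  exact h c

theorem Nested.replace_bars {col : ℕ → Colour} {u v w : Word} (h : Nested col (u ++ (w ++ v)))
    (hw : w.reduceOption = []) (c : ℕ) : Nested col (u ++ (List.replicate c none ++ v)) :=
  h.of_reduceOption (by simp [List.reduceOption_append, hw])

theorem mem_fillWord {y : Word} {gs : List Word} {i : ℕ} (h : some i ∈ fillWord y gs) :
    some i ∈ y ∨ ∃ g ∈ gs, some i ∈ g := by
  induction y generalizing gs with
  | nil => simp [fillWord] at h
  | cons o y ih =>
    cases o with
    | some k =>
      rw [fillWord, List.mem_cons] at h
      rcases h with h | h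
      · simp [h]
      · rcases ih h with h | h
        · simp [h]
        · exact Or.inr h
    | none =>
      cases gs with
      | nil =>
        rw [fillWord_nil] at h
        exact Or.inl h
      | cons g gs =>
        rw [fillWord, List.mem_append] at h
        rcases h with h | h
        · exact Or.inr ⟨g, by simp, h⟩
        · rcases ih h with h | ⟨g, hg, h⟩
          · simp [h]
          · exact Or.inr ⟨g, by simp [hg], h⟩

theorem reduceOption_fillWord_bars (y : Word) (cs : List ℕ) :
    (fillWord y (cs.map fun c => List.replicate c none)).reduceOption = y.reduceOption := by
  induction y generalizing cs with
  | nil => rfl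
  | cons o y ih =>
    cases o with
    | some k =>
      rw [fillWord, List.reduceOption_cons_of_some, List.reduceOption_cons_of_some, ih]
    | none =>
      cases cs with
      | nil => rw [List.map_nil, fillWord_nil]
      | cons c cs =>
        rw [List.map_cons, fillWord, List.reduceOption_append, reduceOption_replicate_none, ih,
          List.reduceOption_cons_of_none, List.nil_append]

/-! ### The evaluation of words in a pair -/

/-- The colour of an element of a pair. -/
def PairData.colour {D : PairData.{w}} : D.M ⊕ D.Z → Colour
  | .inl m => .closed (D.ar m)
  | .inr z => .opened (D.arZ z)

namespace SetPair

open PairData (colour)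

variable {P : SetPair.{w}}

/-- Insert elements of `As` of the given arities into the inputs from the `p`-th one on. -/
def fillZ (z : P.Z) (p : ℕ) : List ℕ → P.Z
  | [] => z
  | c :: cs => fillZ (P.ract z p c) (p + c) cs

theorem arZ_fillZ (z : P.Z) (p q : ℕ) (cs : List ℕ) (h : P.arZ z = p + cs.length + q) :
    P.arZ (fillZ z p cs) = p + cs.sum + q := by
  induction cs generalizing z p with
  | nil => simpa [fillZ] using h
  | cons c cs ih =>
    rw [List.length_cons] at h
    have h1 := P.arZ_ract z p c (by omega)
    rw [fillZ, ih _ _ (by omega), List.sum_cons]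
    omega

theorem fillZ_append (z : P.Z) (p : ℕ) (cs cs' : List ℕ) :
    fillZ z p (cs ++ cs') = fillZ (fillZ z p cs) (p + cs.sum) cs' := by
  induction cs generalizing z p with
  | nil => rfl
  | cons c cs ih => simp [fillZ, ih, add_assoc]

/-- An insertion on the left of the current input commutes with the later insertions. -/
theorem ract_fillZ (z : P.Z) (p q c : ℕ) (cs : List ℕ) (hq : q < p)
    (h : p + cs.length ≤ P.arZ z) :
    P.ract (fillZ z p cs) q c = fillZ (P.ract z q c) (p - 1 + c) cs := by
  induction cs generalizing z p with
  | nil => rfl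
  | cons d cs ih =>
    rw [List.length_cons] at h
    have h1 := P.arZ_ract z p d (by omega)
    rw [fillZ, fillZ, ih _ _ (by omega) (by omega)]
    obtain ⟨m, rfl⟩ := Nat.exists_eq_add_of_lt hq
    have h2 := P.ract_comm z q m c d (by omega)
    rw [show q + m + 1 = q + 1 + m by omega, ← h2]
    congr 1
    · congr 1
      omega
    · omega

/-- An insertion into an input of an inserted element of `As` may be carried out in `As`. -/
theorem fillZ_refine (z : P.Z) (cs₁ cs₂ : List ℕ) (e f c : ℕ)
    (h : P.arZ z = cs₁.length + 1 + cs₂.length) :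
    fillZ z 0 (cs₁ ++ (e + c + f) :: cs₂) =
      P.ract (fillZ z 0 (cs₁ ++ (e + 1 + f) :: cs₂)) (cs₁.sum + e) c := by
  have h1 := arZ_fillZ z 0 (1 + cs₂.length) cs₁ (by omega)
  have h2 := P.arZ_ract (fillZ z 0 cs₁) (0 + cs₁.sum) (e + 1 + f) (by omega)
  rw [fillZ_append, fillZ_append, fillZ, fillZ,
    ract_fillZ (P.ract (fillZ z 0 cs₁) (0 + cs₁.sum) (e + 1 + f)) _ _ _ _ (by omega) (by omega),
    ← P.ract_assoc _ _ _ _ _ (show 0 + cs₁.sum < _ by omega)]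
  congr 1
  · congr 1
    omega
  · omega

variable (ρ : ℕ → P.M ⊕ P.Z)

/-- The state of the reading of a chunk of an open letter: `z` is the element, with the insertions
that have been read, and `p` is the current input, if there is one left. -/
def park (z : P.Z) (p : ℕ) : Option (P.Z × ℕ) := if p < P.arZ z then some (z, p) else none

/-- The symbol that is emitted at the end of the reading of a chunk of an open letter. -/
def finish (z : P.Z) (p : ℕ) : List P.Tok := if p < P.arZ z then [] else [.leaf z]

/-- The next state of the reading of a word. -/
def next : Option (P.Z × ℕ) → Option ℕ → Option (P.Z × ℕ)
  | none, none => none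
  | none, some i =>
    match ρ i with
    | .inl _ => none
    | .inr z => park z 0
  | some (z, p), none => some (P.ract z p 2, p + 1)
  | some (z, p), some _ => park (P.ract z p 0) p

open Classical in
/-- The symbols that are emitted when a letter or a bar is read after the word `pre`. -/
noncomputable def emit (pre : Word) : Option (P.Z × ℕ) → Option ℕ → List P.Tok
  | none, none => [.bar]
  | none, some i =>
    match ρ i with
    | .inl m => if some i ∈ pre then [.close] else [.op m]
    | .inr z => finish z 0
  | some _, none => []
  | some (z, p), some _ => finish (P.ract z p 0) p

/-- The state after the reading of a word. -/
def readState : Option (P.Z × ℕ) → Word → Option (P.Z × ℕ)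
  | s, [] => s
  | s, o :: w => readState (next ρ s o) w

/-- The symbols of a word: a bar becomes a bar, the first occurrence of a closed letter begins an
operation, its other occurrences end inputs, and a chunk `i|^{c₁}i⋯|^{c_n}i` of an open letter
becomes the element of `Z` that belongs to `i`, with elements of `As` of arities `c₁, …, c_n`
inserted. The word `pre` has been read before. -/
noncomputable def tok : Word → Option (P.Z × ℕ) → Word → List P.Tok
  | _, _, [] => []
  | pre, s, o :: w => emit ρ pre s o ++ tok (pre ++ [o]) (next ρ s o) w

variable {ρ}

theorem readState_append (s : Option (P.Z × ℕ)) (u v : Word) :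
    readState ρ s (u ++ v) = readState ρ (readState ρ s u) v := by
  induction u generalizing s with
  | nil => rfl
  | cons o u ih => exact ih _

theorem tok_append (pre : Word) (s : Option (P.Z × ℕ)) (u v : Word) :
    tok ρ pre s (u ++ v) = tok ρ pre s u ++ tok ρ (pre ++ u) (readState ρ s u) v := by
  induction u generalizing pre s with
  | nil => simp [tok, readState]
  | cons o u ih => simp [tok, readState, ih]

theorem tok_congr {ρ' : ℕ → P.M ⊕ P.Z} {pre pre' : Word} {s : Option (P.Z × ℕ)} {w : Word}
    (hρ : ∀ i, some i ∈ w → ρ i = ρ' i)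
    (hp : ∀ i, some i ∈ w → (some i ∈ pre ↔ some i ∈ pre')) :
    tok ρ pre s w = tok ρ' pre' s w := by
  induction w generalizing pre pre' s with
  | nil => rfl
  | cons o w ih =>
    have h1 : next ρ s o = next ρ' s o := by
      cases s <;> cases o <;> simp [next, hρ]
    have h2 : emit ρ pre s o = emit ρ' pre' s o := by
      cases s <;> cases o <;> simp [emit, hρ, hp]
    rw [tok, tok, h1, h2]
    congr 1
    refine ih (fun i hi => hρ i (by simp [hi])) fun i hi => ?_
    have := hp i (by simp [hi])
    simp [this]

theorem tok_rename {f : ℕ → ℕ} {pre w : Word} {s : Option (P.Z × ℕ)}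
    (hf : ∀ i j, some i ∈ w → some j ∈ pre ++ w → f i = f j → i = j) :
    tok ρ (renameWord f pre) s (renameWord f w) = tok (ρ ∘ f) pre s w := by
  induction w generalizing pre s with
  | nil => rfl
  | cons o w ih =>
    have h1 : next ρ s (o.map f) = next (ρ ∘ f) s o := by
      cases s <;> cases o <;> rfl
    have h2 : emit ρ (renameWord f pre) s (o.map f) = emit (ρ ∘ f) pre s o := by
      cases s with
      | some s => cases o <;> rfl
      | none =>
        cases o with
        | none => rfl
        | some i =>
          have : some (f i) ∈ renameWord f pre ↔ some i ∈ pre := by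
            rw [mem_renameWord]
            constructor
            · rintro ⟨j, hj, e⟩
              have := hf i j (by simp) (by simp [hj]) e.symm
              rwa [this]
            · exact fun hi => ⟨i, hi, rfl⟩
          simp [emit, this]
    have h3 := ih (pre := pre ++ [o]) (s := next (ρ ∘ f) s o) fun i j hi hj =>
      hf i j (by simp [hi]) (by simpa using hj)
    rw [show renameWord f (o :: w) = o.map f :: renameWord f w from rfl, tok, tok, h1, h2, ← h3]
    simp [renameWord]

theorem tok_bars (pre : Word) (n : ℕ) (v : Word) :
    tok ρ pre none (List.replicate n none ++ v) = List.replicate n .bar ++ tok ρ pre none v := by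
  induction n generalizing pre with
  | zero => rfl
  | succ n ih =>
    rw [List.replicate_succ, List.cons_append, tok, next, emit, ih, List.replicate_succ]
    rw [tok_congr (fun _ _ => rfl) (pre' := pre) (by simp)]
    rfl

/-- The reading of the bars between two occurrences of an open letter. -/
theorem read_bars_chunk (pre : Word) (z : P.Z) (p k c : ℕ) (v : Word) (hp : p < P.arZ z) :
    readState ρ (some (P.ract z p (k + 1), p + k)) (List.replicate c none ++ v) =
        readState ρ (some (P.ract z p (k + c + 1), p + k + c)) v ∧
      tok ρ pre (some (P.ract z p (k + 1), p + k)) (List.replicate c none ++ v) =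
        tok ρ pre (some (P.ract z p (k + c + 1), p + k + c)) v := by
  induction c generalizing pre k with
  | zero => exact ⟨rfl, rfl⟩
  | succ c ih =>
    have h := P.ract_assoc z p k 0 2 hp
    simp only [add_zero] at h
    obtain ⟨h1, h2⟩ := ih (pre ++ [none]) (k + 1)
    rw [List.replicate_succ, List.cons_append]
    constructor
    · rw [readState, next, h]
      refine h1.trans ?_
      rw [show k + 1 + c + 1 = k + (c + 1) + 1 by omega,
        show p + (k + 1) + c = p + k + (c + 1) by omega]
    · rw [tok, next, emit, h]
      refine h2.trans ?_
      rw [tok_congr (fun _ _ => rfl) (pre' := pre) (by simp),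
        show k + 1 + c + 1 = k + (c + 1) + 1 by omega,
        show p + (k + 1) + c = p + k + (c + 1) by omega]

/-- The reading of what follows the first occurrence of an open letter in its chunk. -/
theorem read_chunk_tail (i : ℕ) (cs : List ℕ) : ∀ (pre : Word) (z : P.Z) (p : ℕ) (v : Word),
    P.arZ z = p + cs.length → chunk i cs = some i :: v →
      readState ρ (park z p) v = none ∧
        finish z p ++ tok ρ pre (park z p) v = [.leaf (fillZ z p cs)] := by
  induction cs with
  | nil =>
    intro pre z p v h hv
    obtain rfl : v = [] := by simpa [chunk, weave] using hv.symm
    have : ¬ p < P.arZ z := by simp [h]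
    simp [park, finish, this, readState, tok, fillZ]
  | cons c cs ih =>
    intro pre z p v h hv
    rw [List.length_cons] at h
    have hp : p < P.arZ z := by omega
    obtain ⟨v', hv'⟩ := exists_weave_eq_cons i (cs.map fun c => List.replicate c none)
    obtain rfl : v = List.replicate c none ++ some i :: v' := by
      rw [chunk, List.map_cons, weave, hv', List.cons.injEq] at hv
      exact hv.2.symm
    have h1 := P.arZ_ract z p c hp
    obtain ⟨h2, h3⟩ := read_bars_chunk (ρ := ρ) pre z p 0 c (some i :: v') hp
    have h4 := P.ract_assoc z p c 0 0 hp
    simp only [add_zero] at h4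
    simp only [zero_add, add_zero, P.ract_one z p hp] at h2 h3
    obtain ⟨h5, h6⟩ := ih (pre ++ [some i]) (P.ract z p c) (p + c) v' (by omega) hv'
    rw [park, finish, if_pos hp, if_pos hp, h2, h3, readState, next, tok, emit, next, h4]
    exact ⟨h5, by rw [List.nil_append, h6, fillZ]⟩

theorem readState_chunk {i : ℕ} {z : P.Z} (hz : ρ i = .inr z) {cs : List ℕ}
    (h : cs.length = P.arZ z) : readState ρ none (chunk i cs) = none := by
  obtain ⟨v, hv⟩ := exists_weave_eq_cons i (cs.map fun c => List.replicate c none)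
  have := read_chunk_tail (ρ := ρ) i cs [] z 0 v (by omega) hv
  rw [chunk, hv, readState, next, hz]
  exact this.1

theorem tok_chunk_open {i : ℕ} {z : P.Z} (hz : ρ i = .inr z) {cs : List ℕ}
    (h : cs.length = P.arZ z) (pre : Word) :
    tok ρ pre none (chunk i cs) = [.leaf (fillZ z 0 cs)] := by
  obtain ⟨v, hv⟩ := exists_weave_eq_cons i (cs.map fun c => List.replicate c none)
  have := read_chunk_tail (ρ := ρ) i cs (pre ++ [some i]) z 0 v (by omega) hv
  rw [chunk, hv, tok, next, emit, hz]
  exact this.2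

theorem exists_inl {i : ℕ} (h : (colour (ρ i)).isOpen = false) : ∃ m, ρ i = .inl m := by
  cases e : ρ i with
  | inl m => exact ⟨m, rfl⟩
  | inr z =>
    rw [e] at h
    cases h

theorem exists_inr {i : ℕ} (h : (colour (ρ i)).isOpen = true) : ∃ z, ρ i = .inr z := by
  cases e : ρ i with
  | inr z => exact ⟨z, rfl⟩
  | inl m =>
    rw [e] at h
    cases h

theorem arity_inl {i : ℕ} {m : P.M} (h : ρ i = .inl m) : (colour (ρ i)).arity = P.ar m := by
  rw [h]
  rfl

theorem arity_inr {i : ℕ} {z : P.Z} (h : ρ i = .inr z) : (colour (ρ i)).arity = P.arZ z := by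
  rw [h]
  rfl

theorem readState_segmented {u : Word} (h : Segmented (fun i => colour (ρ i)) u) :
    readState ρ none u = none := by
  induction h with
  | nil => rfl
  | bar _ ih => exact ih
  | letter i hi _ ih =>
    obtain ⟨m, hm⟩ := exists_inl hi
    rw [readState, next, hm]
    exact ih
  | chunk i cs hi hcs _ _ ih =>
    obtain ⟨z, hz⟩ := exists_inr hi
    rw [arity_inr hz] at hcs
    rw [readState_append, readState_chunk hz hcs, ih]

theorem tok_append_of_leafy {pre u v : Word} (h : Leafy (fun i => colour (ρ i)) u) :
    tok ρ pre none (u ++ v) = tok ρ pre none u ++ tok ρ (pre ++ u) none v := by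
  rw [tok_append, readState_segmented h.segmented]

theorem tok_eq_of_disjoint {pre w : Word} (s : Option (P.Z × ℕ)) (h : DisjointLetters w pre) :
    tok ρ pre s w = tok ρ [] s w :=
  tok_congr (fun _ _ => rfl) fun i hi => by simp [h i hi]

/-- The reading of what follows the first occurrence of a closed letter, up to its last one. -/
theorem tok_weave_tail {r : ℕ} {m : P.M} (hm : ρ r = .inl m) (gs : List Word) :
    ∀ (pre v : Word), some r ∈ pre → weave r gs = some r :: v →
      (∀ g ∈ gs, Leafy (fun i => colour (ρ i)) g) → (∀ g ∈ gs, some r ∉ g) →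
      (∀ g ∈ gs, DisjointLetters g pre) → gs.Pairwise DisjointLetters →
      readState ρ none v = none ∧ tok ρ pre none v = gaps (gs.map (tok ρ [] none)) := by
  induction gs with
  | nil =>
    intro pre v _ hv _ _ _ _
    obtain rfl : v = [] := by simpa [weave] using hv.symm
    exact ⟨rfl, rfl⟩
  | cons g gs ih =>
    intro pre v hr hv hl hrg hd hp
    obtain ⟨v', hv'⟩ := exists_weave_eq_cons r gs
    obtain rfl : v = g ++ some r :: v' := by
      rw [weave, hv', List.cons.injEq] at hv
      exact hv.2.symm
    rw [List.pairwise_cons] at hp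
    have hg := readState_segmented (hl g (by simp)).segmented
    obtain ⟨h1, h2⟩ := ih (pre ++ g ++ [some r]) v' (by simp) hv'
      (fun g hg => hl g (by simp [hg])) (fun g hg => hrg g (by simp [hg])) (by
        intro g' hg' i hi
        have h3 := hd g' (by simp [hg']) i hi
        have h4 := (hp.1 g' hg').symm i hi
        have h5 : i ≠ r := fun e => hrg g' (by simp [hg']) (e ▸ hi)
        simp [h3, h4, h5]) hp.2
    rw [readState_append, tok_append, hg, readState, next, hm, tok, next, emit, hm]
    refine ⟨h1, ?_⟩
    have h6 : some r ∈ pre ++ g := by simp [hr]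
    simp only [if_pos h6]
    rw [h2, List.map_cons, gaps, tok_eq_of_disjoint none (hd g (by simp))]
    rfl

/-- The symbols of the occurrences of a closed letter and of what occurs between them. -/
theorem tok_weave {r : ℕ} {m : P.M} (hm : ρ r = .inl m) {gs : List Word} {pre : Word}
    (hr : some r ∉ pre) (hl : ∀ g ∈ gs, Leafy (fun i => colour (ρ i)) g)
    (hrg : ∀ g ∈ gs, some r ∉ g) (hd : ∀ g ∈ gs, DisjointLetters g pre)
    (hp : gs.Pairwise DisjointLetters) (v : Word) :
    tok ρ pre none (weave r gs ++ v) =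
      (.op m :: gaps (gs.map (tok ρ [] none))) ++ tok ρ (pre ++ weave r gs) none v := by
  obtain ⟨v', hv'⟩ := exists_weave_eq_cons r gs
  obtain ⟨h1, h2⟩ := tok_weave_tail hm gs (pre ++ [some r]) v' (by simp) hv' hl hrg (by
    intro g hg i hi
    have h3 := hd g hg i hi
    have h5 : i ≠ r := fun e => hrg g hg (e ▸ hi)
    simp [h3, h5]) hp
  rw [hv', List.cons_append, tok, next, emit, hm]
  simp only [if_neg hr]
  rw [tok_append, h1, h2]
  simp

/-- The symbols of a substitution into the bars of a word with closed letters. -/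
theorem tok_fillWord (y : Word) : ∀ (gs : List Word) (pre pre' : Word),
    (∀ i, some i ∈ y → (colour (ρ i)).isOpen = false) → y.count none = gs.length →
      (∀ g ∈ gs, Leafy (fun i => colour (ρ i)) g) → (∀ g ∈ gs, DisjointLetters g y) →
      (∀ g ∈ gs, DisjointLetters g pre) → gs.Pairwise DisjointLetters →
      (∀ i, some i ∈ y → (some i ∈ pre ↔ some i ∈ pre')) →
      readState ρ none (fillWord y gs) = none ∧
      tok ρ pre none (fillWord y gs) = fill (tok ρ pre' none y) (gs.map (tok ρ [] none)) := by
  induction y with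
  | nil =>
    intros
    exact ⟨rfl, rfl⟩
  | cons o y ih =>
    intro gs pre pre' hy hn hl hdy hd hp he
    have hy' : ∀ i, some i ∈ y → (colour (ρ i)).isOpen = false := fun i hi => hy i (by simp [hi])
    have hdy' : ∀ g ∈ gs, DisjointLetters g y := fun g hg i hi hi' =>
      hdy g hg i hi (by simp [hi'])
    cases o with
    | some k =>
      obtain ⟨m, hm⟩ := exists_inl (hy k (by simp))
      have hk := he k (by simp)
      obtain ⟨h1, h2⟩ := ih gs (pre ++ [some k]) (pre' ++ [some k]) hy' (by simpa using hn) hl hdy'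
        (by
          intro g hg i hi
          have h3 := hd g hg i hi
          have h5 : i ≠ k := by
            rintro rfl
            exact hdy g hg i hi (by simp)
          simp [h3, h5]) hp (by
          intro i hi
          simp [he i (by simp [hi])])
      rw [fillWord, readState, next, tok, tok, next, emit, emit, hm]
      refine ⟨h1, ?_⟩
      simp only [hk, h2]
      by_cases hkp : some k ∈ pre' <;> simp [hkp, fill]
    | none =>
      cases gs with
      | nil => simp at hn
      | cons g gs =>
        rw [List.pairwise_cons] at hp
        have hg := readState_segmented (hl g (by simp)).segmented
        obtain ⟨h1, h2⟩ := ih gs (pre ++ g) (pre' ++ [none]) hy' (by simpa using hn)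
          (fun g hg => hl g (by simp [hg])) (fun g hg => hdy' g (by simp [hg]))
          (by
            intro g' hg' i hi
            have h3 := hd g' (by simp [hg']) i hi
            have h4 := (hp.1 g' hg').symm i hi
            simp [h3, h4]) hp.2 (by
            intro i hi
            have h4 : some i ∉ g := fun hi' => hdy' g (by simp) i hi' hi
            simp [he i (by simp [hi]), h4])
        rw [fillWord, readState_append, hg, tok_append, hg, tok, next, emit, h2,
          tok_eq_of_disjoint none (hd g (by simp))]
        exact ⟨h1, rfl⟩

end SetPair

namespace SetPair

open PairData (colour)

variable {P : SetPair.{w}} {ρ : ℕ → P.M ⊕ P.Z}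

theorem tok_only_bars (pre : Word) (n : ℕ) :
    tok ρ pre none (List.replicate n none) = List.replicate n .bar := by
  have := tok_bars (ρ := ρ) pre n []
  simpa [tok] using this

theorem map_tok_bars (cs : List ℕ) :
    (cs.map fun c => List.replicate c (none : Option ℕ)).map (tok ρ [] none) =
      cs.map fun c => List.replicate c .bar := by
  rw [List.map_map]
  exact List.map_congr_left fun c _ => tok_only_bars [] c

theorem tok_chunk_closed {r : ℕ} {m : P.M} (hm : ρ r = .inl m) (cs : List ℕ) {pre : Word}
    (hr : some r ∉ pre) (v : Word) :
    tok ρ pre none (chunk r cs ++ v) = (.op m :: gaps (cs.map fun c => List.replicate c .bar)) ++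
      tok ρ (pre ++ chunk r cs) none v := by
  rw [chunk, tok_weave hm hr (forall_bars fun c => leafy_bars c) (forall_bars fun c => by
    simp [List.mem_replicate]) (forall_bars fun c i hi => by simp [List.mem_replicate] at hi)
    (pairwise_disjoint_bars cs), map_tok_bars]

theorem bar_depth {τ₁ τ₂ τ : List P.Tok} (h : Depth (τ₁ ++ .bar :: τ₂) 0 0) (hτ : Depth τ 0 0) :
    Depth (τ₁ ++ (τ ++ τ₂)) 0 0 := by
  obtain ⟨s, h1, h2⟩ := h.split
  have := hτ.add s
  rw [zero_add] at this
  exact h1.append (this.append h2)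

/-- The symbols of a nested word form a complete list. -/
theorem depth_tok {w : Word} (h : Nested (fun i => colour (ρ i)) w) :
    Depth (tok ρ [] none w) 0 0 := by
  induction hn : w.reduceOption.length using Nat.strong_induction_on generalizing w with
  | _ n ih =>
    subst hn
    by_cases hw : ∃ i, some i ∈ w
    · obtain ⟨a, r, cs, b, rfl, ha, hb, hcs⟩ := h.exists_chunk hw
      have h1 := h.remove_chunk ha hb [none] rfl
      have h2 := ih _ (by
        simp only [List.reduceOption_append, reduceOption_chunk, List.length_append,
          List.length_replicate]
        simp) h1 rfl
      obtain ⟨h3, h4⟩ := h.leafy.split (p := r) (by simp [mem_chunk]) (fun i => mem_chunk.1)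
        (fun _ => ⟨ha, hb⟩)
      rw [tok_append_of_leafy h3] at h2 ⊢
      rw [List.nil_append] at h2 ⊢
      have h5 : tok ρ a none ([none] ++ b) = .bar :: tok ρ a none b := by
        have := tok_bars (ρ := ρ) a 1 b
        simpa using this
      have h6 : tok ρ (a ++ chunk r cs) none b = tok ρ a none b :=
        tok_congr (fun _ _ => rfl) fun i hi => by
          have : i ≠ r := fun e => hb (e ▸ hi)
          simp [mem_chunk, this]
      rw [h5] at h2
      cases hr : ρ r with
      | inl m =>
        rw [tok_chunk_closed hr cs ha, h6]
        refine bar_depth h2 (op_depth m _ ?_ ?_)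
        · intro g hg
          obtain ⟨c, _, rfl⟩ := List.mem_map.1 hg
          exact bars_depth' c 0
        · rw [List.length_map, hcs, arity_inl hr]
      | inr z =>
        rw [arity_inr hr] at hcs
        rw [tok_append, readState_chunk hr hcs, tok_chunk_open hr hcs, h6]
        exact bar_depth h2 rfl
    · obtain ⟨c, rfl⟩ := eq_replicate_none (not_exists.1 hw)
      rw [tok_only_bars]
      exact bars_depth' c 0

theorem totalArity_append (s s' : List (Option P.Z)) :
    totalArity P.arZ (s ++ s') = totalArity P.arZ s + totalArity P.arZ s' := by
  induction s with
  | nil => simp [totalArity]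
  | cons o s ih => cases o <;> simp [totalArity, ih, add_assoc]

/-- The number of bars of a word is the arity of the result of its evaluation. -/
theorem totalArity_tok {w : Word} (h : Segmented (fun i => colour (ρ i)) w) (pre : Word) :
    totalArity P.arZ (slots (tok ρ pre none w)) = w.count none := by
  induction h generalizing pre with
  | nil => rfl
  | bar _ ih =>
    rw [tok, emit, next, List.singleton_append, slots, totalArity, ih, List.count_cons_self]
    omega
  | @letter w i hi _ ih =>
    obtain ⟨m, hm⟩ := exists_inl hi
    have h1 := ih (pre ++ [some i])
    rw [tok, emit, next, hm]
    simp only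
    rw [List.count_cons_of_ne (by simp), ← h1]
    split_ifs <;> rfl
  | chunk i cs hi hcs _ _ ih =>
    obtain ⟨z, hz⟩ := exists_inr hi
    rw [arity_inr hz] at hcs
    have h1 := arZ_fillZ z 0 0 cs (by omega)
    rw [tok_append, readState_chunk hz hcs, tok_chunk_open hz hcs, slots_append,
      totalArity_append, ih, List.count_append, count_none_chunk]
    simp only [slots, totalArity]
    omega

/-- The number of bars of a word with closed letters is the arity of its evaluation. -/
theorem length_slots_tok {w : Word} (h : ∀ i, some i ∈ w → (colour (ρ i)).isOpen = false)
    (pre : Word) : (slots (tok ρ pre none w)).length = w.count none := by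
  induction w generalizing pre with
  | nil => rfl
  | cons o w ih =>
    have ih' := ih (fun i hi => h i (by simp [hi])) (pre ++ [o])
    cases o with
    | none =>
      rw [tok, emit, next, List.singleton_append, slots, List.length_cons, ih',
        List.count_cons_self]
    | some i =>
      obtain ⟨m, hm⟩ := exists_inl (h i (by simp))
      rw [tok, emit, next, hm]
      simp only
      rw [List.count_cons_of_ne (by simp), ← ih']
      split_ifs <;> rfl

variable (ρ) in
/-- The value of a word that represents an operation of `RL_2` with output of colour `d`, at the
elements `ρ`. -/
noncomputable def eval (d : Colour) (w : Word) : P.M ⊕ P.Z :=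
  if d.isOpen then .inr (evalZ (tok ρ [] none w)) else .inl (evalM (tok ρ [] none w))

theorem colour_eval {d : Colour} {w : Word} (h : Valid (fun i => colour (ρ i)) d w) :
    colour (eval ρ d w) = d := by
  have h1 := depth_tok h.toNested
  have h2 := ar_evalM h1
  cases d with
  | closed n =>
    have h3 := length_slots_tok (h.colour rfl) []
    simp only [eval, Colour.isOpen, PairData.colour, Bool.false_eq_true, if_false]
    rw [h2, h3, h.bars]
    rfl
  | opened n =>
    simp only [eval, Colour.isOpen, PairData.colour, if_true]
    rw [evalZ, P.arZ_act _ _ h2.symm, totalArity_tok h.leafy.segmented, h.bars]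
    rfl

theorem eval_congr {ρ' : ℕ → P.M ⊕ P.Z} {d : Colour} {w : Word}
    (h : ∀ i, some i ∈ w → ρ i = ρ' i) : eval ρ d w = eval ρ' d w := by
  rw [eval, eval, tok_congr h fun _ _ => Iff.rfl]

theorem eval_rename {f : ℕ → ℕ} {d : Colour} {w : Word} (hf : InjLetters f w) :
    eval ρ d (renameWord f w) = eval (ρ ∘ f) d w := by
  have := tok_rename (ρ := ρ) (f := f) (pre := []) (w := w) (s := none) hf
  rw [eval, eval, ← this]
  rfl

theorem fillZ_one (z : P.Z) (p n : ℕ) (h : p + n ≤ P.arZ z) :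
    fillZ z p (List.replicate n 1) = z := by
  induction n generalizing p with
  | zero => rfl
  | succ n ih => rw [List.replicate_succ, fillZ, P.ract_one z p (by omega), ih _ (by omega)]

/-- The units of the operad `RL_2` denote identities. -/
theorem eval_chunk (i : ℕ) :
    eval ρ (colour (ρ i)) (chunk i (List.replicate (colour (ρ i)).arity 1)) = ρ i := by
  cases h : ρ i with
  | inl m =>
    have h1 := tok_chunk_closed h (List.replicate (P.ar m) 1) (pre := []) (by simp) []
    rw [List.append_nil, tok, List.append_nil] at h1
    simp only [eval, PairData.colour, Colour.arity, Colour.isOpen, Bool.false_eq_true, if_false]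
    rw [h1, evalM_op]
    · simp only [List.map_replicate, List.replicate_one]
      exact bars_isSlot _
    · simp
  | inr z =>
    have h1 := tok_chunk_open h (cs := List.replicate (P.arZ z) 1) (by simp) []
    simp only [eval, PairData.colour, Colour.arity, Colour.isOpen, if_true]
    have h2 := evalM_leaf (P := P) [] [] z
    have h3 := evalM_bars (P := P) 1
    rw [List.replicate_one, P.mu_one] at h3
    rw [List.nil_append, List.nil_append, h3] at h2
    rw [h1, fillZ_one _ _ _ (by simp), evalZ, h2]
    exact congrArg Sum.inr (P.one_act z)

/-- A bar of a chunk lies in one of its gaps, and its replacement with `c` bars is again a chunk. -/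
theorem exists_chunk_split {i : ℕ} {cs : List ℕ} {u v : Word} (h : chunk i cs = u ++ none :: v) :
    ∃ cs₁ e f cs₂, cs = cs₁ ++ (e + 1 + f) :: cs₂ ∧ u.count none = cs₁.sum + e ∧
      ∀ c, chunk i (cs₁ ++ (e + c + f) :: cs₂) = u ++ (List.replicate c none ++ v) := by
  induction cs generalizing u with
  | nil =>
    have := congrArg (List.count none) h
    simp [count_none_chunk] at this
  | cons d cs ih =>
    have hcons : ∀ d' cs',
        chunk i (d' :: cs') = some i :: (List.replicate d' none ++ chunk i cs') :=
      fun _ _ => rfl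
    rw [hcons] at h
    cases u with
    | nil => simp at h
    | cons o u =>
      rw [List.cons_append, List.cons.injEq] at h
      obtain ⟨rfl, h⟩ := h
      rcases List.append_eq_append_iff.1 h with ⟨u', rfl, h1⟩ | ⟨v', h1, h2⟩
      · obtain ⟨cs₁, e, f, cs₂, rfl, h2, h3⟩ := ih h1
        refine ⟨d :: cs₁, e, f, cs₂, rfl, ?_, fun c => ?_⟩
        · rw [List.count_cons_of_ne (by simp), List.count_append, h2, List.sum_cons]
          simp [add_assoc]
        · rw [List.cons_append, hcons, h3]
          simp
      · cases v' with
        | nil =>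
          rw [List.append_nil] at h1
          obtain ⟨x, hx⟩ := exists_weave_eq_cons i (cs.map fun c => List.replicate c none)
          rw [chunk, hx] at h2
          simp at h2
        | cons o v' =>
          rw [List.cons_append, List.cons.injEq] at h2
          obtain ⟨rfl, rfl⟩ := h2
          have h4 : ∀ o ∈ u, o = none := fun o ho =>
            List.eq_of_mem_replicate (h1 ▸ List.mem_append_left _ ho : o ∈ List.replicate d none)
          have h5 : ∀ o ∈ v', o = none := fun o ho => List.eq_of_mem_replicate
            (h1 ▸ List.mem_append_right _ (List.mem_cons_of_mem _ ho) : o ∈ List.replicate d none)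
          obtain ⟨e, rfl⟩ : ∃ e, u = List.replicate e none := ⟨_, List.eq_replicate_of_mem h4⟩
          obtain ⟨f, rfl⟩ : ∃ f, v' = List.replicate f none := ⟨_, List.eq_replicate_of_mem h5⟩
          have h8 := congrArg List.length h1
          simp only [List.length_replicate, List.length_append, List.length_cons] at h8
          refine ⟨[], e, f, cs, ?_, ?_, fun c => ?_⟩
          · rw [List.nil_append, h8]
            congr 1
            omega
          · rw [List.count_cons_of_ne (by simp)]
            simp
          · rw [List.nil_append, hcons, List.replicate_add, List.replicate_add]
            simp only [List.append_assoc, List.cons_append]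

/-- A bar of a word is a bar of its symbols, or an input of an element of `Z`. -/
theorem tok_bar_cases {w : Word} (h : Segmented (fun i => colour (ρ i)) w) :
    ∀ (pre u v : Word), w = u ++ none :: v →
      (∃ τ₁ τ₂, totalArity P.arZ (slots τ₁) = u.count none ∧
        tok ρ pre none w = τ₁ ++ .bar :: τ₂ ∧ ∀ c,
        tok ρ pre none (u ++ (List.replicate c none ++ v)) = τ₁ ++ (List.replicate c .bar ++ τ₂)) ∨
      (∃ τ₁ τ₂ z q, totalArity P.arZ (slots τ₁) + q = u.count none ∧ q < P.arZ z ∧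
        tok ρ pre none w = τ₁ ++ .leaf z :: τ₂ ∧ ∀ c,
        tok ρ pre none (u ++ (List.replicate c none ++ v)) = τ₁ ++ .leaf (P.ract z q c) :: τ₂) := by
  induction h with
  | nil =>
    intro pre u v h
    simp at h
  | @bar w _ ih =>
    intro pre u v h
    cases u with
    | nil =>
      rw [List.nil_append, List.cons.injEq] at h
      obtain ⟨-, rfl⟩ := h
      refine Or.inl ⟨[], tok ρ pre none w, rfl, ?_, fun c => ?_⟩
      · have := tok_bars (ρ := ρ) pre 1 w
        simpa using this
      · exact tok_bars pre c w
    | cons o u =>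
      rw [List.cons_append, List.cons.injEq] at h
      obtain ⟨rfl, h⟩ := h
      rcases ih (pre ++ [none]) u v h with ⟨τ₁, τ₂, h1, h2, h3⟩ | ⟨τ₁, τ₂, z, q, h1, h4, h2, h3⟩
      · refine Or.inl ⟨.bar :: τ₁, τ₂, ?_, ?_, fun c => ?_⟩
        · rw [slots, totalArity, h1, List.count_cons_self]
          omega
        · rw [tok, next, emit, h2]
          rfl
        · rw [List.cons_append, tok, next, emit, h3]
          rfl
      · refine Or.inr ⟨.bar :: τ₁, τ₂, z, q, ?_, h4, ?_, fun c => ?_⟩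
        · rw [slots, totalArity, List.count_cons_self]
          omega
        · rw [tok, next, emit, h2]
          rfl
        · rw [List.cons_append, tok, next, emit, h3]
          rfl
  | @letter w i hi _ ih =>
    intro pre u v h
    obtain ⟨m, hm⟩ := exists_inl hi
    cases u with
    | nil => simp at h
    | cons o u =>
      rw [List.cons_append, List.cons.injEq] at h
      obtain ⟨rfl, h⟩ := h
      have h0 : ∀ w, tok ρ pre none (some i :: w) =
          emit ρ pre none (some i) ++ tok ρ (pre ++ [some i]) none w := by
        intro w
        rw [tok, next, hm]
      have h5 : slots (emit ρ pre none (some i)) = [] := by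
        rw [emit, hm]
        simp only
        split_ifs <;> rfl
      rw [List.count_cons_of_ne (by simp)]
      rcases ih (pre ++ [some i]) u v h with ⟨τ₁, τ₂, h1, h2, h3⟩ | ⟨τ₁, τ₂, z, q, h1, h4, h2, h3⟩
      · refine Or.inl ⟨emit ρ pre none (some i) ++ τ₁, τ₂, ?_, ?_, fun c => ?_⟩
        · rw [slots_append, h5, List.nil_append, h1]
        · rw [h0, h2, List.append_assoc]
        · rw [List.cons_append, h0, h3, List.append_assoc]
      · refine Or.inr ⟨emit ρ pre none (some i) ++ τ₁, τ₂, z, q, ?_, h4, ?_, fun c => ?_⟩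
        · rw [slots_append, h5, List.nil_append, h1]
        · rw [h0, h2, List.append_assoc]
        · rw [List.cons_append, h0, h3, List.append_assoc]
  | @chunk w i cs hi hcs hiw hw ih =>
    intro pre u v h
    obtain ⟨z, hz⟩ := exists_inr hi
    rw [arity_inr hz] at hcs
    have h0 : ∀ pre w, tok ρ pre none (chunk i cs ++ w) =
        .leaf (fillZ z 0 cs) :: tok ρ (pre ++ chunk i cs) none w := by
      intro pre w
      rw [tok_append, readState_chunk hz hcs, tok_chunk_open hz hcs]
      rfl
    rcases List.append_eq_append_iff.1 h with ⟨u', rfl, h1⟩ | ⟨v', h1, h2⟩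
    · rcases ih (pre ++ chunk i cs) u' v h1 with
        ⟨τ₁, τ₂, h1, h2, h3⟩ | ⟨τ₁, τ₂, z', q, h1, h4, h2, h3⟩
      · have h5 := arZ_fillZ z 0 0 cs (by omega)
        refine Or.inl ⟨.leaf (fillZ z 0 cs) :: τ₁, τ₂, ?_, ?_, fun c => ?_⟩
        · rw [slots, totalArity, h1, List.count_append, count_none_chunk]
          omega
        · rw [h0, h2]
          rfl
        · rw [List.append_assoc, h0, h3]
          rfl
      · have h5 := arZ_fillZ z 0 0 cs (by omega)
        refine Or.inr ⟨.leaf (fillZ z 0 cs) :: τ₁, τ₂, z', q, ?_, h4, ?_, fun c => ?_⟩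
        · rw [slots, totalArity, List.count_append, count_none_chunk]
          omega
        · rw [h0, h2]
          rfl
        · rw [List.append_assoc, h0, h3]
          rfl
    · cases v' with
      | nil =>
        rw [List.append_nil] at h1
        rcases ih (pre ++ chunk i cs) [] v (by simpa using h2.symm) with
          ⟨τ₁, τ₂, h3, h4, h5⟩ | ⟨τ₁, τ₂, z', q, h3, h6, h4, h5⟩
        · have h7 := arZ_fillZ z 0 0 cs (by omega)
          refine Or.inl ⟨.leaf (fillZ z 0 cs) :: τ₁, τ₂, ?_, ?_, fun c => ?_⟩
          · rw [slots, totalArity, h3, ← h1, count_none_chunk]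
            simp [h7]
          · rw [h0, h4]
            rfl
          · rw [← h1, h0]
            have := h5 c
            rw [List.nil_append] at this
            rw [this]
            rfl
        · have h7 := arZ_fillZ z 0 0 cs (by omega)
          refine Or.inr ⟨.leaf (fillZ z 0 cs) :: τ₁, τ₂, z', q, ?_, h6, ?_, fun c => ?_⟩
          · rw [slots, totalArity, ← h1, count_none_chunk]
            rw [List.count_nil] at h3
            omega
          · rw [h0, h4]
            rfl
          · rw [← h1, h0]
            have := h5 c
            rw [List.nil_append] at this
            rw [this]
            rfl
      | cons o v' =>
        rw [List.cons_append, List.cons.injEq] at h2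
        obtain ⟨rfl, h2⟩ := h2
        obtain ⟨cs₁, e, f, cs₂, rfl, h3, h4⟩ := exists_chunk_split h1
        rw [List.length_append, List.length_cons] at hcs
        have h5 := arZ_fillZ z 0 0 (cs₁ ++ (e + 1 + f) :: cs₂)
          (by rw [List.length_append, List.length_cons]; omega)
        rw [List.sum_append, List.sum_cons] at h5
        refine Or.inr ⟨[], tok ρ (pre ++ chunk i (cs₁ ++ (e + 1 + f) :: cs₂)) none w,
          fillZ z 0 (cs₁ ++ (e + 1 + f) :: cs₂), cs₁.sum + e, ?_, by omega, h0 pre w, fun c => ?_⟩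
        · simp [slots, totalArity, h3]
        · have h6 : u ++ (List.replicate c none ++ v) =
              chunk i (cs₁ ++ (e + c + f) :: cs₂) ++ w := by
            rw [h4, h2]
            simp
          have h7 : (cs₁ ++ (e + c + f) :: cs₂).length = P.arZ z := by
            rw [List.length_append, List.length_cons]
            omega
          rw [h6, tok_append, readState_chunk hz h7, tok_chunk_open hz h7,
            fillZ_refine z cs₁ cs₂ e f c (by omega)]
          rw [tok_congr (fun _ _ => rfl)
            (pre' := pre ++ chunk i (cs₁ ++ (e + 1 + f) :: cs₂)) (by simp [mem_chunk])]
          rfl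

end SetPair

namespace SetPair

open PairData (colour)

variable {P : SetPair.{w}} {ρ : ℕ → P.M ⊕ P.Z}

/-- The replacement of a bar with `c` bars is the right action of the element of `As` of
arity `c`. -/
theorem evalZ_bars {u v : Word} (h : Nested (fun i => colour (ρ i)) (u ++ none :: v)) (c : ℕ) :
    evalZ (tok ρ [] none (u ++ (List.replicate c none ++ v))) =
      P.ract (evalZ (tok ρ [] none (u ++ none :: v))) (u.count none) c := by
  have hd := depth_tok h
  rcases tok_bar_cases h.leafy.segmented [] u v rfl with
    ⟨τ₁, τ₂, h1, h2, h3⟩ | ⟨τ₁, τ₂, z, q, h1, h4, h2, h3⟩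
  · rw [h2] at hd
    have h5 := ar_evalM hd
    rw [slots_append, List.length_append, slots, List.length_cons] at h5
    obtain ⟨s, h6, h7⟩ := hd.split
    rw [h2, h3, evalZ, evalZ, evalM_insert h6 (bars_depth' c 0) (show Depth τ₂ s 0 from h7),
      evalM_bars, ← h1,
      slots_append, slots_append, slots_append, slots, slots_bars, P.ract_outer _ _ _ _ (by omega)]
  · rw [h2] at hd
    have h5 := ar_evalM hd
    rw [slots_append, List.length_append, slots, List.length_cons] at h5
    rw [h2, h3, evalZ, evalZ, evalM_leaf, evalM_leaf, ← h1, slots_append, slots_append, slots,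
      slots, P.ract_inner _ _ _ _ _ _ (by rw [← evalM_leaf _ _ z]; omega) h4]

theorem evalZ_fillWord_bars (v : Word) : ∀ (u : Word) (cs : List ℕ),
    Nested (fun i => colour (ρ i)) (u ++ v) → v.count none = cs.length →
      evalZ (tok ρ [] none (u ++ fillWord v (cs.map fun c => List.replicate c none))) =
        fillZ (evalZ (tok ρ [] none (u ++ v))) (u.count none) cs := by
  induction v with
  | nil =>
    intro u cs _ hc
    obtain rfl : cs = [] := by simpa using hc.symm
    rfl
  | cons o v ih =>
    intro u cs h hc
    cases o with
    | some i =>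
      have := ih (u ++ [some i]) cs (by simpa using h) (by simpa using hc)
      simpa [fillWord] using this
    | none =>
      cases cs with
      | nil => simp at hc
      | cons c cs =>
        have h1 : Nested (fun i => colour (ρ i)) (u ++ (List.replicate c none ++ v)) :=
          Nested.replace_bars (w := [none]) h rfl c
        have := ih (u ++ List.replicate c none) cs (by simpa using h1) (by simpa using hc)
        rw [List.append_assoc, List.append_assoc, evalZ_bars h] at this
        rw [List.map_cons, fillWord, fillZ, this]
        simp

open Function in
/-- A substitution into a closed letter `p`: the symbols of the composite arise from those of the
outer word when the operation that belongs to `p` is replaced with the symbols `τ` of the inner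
word, with the gaps of `p` in the place of the bars of `τ`. -/
theorem evals_subst_closed {p : ℕ} {a b y : Word} {gs : List Word}
    (hx : Nested (fun i => colour (update ρ p (.inl (evalM (tok ρ [] none y))) i))
      (a ++ (weave p gs ++ b)))
    (ha : some p ∉ a) (hgs : ∀ g ∈ gs, some p ∉ g) (hb : some p ∉ b)
    (hy : Nested (fun i => colour (ρ i)) y) (hyc : ∀ i, some i ∈ y → (colour (ρ i)).isOpen = false)
    (hn : y.count none = gs.length) (hd : DisjointLetters y (a ++ (weave p gs ++ b))) :
    ∃ τ₁ τ τ₂ gs' r, Depth τ₁ 0 r ∧ Depth τ 0 0 ∧ Depth τ₂ r 0 ∧ (∀ g ∈ gs', Depth g 0 0) ∧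
      gs'.length = (slots τ).length ∧
      tok ρ [] none (a ++ (fillWord y gs ++ b)) = τ₁ ++ (fill τ gs' ++ τ₂) ∧
      tok (update ρ p (.inl (evalM (tok ρ [] none y)))) [] none (a ++ (weave p gs ++ b)) =
        τ₁ ++ (.op (evalM τ) :: gaps gs' ++ τ₂) := by
  set t := evalM (tok ρ [] none y) with ht
  set ρ' := update ρ p (.inl t) with hρ'
  have e : ∀ {w : Word}, some p ∉ w → ∀ i, some i ∈ w → ρ' i = ρ i := fun hw i hi =>
    update_of_ne (by rintro rfl; exact hw hi) _ _
  have ec : ∀ {w : Word}, some p ∉ w → ∀ i, some i ∈ w → colour (ρ i) = colour (ρ' i) :=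
    fun hw i hi => by rw [e hw i hi]
  have hp : ρ' p = .inl t := update_self _ _ _
  have hpc : (colour (ρ' p)).isOpen = false := by rw [hp]; rfl
  have hpy : some p ∉ y := fun h => hd p h (by simp [mem_weave])
  -- the letters between two occurrences of `p`
  have hgap : ∀ gs₁ g gs₂, gs = gs₁ ++ g :: gs₂ → ∀ i, some i ∈ g →
      some i ∉ a ++ weave p gs₁ ∧ some i ∉ weave p gs₂ ++ b := by
    rintro gs₁ g gs₂ rfl i hi
    exact hx.gap_weave (hgs g (by simp)) hi
  have hga : ∀ g ∈ gs, DisjointLetters g a := by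
    intro g hg i hi hia
    obtain ⟨gs₁, gs₂, h⟩ := List.append_of_mem hg
    exact (hgap gs₁ g gs₂ h i hi).1 (by simp [hia])
  have hgb : ∀ g ∈ gs, DisjointLetters g b := by
    intro g hg i hi hib
    obtain ⟨gs₁, gs₂, h⟩ := List.append_of_mem hg
    exact (hgap gs₁ g gs₂ h i hi).2 (by simp [hib])
  have hgg : gs.Pairwise DisjointLetters := by
    rw [List.pairwise_iff_getElem]
    intro i j hi hj hij k hk hk'
    have h1 : gs = gs.take i ++ gs[i] :: gs.drop (i + 1) := by simp
    refine (hgap _ _ _ h1 k hk).2 (List.mem_append_left _ (mem_weave.2 (Or.inr ⟨gs[j], ?_, hk'⟩)))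
    exact List.mem_drop_iff_getElem.2 ⟨j - (i + 1), by omega, by congr 1; omega⟩
  have hgy : ∀ g ∈ gs, DisjointLetters g y := fun g hg i hi hiy =>
    hd i hiy (by simp [mem_weave]; exact Or.inr (Or.inl (Or.inr ⟨g, hg, hi⟩)))
  have hgn : ∀ g ∈ gs, Nested (fun i => colour (ρ i)) g := by
    intro g hg
    obtain ⟨gs₁, gs₂, rfl⟩ := List.append_of_mem hg
    rw [weave_append] at hx
    have h1 : Nested (fun i => colour (ρ' i)) g :=
      Nested.part (u := a ++ weave p gs₁) (v := weave p gs₂ ++ b) (by simpa using hx)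
        (fun i hi => (hgap _ _ _ rfl i hi).1) (fun i hi => (hgap _ _ _ rfl i hi).2)
    exact h1.congr (ec (hgs g hg))
  have hab : Nested (fun i => colour (ρ i)) (a ++ none :: b) := by
    have h1 : Nested (fun i => colour (ρ' i)) (a ++ b) := by
      refine hx.of_sublist (List.Sublist.append_left (List.sublist_append_right _ _) _) ?_
      intro i hi
      have h2 : some i ∉ weave p gs := by
        rw [mem_weave, not_or]
        refine ⟨fun h => ?_, ?_⟩
        · cases h
          simp [ha, hb] at hi
        · rintro ⟨g, hg, hig⟩
          rcases List.mem_append.1 hi with h | h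
          · exact hga g hg i hig h
          · exact hgb g hg i hig h
      rw [List.count_append, List.count_append, List.count_append, List.count_eq_zero.2 h2,
        zero_add]
    refine (h1.congr (ec (by simp [ha, hb]))).of_reduceOption ?_
    simp [List.reduceOption_append]
  have hla : Leafy (fun i => colour (ρ i)) a := by
    obtain ⟨v, hv⟩ := exists_weave_eq_cons p gs
    rw [hv] at hx
    have h1 := (Leafy.split (m := [some p]) (v := v ++ b) (p := p) hx.leafy (by simp) (by simp)
      (by simp [hpc])).1
    exact ⟨fun i ho hi => by rw [ec ha i hi] at ho ⊢; exact h1.count i ho hi,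
      fun i j hij hj hs => h1.leaf i j hij (by rw [← ec ha j (hs.subset (by simp))]; exact hj) hs⟩
  have hlg : ∀ g ∈ gs, Leafy (fun i => colour (ρ' i)) g := fun g hg =>
    ((hgn g hg).congr fun i hi => (ec (hgs g hg) i hi).symm).leafy
  have hla' : Leafy (fun i => colour (ρ' i)) a := by
    refine ⟨fun i ho hi => ?_, fun i j hij hj hs => hla.leaf i j hij ?_ hs⟩
    · rw [← ec ha i hi] at ho ⊢
      exact hla.count i ho hi
    · rw [ec ha j (hs.subset (by simp))]
      exact hj
  have hdab := depth_tok hab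
  have htb : tok ρ a none (none :: b) = .bar :: tok ρ a none b := by
    have := tok_bars (ρ := ρ) a 1 b
    simpa using this
  rw [tok_append_of_leafy hla, List.nil_append, htb] at hdab
  obtain ⟨r, h1, h2⟩ := hdab.split
  obtain ⟨h3, h4⟩ := tok_fillWord y gs a [] hyc hn (fun g hg => (hgn g hg).leafy) hgy hga hgg
    fun i hi => by simpa using fun hia => hd i hi (by simp [hia])
  refine ⟨tok ρ [] none a, tok ρ [] none y, tok ρ a none b, gs.map (tok ρ [] none), r, h1,
    depth_tok hy, h2, ?_, ?_, ?_, ?_⟩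
  · intro g hg
    obtain ⟨g', hg', rfl⟩ := List.mem_map.1 hg
    exact depth_tok (hgn g' hg')
  · rw [List.length_map, length_slots_tok hyc, hn]
  · rw [tok_append_of_leafy hla, List.nil_append, tok_append, h3, h4]
    congr 2
    refine tok_congr (fun _ _ => rfl) fun i hi => ?_
    rw [List.mem_append, or_iff_left]
    intro hif
    rcases mem_fillWord hif with h | ⟨g, hg, h⟩
    · exact hd i h (by simp [hi])
    · exact hgb g hg i h hi
  · rw [tok_append_of_leafy hla', List.nil_append, tok_weave hp ha hlg hgs hga hgg, ← ht]
    have h5 : gs.map (tok ρ' [] none) = gs.map (tok ρ [] none) :=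
      List.map_congr_left fun g hg => tok_congr (e (hgs g hg)) fun _ _ => Iff.rfl
    have h6 : tok ρ' (a ++ weave p gs) none b = tok ρ a none b := by
      refine tok_congr (e hb) fun i hi => ?_
      rw [List.mem_append, or_iff_left]
      rw [mem_weave, not_or]
      refine ⟨fun h => ?_, ?_⟩
      · cases h
        exact hb hi
      · rintro ⟨g, hg, hig⟩
        exact hgb g hg i hig hi
    rw [tok_congr (e ha) fun _ _ => Iff.rfl, h5, h6]

open Function in
/-- The evaluation of a composite is the evaluation of the outer word at the value of the inner
word. -/
theorem eval_subst_weave {p : ℕ} {a b y : Word} {gs : List Word} {c d : Colour}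
    (hy : Valid (fun i => colour (ρ i)) c y)
    (hx : Valid (fun i => colour (update ρ p (eval ρ c y) i)) d (a ++ (weave p gs ++ b)))
    (ha : some p ∉ a) (hgs : ∀ g ∈ gs, some p ∉ g) (hb : some p ∉ b)
    (hd : DisjointLetters y (a ++ (weave p gs ++ b))) :
    eval ρ d (a ++ (fillWord y gs ++ b)) =
      eval (update ρ p (eval ρ c y)) d (a ++ (weave p gs ++ b)) := by
  have hpx : some p ∈ a ++ (weave p gs ++ b) := by simp [mem_weave]
  have hcp := colour_eval hy
  have hn : y.count none = gs.length := by
    have h1 := hx.count p hpx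
    rw [List.count_append, List.count_append, List.count_eq_zero.2 ha, List.count_eq_zero.2 hb,
      count_weave_self hgs, update_self, hcp] at h1
    rw [hy.bars]
    omega
  cases hc : c.isOpen with
  | false =>
    have he : eval ρ c y = .inl (evalM (tok ρ [] none y)) := by simp [eval, hc]
    rw [he] at hx ⊢
    obtain ⟨τ₁, τ, τ₂, gs', r, h1, h2, h3, h4, h5, h6, h7⟩ :=
      evals_subst_closed hx.toNested ha hgs hb hy.toNested (hy.colour hc) hn hd
    have h8 : evalM (τ₁ ++ (fill τ gs' ++ τ₂)) = evalM (τ₁ ++ (.op (evalM τ) :: gaps gs' ++ τ₂)) :=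
      evalM_subst h1 h2 h3 gs' h4 h5
    rw [eval, eval, h6, h7, evalZ, evalZ, h8]
    congr 3
    simp only [slots_append, List.cons_append, slots, slots_fill _ _ h5, slots_gaps]
  | true =>
    have he : eval ρ c y = .inr (evalZ (tok ρ [] none y)) := by simp [eval, hc]
    rw [he] at hx ⊢
    set z := evalZ (tok ρ [] none y) with hz
    set ρ' := update ρ p (.inr z) with hρ'
    have e : ∀ {w : Word}, some p ∉ w → ∀ i, some i ∈ w → ρ' i = ρ i := fun hw i hi =>
      update_of_ne (by rintro rfl; exact hw hi) _ _
    have ec : ∀ {w : Word}, some p ∉ w → ∀ i, some i ∈ w → colour (ρ i) = colour (ρ' i) :=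
      fun hw i hi => by rw [e hw i hi]
    have hp : ρ' p = .inr z := update_self _ _ _
    have hpc : (colour (ρ' p)).isOpen = true := by rw [hp]; rfl
    have hdo : d.isOpen = true := by
      by_contra h
      have := hx.colour (by simpa using h) p hpx
      rw [hpc] at this
      cases this
    -- only bars lie between the occurrences of the open letter `p`
    obtain ⟨cs, rfl⟩ : ∃ cs : List ℕ, gs = cs.map fun c => List.replicate c none := by
      refine exists_map_replicate fun g hg i hi => ?_
      have h2 : i ≠ p := fun er => hgs g hg (er ▸ hi)
      obtain ⟨gs₁, gs₂, rfl⟩ := List.append_of_mem hg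
      refine hx.leaf i p h2 hpc ?_
      obtain ⟨u, hu⟩ := exists_weave_eq_append p gs₁
      obtain ⟨v, hv⟩ := exists_weave_eq_cons p gs₂
      rw [weave_append, hu, hv]
      have h3 : [some p, some i, some p].Sublist ([some p] ++ (g ++ [some p])) :=
        List.Sublist.cons_cons _ ((List.singleton_sublist.2 hi).append (List.Sublist.refl _))
      refine h3.trans ?_
      refine List.Sublist.trans ?_ (List.sublist_append_right a _)
      rw [List.append_assoc, List.append_assoc]
      refine List.Sublist.trans ?_ (List.sublist_append_right u _)
      simp
    rw [List.length_map] at hn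
    change Valid _ _ (a ++ (chunk p cs ++ b)) at hx
    change DisjointLetters y (a ++ (chunk p cs ++ b)) at hd
    have hcs : cs.length = P.arZ z := by
      rw [← hn, hy.bars, ← hcp, he]
      rfl
    have hab : Nested (fun i => colour (ρ i)) (a ++ ([none] ++ b)) :=
      (hx.remove_chunk ha hb [none] rfl).congr (ec (by simp [ha, hb]))
    have hla' := (hx.leafy.split (p := p) (by simp [mem_chunk]) (fun i => mem_chunk.1)
      (fun _ => ⟨ha, hb⟩)).1
    have hla : Leafy (fun i => colour (ρ i)) a :=
      ⟨fun i ho hi => by rw [ec ha i hi] at ho ⊢; exact hla'.count i ho hi,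
        fun i j hij hj hs => hla'.leaf i j hij (by rw [← ec ha j (hs.subset (by simp))]; exact hj)
          hs⟩
    have hF : Nested (fun i => colour (ρ i))
        (fillWord y (cs.map fun c => List.replicate c none)) :=
      hy.toNested.of_reduceOption (reduceOption_fillWord_bars y cs)
    have hFy : ∀ i, some i ∈ fillWord y (cs.map fun c => List.replicate c none) → some i ∈ y := by
      intro i hi
      rcases mem_fillWord hi with h | ⟨g, hg, h⟩
      · exact h
      · obtain ⟨c, _, rfl⟩ := List.mem_map.1 hg
        simp [List.mem_replicate] at h
    have hdab := depth_tok hab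
    have htb : tok ρ a none ([none] ++ b) = .bar :: tok ρ a none b := by
      have := tok_bars (ρ := ρ) a 1 b
      simpa using this
    rw [tok_append_of_leafy hla, List.nil_append, htb] at hdab
    obtain ⟨r, h1, h2⟩ := hdab.split
    have h3 : evalZ (tok ρ [] none (fillWord y (cs.map fun c => List.replicate c none))) =
        fillZ z 0 cs := evalZ_fillWord_bars y [] cs hy.toNested hn
    have h4 : tok ρ (a ++ fillWord y (cs.map fun c => List.replicate c none)) none b =
        tok ρ a none b := tok_congr (fun _ _ => rfl) fun i hi => by
      rw [List.mem_append, or_iff_left]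
      exact fun hif => hd i (hFy i hif) (by simp [hi])
    have h5 : tok ρ' (a ++ chunk p cs) none b = tok ρ a none b := tok_congr (e hb) fun i hi => by
      rw [List.mem_append, or_iff_left]
      exact fun hif => hb (mem_chunk.1 hif ▸ hi)
    -- the part of the composite that comes from `y` is complete, and denotes `z` with the bars of
    -- the chunk of `p` inserted
    have h6 : evalZ (tok ρ [] none (a ++ (fillWord y (cs.map fun c => List.replicate c none) ++ b)))
        = evalZ (tok ρ' [] none (a ++ (chunk p cs ++ b))) := by
      rw [tok_append_of_leafy hla, tok_append_of_leafy hF.leafy, tok_append_of_leafy hla',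
        List.nil_append, h4, tok_append, readState_chunk hp hcs, tok_chunk_open hp hcs, h5,
        tok_eq_of_disjoint none fun i hi hia => hd i (hFy i hi) (by simp [hia]),
        evalZ_insert h1 (depth_tok hF) (show Depth (tok ρ a none b) r 0 from h2), h3,
        tok_congr (e ha) fun _ _ => Iff.rfl]
      rfl
    simp only [eval, hdo, if_true, h6]
    rfl

open Function in
/-- The evaluation of words in a pair respects the composition of the operad. -/
theorem eval_substLetter {p : ℕ} {x y : Word} {c d : Colour}
    (hy : Valid (fun i => colour (ρ i)) c y)
    (hx : Valid (fun i => colour (update ρ p (eval ρ c y) i)) d x) (hp : some p ∈ x)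
    (hd : DisjointLetters y x) :
    eval ρ d (substLetter p x y) = eval (update ρ p (eval ρ c y)) d x := by
  have h := hx.count p hp
  obtain ⟨a, gs, b, rfl, hn, ha, hgs, hb⟩ := exists_weave h
  rw [update_self, colour_eval hy] at hn
  rw [substLetter_weave ha hgs hb (by rw [hy.bars, hn]), eval_subst_weave hy hx ha hgs hb hd]

end SetPair

/-! ### The words of the generators -/

/-- The letters of a word. -/
def letters (w : Word) : List ℕ := w.reduceOption.dedup

theorem mem_letters {w : Word} (i : ℕ) : some i ∈ w ↔ i ∈ letters w := by
  rw [letters, List.mem_dedup, mem_reduceOption]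

theorem nodup_letters (w : Word) : (letters w).Nodup := List.nodup_dedup _

/-- The substitution of a word for a letter, in terms of the numbering of the letters. -/
theorem renameWord_substLetter {p : ℕ} {x y : Word} {Q N N' : List ℕ}
    (hy : ∀ i, some i ∈ y ↔ i ∈ N') (hd : DisjointLetters y x) (hp : p ∉ Q)
    (hQ : ∀ i ∈ N', i ∉ Q) :
    renameWord (Q ++ (N' ++ N)).idxOf (substLetter p x y) =
      substWord Q.length N'.length (renameWord (Q ++ p :: N).idxOf x) (renameWord N'.idxOf y) := by
  rw [substLetter, renameWord_graftWith, substWord, graft_eq_graftWith, blocks_renameWord,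
    graftWith_rename (p' := p)]
  · refine graftWith_congr x _ (fun j hj hjp => ?_) fun b hb k hk => ?_
    · have h1 : j ∉ N' := fun h => hd j ((hy j).2 h) hj
      simp only [Function.comp_apply, List.idxOf_append, id_eq, if_neg h1]
      split_ifs with hjQ
      · simp [shiftOuter, List.idxOf_lt_length_of_mem hjQ]
      · rw [List.idxOf_cons_ne _ (Ne.symm hjp)]
        simp only [shiftOuter]
        split_ifs <;> omega
    · have h1 : k ∈ N' := (hy k).1 (mem_of_mem_blocks hb hk)
      simp only [Function.comp_apply, List.idxOf_append, id_eq, if_pos h1, if_neg (hQ k h1)]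
  · intro j hj
    rw [List.idxOf_append]
    split_ifs with hjQ
    · have := List.idxOf_lt_length_of_mem hjQ
      exact ⟨fun h => by omega, fun h => absurd (h ▸ hjQ) hp⟩
    · by_cases h : j = p
      · simp [h]
      · rw [List.idxOf_cons_ne _ (Ne.symm h)]
        simp [h]

theorem renameWord_substLetter_head {p : ℕ} {x y : Word} {N N' : List ℕ}
    (hy : ∀ i, some i ∈ y ↔ i ∈ N') (hd : DisjointLetters y x) :
    renameWord (N' ++ N).idxOf (substLetter p x y) =
      substWord 0 N'.length (renameWord (p :: N).idxOf x) (renameWord N'.idxOf y) :=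
  renameWord_substLetter (Q := []) hy hd (by simp) (by simp)

theorem nodup_cons_erase {p : ℕ} {x : Word} (hp : some p ∈ x) :
    (p :: (letters x).erase p).Nodup ∧ ∀ i, some i ∈ x ↔ i ∈ p :: (letters x).erase p := by
  have hperm := List.perm_cons_erase ((mem_letters p).1 hp)
  exact ⟨hperm.nodup_iff.1 (nodup_letters x), fun i => by rw [mem_letters, hperm.mem_iff]⟩

theorem letters_substLetter {p : ℕ} {x y : Word} {n : ℕ} (hx : x.count (some p) = n + 1)
    (hy : y.count none = n) (i : ℕ) :
    some i ∈ substLetter p x y ↔ (some i ∈ x ∧ i ≠ p) ∨ some i ∈ y := by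
  obtain ⟨a, gs, b, rfl, hn, ha, hgs, hb⟩ := exists_weave hx
  have hf : ∀ (y : Word) (gs : List Word), y.count none = gs.length →
      (some i ∈ fillWord y gs ↔ some i ∈ y ∨ ∃ g ∈ gs, some i ∈ g) := by
    intro y
    induction y with
    | nil =>
      intro gs h
      obtain rfl : gs = [] := by simpa using h.symm
      simp [fillWord]
    | cons o y ih =>
      intro gs h
      cases o with
      | some k =>
        rw [fillWord, List.mem_cons, ih gs (by simpa using h), List.mem_cons, or_assoc]
      | none =>
        cases gs with
        | nil => simp at h
        | cons g gs =>
          rw [fillWord, List.mem_append, ih gs (by simpa using h)]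
          simp only [List.mem_cons, exists_eq_or_imp, reduceCtorEq, false_or]
          tauto
  rw [substLetter_weave ha hgs hb (by rw [hy, hn]), List.mem_append, List.mem_append,
    hf y gs (by rw [hy, hn]), List.mem_append, List.mem_append, mem_weave]
  have h1 : some i ∈ a → i ≠ p := fun h e => ha (e ▸ h)
  have h2 : some i ∈ b → i ≠ p := fun h e => hb (e ▸ h)
  have h3 : (∃ g ∈ gs, some i ∈ g) → i ≠ p := fun ⟨g, hg, h⟩ e => hgs g hg (e ▸ h)
  rw [Option.some.injEq]
  generalize (∃ g ∈ gs, some i ∈ g) = G at h3 ⊢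
  by_cases hi : i = p
  · subst hi
    tauto
  · tauto

theorem Valid.substLetter {col : ℕ → Colour} {p : ℕ} {x y : Word} {c d : Colour}
    (hx : Valid col d x) (hy : Valid col c y) (hc : col p = c) (hp : some p ∈ x)
    (hd : DisjointLetters y x) : Valid col d (substLetter p x y) := by
  obtain ⟨h1, h2⟩ := nodup_cons_erase hp
  have h3 := (valid_iff_isRLStage h2 h1).2 hx
  have h4 := (valid_iff_isRLStage mem_letters (nodup_letters y)).2 hy
  rw [List.map_cons, hc] at h3
  have h5 := IsRLStage.subst (pre := []) h3 h4
  rw [List.nil_append, ← List.map_append, List.length_nil, List.length_map,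
    ← renameWord_substLetter_head mem_letters hd] at h5
  refine (valid_iff_isRLStage ?_ ?_).1 h5
  · intro i
    rw [letters_substLetter (n := c.arity) (by rw [hx.count p hp, hc]) hy.bars, List.mem_append,
      ← mem_letters, h2, List.mem_cons]
    have h6 : i ∈ (letters x).erase p → i ≠ p := fun h e => (List.nodup_cons.1 h1).1 (e ▸ h)
    tauto
  · rw [List.nodup_append]
    refine ⟨nodup_letters y, (List.nodup_cons.1 h1).2, fun i hi j hj e => ?_⟩
    subst e
    exact hd i ((mem_letters i).2 hi) ((mem_letters i).2 (List.mem_of_mem_erase hj))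

/-- The word `i|i|⋯|i` with `n` bars. -/
abbrev corolla (i n : ℕ) : Word := chunk i (List.replicate n 1)

theorem count_none_corolla (i n : ℕ) : (corolla i n).count none = n := by
  rw [count_none_chunk]
  simp

theorem corolla_eq_weave (i n : ℕ) : corolla i n = weave i (List.replicate n [none]) := by
  simp [corolla, chunk]

theorem corolla_add (i p q : ℕ) :
    corolla i (p + 1 + q) = corolla i p ++ none :: corolla i q := by
  rw [corolla_eq_weave, corolla_eq_weave, corolla_eq_weave, add_assoc, add_comm 1 q,
    List.replicate_add, List.replicate_succ, weave_append]
  rfl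

theorem fillWord_weave_bars (i : ℕ) (gs : List Word) :
    fillWord (weave i (List.replicate gs.length [none])) gs = weave i gs := by
  induction gs with
  | nil => rfl
  | cons g gs ih =>
    rw [List.length_cons, List.replicate_succ, weave, weave, fillWord, List.singleton_append,
      fillWord, ih]

theorem fillWord_corolla (i : ℕ) (gs : List Word) :
    fillWord (corolla i gs.length) gs = weave i gs := by
  rw [corolla_eq_weave, fillWord_weave_bars]

theorem fillWord_corolla_bars (i : ℕ) (cs : List ℕ) :
    fillWord (corolla i cs.length) (cs.map fun c => List.replicate c none) = chunk i cs := by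
  have := fillWord_corolla i (cs.map fun c => List.replicate c none)
  rwa [List.length_map] at this

/-- The word of a partial composition: `j` is inserted into the input of `i` with `p` inputs on its
left and `q` inputs on its right. -/
abbrev compWord (i j p q l : ℕ) : Word := corolla i p ++ (corolla j l ++ corolla i q)

/-- The word of a right action of `As`. -/
abbrev ractWord (i p q l : ℕ) : Word := corolla i p ++ (List.replicate l none ++ corolla i q)

/-- An input of a wide action: a bar, or an inserted letter. -/
def slotWord (col : ℕ → Colour) : Option ℕ → Word
  | none => [none]
  | some j => corolla j (col j).arity

/-- The word of a wide action. -/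
abbrev actWord (col : ℕ → Colour) (i : ℕ) (s : List (Option ℕ)) : Word :=
  weave i (s.map (slotWord col))

theorem mem_slotWord {col : ℕ → Colour} {s : List (Option ℕ)} {k : ℕ} :
    (∃ g ∈ s.map (slotWord col), some k ∈ g) ↔ some k ∈ s := by
  simp only [List.mem_map, exists_exists_and_eq_and]
  constructor
  · rintro ⟨o, ho, h⟩
    cases o with
    | none => simp [slotWord] at h
    | some j =>
      rw [slotWord, mem_chunk] at h
      rwa [h]
  · exact fun h => ⟨some k, h, by rw [slotWord, mem_chunk]⟩

theorem mem_actWord {col : ℕ → Colour} {i : ℕ} {s : List (Option ℕ)} {k : ℕ} :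
    some k ∈ actWord col i s ↔ k = i ∨ some k ∈ s := by
  rw [mem_weave, mem_slotWord, Option.some.injEq]

theorem valid_bars (col : ℕ → Colour) (n : ℕ) :
    Valid col (.closed n) (List.replicate n none) :=
  ⟨nested_of_no_letters (by simp [List.mem_replicate]), by simp [Colour.arity],
    fun _ i hi => by simp [List.mem_replicate] at hi⟩

theorem nested_chunk {col : ℕ → Colour} {i : ℕ} {cs : List ℕ} (h : cs.length = (col i).arity) :
    Nested col (chunk i cs) := by
  have h1 : Nested col ([] ++ ([] ++ [])) := nested_of_no_letters (by simp)
  simpa using h1.insert_chunk (r := i) (cs := cs) rfl (by simp) (by simp) h (by simp)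

theorem valid_corolla {col : ℕ → Colour} {i : ℕ} {d : Colour} (h : (col i).arity = d.arity)
    (hd : d.isOpen = false → (col i).isOpen = false) : Valid col d (corolla i d.arity) :=
  ⟨nested_chunk (by simp [h]), count_none_corolla _ _, fun ho k hk => by
    rw [mem_chunk.1 hk]
    exact hd ho⟩

theorem valid_compWord {col : ℕ → Colour} {i j p q l : ℕ} (hij : i ≠ j)
    (hi : col i = .closed (p + 1 + q)) (hj : col j = .closed l) :
    Valid col (.closed (p + l + q)) (compWord i j p q l) := by
  have h1 : Nested col (corolla i p ++ ([none] ++ corolla i q)) := by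
    have := nested_chunk (col := col) (i := i) (cs := List.replicate (p + 1 + q) 1)
      (by simp [hi, Colour.arity])
    rwa [show chunk i (List.replicate (p + 1 + q) 1) = _ from corolla_add i p q] at this
  refine ⟨h1.insert_chunk rfl ?_ ?_ (by simp [hj, Colour.arity]) ?_, ?_, ?_⟩
  · simpa [mem_chunk] using hij.symm
  · simpa [mem_chunk] using hij.symm
  · intro k hk hk'
    rw [mem_chunk.1 hk', hi] at hk
    cases hk
  · simp only [List.count_append, count_none_corolla, Colour.arity]
    omega
  · intro _ k hk
    simp only [List.mem_append, mem_chunk] at hk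
    rcases hk with rfl | rfl | rfl
    · rw [hi]; rfl
    · rw [hj]; rfl
    · rw [hi]; rfl

theorem valid_ractWord {col : ℕ → Colour} {i p q l : ℕ} (hi : col i = .opened (p + 1 + q)) :
    Valid col (.opened (p + l + q)) (ractWord i p q l) := by
  have h1 := nested_chunk (col := col) (i := i) (cs := List.replicate (p + 1 + q) 1)
      (by simp [hi, Colour.arity])
  refine ⟨h1.of_reduceOption ?_, ?_, fun h => by cases h⟩
  · rw [show chunk i (List.replicate (p + 1 + q) 1) = _ from corolla_add i p q]
    simp [List.reduceOption_append]
  · simp only [List.count_append, count_none_corolla, Colour.arity, List.count_replicate_self]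
    omega

theorem count_none_weave (i : ℕ) (gs : List Word) :
    (weave i gs).count none = (gs.map (List.count none)).sum := by
  induction gs with
  | nil => simp [weave]
  | cons g gs ih => simp [weave, ih]

theorem valid_actWord {col : ℕ → Colour} {i : ℕ} {s : List (Option ℕ)} {n : ℕ}
    (hi : col i = .closed s.length) (his : some i ∉ s) (hs : s.reduceOption.Nodup)
    (hn : (actWord col i s).count none = n) : Valid col (.opened n) (actWord col i s) := by
  have key : ∀ (s : List (Option ℕ)) (a : Word), some i ∉ s → s.reduceOption.Nodup →
      (∀ j, some j ∈ s → some j ∉ a) → Nested col (a ++ corolla i s.length) →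
        Nested col (a ++ weave i (s.map (slotWord col))) := by
    intro s
    induction s with
    | nil => exact fun _ _ _ _ h => h
    | cons o s ih =>
      intro a h1 h2 h3 h4
      have e : a ++ corolla i (o :: s).length =
          (a ++ [some i]) ++ ([none] ++ corolla i s.length) := by
        rw [List.length_cons, corolla_eq_weave, List.replicate_succ, weave, corolla_eq_weave]
        simp
      rw [e] at h4
      rw [List.map_cons, weave]
      have h5 := ih ((a ++ [some i]) ++ slotWord col o) (fun h => h1 (by simp [h]))
      cases o with
      | none =>
        have := h5 (by simpa using h2) (fun j hj => by
          have h6 : j ≠ i := by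
            rintro rfl
            exact h1 (by simp [hj])
          simp [slotWord, h3 j (by simp [hj]), h6]) (by simpa [slotWord] using h4)
        simpa using this
      | some j =>
        rw [List.reduceOption_cons_of_some, List.nodup_cons, mem_reduceOption] at h2
        have hji : j ≠ i := by
          rintro rfl
          exact h1 (by simp)
        have := h5 h2.2 (fun k hk => by
          have h6 : k ≠ i := by
            rintro rfl
            exact h1 (by simp [hk])
          have h7 : k ≠ j := by
            rintro rfl
            exact h2.1 hk
          simp [slotWord, h3 k (by simp [hk]), h6, h7, mem_chunk]) (by
          rw [List.append_assoc]
          refine h4.insert_chunk rfl ?_ (by simpa [mem_chunk] using hji) (by simp) ?_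
          · simp [h3 j (by simp), hji]
          · intro k hk _ hk'
            have hii : (col i).isOpen = true := mem_chunk.1 hk' ▸ hk
            rw [hi] at hii
            cases hii)
        simpa using this
  refine ⟨?_, hn, fun h => by cases h⟩
  exact key s [] his hs (by simp) (nested_chunk (by simp [hi, Colour.arity]))

/-! ### Generation of the operad by the words of the generators -/

/-- The words that are obtained by substitution from the words of the multiplication, the partial
compositions, the wide actions and the right actions. -/
inductive Generated : (ℕ → Colour) → Colour → Word → Prop
  | congr {col col' : ℕ → Colour} {d : Colour} {w : Word} : Generated col d w →
      (∀ i, some i ∈ w → col' i = col i) → Generated col' d w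
  | subst {col : ℕ → Colour} {d : Colour} {p : ℕ} {x y : Word} : Generated col d x →
      Generated col (col p) y → some p ∈ x → DisjointLetters y x →
        Generated col d (substLetter p x y)
  | mu (col : ℕ → Colour) (n : ℕ) : Generated col (.closed n) (List.replicate n none)
  | comp {col : ℕ → Colour} {i j p q l : ℕ} : i ≠ j → col i = .closed (p + 1 + q) →
      col j = .closed l → Generated col (.closed (p + l + q)) (compWord i j p q l)
  | act {col : ℕ → Colour} {i : ℕ} {s : List (Option ℕ)} {n : ℕ} : col i = .closed s.length →
      some i ∉ s → s.reduceOption.Nodup → (∀ j, some j ∈ s → (col j).isOpen = true) →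
        (actWord col i s).count none = n → Generated col (.opened n) (actWord col i s)
  | ract {col : ℕ → Colour} {i p q l : ℕ} : col i = .opened (p + 1 + q) →
      Generated col (.opened (p + l + q)) (ractWord i p q l)

theorem Generated.valid {col : ℕ → Colour} {d : Colour} {w : Word} (h : Generated col d w) :
    Valid col d w := by
  induction h with
  | congr _ h ih => exact ih.congr h
  | subst _ _ hp hd ih₁ ih₂ => exact ih₁.substLetter ih₂ rfl hp hd
  | mu col n => exact valid_bars col n
  | comp hij hi hj => exact valid_compWord hij hi hj
  | act hi his hs _ hn => exact valid_actWord hi his hs hn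
  | ract hi => exact valid_ractWord hi

theorem Colour.ext_arity {c d : Colour} (h : c.isOpen = d.isOpen) (h' : c.arity = d.arity) :
    c = d := by
  cases c <;> cases d <;> simp_all [isOpen, arity]

theorem Generated.of_isOpen {col : ℕ → Colour} {d d' : Colour} {w : Word}
    (h : Generated col d w) (ho : d'.isOpen = d.isOpen) (ha : w.count none = d'.arity) :
    Generated col d' w := by
  rwa [Colour.ext_arity ho (ha.symm.trans h.valid.bars)]

theorem exists_fresh (w : Word) : ∃ k, some k ∉ w := by
  obtain ⟨k, hk⟩ := Infinite.exists_notMem_finset w.reduceOption.toFinset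
  exact ⟨k, fun h => hk (List.mem_toFinset.2 (mem_reduceOption.2 h))⟩

open Function in
/-- Substitution into a letter that occurs neither in the inner word nor in the gaps of the outer
word. -/
theorem Generated.subst_weave {col : ℕ → Colour} {k : ℕ} {c d : Colour} {y : Word}
    {gs : List Word} (hx : Generated (update col k c) d (weave k gs)) (hy : Generated col c y)
    (hky : some k ∉ y) (hkg : ∀ g ∈ gs, some k ∉ g) (hl : gs.length = c.arity)
    (hd : ∀ g ∈ gs, DisjointLetters y g) : Generated col d (fillWord y gs) := by
  have hne : ∀ {w : Word}, some k ∉ w → ∀ i, some i ∈ w → i ≠ k := by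
    rintro w h i hi rfl
    exact h hi
  have h1 : Generated (update col k c) (update col k c k) y := by
    rw [update_self]
    exact hy.congr fun i hi => update_of_ne (hne hky i hi) _ _
  have h2 := hx.subst h1 (by simp [mem_weave]) fun i hi hi' => by
    rw [mem_weave, Option.some.injEq] at hi'
    rcases hi' with rfl | ⟨g, hg, hi'⟩
    · exact hky hi
    · exact hd g hg i hi hi'
  have h3 := substLetter_weave (a := []) (b := []) (p := k) (by simp) hkg (by simp)
    (hy.valid.bars.trans hl.symm)
  simp only [List.nil_append, List.append_nil] at h3
  rw [h3] at h2
  refine h2.congr fun i hi => (update_of_ne (hne ?_ i hi) _ _).symm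
  intro h
  rcases mem_fillWord h with h | ⟨g, hg, h⟩
  · exact hky h
  · exact hkg g hg h

theorem weave_bars_insert (k p q : ℕ) (g : Word) :
    weave k (List.replicate p [none] ++ g :: List.replicate q [none]) =
      corolla k p ++ (g ++ corolla k q) := by
  rw [weave_append, corolla_eq_weave, corolla_eq_weave]

theorem forall_bars_insert {Q : Word → Prop} {p q : ℕ} {g : Word} (h : Q [none]) (hg : Q g) :
    ∀ g' ∈ List.replicate p [none] ++ g :: List.replicate q [none], Q g' := by
  intro g' hg'
  simp only [List.mem_append, List.mem_replicate, List.mem_cons] at hg'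
  rcases hg' with ⟨_, rfl⟩ | rfl | ⟨_, rfl⟩ <;> assumption

open Function in
/-- The insertion of a new closed letter into a bar is a partial composition. -/
theorem Generated.insert_corolla {col : ℕ → Colour} {u v : Word} {r l n : ℕ}
    (h : Generated col (.closed n) (u ++ none :: v)) (hr : col r = .closed l)
    (hu : some r ∉ u) (hv : some r ∉ v) :
    ∃ m, Generated col (.closed m) (u ++ (corolla r l ++ v)) := by
  obtain ⟨k, hk⟩ := exists_fresh (u ++ (some r :: v))
  simp only [List.mem_append, List.mem_cons, Option.some.injEq, not_or] at hk
  have hn := h.valid.bars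
  have hd : DisjointLetters (u ++ none :: v) (corolla r l) := by
    intro i hi hi'
    rw [mem_chunk.1 hi'] at hi
    simp [hu, hv] at hi
  refine ⟨u.count none + l + v.count none, ?_⟩
  rw [← fillWord_single (corolla r l) rfl rfl]
  refine Generated.subst_weave (k := k) (c := .closed n) ?_ h ?_ ?_ ?_ ?_
  · rw [weave_bars_insert]
    refine Generated.comp hk.2.1 ?_ ?_
    · rw [update_self]
      rw [List.count_append, List.count_cons_self] at hn
      rw [show n = _ from hn.symm]
      congr 1
      omega
    · rw [update_of_ne (Ne.symm hk.2.1), hr]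
  · simp [hk.1, hk.2.2]
  · exact forall_bars_insert (by simp) (by simpa [mem_chunk] using hk.2.1)
  · rw [← show _ = (Colour.closed n).arity from hn]
    simp
  · exact forall_bars_insert (fun i _ => by simp) hd

open Function in
/-- A bar may be replaced with `c` bars: by the insertion of the multiplication if the output is
closed, and by the right action if it is open. -/
theorem Generated.replace_bar {col : ℕ → Colour} {d : Colour} {u v : Word}
    (h : Generated col d (u ++ none :: v)) (c : ℕ) :
    ∃ d' : Colour, d'.isOpen = d.isOpen ∧ Generated col d' (u ++ (List.replicate c none ++ v)) := by
  have hn := h.valid.bars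
  rw [List.count_append, List.count_cons_self] at hn
  obtain ⟨k, hk⟩ := exists_fresh (u ++ none :: v)
  cases d with
  | closed n =>
    have hk' := hk
    simp only [List.mem_append, List.mem_cons, not_or] at hk'
    have h1 : Generated (update col k (.closed c)) (.closed n) (u ++ none :: v) :=
      h.congr fun i hi => update_of_ne (by
        rintro rfl
        exact hk hi) _ _
    obtain ⟨m, h2⟩ := h1.insert_corolla (update_self k (.closed c) col) hk'.1 hk'.2.2
    have h3 : Generated (update col k (.closed c)) (update col k (.closed c) k)
        (List.replicate c none) := by
      rw [update_self]
      exact Generated.mu _ c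
    have h4 := h2.subst h3 (by simp [mem_chunk]) fun i hi => by simp [List.mem_replicate] at hi
    rw [corolla_eq_weave, substLetter_weave hk'.1 (by simp [List.mem_replicate]) hk'.2.2
      (by simp)] at h4
    have h5 := fillWord_bars (List.replicate c none)
    rw [List.count_replicate_self] at h5
    rw [h5] at h4
    refine ⟨.closed m, rfl, h4.congr fun i hi => (update_of_ne ?_ _ _).symm⟩
    rintro rfl
    simp [hk'.1, hk'.2.2, List.mem_replicate] at hi
  | opened n =>
    refine ⟨.opened (u.count none + c + v.count none), rfl, ?_⟩
    rw [← fillWord_single (List.replicate c none) rfl rfl]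
    refine Generated.subst_weave (k := k) (c := .opened n) ?_ h hk ?_ ?_ ?_
    · rw [weave_bars_insert]
      refine Generated.ract ?_
      rw [update_self, show n = _ from hn.symm]
      congr 1
      omega
    · exact forall_bars_insert (by simp) (by simp [List.mem_replicate])
    · rw [← show _ = (Colour.opened n).arity from hn]
      simp
    · exact forall_bars_insert (fun i _ => by simp) (fun i _ => by simp [List.mem_replicate])

theorem Generated.replace_bars {col : ℕ → Colour} (v : Word) : ∀ (u b : Word) (cs : List ℕ)
    {d : Colour}, Generated col d (u ++ (v ++ b)) → v.count none = cs.length →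
    ∃ d' : Colour, d'.isOpen = d.isOpen ∧ Generated col d'
      (u ++ (fillWord v (cs.map fun c => List.replicate c none) ++ b)) := by
  induction v with
  | nil => exact fun u b cs d h _ => ⟨d, rfl, h⟩
  | cons o v ih =>
    intro u b cs d h hl
    cases o with
    | some i =>
      have := ih (u ++ [some i]) b cs (by simpa using h) (by simpa using hl)
      simpa [fillWord] using this
    | none =>
      cases cs with
      | nil => simp at hl
      | cons c cs =>
        obtain ⟨d₁, e₁, h₁⟩ := Generated.replace_bar (by simpa using h) c
        obtain ⟨d₂, e₂, h₂⟩ := ih (u ++ List.replicate c none) b cs (by simpa using h₁)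
          (by simpa using hl)
        exact ⟨d₂, e₂.trans e₁, by simpa [fillWord] using h₂⟩

/-- A word with closed letters is put together from its letters by partial compositions: a letter
with only bars between its occurrences is inserted into a bar of the word without that letter, and
then the bars are replaced with lists of bars. -/
theorem Valid.generated_closed {col : ℕ → Colour} {n : ℕ} {w : Word}
    (h : Valid col (.closed n) w) : Generated col (.closed n) w := by
  induction hk : w.reduceOption.length using Nat.strong_induction_on generalizing n w with
  | _ k ih =>
    by_cases hl : ∃ i, some i ∈ w
    · obtain ⟨a, r, cs, b, rfl, ha, hb, hcs⟩ := h.toNested.exists_chunk hl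
      have hr : col r = .closed cs.length := by
        refine Colour.ext_arity (h.colour rfl r (by simp [mem_chunk])) hcs.symm
      have h1 : Valid col (.closed ((a ++ ([none] ++ b)).count none)) (a ++ ([none] ++ b)) :=
        ⟨h.toNested.remove_chunk ha hb [none] rfl, rfl, fun _ i hi => h.colour rfl i (by
          simp only [List.mem_append, List.mem_singleton, reduceCtorEq, false_or] at hi ⊢
          tauto)⟩
      have h2 := ih _ (by
        rw [← hk]
        simp [List.reduceOption_append, reduceOption_chunk]) h1 rfl
      obtain ⟨m, h3⟩ := Generated.insert_corolla h2 hr ha hb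
      obtain ⟨d, hd, h4⟩ := h3.replace_bars (corolla r cs.length) a b cs
        (count_none_corolla _ _)
      rw [fillWord_corolla_bars] at h4
      exact h4.of_isOpen hd.symm h.bars
    · obtain ⟨c, rfl⟩ := eq_replicate_none (not_exists.1 hl)
      have := h.bars
      rw [List.count_replicate_self] at this
      obtain rfl : c = n := this
      exact Generated.mu col c

/-- A word of disks and half-disks is built from the word `w'` of its disks: letters for half-disks
are put into some of the bars of `w'`, and then the bars are replaced with lists of bars. -/
theorem Segmented.exists_fillWord {col : ℕ → Colour} {w : Word} (h : Segmented col w) :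
    ∃ (w' : Word) (s : List (Option ℕ)) (cs : List ℕ),
      w = fillWord (fillWord w' (s.map (slotWord col))) (cs.map fun c => List.replicate c none) ∧
      w'.count none = s.length ∧
      (fillWord w' (s.map (slotWord col))).count none = cs.length ∧
      w'.reduceOption = w.reduceOption.filter (fun i => !(col i).isOpen) ∧
      (∀ j, some j ∈ s → (col j).isOpen = true ∧ some j ∈ w) ∧ s.reduceOption.Nodup := by
  induction h with
  | nil => exact ⟨[], [], [], by simp [fillWord]⟩
  | @bar w _ ih =>
    obtain ⟨w', s, cs, h1, h2, h3, h4, h5, h6⟩ := ih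
    refine ⟨none :: w', none :: s, 1 :: cs, ?_, by simpa using h2, ?_, by simpa using h4, ?_, ?_⟩
    · simpa [slotWord, fillWord] using h1
    · simpa [slotWord, fillWord] using h3
    · simpa using h5
    · simpa using h6
  | @letter w i hi _ ih =>
    obtain ⟨w', s, cs, h1, h2, h3, h4, h5, h6⟩ := ih
    refine ⟨some i :: w', s, cs, ?_, by simpa using h2, ?_, ?_, ?_, h6⟩
    · simpa [fillWord] using h1
    · simpa [fillWord] using h3
    · simpa [hi] using h4
    · exact fun j hj => ⟨(h5 j hj).1, by simp [(h5 j hj).2]⟩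
  | @chunk w i cs₀ hi hcs hiw _ ih =>
    obtain ⟨w', s, cs, h1, h2, h3, h4, h5, h6⟩ := ih
    refine ⟨none :: w', some i :: s, cs₀ ++ cs, ?_, by simpa using h2, ?_, ?_, ?_, ?_⟩
    · rw [List.map_cons, fillWord, slotWord, List.map_append, fillWord_append, ← h1, ← hcs,
        fillWord_corolla_bars]
      rw [count_none_corolla, List.length_map, hcs]
    · rw [List.map_cons, fillWord, slotWord, List.count_append, h3, count_none_corolla,
        List.length_append, hcs]
    · simp [List.reduceOption_append, reduceOption_chunk, h4, hi]
    · intro j hj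
      rw [List.mem_cons, Option.some.injEq] at hj
      rcases hj with rfl | hj
      · exact ⟨hi, by simp [mem_chunk]⟩
      · exact ⟨(h5 j hj).1, by simp [(h5 j hj).2]⟩
    · rw [List.reduceOption_cons_of_some, List.nodup_cons, mem_reduceOption]
      exact ⟨fun h => hiw (h5 i h).2, h6⟩

open Function in
/-- The operad is generated by the multiplication, the partial compositions, the wide actions and
the right actions. With an open output, the closed letters form a word that is generated by the
first two; the wide action inserts the open letters into its bars, and the right actions adjust the
numbers of bars. -/
theorem Valid.generated {col : ℕ → Colour} {d : Colour} {w : Word} (h : Valid col d w) :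
    Generated col d w := by
  cases d with
  | closed n => exact h.generated_closed
  | opened n =>
    obtain ⟨w', s, cs, h1, h2, h3, h4, h5, h6⟩ := h.toNested.leafy.segmented.exists_fillWord
    have hcl : ∀ i, some i ∈ w' → (col i).isOpen = false ∧ some i ∈ w := by
      intro i hi
      rw [← mem_reduceOption, h4, List.mem_filter, mem_reduceOption] at hi
      exact ⟨by simpa using hi.2, hi.1⟩
    have hr : ∀ l : List ℕ, (l.map some).reduceOption = l := fun l => by
      induction l with
      | nil => rfl
      | cons a l ih => simp [ih]
    have hN : Nested col w' := by
      have e1 : Nested col (w.reduceOption.map some) := h.toNested.of_reduceOption (hr _)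
      have e2 : Nested col (w'.reduceOption.map some) := by
        refine e1.of_sublist ?_ fun i hi => ?_
        · rw [h4]
          exact List.filter_sublist.map some
        · rw [← count_reduceOption, ← count_reduceOption, hr, hr, h4]
          rw [← mem_reduceOption, hr, mem_reduceOption] at hi
          exact List.count_filter (by simpa using (hcl i hi).1)
      exact e2.of_reduceOption (hr _).symm
    have hV : Valid col (.closed s.length) w' := ⟨hN, h2, fun _ i hi => (hcl i hi).1⟩
    -- `k` is a letter for the operation that is denoted by `w'`
    obtain ⟨k, hk⟩ := exists_fresh w
    have hks : some k ∉ s := fun hs => hk (h5 k hs).2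
    have hs : s.map (slotWord (update col k (.closed s.length))) = s.map (slotWord col) := by
      refine List.map_congr_left fun o ho => ?_
      cases o with
      | none => rfl
      | some j =>
        have : j ≠ k := by
          rintro rfl
          exact hks ho
        rw [slotWord, slotWord, update_of_ne this]
    have hg : ∀ g ∈ s.map (slotWord col), ∀ i, some i ∈ g → some i ∈ s := fun g hg i hi =>
      mem_slotWord.1 ⟨g, hg, hi⟩
    have h7 : Generated (update col k (.closed s.length)) (.opened _) (actWord _ k s) :=
      Generated.act (update_self _ _ _) hks h6 (fun j hj => by
        have : j ≠ k := by
          rintro rfl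
          exact hks hj
        rw [update_of_ne this]
        exact (h5 j hj).1) rfl
    rw [actWord, hs] at h7
    have h8 := h7.subst_weave hV.generated_closed (fun hi => hk (hcl k hi).2)
      (fun g hg' hi => hks (hg g hg' k hi)) (by simp [Colour.arity]) fun g hg' i hi hi' => by
        have e := (h5 i (hg g hg' i hi')).1
        rw [(hcl i hi).1] at e
        cases e
    obtain ⟨d', hd', h9⟩ := Generated.replace_bars (fillWord w' (s.map (slotWord col))) [] [] cs
      (by simpa using h8) h3
    rw [List.nil_append, List.append_nil, ← h1] at h9
    exact h9.of_isOpen hd'.symm h.bars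

/-! ### Algebras over the operad in sets -/

open PairData (colour)

open Function in
/-- A family `ev` of operations on the elements of a pair `(M, Z)` in sets, one for each word that
represents an element of `RL_2`, that respects substitution, and that takes the words of the
generators to the structure maps of the pair. The inputs are labelled by the letters of the word;
`ev` has no meaning on other words. -/
structure WordAlgebra (D : PairData.{w}) where
  /-- the value of a word at the given elements -/
  ev : (ℕ → D.M ⊕ D.Z) → Colour → Word → D.M ⊕ D.Z
  colour_ev : ∀ {ρ : ℕ → D.M ⊕ D.Z} {d : Colour} {w : Word},
    Valid (fun i => colour (ρ i)) d w → colour (ev ρ d w) = d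
  ev_congr : ∀ {ρ ρ' : ℕ → D.M ⊕ D.Z} {d : Colour} {w : Word}, Valid (fun i => colour (ρ i)) d w →
    (∀ i, some i ∈ w → ρ i = ρ' i) → ev ρ d w = ev ρ' d w
  ev_corolla : ∀ (ρ : ℕ → D.M ⊕ D.Z) (i : ℕ),
    ev ρ (colour (ρ i)) (corolla i (colour (ρ i)).arity) = ρ i
  ev_subst : ∀ {ρ : ℕ → D.M ⊕ D.Z} {p : ℕ} {x y : Word} {c d : Colour},
    Valid (fun i => colour (ρ i)) c y → Valid (fun i => colour (update ρ p (ev ρ c y) i)) d x →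
      some p ∈ x → DisjointLetters y x →
        ev ρ d (substLetter p x y) = ev (update ρ p (ev ρ c y)) d x
  ev_mu : ∀ (ρ : ℕ → D.M ⊕ D.Z) (n : ℕ), ev ρ (.closed n) (List.replicate n none) = .inl (D.mu n)
  mu_one : D.mu 1 = D.one
  ev_comp : ∀ {ρ : ℕ → D.M ⊕ D.Z} {i j p q : ℕ} {x y : D.M}, i ≠ j → ρ i = .inl x → ρ j = .inl y →
    D.ar x = p + 1 + q →
      ev ρ (.closed (p + D.ar y + q)) (compWord i j p q (D.ar y)) = .inl (D.comp x p y)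
  ev_act : ∀ {ρ : ℕ → D.M ⊕ D.Z} {i : ℕ} {x : D.M} {s : List (Option ℕ)} {zs : List (Option D.Z)},
    ρ i = .inl x → D.ar x = s.length → some i ∉ s → s.reduceOption.Nodup →
      s.map (Option.map ρ) = zs.map (Option.map .inr) →
        ev ρ (.opened ((actWord (fun i => colour (ρ i)) i s).count none))
          (actWord (fun i => colour (ρ i)) i s) = .inr (D.act x zs)
  ev_ract : ∀ {ρ : ℕ → D.M ⊕ D.Z} {i p q : ℕ} {z : D.Z} (l : ℕ), ρ i = .inr z →
    D.arZ z = p + 1 + q → ev ρ (.opened (p + l + q)) (ractWord i p q l) = .inr (D.ract z p l)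

namespace WordAlgebra

variable {D : PairData.{w}} (A : WordAlgebra D)

/-- The word `w` represents an operation, which takes the elements `ρ` to the element `e`. -/
structure Ev (ρ : ℕ → D.M ⊕ D.Z) (w : Word) (e : D.M ⊕ D.Z) : Prop where
  valid : Valid (fun i => colour (ρ i)) (colour e) w
  eq : A.ev ρ (colour e) w = e

variable {A} {ρ : ℕ → D.M ⊕ D.Z}

theorem ev_of_valid {d : Colour} {w : Word} {e : D.M ⊕ D.Z}
    (h : Valid (fun i => colour (ρ i)) d w) (he : A.ev ρ d w = e) : A.Ev ρ w e := by
  have h1 := A.colour_ev h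
  rw [he] at h1
  subst h1
  exact ⟨h, he⟩

theorem Ev.count_none {w : Word} {e : D.M ⊕ D.Z} (h : A.Ev ρ w e) :
    w.count none = (colour e).arity := h.valid.bars

theorem Ev.congr {w : Word} {e : D.M ⊕ D.Z} (h : A.Ev ρ w e) {ρ' : ℕ → D.M ⊕ D.Z}
    (hρ : ∀ i, some i ∈ w → ρ i = ρ' i) : A.Ev ρ' w e :=
  ⟨h.valid.congr fun i hi => by rw [hρ i hi], (A.ev_congr h.valid hρ).symm.trans h.eq⟩

theorem Ev.unique {w : Word} {e e' : D.M ⊕ D.Z} (h : A.Ev ρ w e) (h' : A.Ev ρ w e')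
    (ho : (colour e).isOpen = (colour e').isOpen) : e = e' := by
  rw [← h.eq, ← h'.eq, Colour.ext_arity ho (h.count_none.symm.trans h'.count_none)]

theorem Ev.inl_unique {w : Word} {m m' : D.M} (h : A.Ev ρ w (.inl m)) (h' : A.Ev ρ w (.inl m')) :
    m = m' := Sum.inl.inj (h.unique h' rfl)

theorem Ev.inr_unique {w : Word} {z z' : D.Z} (h : A.Ev ρ w (.inr z)) (h' : A.Ev ρ w (.inr z')) :
    z = z' := Sum.inr.inj (h.unique h' rfl)

theorem ev_letter {i : ℕ} {e : D.M ⊕ D.Z} (h : ρ i = e) :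
    A.Ev ρ (corolla i (colour e).arity) e := by
  subst h
  exact ⟨valid_corolla rfl fun h => h, A.ev_corolla ρ i⟩

theorem ev_bars (n : ℕ) : A.Ev ρ (List.replicate n none) (.inl (D.mu n)) :=
  ev_of_valid (valid_bars _ n) (A.ev_mu ρ n)

theorem ev_bar : A.Ev ρ [none] (.inl D.one) := by
  rw [← A.mu_one]
  exact ev_bars 1

open Function in
theorem Ev.subst_weave {k : ℕ} {a b y : Word} {gs : List Word} {e e' : D.M ⊕ D.Z}
    (hx : A.Ev (update ρ k e) (a ++ (weave k gs ++ b)) e') (hy : A.Ev ρ y e)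
    (hky : some k ∉ y) (ha : some k ∉ a) (hg : ∀ g ∈ gs, some k ∉ g) (hb : some k ∉ b)
    (hd : DisjointLetters y (a ++ (weave k gs ++ b))) :
    A.Ev ρ (a ++ (fillWord y gs ++ b)) e' := by
  have hk : some k ∈ a ++ (weave k gs ++ b) := by simp [mem_weave]
  have hne : ∀ {w : Word}, some k ∉ w → ∀ i, some i ∈ w → i ≠ k := by
    rintro w h i hi rfl
    exact h hi
  have hl := hx.valid.count k hk
  simp only [update_self] at hl
  rw [List.count_append, List.count_append, count_weave_self hg, List.count_eq_zero.2 ha,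
    List.count_eq_zero.2 hb] at hl
  have hc := hy.count_none
  have e1 := substLetter_weave ha hg hb (y := y) (by omega)
  have h1 : Valid (fun i => colour (update ρ k e i)) (colour e') (substLetter k _ y) :=
    hx.valid.substLetter (c := colour e) (hy.valid.congr fun i hi => by
      rw [update_of_ne (hne hky i hi)]) (by rw [update_self]) hk hd
  rw [e1] at h1
  have hk' : some k ∉ a ++ (fillWord y gs ++ b) := by
    simp only [List.mem_append, not_or]
    refine ⟨ha, fun h => ?_, hb⟩
    rcases mem_fillWord h with h | ⟨g, hg', h⟩
    · exact hky h
    · exact hg g hg' h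
  refine ⟨h1.congr fun i hi => by rw [update_of_ne (hne hk' i hi)], ?_⟩
  rw [← e1, A.ev_subst hy.valid (by rw [hy.eq]; exact hx.valid) hk hd, hy.eq, hx.eq]

theorem ev_compWord {i j p q : ℕ} {x y : D.M} (hij : i ≠ j) (hi : ρ i = .inl x)
    (hj : ρ j = .inl y) (h : D.ar x = p + 1 + q) :
    A.Ev ρ (compWord i j p q (D.ar y)) (.inl (D.comp x p y)) :=
  ev_of_valid (valid_compWord hij (by rw [hi, ← h]; rfl) (by rw [hj]; rfl))
    (A.ev_comp hij hi hj h)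

theorem ev_ractWord {i p q : ℕ} {z : D.Z} (l : ℕ) (hi : ρ i = .inr z)
    (h : D.arZ z = p + 1 + q) : A.Ev ρ (ractWord i p q l) (.inr (D.ract z p l)) :=
  ev_of_valid (valid_ractWord (by rw [hi, ← h]; rfl)) (A.ev_ract l hi h)

theorem ev_actWord {i : ℕ} {x : D.M} {s : List (Option ℕ)} {zs : List (Option D.Z)}
    (hi : ρ i = .inl x) (h : D.ar x = s.length) (his : some i ∉ s) (hs : s.reduceOption.Nodup)
    (hz : s.map (Option.map ρ) = zs.map (Option.map .inr)) :
    A.Ev ρ (actWord (fun i => colour (ρ i)) i s) (.inr (D.act x zs)) :=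
  ev_of_valid (valid_actWord (by rw [hi, ← h]; rfl) his hs rfl) (A.ev_act hi h his hs hz)

theorem mem_corolla {i k n : ℕ} : some k ∈ corolla i n ↔ k = i := mem_chunk

open Function in
/-- The insertion of a word into a bar is a partial composition. -/
theorem Ev.insert {u v y : Word} {m m' : D.M} (h : A.Ev ρ (u ++ none :: v) (.inl m))
    (h' : A.Ev ρ y (.inl m')) (hd : DisjointLetters y (u ++ none :: v)) :
    A.Ev ρ (u ++ (y ++ v)) (.inl (D.comp m (u.count none) m')) := by
  obtain ⟨k, hk⟩ := exists_fresh (u ++ none :: v ++ y)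
  obtain ⟨k', hk'⟩ := exists_fresh (some k :: y)
  simp only [List.mem_append, List.mem_cons, not_or, Option.some.injEq] at hk hk'
  have hc := h.count_none
  rw [List.count_append, List.count_cons_self] at hc
  have h1 : A.Ev (update (update ρ k (.inl m)) k' (.inl m'))
      (compWord k k' (u.count none) (v.count none) (D.ar m'))
      (.inl (D.comp m (u.count none) m')) := by
    refine ev_compWord (Ne.symm hk'.1) ?_ (update_self _ _ _) ?_
    · rw [update_of_ne (Ne.symm hk'.1), update_self]
    · rw [← show _ = D.ar m from hc]
      omega
  rw [compWord, corolla_eq_weave k'] at h1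
  have hy : A.Ev (update ρ k (.inl m)) y (.inl m') := h'.congr fun i hi => by
    rw [update_of_ne]
    rintro rfl
    exact hk.2 hi
  have h2 := h1.subst_weave hy hk'.2 (by simpa [mem_corolla] using hk'.1) (by simp)
    (by simpa [mem_corolla] using hk'.1) fun i hi hi' => by
      simp only [List.mem_append, mem_corolla, mem_weave, Option.some.injEq, List.mem_replicate]
        at hi'
      rcases hi' with rfl | (rfl | ⟨g, ⟨_, rfl⟩, hg⟩) | rfl
      · exact hk.2 hi
      · exact hk'.2 hi
      · simp at hg
      · exact hk.2 hi
  rw [← show _ = D.ar m' from h'.count_none, fillWord_bars, ← weave_bars_insert] at h2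
  have h3 := Ev.subst_weave (a := []) (b := []) (by simpa using h2) h
    (by simp [hk.1.1, hk.1.2]) (by simp) (forall_bars_insert (by simp) hk.2) (by simp) (by
      rw [List.nil_append, List.append_nil]
      intro i hi hi'
      rw [mem_weave, Option.some.injEq] at hi'
      rcases hi' with rfl | ⟨g, hg, hi'⟩
      · simp [hk.1.1, hk.1.2] at hi
      · revert hi'
        exact forall_bars_insert (Q := fun g => some i ∉ g) (by simp) (fun h => hd i h hi) g hg)
  rw [fillWord_single _ rfl rfl] at h3
  simpa using h3

open Function in
/-- The replacement of a bar with `l` bars is a right action. -/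
theorem Ev.replace_bar {u v : Word} {z : D.Z} (h : A.Ev ρ (u ++ none :: v) (.inr z)) (l : ℕ) :
    A.Ev ρ (u ++ (List.replicate l none ++ v)) (.inr (D.ract z (u.count none) l)) := by
  obtain ⟨k, hk⟩ := exists_fresh (u ++ none :: v)
  have hc := h.count_none
  rw [List.count_append, List.count_cons_self] at hc
  have h1 : A.Ev (update ρ k (.inr z)) (ractWord k (u.count none) (v.count none) l)
      (.inr (D.ract z (u.count none) l)) := by
    refine ev_ractWord l (update_self _ _ _) ?_
    rw [← show _ = D.arZ z from hc]
    omega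
  rw [ractWord, ← weave_bars_insert] at h1
  have h3 := Ev.subst_weave (a := []) (b := []) (by simpa using h1) h hk (by simp)
    (forall_bars_insert (by simp) (by simp [List.mem_replicate])) (by simp) (by
      rw [List.nil_append, List.append_nil]
      intro i hi hi'
      rw [mem_weave, Option.some.injEq] at hi'
      rcases hi' with rfl | ⟨g, hg, hi'⟩
      · exact hk hi
      · revert hi'
        exact forall_bars_insert (Q := fun g => some i ∉ g) (by simp)
          (by simp [List.mem_replicate]) g hg)
  rw [fillWord_single _ rfl rfl] at h3
  simpa using h3

open Function in
/-- The replacement of the bars of a word by letters for elements of `Z` is a wide action. -/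
theorem Ev.fill {w : Word} {x : D.M} {s : List (Option ℕ)} {zs : List (Option D.Z)}
    (h : A.Ev ρ w (.inl x)) (hl : s.length = D.ar x) (hs : s.reduceOption.Nodup)
    (hz : s.map (Option.map ρ) = zs.map (Option.map .inr)) (hd : ∀ j, some j ∈ s → some j ∉ w) :
    A.Ev ρ (fillWord w (s.map (slotWord fun i => colour (ρ i)))) (.inr (D.act x zs)) := by
  obtain ⟨k, hk⟩ := exists_fresh (w ++ s)
  simp only [List.mem_append, not_or] at hk
  have hne : ∀ j, some j ∈ s → j ≠ k := by
    rintro j hj rfl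
    exact hk.2 hj
  have h1 := ev_actWord (A := A) (ρ := update ρ k (.inl x)) (i := k) (s := s) (zs := zs)
    (update_self _ _ _) hl.symm hk.2 hs (by
      rw [← hz]
      refine List.map_congr_left fun o ho => ?_
      cases o with
      | none => rfl
      | some j => simp [update_of_ne (hne j ho)])
  have e : s.map (slotWord fun i => colour (update ρ k (.inl x) i)) =
      s.map (slotWord fun i => colour (ρ i)) := by
    refine List.map_congr_left fun o ho => ?_
    cases o with
    | none => rfl
    | some j => simp [slotWord, update_of_ne (hne j ho)]
  rw [actWord, e] at h1
  have hm : ∀ {i g}, g ∈ s.map (slotWord fun i => colour (ρ i)) → some i ∈ g → some i ∈ s :=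
    fun hg hi => mem_slotWord.1 ⟨_, hg, hi⟩
  have h3 := Ev.subst_weave (a := []) (b := []) (by simpa using h1) h hk.1 (by simp)
    (fun g hg hi => hk.2 (hm hg hi)) (by simp) (by
      rw [List.nil_append, List.append_nil]
      intro i hi hi'
      rw [mem_weave, Option.some.injEq] at hi'
      rcases hi' with rfl | ⟨g, hg, hi'⟩
      · exact hk.1 hi
      · exact hd i (hm hg hi') hi)
  simpa using h3

open Function in
/-- Letters for given elements of `Z`. -/
theorem exists_names {α β : Type*} (g : α → β) (zs : List (Option α)) : ∀ (ρ₀ : ℕ → β) (N : ℕ),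
    ∃ (ρ : ℕ → β) (s : List (Option ℕ)), (∀ i < N, ρ i = ρ₀ i) ∧
      (∀ j, some j ∈ s → N ≤ j) ∧ s.reduceOption.Nodup ∧
        s.map (Option.map ρ) = zs.map (Option.map g) := by
  induction zs with
  | nil => exact fun ρ₀ N => ⟨ρ₀, [], by simp⟩
  | cons o zs ih =>
    intro ρ₀ N
    cases o with
    | none =>
      obtain ⟨ρ, s, h1, h2, h3, h4⟩ := ih ρ₀ N
      exact ⟨ρ, none :: s, h1, by simpa using h2, by simpa using h3, by simpa using h4⟩
    | some z =>
      obtain ⟨ρ, s, h1, h2, h3, h4⟩ := ih (update ρ₀ N (g z)) (N + 1)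
      refine ⟨ρ, some N :: s, fun i hi => ?_, fun j hj => ?_, ?_, ?_⟩
      · rw [h1 i (by omega), update_of_ne (by omega)]
      · rw [List.mem_cons, Option.some.injEq] at hj
        rcases hj with rfl | hj
        · exact le_rfl
        · exact (Nat.le_succ N).trans (h2 j hj)
      · rw [List.reduceOption_cons_of_some, List.nodup_cons, mem_reduceOption]
        exact ⟨fun h => absurd (h2 N h) (by omega), h3⟩
      · simp [h4, h1 N (by omega)]

end WordAlgebra

/-! ### The axioms of a pair, from an algebra over the operad -/

open PairData (colour)

namespace WordAlgebra

variable {D : PairData.{w}}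

/-- An assignment of elements to the letters `0`, `1`, and the others. -/
def assign (a b c : D.M ⊕ D.Z) : ℕ → D.M ⊕ D.Z
  | 0 => a
  | 1 => b
  | _ + 2 => c

theorem ar_mu (A : WordAlgebra D) (l : ℕ) : D.ar (D.mu l) = l := by
  have := (ev_bars (A := A) (ρ := fun _ => .inl D.one) l).count_none
  rw [List.count_replicate_self] at this
  exact this.symm

theorem ar_one (A : WordAlgebra D) : D.ar D.one = 1 := by rw [← A.mu_one, A.ar_mu]

theorem ar_comp (A : WordAlgebra D) {x : D.M} {p : ℕ} (y : D.M) (h : p < D.ar x) :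
    D.ar (D.comp x p y) + 1 = D.ar x + D.ar y := by
  obtain ⟨q, hq⟩ := Nat.exists_eq_add_of_lt h
  have h1 := ev_compWord (A := A) (ρ := assign (.inl x) (.inl y) (.inl y)) (i := 0) (j := 1)
    (p := p) (q := q) (by simp) rfl rfl (by omega)
  have h2 : _ = D.ar (D.comp x p y) := h1.count_none
  simp only [List.count_append, count_none_corolla] at h2
  omega

theorem one_comp (A : WordAlgebra D) (y : D.M) : D.comp D.one 0 y = y := by
  have h1 := ev_letter (A := A) (ρ := fun _ => .inl y) (i := 0) rfl
  have h2 := Ev.insert (u := []) (v := []) (by simpa using ev_bar (A := A)) h1 (by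
    intro i _
    simp)
  rw [List.nil_append, List.append_nil] at h2
  exact h2.inl_unique h1

theorem ev_split (A : WordAlgebra D) {ρ : ℕ → D.M ⊕ D.Z} {i p q : ℕ} {e : D.M ⊕ D.Z} (hi : ρ i = e)
    (h : (colour e).arity = p + 1 + q) : A.Ev ρ (corolla i p ++ none :: corolla i q) e := by
  have := ev_letter (A := A) hi
  rwa [h, corolla_add] at this

theorem comp_one (A : WordAlgebra D) {x : D.M} {p : ℕ} (h : p < D.ar x) : D.comp x p D.one = x := by
  obtain ⟨q, hq⟩ := Nat.exists_eq_add_of_lt h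
  have h1 := A.ev_split (ρ := fun _ => .inl x) (i := 0) (p := p) (q := q) rfl
    (by rw [show (colour (.inl x : D.M ⊕ D.Z)).arity = D.ar x from rfl]; omega)
  have h2 := h1.insert ev_bar (by intro i hi; simp at hi)
  rw [count_none_corolla] at h2
  exact h2.inl_unique h1

theorem disjoint_corolla {i : ℕ} {w : Word} {n : ℕ} (h : some i ∉ w) :
    DisjointLetters (corolla i n) w := fun _ hk hk' => h (mem_corolla.1 hk ▸ hk')

theorem comp_assoc (A : WordAlgebra D) {x : D.M} {p : ℕ} {y : D.M} {p' : ℕ} (z : D.M)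
    (h : p < D.ar x) (h' : p' < D.ar y) :
    D.comp (D.comp x p y) (p + p') z = D.comp x p (D.comp y p' z) := by
  obtain ⟨q, hq⟩ := Nat.exists_eq_add_of_lt h
  obtain ⟨q', hq'⟩ := Nat.exists_eq_add_of_lt h'
  have hx := A.ev_split (ρ := assign (.inl x) (.inl y) (.inl z)) (i := 0) (p := p) (q := q) rfl
    (by change D.ar x = _; omega)
  have hy := A.ev_split (ρ := assign (.inl x) (.inl y) (.inl z)) (i := 1) (p := p') (q := q') rfl
    (by change D.ar y = _; omega)
  have hz := ev_letter (A := A) (ρ := assign (.inl x) (.inl y) (.inl z)) (i := 2) rfl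
  have h1 := hx.insert (hy.insert hz (disjoint_corolla (by simp [mem_corolla])))
    (by intro i; simp only [List.mem_append, List.mem_cons, mem_corolla]; simp; omega)
  have h2 := hx.insert hy (by
    intro i; simp only [List.mem_append, List.mem_cons, mem_corolla]; simp; omega)
  have h3 := Ev.insert (u := corolla 0 p ++ corolla 1 p') (v := corolla 1 q' ++ corolla 0 q)
    (by simpa using h2) hz (disjoint_corolla (by simp [mem_corolla]))
  simp only [List.count_append, count_none_corolla, List.append_assoc] at h1 h3
  exact h3.inl_unique h1

theorem comp_comm (A : WordAlgebra D) {x : D.M} {p m : ℕ} (y z : D.M) (h : p + 1 + m < D.ar x) :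
    D.comp (D.comp x p y) (p + D.ar y + m) z = D.comp (D.comp x (p + 1 + m) z) p y := by
  obtain ⟨q, hq⟩ := Nat.exists_eq_add_of_lt h
  have hx := A.ev_split (ρ := assign (.inl x) (.inl y) (.inl z)) (i := 0)
    (e := .inl x) (p := p) (q := m + 1 + q) rfl
    (by change D.ar x = _; omega)
  rw [corolla_add] at hx
  have hy : A.Ev (assign (.inl x) (.inl y) (.inl z)) (corolla 1 (D.ar y)) (.inl y) := ev_letter rfl
  have hz : A.Ev (assign (.inl x) (.inl y) (.inl z)) (corolla 2 (D.ar z)) (.inl z) := ev_letter rfl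
  have h1 := hx.insert hy (disjoint_corolla (by simp [mem_corolla]))
  have h2 := Ev.insert (u := corolla 0 p ++ (corolla 1 (D.ar y) ++ corolla 0 m))
    (v := corolla 0 q) (by simpa using h1) hz (disjoint_corolla (by simp [mem_corolla]))
  have h3 := Ev.insert (u := corolla 0 p ++ none :: corolla 0 m) (v := corolla 0 q)
    (by simpa using hx) hz (disjoint_corolla (by simp [mem_corolla]))
  have h4 := Ev.insert (u := corolla 0 p) (v := corolla 0 m ++ (corolla 2 (D.ar z) ++ corolla 0 q))
    (by simpa using h3) hy (disjoint_corolla (by simp [mem_corolla]))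
  simp only [List.count_append, count_none_corolla, List.append_assoc]
    at h2 h4
  have := h2.inl_unique h4
  rw [← add_assoc] at this
  rw [this]
  congr 2
  omega

theorem mu_comp (A : WordAlgebra D) (p q l : ℕ) :
    D.comp (D.mu (p + 1 + q)) p (D.mu l) = D.mu (p + l + q) := by
  have h1 := ev_bars (A := A) (ρ := fun _ => .inl D.one) (p + 1 + q)
  rw [List.replicate_add, List.replicate_succ', List.append_assoc, List.singleton_append] at h1
  have h2 := h1.insert (ev_bars l) (by intro i hi; simp [List.mem_replicate] at hi)
  rw [← List.append_assoc, ← List.replicate_add, ← List.replicate_add, List.count_replicate_self]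
    at h2
  exact h2.inl_unique (ev_bars _)

theorem ract_one (A : WordAlgebra D) {z : D.Z} {p : ℕ} (h : p < D.arZ z) : D.ract z p 1 = z := by
  obtain ⟨q, hq⟩ := Nat.exists_eq_add_of_lt h
  have h1 := A.ev_split (ρ := fun _ => .inr z) (i := 0) (p := p) (q := q) rfl
    (by change D.arZ z = _; omega)
  have h2 := h1.replace_bar 1
  rw [count_none_corolla] at h2
  exact h2.inr_unique h1

theorem ract_assoc (A : WordAlgebra D) {z : D.Z} {p : ℕ} (a b c : ℕ) (h : p < D.arZ z) :
    D.ract (D.ract z p (a + 1 + b)) (p + a) c = D.ract z p (a + c + b) := by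
  obtain ⟨q, hq⟩ := Nat.exists_eq_add_of_lt h
  have h1 := A.ev_split (ρ := fun _ => .inr z) (i := 0) (p := p) (q := q) rfl
    (by change D.arZ z = _; omega)
  have h2 := h1.replace_bar (a + 1 + b)
  rw [List.replicate_add, List.replicate_succ'] at h2
  have h3 := Ev.replace_bar (u := corolla 0 p ++ List.replicate a none)
    (v := List.replicate b none ++ corolla 0 q) (by simpa using h2) c
  have h4 := h1.replace_bar (a + c + b)
  rw [List.replicate_add, List.replicate_add] at h4
  simp only [List.count_append, count_none_corolla, List.append_assoc, List.count_replicate_self]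
    at h3 h4
  exact h3.inr_unique h4

theorem ract_comm (A : WordAlgebra D) {z : D.Z} {p m : ℕ} (l k : ℕ) (h : p + 1 + m < D.arZ z) :
    D.ract (D.ract z p l) (p + l + m) k = D.ract (D.ract z (p + 1 + m) k) p l := by
  obtain ⟨q, hq⟩ := Nat.exists_eq_add_of_lt h
  have hx := A.ev_split (ρ := fun _ => .inr z) (i := 0) (p := p) (q := m + 1 + q) rfl
    (by change D.arZ z = _; omega)
  rw [corolla_add] at hx
  have h1 := hx.replace_bar l
  have h2 := Ev.replace_bar (u := corolla 0 p ++ (List.replicate l none ++ corolla 0 m))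
    (v := corolla 0 q) (by simpa using h1) k
  have h3 := Ev.replace_bar (u := corolla 0 p ++ none :: corolla 0 m) (v := corolla 0 q)
    (by simpa using hx) k
  have h4 := Ev.replace_bar (u := corolla 0 p)
    (v := corolla 0 m ++ (List.replicate k none ++ corolla 0 q)) (by simpa using h3) l
  simp only [List.count_append, count_none_corolla, List.append_assoc,
    List.count_replicate_self] at h2 h4
  have := h2.inr_unique h4
  rw [← add_assoc] at this
  rw [this]
  congr 2
  omega

theorem one_act (A : WordAlgebra D) (z : D.Z) : D.act D.one [some z] = z := by
  have h1 := (ev_bar (A := A) (ρ := fun _ => .inr z)).fill (s := [some 0]) (zs := [some z])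
    (by simp [A.ar_one]) (by simp) rfl (by simp)
  simp only [List.map_cons, List.map_nil, fillWord, slotWord, List.append_nil] at h1
  exact h1.inr_unique (ev_letter rfl)

theorem count_none_weave_slots {ρ : ℕ → D.M ⊕ D.Z} (i : ℕ) {s : List (Option ℕ)} :
    ∀ {zs : List (Option D.Z)}, s.map (Option.map ρ) = zs.map (Option.map .inr) →
      (weave i (s.map (slotWord fun i => colour (ρ i)))).count none = totalArity D.arZ zs := by
  induction s with
  | nil =>
    intro zs h
    obtain rfl : zs = [] := by simpa using h.symm
    rfl
  | cons o s ih =>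
    intro zs h
    cases zs with
    | nil => simp at h
    | cons z zs =>
      simp only [List.map_cons, List.cons.injEq] at h
      rw [List.map_cons, weave, List.count_cons_of_ne (by simp), List.count_append, ih h.2]
      cases o <;> cases z <;> simp at h
      · simp [slotWord, totalArity]
      · rw [slotWord, count_none_corolla, h.1]
        rfl

theorem exists_act_names (a b c : D.M ⊕ D.Z) (zs : List (Option D.Z)) :
    ∃ (ρ : ℕ → D.M ⊕ D.Z) (s : List (Option ℕ)), ρ 0 = a ∧ ρ 1 = b ∧ ρ 2 = c ∧
      (∀ j, some j ∈ s → 3 ≤ j) ∧ s.reduceOption.Nodup ∧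
        s.map (Option.map ρ) = zs.map (Option.map .inr) := by
  obtain ⟨ρ, s, h1, h2⟩ := exists_names Sum.inr zs (assign a b c) 3
  exact ⟨ρ, s, h1 0 (by omega), h1 1 (by omega), h1 2 (by omega), h2⟩

theorem fillWord_compWord {i j : ℕ} {gs₁ gs₂ gs₃ : List Word} :
    fillWord (compWord i j gs₁.length gs₃.length gs₂.length) (gs₁ ++ (gs₂ ++ gs₃)) =
      weave i gs₁ ++ (weave j gs₂ ++ weave i gs₃) := by
  rw [compWord, fillWord_append _ _ _ _ (by rw [count_none_corolla]),
    fillWord_append _ _ _ _ (by rw [count_none_corolla]), fillWord_corolla, fillWord_corolla,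
    fillWord_corolla]

/-- Lists of slots that are put together from three lists. -/
theorem exists_names_three (a b c : D.M ⊕ D.Z) (pre mid post : List (Option D.Z)) :
    ∃ (ρ : ℕ → D.M ⊕ D.Z) (s₁ s₂ s₃ : List (Option ℕ)), ρ 0 = a ∧ ρ 1 = b ∧ ρ 2 = c ∧
      (∀ j, some j ∈ s₁ ++ (s₂ ++ s₃) → 3 ≤ j) ∧ (s₁ ++ (s₂ ++ s₃)).reduceOption.Nodup ∧
        s₁.map (Option.map ρ) = pre.map (Option.map .inr) ∧
        s₂.map (Option.map ρ) = mid.map (Option.map .inr) ∧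
        s₃.map (Option.map ρ) = post.map (Option.map .inr) := by
  obtain ⟨ρ, s, h0, h1, h2, h3, h4, h5⟩ := exists_act_names a b c (pre ++ (mid ++ post))
  rw [List.map_append, List.map_append, List.map_eq_append_iff] at h5
  obtain ⟨s₁, t, rfl, h6, h7⟩ := h5
  rw [List.map_eq_append_iff] at h7
  obtain ⟨s₂, s₃, rfl, h7, h8⟩ := h7
  exact ⟨ρ, s₁, s₂, s₃, h0, h1, h2, h3, h4, h6, h7, h8⟩

theorem not_mem_weave_slots {col : ℕ → Colour} {i k : ℕ} {s : List (Option ℕ)} (hi : k ≠ i)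
    (hs : some k ∉ s) : some k ∉ weave i (s.map (slotWord col)) := by
  rw [show weave i (s.map (slotWord col)) = actWord col i s from rfl, mem_actWord]
  simp [hi, hs]

open Function in
/-- Both sides are the value of one word, in which `1` lies in a gap of `0` and the elements of `Z`
lie in gaps of `0` or `1`: it is the action of `0` with the action of `1` inserted, and the action of
the partial composition of `0` and `1`. -/
theorem act_act (A : WordAlgebra D) {x y : D.M} {pre mid post : List (Option D.Z)}
    (h : pre.length + 1 + post.length = D.ar x) (h' : mid.length = D.ar y) :
    D.act x (pre ++ some (D.act y mid) :: post) =
      D.act (D.comp x pre.length y) (pre ++ (mid ++ post)) := by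
  obtain ⟨ρ, s₁, s₂, s₃, h0, h1, h2, h3, h4, e1, e2, e3⟩ :=
    exists_names_three (.inl x) (.inl y) (.inr (D.act y mid)) pre mid post
  have l1 : s₁.length = pre.length := by simpa using congrArg List.length e1
  have l2 : s₂.length = mid.length := by simpa using congrArg List.length e2
  have l3 : s₃.length = post.length := by simpa using congrArg List.length e3
  have hm : ∀ k, k < 3 → some k ∉ s₁ ∧ some k ∉ s₂ ∧ some k ∉ s₃ := by
    refine fun k hk => ⟨fun h => ?_, fun h => ?_, fun h => ?_⟩ <;>
    exact absurd (h3 k (by simp [h])) (by omega)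
  simp only [List.reduceOption_append, List.nodup_append, List.mem_append, mem_reduceOption] at h4
  have hy := ev_actWord (A := A) (i := 1) (s := s₂) (zs := mid) h1 (by omega) (hm 1 (by omega)).2.1
    h4.2.1.1 e2
  have hx := ev_actWord (A := A) (i := 0) (s := s₁ ++ some 2 :: s₃)
    (zs := pre ++ some (D.act y mid) :: post) h0 (by simp; omega)
    (by simp [hm 0 (by omega)]) (by
      simp only [List.reduceOption_append, List.reduceOption_cons_of_some, List.nodup_append,
        List.nodup_cons, List.mem_cons, mem_reduceOption]
      refine ⟨h4.1, ⟨(hm 2 (by omega)).2.2, h4.2.1.2.1⟩, fun a ha b hb => ?_⟩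
      rcases hb with rfl | hb
      · rintro rfl
        exact (hm _ (by omega)).1 ha
      · exact h4.2.2 a ha b (Or.inr hb)) (by simp [e1, e3, h2])
  have hw := ev_compWord (A := A) (i := 0) (j := 1) (p := s₁.length) (q := s₃.length) (by simp)
    h0 h1 (by omega)
  have h6 := hw.fill (s := s₁ ++ (s₂ ++ s₃)) (zs := pre ++ (mid ++ post)) (by
      have := A.ar_comp (p := s₁.length) (x := x) y (by omega)
      simp only [List.length_append]
      omega) (by
      simp only [List.reduceOption_append, List.nodup_append, List.mem_append, mem_reduceOption]
      exact h4) (by simp [e1, e2, e3]) (by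
      intro j hj
      have := h3 j hj
      simp only [List.mem_append, mem_corolla]
      omega)
  have e4 := fillWord_compWord (i := 0) (j := 1) (gs₁ := s₁.map (slotWord fun i => colour (ρ i)))
    (gs₂ := s₂.map (slotWord fun i => colour (ρ i)))
    (gs₃ := s₃.map (slotWord fun i => colour (ρ i)))
  rw [List.length_map, List.length_map, List.length_map] at e4
  rw [List.map_append, List.map_append, ← h', ← l2, e4, l1] at h6
  rw [actWord, List.map_append, List.map_cons, weave_append, slotWord, corolla_eq_weave] at hx
  have h7 := Ev.subst_weave (A := A) (ρ := ρ) (e := .inr (D.act y mid)) (k := 2)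
    (by rwa [← h2, update_eq_self]) hy
    (not_mem_weave_slots (by simp) (hm 2 (by omega)).2.1)
    (not_mem_weave_slots (by simp) (hm 2 (by omega)).1) (by simp)
    (not_mem_weave_slots (by simp) (hm 2 (by omega)).2.2) (by
      intro i hi hi'
      rw [← corolla_eq_weave] at hi'
      rw [mem_actWord] at hi
      simp only [List.mem_append, mem_corolla] at hi'
      have hi3 : i = 1 ∨ 3 ≤ i := hi.imp id fun h => h3 i (by simp [h])
      rcases hi' with hi' | hi' | hi'
      · rw [show weave 0 (s₁.map _) = actWord _ 0 s₁ from rfl, mem_actWord] at hi'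
        rcases hi with rfl | hi
        · simp [(hm 1 (by omega)).1] at hi'
        · rcases hi' with rfl | hi'
          · omega
          · exact h4.2.2 i hi' i (Or.inl hi) rfl
      · omega
      · rw [show weave 0 (s₃.map _) = actWord _ 0 s₃ from rfl, mem_actWord] at hi'
        rcases hi with rfl | hi
        · simp [(hm 1 (by omega)).2.2] at hi'
        · rcases hi' with rfl | hi'
          · omega
          · exact h4.2.1.2.2 i hi i hi' rfl)
  rw [show (colour (ρ 2)).arity = _ from (congrArg (fun e => (colour e).arity) h2).trans
    hy.count_none.symm, fillWord_bars] at h7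
  exact h7.inr_unique h6

open Function in
theorem ract_inner (A : WordAlgebra D) {x : D.M} {pre : List (Option D.Z)} {z : D.Z}
    {post : List (Option D.Z)} {p : ℕ} (l : ℕ) (h : pre.length + 1 + post.length = D.ar x)
    (hp : p < D.arZ z) :
    D.ract (D.act x (pre ++ some z :: post)) (totalArity D.arZ pre + p) l =
      D.act x (pre ++ some (D.ract z p l) :: post) := by
  obtain ⟨q, hq⟩ := Nat.exists_eq_add_of_lt hp
  obtain ⟨ρ, s₁, s₂, s₃, h0, h1, h2, h3, h4, e1, -, e3⟩ :=
    exists_names_three (.inl x) (.inr z) (.inr (D.ract z p l)) pre [] post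
  have l1 : s₁.length = pre.length := by simpa using congrArg List.length e1
  have l3 : s₃.length = post.length := by simpa using congrArg List.length e3
  have hm : ∀ k, k < 3 → some k ∉ s₁ ∧ some k ∉ s₃ := by
    refine fun k hk => ⟨fun h => ?_, fun h => ?_⟩ <;>
    exact absurd (h3 k (by simp [h])) (by omega)
  simp only [List.reduceOption_append, List.nodup_append, List.mem_append, mem_reduceOption] at h4
  have hx : ∀ (j : ℕ) (z' : D.Z), (j = 1 ∨ j = 2) → ρ j = .inr z' → A.Ev ρ
      (weave 0 (s₁.map (slotWord fun i => colour (ρ i))) ++ (corolla j (D.arZ z') ++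
        weave 0 (s₃.map (slotWord fun i => colour (ρ i)))))
      (.inr (D.act x (pre ++ some z' :: post))) := by
    intro j z' hj hz'
    have := ev_actWord (A := A) (i := 0) (s := s₁ ++ some j :: s₃)
      (zs := pre ++ some z' :: post) h0 (by simp; omega)
      (by simp [hm 0 (by omega)]; omega) (by
        simp only [List.reduceOption_append, List.reduceOption_cons_of_some, List.nodup_append,
          List.nodup_cons, List.mem_cons, mem_reduceOption]
        refine ⟨h4.1, ⟨(hm j (by omega)).2, h4.2.1.2.1⟩, fun a ha b hb => ?_⟩
        rcases hb with rfl | hb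
        · rintro rfl
          exact (hm _ (by omega)).1 ha
        · exact h4.2.2 a ha b (Or.inr hb)) (by simp [e1, e3, hz'])
    rw [actWord, List.map_append, List.map_cons, weave_append, slotWord, hz'] at this
    exact this
  have hz := ev_ractWord (A := A) (i := 1) (p := p) (q := q) l h1 (by omega)
  have hx2 := hx 2 _ (Or.inr rfl) h2
  rw [corolla_eq_weave] at hx2
  have h7 := Ev.subst_weave (A := A) (ρ := ρ) (e := .inr (D.ract z p l)) (k := 2)
    (by rwa [← h2, update_eq_self]) hz (by simp [mem_corolla, List.mem_replicate])
    (not_mem_weave_slots (by simp) (hm 2 (by omega)).1) (by simp)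
    (not_mem_weave_slots (by simp) (hm 2 (by omega)).2) (by
      intro i hi hi'
      rw [← corolla_eq_weave] at hi'
      simp only [List.mem_append, mem_corolla, List.mem_replicate, reduceCtorEq, and_false,
        false_or, or_self] at hi hi'
      subst hi
      simp only [not_mem_weave_slots (col := fun i => colour (ρ i)) (i := 0) (k := 1) (by simp)
        (hm 1 (by omega)).1, not_mem_weave_slots (col := fun i => colour (ρ i)) (i := 0) (k := 1)
        (by simp) (hm 1 (by omega)).2] at hi'
      simp at hi')
  rw [show D.arZ (D.ract z p l) = _ from hz.count_none.symm, fillWord_bars] at h7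
  have hx1 := hx 1 _ (Or.inl rfl) h1
  rw [show D.arZ z = p + 1 + q by omega, corolla_add] at hx1
  have h8 := Ev.replace_bar (u := weave 0 (s₁.map (slotWord fun i => colour (ρ i))) ++ corolla 1 p)
    (v := corolla 1 q ++ weave 0 (s₃.map (slotWord fun i => colour (ρ i)))) (by simpa using hx1) l
  rw [List.count_append, count_none_weave_slots 0 e1, count_none_corolla] at h8
  simp only [List.append_assoc] at h7 h8
  exact h8.inr_unique h7

theorem ract_outer (A : WordAlgebra D) {x : D.M} {pre post : List (Option D.Z)} (l : ℕ)
    (h : pre.length + 1 + post.length = D.ar x) :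
    D.ract (D.act x (pre ++ none :: post)) (totalArity D.arZ pre) l =
      D.act (D.comp x pre.length (D.mu l)) (pre ++ (List.replicate l none ++ post)) := by
  obtain ⟨ρ, s₁, s₂, s₃, h0, h1, h2, h3, h4, e1, e2, e3⟩ :=
    exists_names_three (.inl x) (.inl x) (.inl x) pre (List.replicate l none) post
  obtain rfl : s₂ = List.replicate l none := by
    refine List.eq_replicate_iff.2 ⟨by simpa using congrArg List.length e2, fun o ho => ?_⟩
    have : Option.map ρ o ∈ s₂.map (Option.map ρ) := List.mem_map_of_mem ho
    rw [e2] at this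
    exact (by simpa [List.mem_replicate] using this : _ ∧ o = none).2
  have l1 : s₁.length = pre.length := by simpa using congrArg List.length e1
  have l3 : s₃.length = post.length := by simpa using congrArg List.length e3
  have hm : some 0 ∉ s₁ ∧ some 0 ∉ s₃ := by
    refine ⟨fun h => ?_, fun h => ?_⟩ <;>
    exact absurd (h3 0 (by simp [h])) (by omega)
  have hx := ev_actWord (A := A) (i := 0) (s := s₁ ++ none :: s₃)
    (zs := pre ++ none :: post) h0 (by simp; omega)
    (by simp [hm]) (by
      simpa [List.reduceOption_append, reduceOption_replicate_none] using h4) (by simp [e1, e3])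
  rw [actWord, List.map_append, List.map_cons, weave_append, slotWord, List.singleton_append] at hx
  have h5 := hx.replace_bar l
  rw [count_none_weave_slots 0 e1] at h5
  have hw := (A.ev_split (i := 0) (p := s₁.length) (q := s₃.length) h0
    (by change D.ar x = _; omega)).insert (ev_bars l)
      (by intro i hi; simp [List.mem_replicate] at hi)
  rw [count_none_corolla] at hw
  have h6 := hw.fill (s := s₁ ++ (List.replicate l none ++ s₃))
    (zs := pre ++ (List.replicate l none ++ post)) (by
      have := A.ar_comp (p := s₁.length) (x := x) (D.mu l) (by omega)
      rw [A.ar_mu] at this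
      simp only [List.length_append, List.length_replicate]
      omega) h4 (by simp [e1, e3]) (by
      intro j hj
      have := h3 j hj
      simp only [List.mem_append, mem_corolla, List.mem_replicate, reduceCtorEq, and_false,
        false_or]
      omega)
  rw [List.map_append, List.map_append, fillWord_append _ _ _ _ (by simp [count_none_corolla]),
    fillWord_append _ _ _ _ (by simp), List.map_replicate] at h6
  have e4 := fillWord_bars (List.replicate l none)
  have e5 := fillWord_corolla 0 (s₁.map (slotWord fun i => colour (ρ i)))
  have e6 := fillWord_corolla 0 (s₃.map (slotWord fun i => colour (ρ i)))
  rw [List.count_replicate_self] at e4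
  rw [List.length_map] at e5 e6
  rw [slotWord, e4, e5, e6, l1] at h6
  exact h5.inr_unique h6

end WordAlgebra

/-! ### The algebra over the operad of a pair in sets -/

open PairData (colour)

namespace SetPair

variable {P : SetPair.{w}} {ρ : ℕ → P.M ⊕ P.Z}

theorem tok_weave_all {r : ℕ} {m : P.M} (hm : ρ r = .inl m) {gs : List Word}
    (hl : ∀ g ∈ gs, Leafy (fun i => colour (ρ i)) g) (hrg : ∀ g ∈ gs, some r ∉ g)
    (hp : gs.Pairwise DisjointLetters) :
    tok ρ [] none (weave r gs) = .op m :: gaps (gs.map (tok ρ [] none)) := by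
  have := tok_weave (pre := []) hm (by simp) hl hrg (fun g _ i _ => by simp) hp []
  simpa [tok] using this

theorem leafy_corolla {col : ℕ → Colour} (i : ℕ) : Leafy col (corolla i (col i).arity) :=
  (nested_chunk (by simp)).leafy

theorem evalM_tok_corolla {j : ℕ} {y : P.M} (hj : ρ j = .inl y) :
    evalM (tok ρ [] none (corolla j (P.ar y))) = y := by
  have h1 := tok_chunk_closed hj (List.replicate (P.ar y) 1) (pre := []) (by simp) []
  rw [List.append_nil, tok, List.append_nil] at h1
  rw [corolla, h1]
  refine evalM_op y _ ?_ (by simp)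
  intro g hg
  simp only [List.map_replicate, List.mem_replicate] at hg
  rw [hg.2]
  exact Or.inl rfl

theorem evalM_tok_bars (n : ℕ) : evalM (tok ρ [] none (List.replicate n none)) = P.mu n := by
  rw [tok_only_bars, evalM_bars]

theorem evalM_tok_compWord {i j p q : ℕ} {x y : P.M} (hij : i ≠ j) (hi : ρ i = .inl x)
    (hj : ρ j = .inl y) (h : P.ar x = p + 1 + q) :
    evalM (tok ρ [] none (compWord i j p q (P.ar y))) = P.comp x p y := by
  have e1 : ∀ n, List.replicate n (evalM (tok ρ [] none [none])) = List.replicate n P.one := by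
    intro n
    rw [← P.mu_one, ← evalM_tok_bars (ρ := ρ) 1]
    rfl
  have hl : Leafy (fun i => colour (ρ i)) (corolla j (P.ar y)) := by
    have := leafy_corolla (col := fun i => colour (ρ i)) j
    simp only [hj] at this
    exact this
  have hv := valid_compWord (col := fun i => colour (ρ i)) (p := p) (q := q) (l := P.ar y) hij
    (by rw [hi, ← h]; rfl) (by rw [hj]; rfl)
  rw [compWord, ← weave_bars_insert, tok_weave_all hi (forall_bars_insert (leafy_bars 1) hl)
    (forall_bars_insert (by simp) (by simpa [mem_chunk] using hij)), evalM_gaps]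
  · simp only [List.map_append, List.map_cons, List.map_replicate]
    rw [e1, e1, evalM_tok_corolla hj, insertAll_single _ _ _ _ h]
  · rw [List.forall_mem_map]
    refine forall_bars_insert ?_ ?_
    · exact rfl
    · refine depth_tok ?_
      have := nested_chunk (col := fun i => colour (ρ i)) (i := j)
        (cs := List.replicate (P.ar y) 1) (by rw [hj]; simp [colour, Colour.arity])
      exact this
  · simp
    omega
  · rw [List.pairwise_append]
    refine ⟨?_, ?_, ?_⟩
    · exact List.pairwise_replicate.2 (Or.inr fun i hi => by simp at hi)
    · rw [List.pairwise_cons]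
      refine ⟨fun g hg i _ => ?_, List.pairwise_replicate.2 (Or.inr fun i hi => by simp at hi)⟩
      rw [List.eq_of_mem_replicate hg]
      simp
    · intro g hg g' _ i hi
      rw [List.eq_of_mem_replicate hg] at hi
      simp at hi

theorem evalZ_leaf (z : P.Z) : evalZ [.leaf z] = z := by
  have h : evalM (P := P) [.leaf z] = P.one := by
    have h1 := evalM_leaf (P := P) [] [] z
    have h2 := evalM_bars (P := P) 1
    rw [← P.mu_one, ← h2]
    exact h1
  rw [evalZ, h]
  exact P.one_act z

theorem tok_corolla_open {j : ℕ} {z : P.Z} (hj : ρ j = .inr z) :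
    tok ρ [] none (corolla j (P.arZ z)) = [.leaf z] := by
  rw [corolla, tok_chunk_open hj (by simp), fillZ_one _ _ _ (by omega)]

theorem tok_slotWord {s : List (Option ℕ)} {zs : List (Option P.Z)}
    (h : s.map (Option.map ρ) = zs.map (Option.map .inr)) :
    (s.map (slotWord fun i => colour (ρ i))).map (tok ρ [] none) =
      zs.map fun o => [o.elim .bar .leaf] := by
  induction s generalizing zs with
  | nil =>
    obtain rfl : zs = [] := by simpa using h.symm
    rfl
  | cons o s ih =>
    cases zs with
    | nil => simp at h
    | cons z zs =>
      simp only [List.map_cons, List.cons.injEq] at h ⊢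
      refine ⟨?_, ih h.2⟩
      cases o <;> cases z <;> simp at h
      · rfl
      · have := tok_corolla_open h.1
        rw [slotWord, h.1]
        exact this

theorem tok_actWord {i : ℕ} {x : P.M} {s : List (Option ℕ)} {zs : List (Option P.Z)}
    (hi : ρ i = .inl x) (his : some i ∉ s) (hs : s.reduceOption.Nodup)
    (hz : s.map (Option.map ρ) = zs.map (Option.map .inr)) :
    tok ρ [] none (actWord (fun i => colour (ρ i)) i s) =
      .op x :: gaps (zs.map fun o => [o.elim .bar .leaf]) := by
  rw [actWord, tok_weave_all hi, tok_slotWord hz]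
  · intro g hg
    obtain ⟨o, ho, rfl⟩ := List.mem_map.1 hg
    cases o with
    | none => exact leafy_bars 1
    | some j => exact leafy_corolla j
  · exact fun g hg hk => his (mem_slotWord.1 ⟨g, hg, hk⟩)
  · clear hz his
    induction s with
    | nil => simp
    | cons o s ih =>
      rw [List.map_cons, List.pairwise_cons]
      cases o with
      | none => exact ⟨fun g _ i hi => by simp [slotWord] at hi, ih (by simpa using hs)⟩
      | some j =>
        rw [List.reduceOption_cons_of_some, List.nodup_cons, mem_reduceOption] at hs
        refine ⟨fun g hg i hi hi' => ?_, ih hs.2⟩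
        rw [slotWord, mem_chunk] at hi
        subst hi
        exact hs.1 (mem_slotWord.1 ⟨g, hg, hi'⟩)

theorem evalZ_tok_actWord {i : ℕ} {x : P.M} {s : List (Option ℕ)} {zs : List (Option P.Z)}
    (hi : ρ i = .inl x) (h : P.ar x = s.length) (his : some i ∉ s) (hs : s.reduceOption.Nodup)
    (hz : s.map (Option.map ρ) = zs.map (Option.map .inr)) :
    evalZ (tok ρ [] none (actWord (fun i => colour (ρ i)) i s)) = P.act x zs := by
  have hl : s.length = zs.length := by simpa using congrArg List.length hz
  have e : (zs.map (slots ∘ fun o => [o.elim Tok.bar Tok.leaf])).flatten = zs := by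
    clear hz hl
    induction zs with
    | nil => rfl
    | cons o zs ih =>
      rw [List.map_cons, List.flatten_cons, ih]
      cases o <;> rfl
  rw [tok_actWord hi his hs hz, evalZ, evalM_op, slots, slots_gaps, List.map_map, e]
  · intro g hg
    obtain ⟨o, ho, rfl⟩ := List.mem_map.1 hg
    cases o with
    | none => exact Or.inl rfl
    | some z => exact Or.inr ⟨z, rfl⟩
  · simp [← hl, h]

theorem evalZ_tok_ractWord {i p q : ℕ} {z : P.Z} (l : ℕ) (hi : ρ i = .inr z)
    (h : P.arZ z = p + 1 + q) : evalZ (tok ρ [] none (ractWord i p q l)) = P.ract z p l := by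
  have h1 := nested_chunk (col := fun i => colour (ρ i)) (i := i)
    (cs := List.replicate (p + 1 + q) 1) (by rw [hi, ← h]; simp [colour, Colour.arity])
  have e : chunk i (List.replicate (p + 1 + q) 1) = _ := corolla_add i p q
  have h2 := tok_corolla_open hi
  rw [h, corolla_add] at h2
  rw [e] at h1
  rw [ractWord, evalZ_bars h1, count_none_corolla, h2, evalZ_leaf]

/-- A pair in sets is an algebra over the operad. -/
noncomputable def wordAlgebra (P : SetPair.{w}) : WordAlgebra P.toPairData where
  ev := eval
  colour_ev := colour_eval
  ev_congr _ h := eval_congr h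
  ev_corolla _ i := eval_chunk i
  ev_subst := eval_substLetter
  ev_mu _ n := congrArg Sum.inl (evalM_tok_bars n)
  mu_one := P.mu_one
  ev_comp hij hi hj h := congrArg Sum.inl (evalM_tok_compWord hij hi hj h)
  ev_act hi h his hs hz := congrArg Sum.inr (evalZ_tok_actWord hi h his hs hz)
  ev_ract l hi h := congrArg Sum.inr (evalZ_tok_ractWord l hi h)

end SetPair

/-- A morphism of pairs in sets. -/
structure PairData.Hom (D D' : PairData.{w}) where
  mapM : D.M → D'.M
  mapZ : D.Z → D'.Z
  ar_map : ∀ x, D'.ar (mapM x) = D.ar x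
  arZ_map : ∀ z, D'.arZ (mapZ z) = D.arZ z
  mu_map : ∀ n, mapM (D.mu n) = D'.mu n
  comp_map : ∀ x p y, p < D.ar x → mapM (D.comp x p y) = D'.comp (mapM x) p (mapM y)
  act_map : ∀ x zs, zs.length = D.ar x →
    mapZ (D.act x zs) = D'.act (mapM x) (zs.map (Option.map mapZ))
  ract_map : ∀ z p l, p < D.arZ z → mapZ (D.ract z p l) = D'.ract (mapZ z) p l

/-- The identity of a pair in sets. -/
def PairData.Hom.id (D : PairData.{w}) : D.Hom D where
  mapM x := x
  mapZ z := z
  ar_map _ := rfl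
  arZ_map _ := rfl
  mu_map _ := rfl
  comp_map _ _ _ _ := rfl
  act_map x zs _ := by
    have : zs.map (Option.map fun z => z) = zs := by simp
    rw [this]
  ract_map _ _ _ _ := rfl

namespace WordAlgebra

variable {D D' : PairData.{w}}

theorem colour_map (φ : D.Hom D') (e : D.M ⊕ D.Z) :
    colour (Sum.map φ.mapM φ.mapZ e) = colour e := by
  cases e with
  | inl m => exact congrArg Colour.closed (φ.ar_map m)
  | inr z => exact congrArg Colour.opened (φ.arZ_map z)

theorem exists_slots {ρ : ℕ → D.M ⊕ D.Z} {s : List (Option ℕ)}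
    (h : ∀ j, some j ∈ s → (colour (ρ j)).isOpen = true) :
    ∃ zs : List (Option D.Z), s.map (Option.map ρ) = zs.map (Option.map .inr) := by
  induction s with
  | nil => exact ⟨[], rfl⟩
  | cons o s ih =>
    obtain ⟨zs, hzs⟩ := ih fun j hj => h j (by simp [hj])
    cases o with
    | none => exact ⟨none :: zs, by simp [hzs]⟩
    | some j =>
      have := h j (by simp)
      cases hρ : ρ j with
      | inl m =>
        rw [hρ] at this
        cases this
      | inr z => exact ⟨some z :: zs, by simp [hzs, hρ]⟩

/-- A morphism of pairs respects all operations, because these are generated by the structure maps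
of the pair. -/
theorem map_ev (A : WordAlgebra D) (B : WordAlgebra D') (φ : D.Hom D') {ρ : ℕ → D.M ⊕ D.Z}
    {d : Colour} {w : Word} (h : Valid (fun i => colour (ρ i)) d w) :
    Sum.map φ.mapM φ.mapZ (A.ev ρ d w) = B.ev (Sum.map φ.mapM φ.mapZ ∘ ρ) d w := by
  have key : ∀ {col : ℕ → Colour} {d : Colour} {w : Word}, Generated col d w →
      ∀ ρ : ℕ → D.M ⊕ D.Z, (∀ i, some i ∈ w → colour (ρ i) = col i) →
        Sum.map φ.mapM φ.mapZ (A.ev ρ d w) = B.ev (Sum.map φ.mapM φ.mapZ ∘ ρ) d w := by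
    intro col d w hw
    induction hw with
    | congr _ hc ih => exact fun ρ hρ => ih ρ fun i hi => (hρ i hi).trans (hc i hi)
    | @subst col d p x y hx hy hp hd ihx ihy =>
      intro ρ hρ
      have hl := letters_substLetter (hx.valid.count p hp) hy.valid.bars
      have hρy : ∀ i, some i ∈ y → colour (ρ i) = col i := fun i hi =>
        hρ i ((hl i).2 (Or.inr hi))
      have hvy : Valid (fun i => colour (ρ i)) (col p) y := hy.valid.congr hρy
      have hc := A.colour_ev hvy
      have hρx : ∀ i, some i ∈ x →
          colour (Function.update ρ p (A.ev ρ (col p) y) i) = col i := by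
        intro i hi
        by_cases h : i = p
        · subst h
          rw [Function.update_self, hc]
        · rw [Function.update_of_ne h]
          exact hρ i ((hl i).2 (Or.inl ⟨hi, h⟩))
      have hvx : Valid (fun i => colour (Function.update ρ p (A.ev ρ (col p) y) i)) d x :=
        hx.valid.congr hρx
      have e := ihy ρ hρy
      rw [A.ev_subst hvy hvx hp hd, ihx _ hρx, Function.comp_update, e, B.ev_subst _ _ hp hd]
      · simpa only [Function.comp_apply, colour_map] using hvy
      · rw [← e, ← Function.comp_update]
        simpa only [Function.comp_apply, colour_map] using hvx
    | mu col n =>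
      intro ρ _
      rw [A.ev_mu, B.ev_mu, Sum.map_inl, φ.mu_map]
    | @comp col i j p q l hij hi hj =>
      intro ρ hρ
      have h1 := hρ i (by simp [mem_chunk])
      have h2 := hρ j (by simp [mem_chunk])
      rw [hi] at h1
      rw [hj] at h2
      cases e1 : ρ i with
      | inr z => rw [e1] at h1; cases h1
      | inl x =>
        cases e2 : ρ j with
        | inr z => rw [e2] at h2; cases h2
        | inl y =>
          rw [e1] at h1
          rw [e2] at h2
          have h3 : D.ar x = p + 1 + q := Colour.closed.inj h1
          obtain rfl : D.ar y = l := Colour.closed.inj h2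
          have e3 := B.ev_comp (ρ := Sum.map φ.mapM φ.mapZ ∘ ρ) (p := p) (q := q) hij
            (congrArg (Sum.map φ.mapM φ.mapZ) e1) (congrArg (Sum.map φ.mapM φ.mapZ) e2)
            ((φ.ar_map x).trans h3)
          rw [φ.ar_map] at e3
          rw [A.ev_comp hij e1 e2 h3, e3, Sum.map_inl, φ.comp_map _ _ _ (by omega)]
    | @act col i s n hi his hs ho hn =>
      intro ρ hρ
      subst hn
      have h1 := hρ i (mem_actWord.2 (Or.inl rfl))
      have h2 : ∀ j, some j ∈ s → colour (ρ j) = col j := fun j hj =>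
        hρ j (mem_actWord.2 (Or.inr hj))
      have e : actWord col i s = actWord (fun i => colour (ρ i)) i s := by
        rw [actWord, actWord]
        congr 1
        refine List.map_congr_left fun o ho => ?_
        cases o with
        | none => rfl
        | some j => rw [slotWord, slotWord, h2 j ho]
      obtain ⟨zs, hzs⟩ := exists_slots (ρ := ρ) (s := s) fun j hj => by rw [h2 j hj, ho j hj]
      have hl : s.length = zs.length := by simpa using congrArg List.length hzs
      rw [hi] at h1
      cases e1 : ρ i with
      | inr z => rw [e1] at h1; cases h1
      | inl x =>
        rw [e1] at h1
        have h3 : D.ar x = s.length := Colour.closed.inj h1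
        have e3 := B.ev_act (ρ := Sum.map φ.mapM φ.mapZ ∘ ρ) (zs := zs.map (Option.map φ.mapZ))
          (congrArg (Sum.map φ.mapM φ.mapZ) e1) ((φ.ar_map x).trans h3) his hs (by
            have := congrArg (List.map (Option.map (Sum.map φ.mapM φ.mapZ))) hzs
            simp only [List.map_map, Option.map_comp_map] at this ⊢
            exact this)
        simp only [Function.comp_apply, colour_map] at e3
        rw [e, A.ev_act e1 h3 his hs hzs, e3, Sum.map_inr, φ.act_map _ _ (by omega)]
    | @ract col i p q l hi =>
      intro ρ hρ
      have h1 := hρ i (by simp [mem_chunk])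
      rw [hi] at h1
      cases e1 : ρ i with
      | inl z => rw [e1] at h1; cases h1
      | inr z =>
        rw [e1] at h1
        have h3 : D.arZ z = p + 1 + q := Colour.opened.inj h1
        rw [A.ev_ract l e1 h3, B.ev_ract (ρ := Sum.map φ.mapM φ.mapZ ∘ ρ) l
          (congrArg (Sum.map φ.mapM φ.mapZ) e1) ((φ.arZ_map z).trans h3), Sum.map_inr,
          φ.ract_map _ _ _ (by omega)]
  exact key h.generated ρ fun i _ => rfl

/-- An algebra over the operad is determined by the pair. -/
theorem ev_eq (A B : WordAlgebra D) {ρ : ℕ → D.M ⊕ D.Z} {d : Colour} {w : Word}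
    (h : Valid (fun i => colour (ρ i)) d w) : A.ev ρ d w = B.ev ρ d w := by
  have h1 := map_ev A B (.id D) h
  have h2 : Sum.map (PairData.Hom.id D).mapM (PairData.Hom.id D).mapZ = id := Sum.map_id_id
  rwa [h2] at h1

end WordAlgebra

/-! ### Families of elements that detect equality of morphisms -/

section

variable {C : Type u} [Category.{v} C] [MonoidalCategory C] [SymmetricCategory C]

/-- A property of elements of `A` that holds for a generic element of `A`: for an isomorphism
`T r ≅ A`, as an element of the realization that is corepresented by a comonoidal family `T`. -/
structure Dense (A : C) (S : ∀ Φ : Realization C, Φ.el A → Prop) : Prop where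
  exists_generic : ∃ (𝒮 : Support C) (r : 𝒮.R) (e : 𝒮.T r ≅ A), S 𝒮.realization ⟨r, e.hom⟩
  /-- the property persists when further generic elements are added -/
  inr : ∀ (𝒮 𝒮' : Support C) (x : 𝒮'.realization.el A), S 𝒮'.realization x →
    S (𝒮.prod 𝒮').realization (Support.inr 𝒮 𝒮' x)

namespace Dense

/-- Morphisms that agree on the elements with a dense property agree on a generic element. -/
theorem hom_ext {A B : C} {S : ∀ Φ : Realization C, Φ.el A → Prop} (h : Dense A S) {f g : A ⟶ B}
    (hfg : ∀ (Φ : Realization C) (a : Φ.el A), S Φ a → Φ.map f a = Φ.map g a) : f = g := by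
  obtain ⟨𝒮, r, e, he⟩ := h.exists_generic
  have h2 : e.hom ≫ f = e.hom ≫ g := eq_of_heq (Sigma.mk.inj (hfg 𝒮.realization _ he)).2
  exact (cancel_epi e.hom).1 h2

theorem unit : Dense (𝟙_ C) fun Φ x => x = Φ.unit :=
  ⟨⟨Support.trivial, PUnit.unit, Iso.refl _, rfl⟩, by
    rintro 𝒮 𝒮' _ rfl
    exact Support.inr_unit 𝒮 𝒮'⟩

theorem of_iso {A B : C} {S : ∀ Φ : Realization C, Φ.el A → Prop} (h : Dense A S) (i : A ≅ B) :
    Dense B fun Φ x => ∃ a, S Φ a ∧ x = Φ.map i.hom a := by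
  obtain ⟨⟨𝒮, r, e, he⟩, h2⟩ := h
  refine ⟨⟨𝒮, r, e ≪≫ i, _, he, rfl⟩, ?_⟩
  rintro 𝒮 𝒮' _ ⟨a, ha, rfl⟩
  refine ⟨_, h2 _ _ _ ha, ?_⟩
  have e' : 𝒮.counit ▷ 𝒮'.T a.1 ≫ (λ_ (𝒮'.T a.1)).hom ≫ a.2 ≫ i.hom =
      (𝒮.counit ▷ 𝒮'.T a.1 ≫ (λ_ (𝒮'.T a.1)).hom ≫ a.2) ≫ i.hom := by simp
  exact congrArg (fun f => (⟨(0, a.1), f⟩ : (𝒮.prod 𝒮').realization.el _)) e'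

theorem congr {A : C} {S S' : ∀ Φ : Realization C, Φ.el A → Prop} (h : Dense A S)
    (hS : ∀ Φ a, S Φ a ↔ S' Φ a) : Dense A S' := by
  obtain rfl : S = S' := by
    funext Φ a
    exact propext (hS Φ a)
  exact h

theorem unit_tensor {A : C} {S : ∀ Φ : Realization C, Φ.el A → Prop} (h : Dense A S) :
    Dense (𝟙_ C ⊗ A) fun Φ x => ∃ a, S Φ a ∧ x = Φ.pair Φ.unit a :=
  (h.of_iso (λ_ A).symm).congr fun Φ a => by
    simp only [Iso.symm_hom, Φ.map_leftUnitor_inv]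

variable [HasInitial C]

theorem atom (A : C) : Dense A fun _ _ => True :=
  ⟨⟨Support.var A, (1 : ℕ), Iso.refl A, trivial⟩, fun _ _ _ _ => trivial⟩

/-- The pairs of elements are dense in a tensor product: a generic element of `A` and one of `B`, in
the product of their families, form a generic element of `A ⊗ B`. -/
theorem tensor (A : C) {B : C} {S : ∀ Φ : Realization C, Φ.el B → Prop} (h : Dense B S) :
    Dense (A ⊗ B) fun Φ x => ∃ a b, S Φ b ∧ x = Φ.pair a b := by
  obtain ⟨⟨𝒮, r, e, he⟩, h2⟩ := h
  refine ⟨⟨(Support.var A).prod 𝒮, ((1 : ℕ), r), whiskerLeftIso A e, ?_⟩, ?_⟩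
  · refine ⟨Support.inl _ _ ⟨(1 : ℕ), 𝟙 A⟩, Support.inr _ _ ⟨r, e.hom⟩, h2 _ _ _ he, ?_⟩
    refine Eq.trans ?_ (Support.inl_pair_inr (Support.var A) 𝒮 (1 : ℕ) r (𝟙 A) e.hom).symm
    exact congrArg (fun f => (⟨((1 : ℕ), r), f⟩ : ((Support.var A).prod 𝒮).realization.el _))
      (id_tensorHom _ _).symm
  · rintro 𝒮 𝒮' _ ⟨a, b, hb, rfl⟩
    exact ⟨_, _, h2 _ _ _ hb, Support.inr_pair _ _ _ _⟩

theorem tensorList {κ : Type} (X : κ → C) : ∀ l : List κ,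
    Dense (tensorList X l) fun Φ x => ∃ t : ElList Φ X l, x = t.pure
  | [] => unit.congr fun Φ a => by
    constructor
    · rintro rfl
      exact ⟨.nil, rfl⟩
    · rintro ⟨t, rfl⟩
      cases t
      rfl
  | a :: l => (tensor (X a) (tensorList X l)).congr fun Φ b => by
    constructor
    · rintro ⟨x, _, ⟨t, rfl⟩, rfl⟩
      exact ⟨.cons x t, rfl⟩
    · rintro ⟨t, rfl⟩
      cases t with
      | cons x t => exact ⟨x, _, ⟨t, rfl⟩, rfl⟩

end Dense

theorem hom_ext_unit {B : C} {f g : 𝟙_ C ⟶ B}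
    (h : ∀ Φ : Realization C, Φ.map f Φ.unit = Φ.map g Φ.unit) : f = g :=
  Dense.unit.hom_ext fun Φ a ha => by rw [ha, h]

theorem hom_ext_unit_unit {D : C} {f g : 𝟙_ C ⊗ 𝟙_ C ⟶ D} (h : ∀ Φ : Realization C,
    Φ.map f (Φ.pair Φ.unit Φ.unit) = Φ.map g (Φ.pair Φ.unit Φ.unit)) : f = g :=
  Dense.unit.unit_tensor.hom_ext fun Φ _ ⟨_, hb, e⟩ => by rw [e, hb, h]

variable [HasInitial C]

theorem hom_ext_el {A B : C} {f g : A ⟶ B}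
    (h : ∀ (Φ : Realization C) (a : Φ.el A), Φ.map f a = Φ.map g a) : f = g :=
  (Dense.atom A).hom_ext fun Φ a _ => h Φ a

/-- Morphisms out of a tensor product are determined by their values on elements. -/
theorem hom_ext_tensorList {κ : Type} {X : κ → C} {l : List κ} {B : C} {f g : tensorList X l ⟶ B}
    (h : ∀ (Φ : Realization C) (t : ElList Φ X l), Φ.map f t.pure = Φ.map g t.pure) : f = g :=
  (Dense.tensorList X l).hom_ext fun Φ _ ⟨t, e⟩ => by rw [e, h]

theorem hom_ext_pair_unit {A D : C} {f g : A ⊗ 𝟙_ C ⟶ D} (h : ∀ (Φ : Realization C) (a : Φ.el A),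
    Φ.map f (Φ.pair a Φ.unit) = Φ.map g (Φ.pair a Φ.unit)) : f = g :=
  (Dense.tensor A Dense.unit).hom_ext fun Φ _ ⟨_, _, hb, e⟩ => by rw [e, hb, h]

theorem hom_ext_unit_pair {A D : C} {f g : 𝟙_ C ⊗ A ⟶ D} (h : ∀ (Φ : Realization C) (a : Φ.el A),
    Φ.map f (Φ.pair Φ.unit a) = Φ.map g (Φ.pair Φ.unit a)) : f = g :=
  (Dense.atom A).unit_tensor.hom_ext fun Φ _ ⟨_, _, e⟩ => by rw [e, h]

theorem hom_ext_pair_pair {A B D E : C} {f g : (A ⊗ B) ⊗ D ⟶ E}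
    (h : ∀ (Φ : Realization C) (a : Φ.el A) (b : Φ.el B) (d : Φ.el D),
      Φ.map f (Φ.pair (Φ.pair a b) d) = Φ.map g (Φ.pair (Φ.pair a b) d)) : f = g :=
  ((Dense.tensor A (Dense.tensor B (Dense.atom D))).of_iso (α_ A B D).symm).hom_ext
    fun Φ _ ⟨_, ⟨_, _, ⟨_, _, _, e⟩, e'⟩, e''⟩ => by
      rw [e'', e', e, Iso.symm_hom, Φ.map_assoc_inv, h]

theorem hom_ext_pair_unit_unit {A E : C} {f g : (A ⊗ 𝟙_ C) ⊗ 𝟙_ C ⟶ E}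
    (h : ∀ (Φ : Realization C) (a : Φ.el A),
      Φ.map f (Φ.pair (Φ.pair a Φ.unit) Φ.unit) = Φ.map g (Φ.pair (Φ.pair a Φ.unit) Φ.unit)) :
    f = g :=
  ((Dense.tensor A (Dense.unit_tensor Dense.unit)).of_iso (α_ A (𝟙_ C) (𝟙_ C)).symm).hom_ext
    fun Φ _ ⟨_, ⟨_, _, ⟨_, hb, e⟩, e'⟩, e''⟩ => by
      rw [e'', e', e, hb, Iso.symm_hom, Φ.map_assoc_inv, h]

end

/-! ### The elements of a pair -/

section

variable {C : Type u} [Category.{v} C] [MonoidalCategory C] [SymmetricCategory C]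

/-- The elements that are inserted in a wide action. -/
inductive SlotList (Φ : Realization C) (Z : ℕ → C) : Slots → Type v
  | nil : SlotList Φ Z []
  | bar {s : Slots} : SlotList Φ Z s → SlotList Φ Z (none :: s)
  | cons {l : ℕ} {s : Slots} : Φ.el (Z l) → SlotList Φ Z s → SlotList Φ Z (some l :: s)

namespace SlotList

variable {Φ : Realization C} {Z : ℕ → C}

/-- The factors of an insertion, where the factor of an input that remains is the unit. -/
def toEl : ∀ {s : Slots}, SlotList Φ Z s → ElList Φ (slotFamily Z) s
  | _, nil => .nil
  | _, bar t => .cons (a := none) Φ.unit t.toEl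
  | _, cons x t => .cons (a := some _) x t.toEl

/-- The underlying list. -/
def toList : ∀ {s : Slots}, SlotList Φ Z s → List (Option (Σ n, Φ.el (Z n)))
  | _, nil => []
  | _, bar t => none :: t.toList
  | _, cons x t => some ⟨_, x⟩ :: t.toList

/-- The list of elements that is given by a list of elements of arbitrary arities. -/
def ofList : List (Option (Σ n, Φ.el (Z n))) → Σ s, SlotList Φ Z s
  | [] => ⟨[], nil⟩
  | none :: zs => ⟨none :: (ofList zs).1, bar (ofList zs).2⟩
  | some z :: zs => ⟨some z.1 :: (ofList zs).1, cons z.2 (ofList zs).2⟩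

theorem ofList_toList : ∀ {s : Slots} (t : SlotList Φ Z s), ofList t.toList = ⟨s, t⟩
  | _, nil => rfl
  | _, bar t => by rw [toList, ofList, ofList_toList t]
  | _, cons x t => by rw [toList, ofList, ofList_toList t]

theorem toList_ofList (zs : List (Option (Σ n, Φ.el (Z n)))) : (ofList zs).2.toList = zs := by
  induction zs with
  | nil => rfl
  | cons o zs ih => cases o <;> simp [ofList, toList, ih]

theorem exists_toList (zs : List (Option (Σ n, Φ.el (Z n)))) :
    ∃ (s : Slots) (t : SlotList Φ Z s), t.toList = zs := ⟨_, _, toList_ofList zs⟩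

theorem length_toList : ∀ {s : Slots} (t : SlotList Φ Z s), t.toList.length = s.length
  | _, nil => rfl
  | _, bar t => by simp [toList, length_toList t]
  | _, cons x t => by simp [toList, length_toList t]

theorem totalArity_toList : ∀ {s : Slots} (t : SlotList Φ Z s),
    totalArity Sigma.fst t.toList = s.total
  | _, nil => rfl
  | _, bar t => by simp [toList, totalArity, Slots.total, totalArity_toList t]
  | _, cons x t => by simp [toList, totalArity, Slots.total, totalArity_toList t]

/-- The concatenation of lists of inserted elements. -/
def append : ∀ {s s' : Slots}, SlotList Φ Z s → SlotList Φ Z s' → SlotList Φ Z (s ++ s')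
  | _, _, nil, t' => t'
  | _, _, bar t, t' => bar (t.append t')
  | _, _, cons x t, t' => cons x (t.append t')

theorem toList_append : ∀ {s s' : Slots} (t : SlotList Φ Z s) (t' : SlotList Φ Z s'),
    (t.append t').toList = t.toList ++ t'.toList
  | _, _, nil, _ => rfl
  | _, _, bar t, t' => by simp [append, toList, toList_append t t']
  | _, _, cons x t, t' => by simp [append, toList, toList_append t t']

theorem toEl_append : ∀ {s s' : Slots} (t : SlotList Φ Z s) (t' : SlotList Φ Z s'),
    (t.append t').toEl = t.toEl.append t'.toEl
  | _, _, nil, _ => rfl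
  | _, _, bar t, t' => by simp [append, toEl, ElList.append, toEl_append t t']
  | _, _, cons x t, t' => by simp [append, toEl, ElList.append, toEl_append t t']

theorem exists_append : ∀ (s : Slots) {s' : Slots} (t : SlotList Φ Z (s ++ s')),
    ∃ (t₁ : SlotList Φ Z s) (t₂ : SlotList Φ Z s'), t = t₁.append t₂
  | [], _, t => ⟨nil, t, rfl⟩
  | none :: s, _, t => by
    cases t with
    | bar t =>
      obtain ⟨t₁, t₂, rfl⟩ := exists_append s t
      exact ⟨bar t₁, t₂, rfl⟩
  | some l :: s, _, t => by
    cases t with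
    | cons x t =>
      obtain ⟨t₁, t₂, rfl⟩ := exists_append s t
      exact ⟨cons x t₁, t₂, rfl⟩

/-- The list without inserted elements. -/
def bars (Φ : Realization C) (Z : ℕ → C) : ∀ n : ℕ, SlotList Φ Z (List.replicate n none)
  | 0 => nil
  | n + 1 => bar (bars Φ Z n)

theorem toList_bars (n : ℕ) : (bars Φ Z n).toList = List.replicate n none := by
  induction n with
  | zero => rfl
  | succ n ih => simp [bars, toList, ih, List.replicate_succ]

theorem unitSlots_pure (n : ℕ) : Φ.map (unitSlots Z n) Φ.unit = (bars Φ Z n).toEl.pure := by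
  induction n with
  | zero => exact Φ.map_id _
  | succ n ih =>
    rw [unitSlots, Φ.map_comp, Φ.map_leftUnitor_inv, Φ.map_whiskerLeft, ih]
    rfl

/-- The image of a list of inserted elements under a family of morphisms. -/
def map {Z' : ℕ → C} (g : ∀ n, Z n ⟶ Z' n) : ∀ {s : Slots}, SlotList Φ Z s → SlotList Φ Z' s
  | _, nil => nil
  | _, bar t => bar (t.map g)
  | _, cons x t => cons (Φ.map (g _) x) (t.map g)

theorem toEl_map {Z' : ℕ → C} (g : ∀ n, Z n ⟶ Z' n) : ∀ {s : Slots} (t : SlotList Φ Z s),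
    (t.map g).toEl = t.toEl.map (slotMap g)
  | _, nil => rfl
  | _, bar t => by
    change ElList.cons (a := none) Φ.unit (t.map g).toEl =
      .cons (Φ.map (slotMap g none) Φ.unit) (t.toEl.map (slotMap g))
    rw [toEl_map g t, show Φ.map (slotMap g none) Φ.unit = Φ.unit from Φ.map_id _]
  | _, cons x t => by
    change ElList.cons (a := some _) (Φ.map (g _) x) (t.map g).toEl =
      .cons (Φ.map (slotMap g (some _)) x) (t.toEl.map (slotMap g))
    rw [toEl_map g t]
    rfl

theorem toList_map {Z' : ℕ → C} (g : ∀ n, Z n ⟶ Z' n) : ∀ {s : Slots} (t : SlotList Φ Z s),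
    (t.map g).toList = t.toList.map (Option.map fun z => ⟨z.1, Φ.map (g z.1) z.2⟩)
  | _, nil => rfl
  | _, bar t => by simp [map, toList, toList_map g t]
  | _, cons x t => by simp [map, toList, toList_map g t]

end SlotList

theorem Dense.slotTensor [HasInitial C] (Z : ℕ → C) : ∀ s : Slots,
    Dense (slotTensor Z s) fun Φ x => ∃ t : SlotList Φ Z s, x = t.toEl.pure
  | [] => Dense.unit.congr fun Φ a => by
    constructor
    · rintro rfl
      exact ⟨.nil, rfl⟩
    · rintro ⟨t, rfl⟩
      cases t
      rfl
  | none :: s => (Dense.slotTensor Z s).unit_tensor.congr fun Φ b => by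
    constructor
    · rintro ⟨_, ⟨t, rfl⟩, rfl⟩
      exact ⟨.bar t, rfl⟩
    · rintro ⟨t, rfl⟩
      cases t with
      | bar t => exact ⟨_, ⟨t, rfl⟩, rfl⟩
  | some l :: s => (Dense.tensor (Z l) (Dense.slotTensor Z s)).congr fun Φ b => by
    constructor
    · rintro ⟨x, _, ⟨t, rfl⟩, rfl⟩
      exact ⟨.cons x t, rfl⟩
    · rintro ⟨t, rfl⟩
      cases t with
      | cons x t => exact ⟨x, _, ⟨t, rfl⟩, rfl⟩

theorem hom_ext_pair_slots [HasInitial C] {A B : C} {Z : ℕ → C} {s : Slots}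
    {f g : A ⊗ slotTensor Z s ⟶ B} (h : ∀ (Φ : Realization C) (a : Φ.el A) (t : SlotList Φ Z s),
      Φ.map f (Φ.pair a t.toEl.pure) = Φ.map g (Φ.pair a t.toEl.pure)) : f = g :=
  (Dense.tensor A (Dense.slotTensor Z s)).hom_ext fun Φ _ ⟨_, _, ⟨_, e⟩, e'⟩ => by rw [e', e, h]

theorem hom_ext_pair_pair_slots [HasInitial C] {A A' B : C} {Z : ℕ → C} {s : Slots}
    {f g : A ⊗ (A' ⊗ slotTensor Z s) ⟶ B}
    (h : ∀ (Φ : Realization C) (a : Φ.el A) (b : Φ.el A') (t : SlotList Φ Z s),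
      Φ.map f (Φ.pair a (Φ.pair b t.toEl.pure)) = Φ.map g (Φ.pair a (Φ.pair b t.toEl.pure))) :
    f = g :=
  (Dense.tensor A (Dense.tensor A' (Dense.slotTensor Z s))).hom_ext
    fun Φ _ ⟨_, _, ⟨_, _, ⟨_, e⟩, e'⟩, e''⟩ => by rw [e'', e', e, h]

theorem hom_ext_pair_unit_slots [HasInitial C] {A B : C} {Z : ℕ → C} {s : Slots}
    {f g : A ⊗ (𝟙_ C ⊗ slotTensor Z s) ⟶ B}
    (h : ∀ (Φ : Realization C) (a : Φ.el A) (t : SlotList Φ Z s),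
      Φ.map f (Φ.pair a (Φ.pair Φ.unit t.toEl.pure)) =
        Φ.map g (Φ.pair a (Φ.pair Φ.unit t.toEl.pure))) : f = g :=
  (Dense.tensor A (Dense.slotTensor Z s).unit_tensor).hom_ext
    fun Φ _ ⟨_, _, ⟨_, ⟨_, e⟩, e'⟩, e''⟩ => by rw [e'', e', e, h]

variable (C) in
/-- The structure maps of a pair `(M, Z)`, without the maps `ι`, which are the actions on no
elements of `Z`. -/
structure RawPair where
  M : ℕ → C
  Z : ℕ → C
  one : 𝟙_ C ⟶ M 1
  mu : ∀ l, 𝟙_ C ⟶ M l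
  comp : ∀ (p q : ℕ) {n l r : ℕ}, n = p + 1 + q → r = p + l + q → (M n ⊗ M l ⟶ M r)
  act : ∀ (s : Slots) {k n : ℕ}, k = s.length → n = s.total → (M k ⊗ slotTensor Z s ⟶ Z n)
  ract : ∀ (p q : ℕ) {n l r : ℕ}, n = p + 1 + q → r = p + l + q → (Z n ⊗ 𝟙_ C ⟶ Z r)

namespace RawPair

variable (R : RawPair C)

/-- The axioms of a pair. -/
structure Laws : Prop where
  one_comp : ∀ (l : ℕ) (h : 1 = 0 + 1 + 0) (h' : l = 0 + l + 0),
    R.one ▷ R.M l ≫ R.comp 0 0 h h' = (λ_ (R.M l)).hom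
  comp_one : ∀ (p q n : ℕ) (h : n = p + 1 + q) (h' : n = p + 1 + q),
    R.M n ◁ R.one ≫ R.comp p q h h' = (ρ_ (R.M n)).hom
  comp_assoc : ∀ (p q p' q' n l k s t r : ℕ) (h₁ : n = p + 1 + q) (h₂ : s = p + l + q)
    (h₃ : s = p + p' + 1 + (q' + q)) (h₄ : r = p + p' + k + (q' + q)) (h₅ : l = p' + 1 + q')
    (h₆ : t = p' + k + q') (h₇ : r = p + t + q),
    R.comp p q h₁ h₂ ▷ R.M k ≫ R.comp (p + p') (q' + q) h₃ h₄ =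
      (α_ (R.M n) (R.M l) (R.M k)).hom ≫ R.M n ◁ R.comp p' q' h₅ h₆ ≫ R.comp p q h₁ h₇
  comp_comm : ∀ (p m q n l k s t r : ℕ) (h₁ : n = p + 1 + (m + 1 + q))
    (h₂ : s = p + l + (m + 1 + q)) (h₃ : s = p + l + m + 1 + q) (h₄ : r = p + l + m + k + q)
    (h₅ : n = p + 1 + m + 1 + q) (h₆ : t = p + 1 + m + k + q) (h₇ : t = p + 1 + (m + k + q))
    (h₈ : r = p + l + (m + k + q)),
    R.comp p (m + 1 + q) h₁ h₂ ▷ R.M k ≫ R.comp (p + l + m) q h₃ h₄ =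
      (α_ (R.M n) (R.M l) (R.M k)).hom ≫ R.M n ◁ (β_ (R.M l) (R.M k)).hom ≫
        (α_ (R.M n) (R.M k) (R.M l)).inv ≫ R.comp (p + 1 + m) q h₅ h₆ ▷ R.M l ≫
          R.comp p (m + k + q) h₇ h₈
  mu_one : 𝟙 _ ≫ R.mu 1 = R.one
  mu_comp : ∀ (p q n l r : ℕ) (h : n = p + 1 + q) (h' : r = p + l + q),
    (λ_ (𝟙_ C)).hom ≫ R.mu r = (R.mu n ⊗ₘ R.mu l) ≫ R.comp p q h h'
  one_act : ∀ (n : ℕ) (h : 1 = [some n].length) (h' : n = Slots.total [some n]),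
    (ρ_ (R.Z n)).inv ≫ (λ_ (R.Z n ⊗ 𝟙_ C)).inv ≫ R.one ▷ (R.Z n ⊗ 𝟙_ C) ≫ R.act [some n] h h' =
      𝟙 (R.Z n)
  act_act : ∀ (pre mid post : Slots) (k j t n m : ℕ) (h₁ : j = mid.length) (h₂ : t = mid.total)
    (h₃ : k = (pre ++ some t :: post).length) (h₄ : n = (pre ++ some t :: post).total)
    (h₅ : k = pre.length + 1 + post.length) (h₆ : m = pre.length + j + post.length)
    (h₇ : m = (pre ++ (mid ++ post)).length) (h₈ : n = (pre ++ (mid ++ post)).total),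
    R.M k ◁ plugAt (slotFamily R.Z) pre mid post (some t) (R.M j) (R.act mid h₁ h₂) ≫
        R.act (pre ++ some t :: post) h₃ h₄ =
      (α_ (R.M k) (R.M j) (slotTensor R.Z (pre ++ (mid ++ post)))).inv ≫
        R.comp pre.length post.length h₅ h₆ ▷ slotTensor R.Z (pre ++ (mid ++ post)) ≫
          R.act (pre ++ (mid ++ post)) h₇ h₈
  ract_one : ∀ (p q n : ℕ) (h : n = p + 1 + q) (h' : n = p + 1 + q),
    R.Z n ◁ 𝟙 (𝟙_ C) ≫ R.ract (l := 1) p q h h' = (ρ_ (R.Z n)).hom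
  ract_assoc : ∀ (p q p' q' n l k s t r : ℕ) (h₁ : n = p + 1 + q) (h₂ : s = p + l + q)
    (h₃ : s = p + p' + 1 + (q' + q)) (h₄ : r = p + p' + k + (q' + q)) (_ : l = p' + 1 + q')
    (_ : t = p' + k + q') (h₇ : r = p + t + q),
    R.ract p q h₁ h₂ ▷ 𝟙_ C ≫ R.ract (p + p') (q' + q) h₃ h₄ =
      (α_ (R.Z n) (𝟙_ C) (𝟙_ C)).hom ≫ R.Z n ◁ (λ_ (𝟙_ C)).hom ≫ R.ract p q h₁ h₇
  ract_comm : ∀ (p m q n l k s t r : ℕ) (h₁ : n = p + 1 + (m + 1 + q))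
    (h₂ : s = p + l + (m + 1 + q)) (h₃ : s = p + l + m + 1 + q) (h₄ : r = p + l + m + k + q)
    (h₅ : n = p + 1 + m + 1 + q) (h₆ : t = p + 1 + m + k + q) (h₇ : t = p + 1 + (m + k + q))
    (h₈ : r = p + l + (m + k + q)),
    R.ract p (m + 1 + q) h₁ h₂ ▷ 𝟙_ C ≫ R.ract (p + l + m) q h₃ h₄ =
      (α_ (R.Z n) (𝟙_ C) (𝟙_ C)).hom ≫ R.Z n ◁ (β_ (𝟙_ C) (𝟙_ C)).hom ≫
        (α_ (R.Z n) (𝟙_ C) (𝟙_ C)).inv ≫ R.ract (p + 1 + m) q h₅ h₆ ▷ 𝟙_ C ≫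
          R.ract p (m + k + q) h₇ h₈
  inner : ∀ (pre post : Slots) (p q k l t t' n r : ℕ) (h₁ : t = p + 1 + q) (h₂ : t' = p + l + q)
    (h₃ : k = (pre ++ some t :: post).length) (h₄ : n = (pre ++ some t :: post).total)
    (h₅ : k = (pre ++ some t' :: post).length) (h₆ : r = (pre ++ some t' :: post).total)
    (h₇ : n = pre.total + p + 1 + (q + post.total))
    (h₈ : r = pre.total + p + l + (q + post.total)),
    R.M k ◁ (β_ (𝟙_ C) (slotTensor R.Z (pre ++ some t :: post))).hom ≫
        (α_ (R.M k) (slotTensor R.Z (pre ++ some t :: post)) (𝟙_ C)).inv ≫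
          R.act (pre ++ some t :: post) h₃ h₄ ▷ 𝟙_ C ≫
            R.ract (pre.total + p) (q + post.total) h₇ h₈ =
      R.M k ◁ plugAt (slotFamily R.Z) pre [some t] post (some t') (𝟙_ C)
          (𝟙_ C ◁ (ρ_ (R.Z t)).hom ≫ (β_ (𝟙_ C) (R.Z t)).hom ≫ R.ract p q h₁ h₂) ≫
        R.act (pre ++ some t' :: post) h₅ h₆
  outer : ∀ (pre post : Slots) (k l m n r : ℕ)
    (h₁ : k = (pre ++ none :: post).length) (h₂ : n = (pre ++ none :: post).total)
    (h₃ : n = pre.total + 1 + post.total) (h₄ : r = pre.total + l + post.total)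
    (h₅ : k = pre.length + 1 + post.length) (h₆ : m = pre.length + l + post.length)
    (h₇ : m = (pre ++ (List.replicate l none ++ post)).length)
    (h₈ : r = (pre ++ (List.replicate l none ++ post)).total),
    R.M k ◁ (β_ (𝟙_ C) (slotTensor R.Z (pre ++ none :: post))).hom ≫
        (α_ (R.M k) (slotTensor R.Z (pre ++ none :: post)) (𝟙_ C)).inv ≫
          R.act (pre ++ none :: post) h₁ h₂ ▷ 𝟙_ C ≫ R.ract pre.total post.total h₃ h₄ =
      (α_ (R.M k) (𝟙_ C) (slotTensor R.Z (pre ++ none :: post))).inv ≫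
        (R.M k ◁ R.mu l ≫ R.comp pre.length post.length h₅ h₆) ▷
            slotTensor R.Z (pre ++ none :: post) ≫
          R.M m ◁ expandSlot R.Z pre post l ≫ R.act (pre ++ (List.replicate l none ++ post)) h₇ h₈

variable (Φ : Realization C)

/-- The elements of the objects of a pair. The values of the operations where they have no meaning
are irrelevant. -/
@[reducible]
def data : PairData.{v} where
  M := Σ n, Φ.el (R.M n)
  Z := Σ n, Φ.el (R.Z n)
  ar := Sigma.fst
  arZ := Sigma.fst
  one := ⟨1, Φ.map R.one Φ.unit⟩
  mu l := ⟨l, Φ.map (R.mu l) Φ.unit⟩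
  comp x p y :=
    if h : p < x.1 then
      ⟨p + y.1 + (x.1 - 1 - p),
        Φ.map (R.comp p (x.1 - 1 - p) (by omega) rfl) (Φ.pair x.2 y.2)⟩
    else x
  act x zs :=
    if h : x.1 = (SlotList.ofList zs).1.length then
      ⟨_, Φ.map (R.act (SlotList.ofList zs).1 h rfl) (Φ.pair x.2 (SlotList.ofList zs).2.toEl.pure)⟩
    else
      ⟨_, Φ.map (R.act (List.replicate x.1 none) (by simp) rfl)
        (Φ.pair x.2 (SlotList.bars Φ R.Z x.1).toEl.pure)⟩
  ract z p l :=
    if h : p < z.1 then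
      ⟨p + l + (z.1 - 1 - p),
        Φ.map (R.ract p (z.1 - 1 - p) (by omega) rfl) (Φ.pair z.2 Φ.unit)⟩
    else z

variable {R Φ}

theorem data_comp (p q : ℕ) {n l r : ℕ} (h : n = p + 1 + q) (h' : r = p + l + q)
    (a : Φ.el (R.M n)) (b : Φ.el (R.M l)) :
    (R.data Φ).comp ⟨n, a⟩ p ⟨l, b⟩ = ⟨r, Φ.map (R.comp p q h h') (Φ.pair a b)⟩ := by
  have key : ∀ q' (hq : n = p + 1 + q'), (⟨p + l + q', Φ.map (R.comp p q' hq rfl) (Φ.pair a b)⟩ :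
      (R.data Φ).M) = ⟨r, Φ.map (R.comp p q h h') (Φ.pair a b)⟩ := by
    intro q' hq
    obtain rfl : q' = q := by omega
    subst h'
    rfl
  refine Eq.trans ?_ (key (n - 1 - p) (by omega))
  exact dif_pos (show p < n by omega)

theorem data_ract (p q : ℕ) {n l r : ℕ} (h : n = p + 1 + q) (h' : r = p + l + q)
    (a : Φ.el (R.Z n)) :
    (R.data Φ).ract ⟨n, a⟩ p l = ⟨r, Φ.map (R.ract p q h h') (Φ.pair a Φ.unit)⟩ := by
  have key : ∀ q' (hq : n = p + 1 + q'),
      (⟨p + l + q', Φ.map (R.ract p q' hq rfl) (Φ.pair a Φ.unit)⟩ : (R.data Φ).Z) =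
        ⟨r, Φ.map (R.ract p q h h') (Φ.pair a Φ.unit)⟩ := by
    intro q' hq
    obtain rfl : q' = q := by omega
    subst h'
    rfl
  refine Eq.trans ?_ (key (n - 1 - p) (by omega))
  exact dif_pos (show p < n by omega)

theorem data_act {s : Slots} {k n : ℕ} (h : k = s.length) (h' : n = s.total)
    (a : Φ.el (R.M k)) (t : SlotList Φ R.Z s) :
    (R.data Φ).act ⟨k, a⟩ t.toList = ⟨n, Φ.map (R.act s h h') (Φ.pair a t.toEl.pure)⟩ := by
  have key : ∀ T : Σ s, SlotList Φ R.Z s, T = ⟨s, t⟩ → ∀ hT : k = T.1.length,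
      (⟨_, Φ.map (R.act T.1 hT rfl) (Φ.pair a T.2.toEl.pure)⟩ : (R.data Φ).Z) =
        ⟨n, Φ.map (R.act s h h') (Φ.pair a t.toEl.pure)⟩ := by
    rintro _ rfl hT
    subst h'
    rfl
  have e := t.ofList_toList
  have hT : k = (SlotList.ofList t.toList).1.length := by rw [e, h]
  refine Eq.trans ?_ (key _ e hT)
  exact dif_pos hT

theorem sigma_inj {F : ℕ → Type v} {n : ℕ} {a b : F n} (h : (⟨n, a⟩ : Σ n, F n) = ⟨n, b⟩) :
    a = b := eq_of_heq (Sigma.mk.inj h).2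

end RawPair

end

/-! ### Pairs in terms of elements -/

section

variable {C : Type u} [Category.{v} C] [MonoidalCategory C] [SymmetricCategory C]

theorem exists_eq_of_lt {p n : ℕ} (h : p < n) : ∃ q, n = p + 1 + q :=
  ⟨n - p - 1, by omega⟩

section

variable {Φ : Realization C} {Z : ℕ → C}

theorem plugAt_slots {pre mid post : Slots} {t : ℕ} {W : C}
    (f : W ⊗ slotTensor Z mid ⟶ Z t) (b : Φ.el W) (t₁ : SlotList Φ Z pre)
    (t₂ : SlotList Φ Z mid) (t₃ : SlotList Φ Z post) :
    Φ.map (plugAt (slotFamily Z) pre mid post (some t) W f)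
        (Φ.pair b (t₁.append (t₂.append t₃)).toEl.pure) =
      (t₁.append (.cons (Φ.map f (Φ.pair b t₂.toEl.pure)) t₃)).toEl.pure := by
  rw [SlotList.toEl_append, SlotList.toEl_append, SlotList.toEl_append]
  exact ElList.plugAt_pure (c := some t) f b t₁.toEl t₂.toEl t₃.toEl

theorem expandSlot_pure {pre post : Slots} (l : ℕ) (t₁ : SlotList Φ Z pre)
    (t₃ : SlotList Φ Z post) :
    Φ.map (expandSlot Z pre post l) (t₁.append (.bar t₃)).toEl.pure =
      (t₁.append ((SlotList.bars Φ Z l).append t₃)).toEl.pure := by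
  rw [SlotList.toEl_append, SlotList.toEl_append, SlotList.toEl_append]
  simp only [expandSlot, Φ.map_comp]
  rw [ElList.tensorAppend_pure, Φ.map_whiskerLeft, Φ.map_comp]
  simp only [SlotList.toEl, ElList.pure]
  rw [Φ.map_whiskerRight, SlotList.unitSlots_pure, ElList.tensorAppend_inv_pure,
    ElList.tensorAppend_inv_pure]

end

theorem total_append (s₁ s₂ : Slots) : Slots.total (s₁ ++ s₂) = s₁.total + s₂.total := by
  induction s₁ with
  | nil => simp [Slots.total]
  | cons o s ih => cases o <;> simp [Slots.total, ih] <;> omega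

namespace RawPair

/-- The elements of a pair form a pair in sets. -/
@[reducible]
def Laws.setPair {X : RawPair C} (hX : X.Laws) (Φ : Realization C) : SetPair.{v} where
  toPairData := X.data Φ
  ar_one := rfl
  ar_mu _ := rfl
  ar_comp := by
    rintro ⟨n, a⟩ p ⟨l, b⟩ h
    obtain ⟨q, hq⟩ := exists_eq_of_lt (show p < n from h)
    rw [data_comp p q hq rfl]
    change p + l + q + 1 = n + l
    omega
  one_comp := by
    rintro ⟨l, b⟩
    have e := congrArg (fun f => Φ.map f (Φ.pair Φ.unit b))
      (hX.one_comp l (by omega) (by omega))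
    simp only [Φ.map_comp, Φ.map_whiskerRight, Φ.map_leftUnitor] at e
    refine (data_comp 0 0 (by omega) (show l = 0 + l + 0 by omega) _ b).trans ?_
    exact congrArg (Sigma.mk l) e
  comp_one := by
    rintro ⟨n, a⟩ p h
    obtain ⟨q, hq⟩ := exists_eq_of_lt (show p < n from h)
    have e := congrArg (fun f => Φ.map f (Φ.pair a Φ.unit)) (hX.comp_one p q n hq hq)
    simp only [Φ.map_comp, Φ.map_whiskerLeft, Φ.map_rightUnitor] at e
    refine (data_comp p q hq hq a _).trans ?_
    exact congrArg (Sigma.mk n) e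
  comp_assoc := by
    rintro ⟨n, a⟩ p ⟨l, b⟩ p' ⟨k, c⟩ h h'
    obtain ⟨q, hq⟩ := exists_eq_of_lt (show p < n from h)
    obtain ⟨q', hq'⟩ := exists_eq_of_lt (show p' < l from h')
    have e := congrArg (fun f => Φ.map f (Φ.pair (Φ.pair a b) c))
      (hX.comp_assoc p q p' q' n l k (p + l + q) (p' + k + q') (p + (p' + k + q') + q) hq
        rfl (by omega) (by omega) hq' rfl rfl)
    simp only [Φ.map_comp, Φ.map_whiskerLeft, Φ.map_whiskerRight, Φ.map_assoc] at e
    rw [data_comp p q hq rfl, data_comp (p + p') (q' + q) (by omega)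
      (show p + (p' + k + q') + q = _ by omega), data_comp p' q' hq' rfl,
      data_comp p q hq rfl]
    exact congrArg (Sigma.mk _) e
  comp_comm := by
    rintro ⟨n, a⟩ p m ⟨l, b⟩ ⟨k, c⟩ h
    obtain ⟨q, hq⟩ := exists_eq_of_lt (show p + 1 + m < n from h)
    have e := congrArg (fun f => Φ.map f (Φ.pair (Φ.pair a b) c))
      (hX.comp_comm p m q n l k (p + l + (m + 1 + q)) (p + 1 + m + k + q)
        (p + l + m + k + q) (by omega) rfl (by omega) rfl hq rfl (by omega) (by omega))
    simp only [Φ.map_comp, Φ.map_whiskerLeft, Φ.map_whiskerRight, Φ.map_assoc, Φ.map_assoc_inv,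
      Φ.map_braid] at e
    change (X.data Φ).comp ((X.data Φ).comp ⟨n, a⟩ p ⟨l, b⟩) (p + l + m) ⟨k, c⟩ = _
    rw [data_comp p (m + 1 + q) (by omega) rfl, data_comp (p + l + m) q (by omega)
      rfl, data_comp (p + 1 + m) q hq rfl,
      data_comp p (m + k + q) (by omega) (show p + l + m + k + q = _ by omega)]
    exact congrArg (Sigma.mk _) e
  mu_one := by
    have e := congrArg (fun f => Φ.map f Φ.unit) hX.mu_one
    simp only [Φ.map_comp, Φ.map_id] at e
    exact congrArg (Sigma.mk 1) e
  mu_comp p q l := by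
    have e := congrArg (fun f => Φ.map f (Φ.pair Φ.unit Φ.unit))
      (hX.mu_comp p q (p + 1 + q) l (p + l + q) rfl rfl)
    simp only [Φ.map_comp, Φ.map_leftUnitor, Φ.map_tensor] at e
    refine (data_comp p q rfl rfl _ _).trans ?_
    exact congrArg (Sigma.mk _) e.symm
  arZ_act := by
    rintro ⟨k, a⟩ zs h
    obtain ⟨s, t, rfl⟩ := SlotList.exists_toList zs
    rw [SlotList.length_toList] at h
    refine Eq.trans ?_ (SlotList.totalArity_toList t).symm
    exact congrArg Sigma.fst (data_act h.symm rfl a t)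
  one_act := by
    rintro ⟨n, z⟩
    have e := congrArg (fun f => Φ.map f z) (hX.one_act n rfl rfl)
    simp only [Φ.map_comp, Φ.map_rightUnitor_inv, Φ.map_leftUnitor_inv, Φ.map_whiskerRight,
      Φ.map_id] at e
    refine (data_act rfl rfl _ (.cons z .nil)).trans ?_
    exact congrArg (Sigma.mk n) e
  act_act := by
    rintro ⟨k, a⟩ ⟨j, b⟩ pre mid post h h'
    obtain ⟨s₁, t₁, rfl⟩ := SlotList.exists_toList pre
    obtain ⟨s₂, t₂, rfl⟩ := SlotList.exists_toList mid
    obtain ⟨s₃, t₃, rfl⟩ := SlotList.exists_toList post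
    simp only [SlotList.length_toList] at h h'
    change s₁.length + 1 + s₃.length = k at h
    change s₂.length = j at h'
    have e := congrArg (fun f => Φ.map f (Φ.pair a (Φ.pair b (t₁.append (t₂.append t₃)).toEl.pure)))
      (hX.act_act s₁ s₂ s₃ k j s₂.total (s₁ ++ some s₂.total :: s₃).total
        (s₁.length + j + s₃.length) h'.symm rfl (by simp; omega) rfl h.symm rfl
        (by simp; omega) (by simp [total_append, Slots.total]))
    simp only [Φ.map_comp, Φ.map_whiskerLeft, Φ.map_whiskerRight, Φ.map_assoc_inv,
      plugAt_slots] at e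
    rw [SlotList.length_toList, data_comp s₁.length s₃.length h.symm rfl, data_act h'.symm rfl,
      ← SlotList.toList_append, ← SlotList.toList_append, ← SlotList.toList,
      ← SlotList.toList_append,
      data_act (n := (s₁ ++ some s₂.total :: s₃).total) (s := s₁ ++ (s₂ ++ s₃)) (by simp; omega)
        (by simp [total_append, Slots.total]),
      data_act (n := (s₁ ++ some s₂.total :: s₃).total) (by simp; omega)
        (by simp [total_append, Slots.total])]
    exact congrArg (Sigma.mk _) e
  arZ_ract := by
    rintro ⟨n, a⟩ p l h
    obtain ⟨q, hq⟩ := exists_eq_of_lt (show p < n from h)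
    rw [data_ract p q hq rfl]
    change p + l + q + 1 = n + l
    omega
  ract_one := by
    rintro ⟨n, a⟩ p h
    obtain ⟨q, hq⟩ := exists_eq_of_lt (show p < n from h)
    have e := congrArg (fun f => Φ.map f (Φ.pair a Φ.unit)) (hX.ract_one p q n hq hq)
    simp only [Φ.map_comp, Φ.map_whiskerLeft, Φ.map_id, Φ.map_rightUnitor] at e
    refine (data_ract p q hq hq a).trans ?_
    exact congrArg (Sigma.mk n) e
  ract_assoc := by
    rintro ⟨n, z⟩ p a b c h
    obtain ⟨q, hq⟩ := exists_eq_of_lt (show p < n from h)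
    have e := congrArg (fun f => Φ.map f (Φ.pair (Φ.pair z Φ.unit) Φ.unit))
      (hX.ract_assoc p q a b n (a + 1 + b) c (p + (a + 1 + b) + q) (a + c + b)
        (p + (a + c + b) + q) hq rfl (by omega) (by omega) rfl rfl rfl)
    simp only [Φ.map_comp, Φ.map_whiskerLeft, Φ.map_whiskerRight, Φ.map_assoc,
      Φ.map_leftUnitor] at e
    rw [data_ract p q hq rfl, data_ract (p + a) (b + q) (by omega)
      (show p + (a + c + b) + q = _ by omega), data_ract p q hq rfl]
    exact congrArg (Sigma.mk _) e
  ract_comm := by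
    rintro ⟨n, z⟩ p m l k h
    obtain ⟨q, hq⟩ := exists_eq_of_lt (show p + 1 + m < n from h)
    have e := congrArg (fun f => Φ.map f (Φ.pair (Φ.pair z Φ.unit) Φ.unit))
      (hX.ract_comm p m q n l k (p + l + (m + 1 + q)) (p + 1 + m + k + q)
        (p + l + m + k + q) (by omega) rfl (by omega) rfl hq rfl (by omega) (by omega))
    simp only [Φ.map_comp, Φ.map_whiskerLeft, Φ.map_whiskerRight, Φ.map_assoc,
      Φ.map_assoc_inv, Φ.map_braid] at e
    rw [data_ract p (m + 1 + q) (by omega) rfl, data_ract (p + l + m) q (by omega)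
      rfl, data_ract (p + 1 + m) q hq rfl,
      data_ract p (m + k + q) (by omega) (show p + l + m + k + q = _ by omega)]
    exact congrArg (Sigma.mk _) e
  ract_inner := by
    rintro ⟨k, a⟩ pre ⟨t, z⟩ post p l h hp
    obtain ⟨s₁, t₁, rfl⟩ := SlotList.exists_toList pre
    obtain ⟨s₃, t₃, rfl⟩ := SlotList.exists_toList post
    obtain ⟨q, hq⟩ := exists_eq_of_lt (show p < t from hp)
    simp only [SlotList.length_toList] at h
    change s₁.length + 1 + s₃.length = k at h
    have e := congrArg (fun f => Φ.map f
        (Φ.pair a (Φ.pair Φ.unit (t₁.append ((SlotList.cons z .nil).append t₃)).toEl.pure)))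
      (hX.inner s₁ s₃ p q k l t (p + l + q) (s₁ ++ some t :: s₃).total
        (s₁ ++ some (p + l + q) :: s₃).total hq rfl (by simp; omega) rfl (by simp; omega) rfl
        (by simp only [total_append, Slots.total]; omega)
        (by simp only [total_append, Slots.total]; omega))
    simp only [Φ.map_comp, Φ.map_whiskerLeft, plugAt_slots, Φ.map_braid] at e
    simp only [SlotList.append, Φ.map_assoc_inv, Φ.map_whiskerRight,
      SlotList.toEl, ElList.pure, Φ.map_rightUnitor] at e
    rw [SlotList.totalArity_toList, data_ract p q hq rfl, ← SlotList.toList, ← SlotList.toList,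
      ← SlotList.toList_append, ← SlotList.toList_append,
      data_act (by simp; omega) rfl, data_act (by simp; omega) rfl,
      data_ract (s₁.total + p) (q + s₃.total) (by simp only [total_append, Slots.total]; omega)
        (show (s₁ ++ some (p + l + q) :: s₃).total = _ by
          simp only [total_append, Slots.total]; omega)]
    exact congrArg (Sigma.mk _) e
  ract_outer := by
    rintro ⟨k, a⟩ pre post l h
    obtain ⟨s₁, t₁, rfl⟩ := SlotList.exists_toList pre
    obtain ⟨s₃, t₃, rfl⟩ := SlotList.exists_toList post
    simp only [SlotList.length_toList] at h
    change s₁.length + 1 + s₃.length = k at h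
    have hb : (List.replicate l (none : Option ℕ)).length = l := by simp
    have hb' : Slots.total (List.replicate l none) = l := by
      rw [← SlotList.totalArity_toList (SlotList.bars Φ X.Z l), SlotList.toList_bars]
      clear hb
      induction l with
      | zero => rfl
      | succ l ih => rw [List.replicate_succ, totalArity, ih, add_comm]
    have e := congrArg (fun f => Φ.map f
        (Φ.pair a (Φ.pair Φ.unit (t₁.append (SlotList.bar t₃)).toEl.pure)))
      (hX.outer s₁ s₃ k l (s₁.length + l + s₃.length) (s₁ ++ none :: s₃).total
        (s₁ ++ (List.replicate l none ++ s₃)).total (by simp; omega) rfl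
        (by simp only [total_append, Slots.total]; omega)
        (by simp only [total_append, hb']; omega) h.symm rfl (by simp; omega) rfl)
    simp only [Φ.map_comp, Φ.map_whiskerLeft, Φ.map_braid, Φ.map_assoc_inv, Φ.map_whiskerRight,
      expandSlot_pure] at e
    rw [SlotList.totalArity_toList, SlotList.length_toList,
      data_comp s₁.length s₃.length h.symm rfl, ← SlotList.toList,
      ← SlotList.toList_append, ← SlotList.toList_bars (Φ := Φ) (Z := X.Z),
      ← SlotList.toList_append, ← SlotList.toList_append,
      data_act (by simp; omega) rfl, data_act (by simp; omega) rfl,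
      data_ract s₁.total s₃.total (by simp only [total_append, Slots.total]; omega)
        (show (s₁ ++ (List.replicate l none ++ s₃)).total = _ by
          simp only [total_append, hb']; omega)]
    exact congrArg (Sigma.mk _) e

end RawPair

end

/-! ### The axioms of a pair from the evaluation of words -/

section

variable {C : Type u} [Category.{v} C] [MonoidalCategory C] [SymmetricCategory C] [HasInitial C]

namespace RawPair

/-- If the words act on the elements of the objects of `R`, then `R` satisfies the axioms of a
pair: each axiom is an equality of two evaluations of the same word, on generic elements. -/
theorem laws_of_wordAlgebra {R : RawPair C} (A : ∀ Φ, WordAlgebra (R.data Φ)) : R.Laws where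
  one_comp l h h' := hom_ext_unit_pair fun Φ b => by
    simp only [Φ.map_comp, Φ.map_whiskerRight, Φ.map_leftUnitor]
    exact sigma_inj ((data_comp 0 0 h h' _ b).symm.trans ((A Φ).one_comp ⟨l, b⟩))
  comp_one p q n h h' := hom_ext_pair_unit fun Φ a => by
    simp only [Φ.map_comp, Φ.map_whiskerLeft, Φ.map_rightUnitor]
    exact sigma_inj ((data_comp p q h h' a _).symm.trans
      ((A Φ).comp_one (x := ⟨n, a⟩) (show p < n by omega)))
  comp_assoc p q p' q' n l k s t r h₁ h₂ h₃ h₄ h₅ h₆ h₇ := hom_ext_pair_pair fun Φ a b c => by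
    simp only [Φ.map_comp, Φ.map_whiskerLeft, Φ.map_whiskerRight, Φ.map_assoc]
    have e := (A Φ).comp_assoc (x := ⟨n, a⟩) (y := ⟨l, b⟩) (p := p) (p' := p') ⟨k, c⟩
      (show p < n by omega) (show p' < l by omega)
    rw [data_comp p q h₁ h₂, data_comp (p + p') (q' + q) h₃ h₄, data_comp p' q' h₅ h₆,
      data_comp p q h₁ h₇] at e
    exact sigma_inj e
  comp_comm p m q n l k s t r h₁ h₂ h₃ h₄ h₅ h₆ h₇ h₈ := hom_ext_pair_pair fun Φ a b c => by
    simp only [Φ.map_comp, Φ.map_whiskerLeft, Φ.map_whiskerRight, Φ.map_assoc, Φ.map_assoc_inv,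
      Φ.map_braid]
    have e := (A Φ).comp_comm (x := ⟨n, a⟩) (p := p) (m := m) ⟨l, b⟩ ⟨k, c⟩
      (show p + 1 + m < n by omega)
    change (R.data Φ).comp ((R.data Φ).comp ⟨n, a⟩ p ⟨l, b⟩) (p + l + m) ⟨k, c⟩ = _ at e
    rw [data_comp p (m + 1 + q) h₁ h₂, data_comp (p + l + m) q h₃ h₄,
      data_comp (p + 1 + m) q h₅ h₆, data_comp p (m + k + q) h₇ h₈] at e
    exact sigma_inj e
  mu_one := hom_ext_unit fun Φ => by
    simp only [Φ.map_comp, Φ.map_id]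
    exact sigma_inj (A Φ).mu_one
  mu_comp p q n l r h h' := hom_ext_unit_unit fun Φ => by
    subst h h'
    simp only [Φ.map_comp, Φ.map_leftUnitor, Φ.map_tensor]
    have e := (A Φ).mu_comp p q l
    exact (sigma_inj ((data_comp p q rfl rfl _ _).symm.trans e)).symm
  one_act n h h' := hom_ext_el fun Φ z => by
    simp only [Φ.map_comp, Φ.map_rightUnitor_inv, Φ.map_leftUnitor_inv, Φ.map_whiskerRight,
      Φ.map_id]
    exact sigma_inj ((data_act h h' _ (.cons z .nil)).symm.trans ((A Φ).one_act ⟨n, z⟩))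
  act_act pre mid post k j t n m h₁ h₂ h₃ h₄ h₅ h₆ h₇ h₈ := hom_ext_pair_pair_slots
    fun Φ a b u => by
    obtain ⟨t₁, u, rfl⟩ := SlotList.exists_append pre u
    obtain ⟨t₂, t₃, rfl⟩ := SlotList.exists_append mid u
    simp only [Φ.map_comp, Φ.map_whiskerLeft, Φ.map_whiskerRight, Φ.map_assoc_inv,
      plugAt_slots]
    have e := (A Φ).act_act (x := ⟨k, a⟩) (y := ⟨j, b⟩) (pre := t₁.toList) (mid := t₂.toList)
      (post := t₃.toList) (by simp only [SlotList.length_toList]; exact h₅.symm)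
      (by rw [SlotList.length_toList]; exact h₁.symm)
    rw [SlotList.length_toList, data_comp pre.length post.length h₅ h₆, data_act h₁ h₂,
      ← SlotList.toList_append, ← SlotList.toList_append, ← SlotList.toList,
      ← SlotList.toList_append, data_act h₃ h₄, data_act h₇ h₈] at e
    exact sigma_inj e
  ract_one p q n h h' := hom_ext_pair_unit fun Φ a => by
    simp only [Φ.map_comp, Φ.map_whiskerLeft, Φ.map_id, Φ.map_rightUnitor]
    exact sigma_inj ((data_ract p q h h' a).symm.trans
      ((A Φ).ract_one (z := ⟨n, a⟩) (show p < n by omega)))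
  ract_assoc p q a b n l c s t r h₁ h₂ h₃ h₄ h₅ h₆ h₇ := hom_ext_pair_unit_unit fun Φ z => by
    simp only [Φ.map_comp, Φ.map_whiskerLeft, Φ.map_whiskerRight, Φ.map_assoc,
      Φ.map_leftUnitor]
    have e := (A Φ).ract_assoc (z := ⟨n, z⟩) (p := p) a b c (show p < n by omega)
    subst h₅ h₆
    rw [data_ract p q h₁ h₂, data_ract (p + a) (b + q) h₃ h₄, data_ract p q h₁ h₇] at e
    exact sigma_inj e
  ract_comm p m q n l k s t r h₁ h₂ h₃ h₄ h₅ h₆ h₇ h₈ := hom_ext_pair_unit_unit fun Φ z => by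
    simp only [Φ.map_comp, Φ.map_whiskerLeft, Φ.map_whiskerRight, Φ.map_assoc,
      Φ.map_assoc_inv, Φ.map_braid]
    have e := (A Φ).ract_comm (z := ⟨n, z⟩) (p := p) (m := m) l k (show p + 1 + m < n by omega)
    rw [data_ract p (m + 1 + q) h₁ h₂, data_ract (p + l + m) q h₃ h₄,
      data_ract (p + 1 + m) q h₅ h₆, data_ract p (m + k + q) h₇ h₈] at e
    exact sigma_inj e
  inner pre post p q k l t t' n r h₁ h₂ h₃ h₄ h₅ h₆ h₇ h₈ := hom_ext_pair_unit_slots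
    fun Φ a u => by
    obtain ⟨t₁, u, rfl⟩ := SlotList.exists_append pre u
    cases u with
    | cons z t₃ =>
      have e₁ := plugAt_slots (Z := R.Z) (𝟙_ C ◁ (ρ_ (R.Z t)).hom ≫ (β_ (𝟙_ C) (R.Z t)).hom ≫
        R.ract p q h₁ h₂) Φ.unit t₁ (.cons z .nil) t₃
      simp only [Φ.map_comp, SlotList.append, SlotList.toEl, ElList.pure, Φ.map_whiskerLeft,
        Φ.map_rightUnitor, Φ.map_braid] at e₁
      have e₂ : Φ.map (plugAt (slotFamily R.Z) pre [some t] post (some t') (𝟙_ C)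
          (𝟙_ C ◁ (ρ_ (R.Z t)).hom ≫ (β_ (𝟙_ C) (R.Z t)).hom ≫ R.ract p q h₁ h₂))
          (Φ.pair Φ.unit (t₁.append (.cons z t₃)).toEl.pure) = _ := e₁
      have e := (A Φ).ract_inner (x := ⟨k, a⟩) (pre := t₁.toList) (z := ⟨t, z⟩)
        (post := t₃.toList) (p := p) l
        (by simp only [SlotList.length_toList]; rw [h₃]; simp; omega) (show p < t by omega)
      rw [SlotList.totalArity_toList, data_ract p q h₁ h₂, ← SlotList.toList, ← SlotList.toList,
        ← SlotList.toList_append, ← SlotList.toList_append, data_act h₃ h₄, data_act h₅ h₆,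
        data_ract (pre.total + p) (q + post.total) h₇ h₈] at e
      simp only [Φ.map_comp, Φ.map_whiskerLeft, Φ.map_whiskerRight, Φ.map_assoc_inv, Φ.map_braid]
      refine (sigma_inj e).trans ?_
      rw [e₂]
  outer pre post k l m n r h₁ h₂ h₃ h₄ h₅ h₆ h₇ h₈ := hom_ext_pair_unit_slots fun Φ a u => by
    obtain ⟨t₁, u, rfl⟩ := SlotList.exists_append pre u
    cases u with
    | bar t₃ =>
      have e := (A Φ).ract_outer (x := ⟨k, a⟩) (pre := t₁.toList) (post := t₃.toList) l
        (by simp only [SlotList.length_toList]; exact h₅.symm)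
      rw [SlotList.totalArity_toList, SlotList.length_toList,
        data_comp pre.length post.length h₅ h₆, ← SlotList.toList,
        ← SlotList.toList_append, ← SlotList.toList_bars (Φ := Φ) (Z := R.Z),
        ← SlotList.toList_append, ← SlotList.toList_append,
        data_act h₁ h₂, data_act h₇ h₈, data_ract pre.total post.total h₃ h₄] at e
      simp only [Φ.map_comp, Φ.map_whiskerLeft, Φ.map_braid, Φ.map_assoc_inv, Φ.map_whiskerRight,
        expandSlot_pure]
      exact sigma_inj e

end RawPair

end

/-! ### Pairs and their structure maps -/

section

variable {C : Type u} [Category.{v} C] [MonoidalCategory C] [SymmetricCategory C]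

/-- The structure maps of a pair. -/
@[reducible]
def PairE.raw (X : PairE C) : RawPair C where
  M := X.operad.obj
  Z := X.family
  one := X.operad.one
  mu := X.mult.map
  comp := X.operad.comp
  act := X.left.act
  ract := X.right.act

theorem PairE.laws (X : PairE C) : X.raw.Laws where
  one_comp := X.operad.one_comp
  comp_one := X.operad.comp_one
  comp_assoc := X.operad.comp_assoc
  comp_comm := X.operad.comp_comm
  mu_one := X.mult.one_map
  mu_comp := X.mult.comp_map
  one_act := X.left.one_act
  act_act := X.left.act_act
  ract_one := X.right.act_one
  ract_assoc := X.right.act_assoc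
  ract_comm := X.right.act_comm
  inner := X.compatible.inner
  outer := X.compatible.outer

namespace RawPair

variable {R : RawPair C}

/-- The operad of a pair. -/
@[reducible]
def Laws.operad (hR : R.Laws) : NSOperad C where
  obj := R.M
  one := R.one
  comp := R.comp
  one_comp := hR.one_comp
  comp_one := hR.comp_one
  comp_assoc := hR.comp_assoc
  comp_comm := hR.comp_comm

theorem total_replicate_none (n : ℕ) : Slots.total (List.replicate n none) = n := by
  induction n with
  | zero => rfl
  | succ n ih => rw [List.replicate_succ, Slots.total, ih, add_comm]

/-- The action on no elements of `Z`. -/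
def incl (R : RawPair C) (n : ℕ) : R.M n ⟶ R.Z n :=
  (ρ_ _).inv ≫ R.M n ◁ unitSlots R.Z n ≫
    R.act (List.replicate n none) (by simp) (total_replicate_none n).symm

theorem map_incl (Φ : Realization C) {n : ℕ} (a : Φ.el (R.M n)) :
    (⟨n, Φ.map (R.incl n) a⟩ : (R.data Φ).Z) =
      (R.data Φ).act ⟨n, a⟩ (List.replicate n none) := by
  rw [← SlotList.toList_bars (Φ := Φ) (Z := R.Z), data_act (n := n) (by simp)
    (total_replicate_none n).symm]
  simp only [incl, Φ.map_comp, Φ.map_rightUnitor_inv, Φ.map_whiskerLeft, SlotList.unitSlots_pure]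

theorem multiComp_incl_aux (hR : R.Laws) (Φ : Realization C) : ∀ (s : Slots) (p : ℕ) {k n : ℕ}
    (h : k = p + s.length) (h' : n = p + s.total) (a : Φ.el (R.M k)) (t : SlotList Φ R.M s)
    (pre : List (Option (R.data Φ).Z)), pre.length = p →
    (R.data Φ).act ⟨n, Φ.map (hR.operad.multiComp s p h h') (Φ.pair a t.toEl.pure)⟩
        (pre ++ List.replicate s.total none) =
      (R.data Φ).act ⟨k, a⟩ (pre ++ (t.map R.incl).toList)
  | [], p, k, n, h, h', a, t, pre, hp => by
    cases t
    subst hp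
    obtain rfl : n = k := h'.trans h.symm
    simp only [NSOperad.multiComp, Φ.map_comp, SlotList.toEl, ElList.pure, Φ.map_rightUnitor]
    rw [eqToHom_refl, Φ.map_id]
    rfl
  | none :: s, p, k, n, h, h', a, t, pre, hp => by
    cases t with
    | bar t =>
      have e := multiComp_incl_aux hR Φ s (p + 1) (k := k) (n := n)
        (by rw [h, List.length_cons]; omega) (by rw [h', Slots.total]; omega) a t (pre ++ [none])
        (by simp [hp])
      simp only [NSOperad.multiComp, Φ.map_comp, SlotList.toEl, ElList.pure, Φ.map_whiskerLeft,
        Φ.map_leftUnitor]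
      rw [List.append_assoc, List.append_assoc] at e
      rw [Slots.total, add_comm, List.replicate_succ]
      exact e
  | some l :: s, p, k, n, h, h', a, t, pre, hp => by
    cases t with
    | cons b t =>
      have e := multiComp_incl_aux hR Φ s (p + l) (k := p + l + s.length) (n := n)
        rfl (by rw [h', Slots.total]; omega)
        (Φ.map (R.comp p s.length (by rw [h, List.length_cons]; omega) rfl) (Φ.pair a b)) t
        (pre ++ List.replicate l none) (by simp [hp])
      simp only [NSOperad.multiComp, Φ.map_comp, SlotList.toEl, ElList.pure, Φ.map_assoc_inv,
        Φ.map_whiskerRight]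
      rw [Slots.total, List.replicate_add, ← List.append_assoc]
      refine e.trans ?_
      rw [SlotList.map, SlotList.toList, map_incl, List.append_assoc,
        ← data_comp (r := p + l + s.length) p s.length
          (by rw [h, List.length_cons]; omega) rfl]
      have e' := (hR.setPair Φ).act_act ⟨k, a⟩ ⟨l, b⟩ pre (List.replicate l none)
        (t.map R.incl).toList
        (by
          rw [SlotList.length_toList, hp]
          change p + 1 + s.length = k
          rw [h, List.length_cons]
          omega) (List.length_replicate ..)
      rw [hp] at e'
      exact e'.symm

/-- The pair with given structure maps. -/
def Laws.toPairE [HasInitial C] (hR : R.Laws) : PairE C where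
  operad := hR.operad
  mult :=
    { map := R.mu
      one_map := hR.mu_one
      comp_map := hR.mu_comp }
  family := R.Z
  left :=
    { act := R.act
      one_act := hR.one_act
      act_act := hR.act_act
      incl := R.incl
      multiComp_incl := fun s k n h₁ h₂ h₃ h₄ => hom_ext_pair_slots fun Φ a t => by
        have e := multiComp_incl_aux hR Φ s 0 h₃ h₄ a t [] rfl
        simp only [Φ.map_comp, Φ.map_whiskerLeft, ElList.tensorMap_pure, ← SlotList.toEl_map]
        refine sigma_inj ((map_incl Φ _).trans ?_)
        rw [show List.replicate n (none : Option (R.data Φ).Z) = List.replicate s.total none by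
          rw [h₂]]
        refine e.trans ?_
        exact data_act h₁ h₂ a (t.map R.incl) }
  right :=
    { act := R.ract
      act_one := hR.ract_one
      act_assoc := hR.ract_assoc
      act_comm := hR.ract_comm }
  compatible :=
    { inner := hR.inner
      outer := hR.outer }

end RawPair

theorem multiComp_replicate_none (M : NSOperad C) (Φ : Realization C) (l p : ℕ) {n : ℕ}
    (h : n = p + (List.replicate l none).length) (h' : n = p + Slots.total (List.replicate l none))
    (a : Φ.el (M.obj n)) (t : SlotList Φ M.obj (List.replicate l none)) :
    Φ.map (M.multiComp (List.replicate l none) p h h') (Φ.pair a t.toEl.pure) = a := by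
  induction l generalizing p with
  | zero =>
    cases t
    simp only [List.replicate, NSOperad.multiComp, Φ.map_comp, SlotList.toEl, ElList.pure,
      Φ.map_rightUnitor]
    rw [eqToHom_refl, Φ.map_id]
  | succ l ih =>
    cases t with
    | bar t =>
      simp only [List.replicate, NSOperad.multiComp, Φ.map_comp, SlotList.toEl, ElList.pure,
        Φ.map_whiskerLeft, Φ.map_leftUnitor]
      exact ih (p + 1) _ _ t

/-- The maps `ι` are determined by the actions. -/
theorem PairE.incl_eq [HasInitial C] (X : PairE C) : X.left.incl = X.raw.incl := by
  funext n
  refine hom_ext_el fun Φ a => ?_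
  have e := congrArg (fun f => Φ.map f (Φ.pair a (SlotList.bars Φ X.operad.obj n).toEl.pure))
    (X.left.multiComp_incl (List.replicate n none) n n (by simp)
      (RawPair.total_replicate_none n).symm (by simp)
      (by rw [RawPair.total_replicate_none, zero_add]))
  simp only [Φ.map_comp, multiComp_replicate_none, Φ.map_whiskerLeft, ElList.tensorMap_pure,
    ← SlotList.toEl_map] at e
  rw [e]
  refine RawPair.sigma_inj (Eq.trans ?_ (RawPair.map_incl (R := X.raw) Φ a).symm)
  have hb : (SlotList.map X.left.incl (SlotList.bars Φ X.operad.obj n)).toList =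
      List.replicate n none := by
    rw [SlotList.toList_map, SlotList.toList_bars, List.map_replicate]
    rfl
  rw [← hb]
  exact (RawPair.data_act (R := X.raw) _ _ a _).symm

theorem PairE.toPairE_raw [HasInitial C] (X : PairE C) : X.laws.toPairE = X := by
  have h := X.incl_eq
  obtain ⟨M, m, Z, ⟨L, incl, hi⟩, R, hc⟩ := X
  have h' : RawPair.incl ⟨M.obj, Z, M.one, m.map, M.comp, L.act, R.act⟩ = incl := h.symm
  subst h'
  rfl

end

/-! ### Lists of elements of the objects of a pair -/

open PairData (colour)

section

variable {C : Type u} [Category.{v} C] [MonoidalCategory C] [SymmetricCategory C]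

namespace RawPair

variable {R : RawPair C} {Φ : Realization C}

/-- An element of one of the objects of a pair. -/
def ofEl : ∀ {c : Colour}, Φ.el (colourFamily R.M R.Z c) → (R.data Φ).M ⊕ (R.data Φ).Z
  | .closed n, a => .inl ⟨n, a⟩
  | .opened n, z => .inr ⟨n, z⟩

theorem colour_ofEl : ∀ {c : Colour} (a : Φ.el (colourFamily R.M R.Z c)),
    colour (D := R.data Φ) (ofEl a) = c
  | .closed _, _ => rfl
  | .opened _, _ => rfl

theorem ofEl_inj : ∀ {c : Colour} {a b : Φ.el (colourFamily R.M R.Z c)}, ofEl a = ofEl b → a = b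
  | .closed _, _, _, h => sigma_inj (Sum.inl.inj h)
  | .opened _, _, _, h => sigma_inj (Sum.inr.inj h)

theorem exists_ofEl : ∀ e : (R.data Φ).M ⊕ (R.data Φ).Z,
    ∃ a : Φ.el (colourFamily R.M R.Z (colour (D := R.data Φ) e)), ofEl a = e
  | .inl m => ⟨m.2, rfl⟩
  | .inr z => ⟨z.2, rfl⟩

/-- The underlying list of a list of elements. -/
def listOf : ∀ {cs : List Colour}, ElList Φ (colourFamily R.M R.Z) cs →
    List ((R.data Φ).M ⊕ (R.data Φ).Z)
  | _, .nil => []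
  | _, .cons a t => ofEl a :: listOf t

theorem map_colour_listOf : ∀ {cs : List Colour} (t : ElList Φ (colourFamily R.M R.Z) cs),
    (listOf t).map (colour (D := R.data Φ)) = cs
  | _, .nil => rfl
  | _, .cons a t => by rw [listOf, List.map_cons, colour_ofEl, map_colour_listOf t]

theorem length_listOf {cs : List Colour} (t : ElList Φ (colourFamily R.M R.Z) cs) :
    (listOf t).length = cs.length := by
  rw [← List.length_map (colour (D := R.data Φ)), map_colour_listOf]

theorem listOf_append : ∀ {cs cs' : List Colour} (t : ElList Φ (colourFamily R.M R.Z) cs)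
    (t' : ElList Φ (colourFamily R.M R.Z) cs'), listOf (t.append t') = listOf t ++ listOf t'
  | _, _, .nil, _ => rfl
  | _, _, .cons a t, t' => by
    rw [ElList.append, listOf, listOf, listOf_append t t', List.cons_append]

theorem exists_append : ∀ (cs : List Colour) {cs' : List Colour}
    (t : ElList Φ (colourFamily R.M R.Z) (cs ++ cs')), ∃ t₁ t₂, t = ElList.append (l := cs) t₁ t₂
  | [], _, t => ⟨.nil, t, rfl⟩
  | _ :: cs, _, .cons a t => by
    obtain ⟨t₁, t₂, rfl⟩ := exists_append cs t
    exact ⟨.cons a t₁, t₂, rfl⟩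

/-- The list of elements that is given by a list of elements of arbitrary colours. -/
def elList : List ((R.data Φ).M ⊕ (R.data Φ).Z) → Σ cs, ElList Φ (colourFamily R.M R.Z) cs
  | [] => ⟨[], .nil⟩
  | .inl m :: es => ⟨.closed m.1 :: (elList es).1, .cons (a := .closed m.1) m.2 (elList es).2⟩
  | .inr z :: es => ⟨.opened z.1 :: (elList es).1, .cons (a := .opened z.1) z.2 (elList es).2⟩

theorem elList_listOf : ∀ {cs : List Colour} (t : ElList Φ (colourFamily R.M R.Z) cs),
    elList (listOf t) = ⟨cs, t⟩
  | _, .nil => rfl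
  | .closed _ :: _, .cons a t => by rw [listOf, ofEl, elList, elList_listOf t]
  | .opened _ :: _, .cons a t => by rw [listOf, ofEl, elList, elList_listOf t]

theorem exists_listOf : ∀ es : List ((R.data Φ).M ⊕ (R.data Φ).Z),
    ∃ t : ElList Φ (colourFamily R.M R.Z) (es.map (colour (D := R.data Φ))), listOf t = es
  | [] => ⟨.nil, rfl⟩
  | e :: es => by
    obtain ⟨a, ha⟩ := exists_ofEl e
    obtain ⟨t, ht⟩ := exists_listOf es
    exact ⟨.cons a t, by rw [listOf, ha, ht]⟩

end RawPair

/-! ### The words of the generators, with numbered inputs -/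

/-- The colours of the elements that are inserted in a wide action. -/
@[reducible]
def slotColours : Slots → List Colour
  | [] => []
  | none :: s => slotColours s
  | some l :: s => .opened l :: slotColours s

/-- The tensor product of the inserted factors, without the factors that are units. -/
def collapse (M Z : ℕ → C) : ∀ s : Slots,
    slotTensor Z s ≅ tensorList (colourFamily M Z) (slotColours s)
  | [] => Iso.refl _
  | none :: s => λ_ _ ≪≫ collapse M Z s
  | some l :: s => whiskerLeftIso (Z l) (collapse M Z s)

theorem map_collapse {R : RawPair C} {Φ : Realization C} : ∀ {s : Slots} (t : SlotList Φ R.Z s),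
    ∃ t' : ElList Φ (colourFamily R.M R.Z) (slotColours s),
      Φ.map (collapse R.M R.Z s).hom t.toEl.pure = t'.pure ∧
        RawPair.listOf t' = t.toList.reduceOption.map .inr
  | _, .nil => ⟨.nil, Φ.map_id _, rfl⟩
  | _, .bar t => by
    obtain ⟨t', h1, h2⟩ := map_collapse t
    refine ⟨t', ?_, h2⟩
    rw [← h1]
    simp only [collapse, Iso.trans_hom, Φ.map_comp, SlotList.toEl, ElList.pure, Φ.map_leftUnitor]
  | some l :: s, .cons z t => by
    obtain ⟨t', h1, h2⟩ := map_collapse t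
    refine ⟨.cons (a := Colour.opened l) z t', ?_, ?_⟩
    · simp only [collapse, whiskerLeftIso_hom, SlotList.toEl, ElList.pure, Φ.map_whiskerLeft, h1]
    · rw [RawPair.listOf, h2]
      rfl

theorem exists_collapse {R : RawPair C} {Φ : Realization C} : ∀ {s : Slots}
    (t' : ElList Φ (colourFamily R.M R.Z) (slotColours s)), ∃ t : SlotList Φ R.Z s,
      Φ.map (collapse R.M R.Z s).inv t'.pure = t.toEl.pure ∧
        RawPair.listOf t' = t.toList.reduceOption.map .inr
  | [], .nil => ⟨.nil, Φ.map_id _, rfl⟩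
  | none :: s, t' => by
    obtain ⟨t, h1, h2⟩ := exists_collapse (s := s) t'
    refine ⟨.bar t, ?_, h2⟩
    simp only [collapse, Iso.trans_inv, Φ.map_comp, SlotList.toEl, ElList.pure, h1,
      Φ.map_leftUnitor_inv]
  | some l :: s, .cons z t' => by
    obtain ⟨t, h1, h2⟩ := exists_collapse (s := s) t'
    refine ⟨.cons z t, ?_, ?_⟩
    · simp only [collapse, whiskerLeftIso_inv, SlotList.toEl, ElList.pure, Φ.map_whiskerLeft, h1]
    · rw [RawPair.listOf, h2]
      rfl

/-- The inputs of a wide action: bars, and letters that are numbered from `m`. -/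
def slotBlocks : ℕ → Slots → List Word
  | _, [] => []
  | m, none :: s => [none] :: slotBlocks m s
  | m, some l :: s => corolla m l :: slotBlocks (m + 1) s

theorem renameWord_weave (f : ℕ → ℕ) (i : ℕ) (gs : List Word) :
    renameWord f (weave i gs) = weave (f i) (gs.map (renameWord f)) := by
  induction gs with
  | nil => rfl
  | cons g gs ih => rw [weave, List.map_cons, weave, ← ih]; simp [renameWord]

theorem renameWord_bars (f : ℕ → ℕ) (n : ℕ) :
    renameWord f (List.replicate n none) = List.replicate n none := by
  simp [renameWord]

theorem renameWord_corolla (f : ℕ → ℕ) (i n : ℕ) :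
    renameWord f (corolla i n) = corolla (f i) n := by
  rw [corolla_eq_weave, renameWord_weave, corolla_eq_weave, List.map_replicate]
  rfl

theorem idWord_eq (n : ℕ) : idWord n = corolla 0 n := by
  rw [corolla_eq_weave]
  induction n with
  | zero => rfl
  | succ n ih => rw [idWord, ih, List.replicate_succ, weave]; rfl

theorem map_renameWord_slotWord {col : ℕ → Colour} : ∀ {s : List (Option ℕ)} {s' : Slots}
    (Q : List ℕ), (Q ++ s.reduceOption).Nodup →
      s.map (Option.map col) = s'.map (Option.map .opened) →
      s.map (renameWord (Q ++ s.reduceOption).idxOf ∘ slotWord col) = slotBlocks Q.length s' ∧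
        s.reduceOption.map col = slotColours s'
  | [], [], _, _, _ => ⟨rfl, rfl⟩
  | none :: s, none :: s', Q, h, h' => by
    have := map_renameWord_slotWord (s := s) (s' := s') Q (by simpa using h) (by simpa using h')
    simpa [slotBlocks, slotWord, slotColours, renameWord] using this
  | some j :: s, some l :: s', Q, h, h' => by
    simp only [List.map_cons, Option.map_some, List.cons.injEq, Option.some.injEq] at h'
    rw [List.reduceOption_cons_of_some] at h
    have := map_renameWord_slotWord (s := s) (s' := s') (Q ++ [j]) (by simpa using h) h'.2
    have hj : (Q ++ j :: s.reduceOption).idxOf j = Q.length := by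
      have : j ∉ Q := fun hq => List.disjoint_of_nodup_append h hq (by simp)
      rw [List.idxOf_append, if_neg this]
      simp
    rw [List.append_assoc, List.singleton_append, List.length_append] at this
    rw [List.reduceOption_cons_of_some, List.map_cons, List.map_cons, this.1, this.2, h'.1]
    refine ⟨?_, rfl⟩
    rw [Function.comp_apply, slotWord, renameWord_corolla, hj, h'.1]
    rfl
  | [], some _ :: _, _, _, h' => by simp at h'
  | [], none :: _, _, _, h' => by simp at h'
  | none :: _, [], _, _, h' => by simp at h'
  | some _ :: _, [], _, _, h' => by simp at h'
  | none :: _, some _ :: _, _, _, h' => by simp at h'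
  | some _ :: _, none :: _, _, _, h' => by simp at h'

theorem renameWord_actWord {col : ℕ → Colour} {i : ℕ} {s : List (Option ℕ)} {s' : Slots}
    (hi : some i ∉ s) (h : s.reduceOption.Nodup)
    (h' : s.map (Option.map col) = s'.map (Option.map .opened)) :
    renameWord (i :: s.reduceOption).idxOf (actWord col i s) = weave 0 (slotBlocks 1 s') ∧
      s.reduceOption.map col = slotColours s' := by
  have := map_renameWord_slotWord (Q := [i])
    (by simpa [List.nodup_cons, mem_reduceOption] using ⟨hi, h⟩) h'
  rw [actWord, renameWord_weave, List.idxOf_cons_self, List.map_map]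
  exact ⟨congrArg (weave 0) this.1, this.2⟩

theorem isRLStage_comp {p q n l r : ℕ} (h : n = p + 1 + q) (h' : r = p + l + q) :
    IsRLStage 2 [.closed n, .closed l] (.closed r) (compWord 0 1 p q l) := by
  subst h h'
  exact isRLStage_iff.2 ⟨valid_compWord (by simp) rfl rfl, fun i => by
    simp only [List.mem_append, mem_chunk, List.length_cons, List.length_nil]
    omega⟩

theorem isRLStage_ract {p q n l r : ℕ} (h : n = p + 1 + q) (h' : r = p + l + q) :
    IsRLStage 2 [.opened n] (.opened r) (ractWord 0 p q l) := by
  subst h h'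
  exact isRLStage_iff.2 ⟨valid_ractWord rfl, fun i => by simp [mem_chunk]⟩

theorem isRLStage_bars (n : ℕ) : IsRLStage 2 [] (.closed n) (List.replicate n none) :=
  isRLStage_iff.2 ⟨valid_bars _ n, fun i => by simp [List.mem_replicate]⟩

theorem isRLStage_act {s : Slots} {k n : ℕ} (h : k = s.length) (h' : n = s.total) :
    IsRLStage 2 (.closed k :: slotColours s) (.opened n) (weave 0 (slotBlocks 1 s)) := by
  obtain ⟨col, s', h1, h2, h3, h4⟩ := WordAlgebra.exists_names Colour.opened s
    (fun _ => Colour.closed k) 1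
  have h5 : some 0 ∉ s' := fun h => absurd (h2 0 h) (by simp)
  have hl : s'.length = s.length := by simpa using congrArg List.length h4
  obtain ⟨h6, h7⟩ := renameWord_actWord h5 h3 h4
  have h8 : ∀ (s' : List (Option ℕ)) (s : Slots), s'.map (Option.map col) =
      s.map (Option.map .opened) →
        ((s'.map (slotWord col)).map (List.count none)).sum = s.total := by
    intro s'
    induction s' with
    | nil => intro s h; cases s with
      | nil => rfl
      | cons => simp at h
    | cons o s' ih =>
      intro s h
      cases s with
      | nil => simp at h
      | cons o' s =>
        simp only [List.map_cons, List.cons.injEq] at h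
        cases o <;> cases o' <;> simp at h
        · have := ih s h
          rw [List.map_map] at this
          simp [slotWord, this, Slots.total]
        · have := ih s h.2
          rw [List.map_map] at this
          simp [slotWord, this, Slots.total, h.1, count_none_corolla, Colour.arity]
  have h9 := (valid_iff_isRLStage (w := actWord col 0 s') (d := .opened n)
    (N := 0 :: s'.reduceOption) (fun i => by simp [mem_actWord, mem_reduceOption])
    (by simpa [List.nodup_cons, mem_reduceOption] using ⟨h5, h3⟩)).2
    (valid_actWord (by rw [h1 0 (by simp), h, hl]) h5 h3
      (by rw [actWord, count_none_weave, h8 _ _ h4, h']))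
  rw [h6, List.map_cons, h7, h1 0 (by simp)] at h9
  exact h9

end

/-! ### The pair of an algebra -/

open PairData (colour)

section

variable {C : Type u} [Category.{v} C] [MonoidalCategory C] [SymmetricCategory C] [HasColimits C]

namespace RL2Algebra

/-- The operation of an element of `RL_2` on an algebra. -/
noncomputable abbrev op (X : RL2Algebra C) {cs : List Colour} {d : Colour} (x : RL2 cs d) :
    tensorList (colourFamily X.closedPart X.openPart) cs ⟶
      colourFamily X.closedPart X.openPart d :=
  actionAt (X.act cs d) x

/-- The structure maps of the pair of an algebra: the operations of the words of the generators. -/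
@[reducible]
noncomputable def raw (X : RL2Algebra C) : RawPair C where
  M := X.closedPart
  Z := X.openPart
  one := X.op (d := .closed 1) ⟨_, isRLStage_bars 1⟩
  mu l := X.op (d := .closed l) ⟨_, isRLStage_bars l⟩
  comp _ _ n l _ h h' := X.closedPart n ◁ (ρ_ (X.closedPart l)).inv ≫
    X.op ⟨_, isRLStage_comp h h'⟩
  act s k _ h h' := X.closedPart k ◁ (collapse X.closedPart X.openPart s).hom ≫
    X.op ⟨_, isRLStage_act h h'⟩
  ract _ _ _ _ _ h h' := X.op ⟨_, isRLStage_ract h h'⟩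

variable {X : RL2Algebra C} {Φ : Realization C}

open RawPair

open Classical in
variable (X Φ) in
/-- The operation of a word with numbered letters on a list of elements. The value is irrelevant if
the colours do not match. -/
noncomputable def val (es : List ((X.raw.data Φ).M ⊕ (X.raw.data Φ).Z)) (d : Colour) (w : Word) :
    (X.raw.data Φ).M ⊕ (X.raw.data Φ).Z :=
  if h : IsRLStage 2 (elList es).1 d w then ofEl (Φ.map (X.op ⟨w, h⟩) (elList es).2.pure)
  else .inl (X.raw.data Φ).one

theorem val_listOf {cs : List Colour} {d : Colour} (t : ElList Φ (colourFamily X.raw.M X.raw.Z) cs)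
    {w : Word} (h : IsRLStage 2 cs d w) :
    X.val Φ (listOf t) d w = ofEl (Φ.map (X.op ⟨w, h⟩) t.pure) := by
  have key : ∀ (T : Σ cs, ElList Φ (colourFamily X.raw.M X.raw.Z) cs), T = ⟨cs, t⟩ →
      ∀ hT : IsRLStage 2 T.1 d w, ofEl (Φ.map (X.op ⟨w, hT⟩) T.2.pure) =
        ofEl (R := X.raw) (Φ.map (X.op ⟨w, h⟩) t.pure) := by
    rintro _ rfl _
    rfl
  have e := elList_listOf t
  have hT : IsRLStage 2 (elList (listOf t)).1 d w := by rwa [e]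
  exact (dif_pos hT).trans (key _ e hT)

theorem val_idWord (e : (X.raw.data Φ).M ⊕ (X.raw.data Φ).Z) :
    X.val Φ [e] (colour e) (idWord (colour e).arity) = e := by
  obtain ⟨a, ha⟩ := exists_ofEl e
  have h := val_listOf (d := colour e) (.cons a .nil) (isRLStage_idWord 2 (colour e))
  rw [listOf, ha] at h
  refine h.trans ?_
  have h2 := X.act_id (colour e)
  rw [show X.op ⟨idWord (colour e).arity, isRLStage_idWord 2 (colour e)⟩ = _ from h2, ElList.pure,
    ElList.pure, Φ.map_rightUnitor, ha]

/-- The associativity axiom. By equivariance, substitution into the first letter is enough. -/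
theorem val_substWord {mid post : List ((X.raw.data Φ).M ⊕ (X.raw.data Φ).Z)} {c d : Colour}
    {x y : Word} (hx : IsRLStage 2 (c :: post.map colour) d x)
    (hy : IsRLStage 2 (mid.map colour) c y) :
    X.val Φ (mid ++ post) d (substWord 0 mid.length x y) =
      X.val Φ (X.val Φ mid c y :: post) d x := by
  obtain ⟨t₂, h₂⟩ := exists_listOf mid
  obtain ⟨t₃, h₃⟩ := exists_listOf post
  have e1 : X.val Φ mid c y = ofEl (Φ.map (X.op ⟨y, hy⟩) t₂.pure) := by rw [← val_listOf, h₂]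
  have e2 : X.val Φ (mid ++ post) d (substWord 0 mid.length x y) =
      ofEl (Φ.map (X.op (RL2.subst (pre := []) ⟨x, hx⟩ ⟨y, hy⟩)) (t₂.append t₃).pure) := by
    have := val_listOf (t₂.append t₃) (IsRLStage.subst (pre := []) hx hy)
    rw [listOf_append, h₂, h₃] at this
    rwa [← List.length_map (as := mid) colour]
  have e3 := val_listOf (.cons (Φ.map (X.op ⟨y, hy⟩) t₂.pure) t₃) hx
  rw [listOf, h₃, ← e1] at e3
  rw [e2, e3]
  have e4 := X.act_subst [] (mid.map colour) (post.map colour) c d ⟨x, hx⟩ ⟨y, hy⟩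
  refine congrArg ofEl ((congrArg (fun f => Φ.map f (t₂.append t₃).pure) e4).trans ?_)
  rw [Φ.map_comp]
  exact congrArg _ (ElList.tensorAt_pure (pre := []) (X.op ⟨y, hy⟩) .nil t₂ t₃)

theorem val_swapWord {pre post : List ((X.raw.data Φ).M ⊕ (X.raw.data Φ).Z)}
    {a b : (X.raw.data Φ).M ⊕ (X.raw.data Φ).Z} {d : Colour} {w : Word}
    (hw : IsRLStage 2 ((pre ++ a :: b :: post).map colour) d w) :
    X.val Φ (pre ++ b :: a :: post) d (swapWord pre.length w) =
      X.val Φ (pre ++ a :: b :: post) d w := by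
  obtain ⟨t₁, h₁⟩ := exists_listOf pre
  obtain ⟨t₂, h₂⟩ := exists_listOf post
  obtain ⟨a', ha⟩ := exists_ofEl a
  obtain ⟨b', hb⟩ := exists_ofEl b
  rw [List.map_append, List.map_cons, List.map_cons] at hw
  have e1 : X.val Φ (pre ++ b :: a :: post) d (swapWord pre.length w) = ofEl
      (Φ.map (X.op (RL2.swap ⟨w, hw⟩)) (t₁.append (.cons b' (.cons a' t₂))).pure) := by
    have := val_listOf (t₁.append (.cons b' (.cons a' t₂))) hw.swap
    simp only [listOf_append, listOf, h₁, h₂, ha, hb] at this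
    rwa [← List.length_map (as := pre) colour]
  have e2 := val_listOf (t₁.append (.cons a' (.cons b' t₂))) hw
  simp only [listOf_append, listOf, h₁, h₂, ha, hb] at e2
  rw [e1, e2]
  have e3 := X.act_swap (pre.map colour) (post.map colour) (colour a) (colour b) d ⟨w, hw⟩
  refine congrArg ofEl ((congrArg (fun f => Φ.map f _) e3).trans ?_)
  rw [Φ.map_comp, ElList.tensorSwap_pure]

theorem swapWord_renameWord {Q N : List ℕ} {a b : ℕ} {w : Word} (h : (Q ++ a :: b :: N).Nodup)
    (hw : ∀ i, some i ∈ w → i ∈ Q ++ a :: b :: N) :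
    renameWord (Q ++ b :: a :: N).idxOf w =
      swapWord Q.length (renameWord (Q ++ a :: b :: N).idxOf w) := by
  have h1 : a ∉ Q ∧ b ∉ Q ∧ a ≠ b := by
    simp only [List.nodup_append, List.nodup_cons, List.mem_cons] at h
    exact ⟨fun ha => h.2.2 a ha a (Or.inl rfl) rfl, fun hb => h.2.2 b hb b (by simp) rfl,
      fun e => h.2.1.1 (Or.inl e)⟩
  rw [swapWord, show List.map (Option.map (Equiv.swap Q.length (Q.length + 1))) =
    renameWord (Equiv.swap Q.length (Q.length + 1)) from rfl, renameWord_comp]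
  refine renameWord_congr fun i hi => ?_
  simp only [Function.comp_apply, List.idxOf_append]
  split_ifs with hQ
  · have := List.idxOf_lt_length_of_mem hQ
    rw [Equiv.swap_apply_of_ne_of_ne (by omega) (by omega)]
  · by_cases ha : i = a
    · subst ha
      rw [List.idxOf_cons_ne _ h1.2.2.symm, List.idxOf_cons_self, List.idxOf_cons_self, zero_add,
        Equiv.swap_apply_left, add_comm]
    · by_cases hb : i = b
      · subst hb
        rw [List.idxOf_cons_ne _ h1.2.2, List.idxOf_cons_self, List.idxOf_cons_self, zero_add,
          show Nat.succ 0 + Q.length = Q.length + 1 by omega, Equiv.swap_apply_right]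
      · rw [List.idxOf_cons_ne _ (Ne.symm ha), List.idxOf_cons_ne _ (Ne.symm hb),
          List.idxOf_cons_ne _ (Ne.symm ha), List.idxOf_cons_ne _ (Ne.symm hb),
          Equiv.swap_apply_of_ne_of_ne (by omega) (by omega)]

/-- By equivariance, the value of a word does not depend on the numbering of its letters. -/
theorem val_perm {ρ : ℕ → (X.raw.data Φ).M ⊕ (X.raw.data Φ).Z} {d : Colour} {w : Word}
    (hw : Valid (fun i => colour (ρ i)) d w) {N N' : List ℕ} (h : N.Perm N') : ∀ Q : List ℕ,
    (Q ++ N).Nodup → (∀ i, some i ∈ w ↔ i ∈ Q ++ N) →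
      X.val Φ ((Q ++ N).map ρ) d (renameWord (Q ++ N).idxOf w) =
        X.val Φ ((Q ++ N').map ρ) d (renameWord (Q ++ N').idxOf w) := by
  induction h with
  | nil => exact fun _ _ _ => rfl
  | cons a _ ih =>
    intro Q h1 h2
    have := ih (Q ++ [a]) (by simpa using h1) (by simpa using h2)
    simpa using this
  | swap a b N =>
    intro Q h1 h2
    have h3 : (Q ++ b :: a :: N).Perm (Q ++ a :: b :: N) := (List.Perm.swap a b N).append_left Q
    have h1' := h3.nodup_iff.1 h1
    have h2' : ∀ i, some i ∈ w ↔ i ∈ Q ++ a :: b :: N := fun i => (h2 i).trans h3.mem_iff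
    rw [swapWord_renameWord h1' fun i hi => (h2' i).1 hi]
    have := val_swapWord (X := X) (Φ := Φ) (pre := Q.map ρ) (a := ρ a) (b := ρ b) (post := N.map ρ)
      (d := d) (w := renameWord (Q ++ a :: b :: N).idxOf w) (by
        have := (valid_iff_isRLStage h2' h1').2 hw
        simpa [Function.comp_def] using this)
    simpa using this
  | trans h _ ih ih' =>
    intro Q h1 h2
    have h3 := h.append_left Q
    exact (ih Q h1 h2).trans (ih' Q (h3.nodup_iff.1 h1) fun i => (h2 i).trans h3.mem_iff)

variable (X Φ) in
/-- The operation of a word with labelled letters, numbered in the order of `letters w`. -/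
noncomputable def ev (ρ : ℕ → (X.raw.data Φ).M ⊕ (X.raw.data Φ).Z) (d : Colour) (w : Word) :
    (X.raw.data Φ).M ⊕ (X.raw.data Φ).Z :=
  X.val Φ ((letters w).map ρ) d (renameWord (letters w).idxOf w)

theorem ev_eq_val {ρ : ℕ → (X.raw.data Φ).M ⊕ (X.raw.data Φ).Z} {d : Colour} {w : Word}
    (hw : Valid (fun i => colour (ρ i)) d w) {N : List ℕ} (hN : ∀ i, some i ∈ w ↔ i ∈ N)
    (hd : N.Nodup) : X.ev Φ ρ d w = X.val Φ (N.map ρ) d (renameWord N.idxOf w) :=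
  val_perm hw ((List.perm_ext_iff_of_nodup (nodup_letters w) hd).2 fun i => by
    rw [← mem_letters, hN]) [] (nodup_letters w) mem_letters

theorem colour_val {es : List ((X.raw.data Φ).M ⊕ (X.raw.data Φ).Z)} {d : Colour} {w : Word}
    (hw : IsRLStage 2 (es.map colour) d w) : colour (X.val Φ es d w) = d := by
  obtain ⟨t, ht⟩ := exists_listOf es
  rw [← ht, val_listOf t hw, colour_ofEl]

theorem isRLStage_map {ρ : ℕ → (X.raw.data Φ).M ⊕ (X.raw.data Φ).Z} {d : Colour} {w : Word}
    (hw : Valid (fun i => colour (ρ i)) d w) {N : List ℕ} (hN : ∀ i, some i ∈ w ↔ i ∈ N)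
    (hd : N.Nodup) : IsRLStage 2 ((N.map ρ).map colour) d (renameWord N.idxOf w) := by
  rw [List.map_map]
  exact (valid_iff_isRLStage hN hd).2 hw

open Function in
/-- The associativity axiom of an algebra, for words whose letters have arbitrary names. -/
theorem ev_substLetter {ρ : ℕ → (X.raw.data Φ).M ⊕ (X.raw.data Φ).Z} {p : ℕ} {x y : Word}
    {c d : Colour} (hy : Valid (fun i => colour (ρ i)) c y)
    (hx : Valid (fun i => colour (update ρ p (X.ev Φ ρ c y) i)) d x) (hp : some p ∈ x)
    (hd : DisjointLetters y x) :
    X.ev Φ ρ d (substLetter p x y) = X.ev Φ (update ρ p (X.ev Φ ρ c y)) d x := by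
  obtain ⟨h1, h2⟩ := nodup_cons_erase hp
  have hc := colour_val (isRLStage_map hy mem_letters (nodup_letters y))
  have hpN := (List.nodup_cons.1 h1).1
  have e1 : ((letters x).erase p).map (update ρ p (X.ev Φ ρ c y)) = ((letters x).erase p).map ρ :=
    List.map_congr_left fun i hi => update_of_ne (ne_of_mem_of_not_mem hi hpN) _ _
  have hx' := isRLStage_map hx h2 h1
  rw [List.map_cons, update_self, e1, List.map_cons] at hx'
  change IsRLStage 2 (colour (X.val Φ _ c _) :: _) d _ at hx'
  rw [hc] at hx'
  have e2 := val_substWord hx' (isRLStage_map hy mem_letters (nodup_letters y))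
  rw [ev_eq_val hx h2 h1, List.map_cons, update_self, e1]
  refine Eq.trans ?_ e2
  rw [← List.map_append, List.length_map, ← renameWord_substLetter_head mem_letters hd]
  have hpy : some p ∉ y := fun h => hd p h hp
  refine ev_eq_val ((hx.substLetter (c := c) (hy.congr fun i hi => ?_) ?_ hp hd).congr
    fun i hi => ?_) (fun i => ?_) ?_
  · rw [update_of_ne]
    rintro rfl
    exact hpy hi
  · rw [update_self]
    exact hc
  all_goals
    have hl := letters_substLetter (p := p) (x := x) (y := y) (n := c.arity)
      (by rw [hx.count p hp, update_self]; exact congrArg (fun c => c.arity + 1) hc) hy.bars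
  · rw [update_of_ne]
    rintro rfl
    rcases (hl i).1 hi with h | h
    · exact h.2 rfl
    · exact hpy h
  · rw [hl, List.mem_append, ← mem_letters, h2, List.mem_cons]
    have h6 : i ∈ (letters x).erase p → i ≠ p := fun h e => hpN (e ▸ h)
    tauto
  · rw [List.nodup_append]
    refine ⟨nodup_letters y, (List.nodup_cons.1 h1).2, fun i hi j hj e => ?_⟩
    subst e
    exact hd i ((mem_letters i).2 hi) ((mem_letters i).2 (List.mem_of_mem_erase hj))

/-- The operations of an algebra on elements. -/
noncomputable def wordAlgebra (X : RL2Algebra C) (Φ : Realization C) :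
    WordAlgebra (X.raw.data Φ) where
  ev := X.ev Φ
  colour_ev h := colour_val (isRLStage_map h mem_letters (nodup_letters _))
  ev_congr {ρ ρ' d w} h h' := by
    rw [ev, ev, List.map_congr_left fun i hi => h' i ((mem_letters i).2 hi)]
  ev_corolla ρ i := by
    rw [ev_eq_val (N := [i]) (valid_corolla rfl fun h => h) (fun j => by simp [mem_chunk])
      (by simp), renameWord_corolla, List.idxOf_cons_self, ← idWord_eq]
    exact val_idWord (ρ i)
  ev_subst := ev_substLetter
  ev_mu ρ n := by
    rw [ev_eq_val (N := []) (valid_bars _ n) (fun j => by simp [List.mem_replicate]) (by simp),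
      renameWord_bars]
    exact val_listOf .nil (isRLStage_bars n)
  mu_one := rfl
  ev_comp {ρ i j p q x y} hij hi hj h := by
    obtain ⟨n, a⟩ := x
    obtain ⟨l, b⟩ := y
    have hn : n = p + 1 + q := h
    subst hn
    rw [ev_eq_val (N := [i, j]) (valid_compWord hij (by rw [hi]; rfl) (by rw [hj]; rfl))
      (fun k => by simp only [List.mem_append, mem_chunk, List.mem_cons]; tauto)
      (by simpa using hij)]
    have e : renameWord [i, j].idxOf (compWord i j p q l) = compWord 0 1 p q l := by
      have h1 : [i, j].idxOf j = 1 := by rw [List.idxOf_cons_ne _ hij, List.idxOf_cons_self]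
      have h2 := fun m => renameWord_corolla [i, j].idxOf i m
      have h3 := fun m => renameWord_corolla [i, j].idxOf j m
      rw [List.idxOf_cons_self] at h2
      rw [h1] at h3
      rw [compWord, compWord, ← h2, ← h2, ← h3]
      simp only [renameWord, List.map_append]
    have e2 := val_listOf (X := X) (Φ := Φ)
      (.cons (a := Colour.closed _) a (.cons (a := Colour.closed _) b .nil))
      (isRLStage_comp (p := p) (q := q) (l := l) rfl rfl)
    rw [show (X.raw.data Φ).ar ⟨l, b⟩ = l from rfl, e, List.map_cons, hi, List.map_cons, hj,
      List.map_nil, data_comp p q rfl rfl]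
    refine e2.trans (congrArg (fun c => Sum.inl (⟨_, c⟩ : (X.raw.data Φ).M)) ?_)
    simp only [Φ.map_comp, Φ.map_whiskerLeft, Φ.map_rightUnitor_inv]
    rfl
  ev_act {ρ i x s zs} hi h his hs hz := by
    obtain ⟨k, a⟩ := x
    obtain ⟨s', t, rfl⟩ := SlotList.exists_toList zs
    have hl : s.length = s'.length := by
      simpa [SlotList.length_toList] using congrArg List.length hz
    have hk : k = s'.length := (show k = s.length from h).trans hl
    have hc : s.map (Option.map fun i => colour (ρ i)) = s'.map (Option.map .opened) := by
      have e1 := congrArg (List.map (Option.map colour)) hz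
      rw [List.map_map, List.map_map, Option.map_comp_map, Option.map_comp_map] at e1
      refine e1.trans ?_
      clear e1 hz hk hl h hi
      induction t with
      | nil => rfl
      | bar t ih => exact congrArg _ ih
      | cons z t ih => exact congrArg _ ih
    obtain ⟨e1, e2⟩ := renameWord_actWord his hs hc
    obtain ⟨t', e3, e4⟩ := map_collapse t
    have hn : ((actWord (fun i => colour (ρ i)) i s).count none) = s'.total := by
      rw [← count_none_renameWord (i :: s.reduceOption).idxOf, e1]
      exact (isRLStage_act hk rfl).bars
    have hv : Valid (fun i => colour (ρ i)) (.opened s'.total)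
        (actWord (fun i => colour (ρ i)) i s) :=
      valid_actWord (by rw [hi]; exact congrArg _ h) his hs hn
    rw [hn, ev_eq_val (N := i :: s.reduceOption) hv
      (fun j => by simp [mem_actWord, mem_reduceOption])
      (by simpa [List.nodup_cons, mem_reduceOption] using ⟨his, hs⟩), e1, List.map_cons, hi]
    have e5 : s.reduceOption.map ρ = listOf t' := by
      rw [e4, ← List.reduceOption_map, hz, List.reduceOption_map]
    have e6 := val_listOf (X := X) (Φ := Φ) (.cons (a := Colour.closed k) a t')
      (isRLStage_act hk rfl)
    rw [e5, data_act hk rfl]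
    refine e6.trans (congrArg (fun c => Sum.inr (⟨_, c⟩ : (X.raw.data Φ).Z)) ?_)
    simp only [Φ.map_comp, Φ.map_whiskerLeft, e3]
    rfl
  ev_ract {ρ i p q z} l hi h := by
    obtain ⟨n, a⟩ := z
    have hn : n = p + 1 + q := h
    subst hn
    rw [ev_eq_val (N := [i]) (valid_ractWord (by rw [hi]; rfl)) (fun j => by simp [mem_chunk])
      (by simp)]
    have e : renameWord [i].idxOf (ractWord i p q l) = ractWord 0 p q l := by
      have h2 := fun m => renameWord_corolla [i].idxOf i m
      rw [List.idxOf_cons_self] at h2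
      rw [ractWord, ractWord, ← h2, ← h2]
      simp [renameWord]
    rw [e, List.map_cons, hi, List.map_nil, data_ract p q rfl rfl]
    exact val_listOf (X := X) (Φ := Φ) (.cons (a := Colour.opened _) a .nil)
      (isRLStage_ract (p := p) (q := q) (l := l) rfl rfl)

theorem laws (X : RL2Algebra C) : X.raw.Laws := RawPair.laws_of_wordAlgebra X.wordAlgebra

end RL2Algebra

end

/-! ### The operations of a pair -/

open PairData (colour)

section

variable {C : Type u} [Category.{v} C] [MonoidalCategory C] [SymmetricCategory C]

namespace RawPair

variable {R : RawPair C}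

/-- The operations of a pair on elements. -/
noncomputable abbrev Laws.wordAlgebra (hR : R.Laws) (Φ : Realization C) :
    WordAlgebra (R.data Φ) := (hR.setPair Φ).wordAlgebra

/-- A permutation of the inputs is induced by a morphism. -/
theorem exists_perm (col : ℕ → Colour) {N N' : List ℕ} (h : N.Perm N') :
    ∃ σ : tensorList (colourFamily R.M R.Z) (N'.map col) ⟶
        tensorList (colourFamily R.M R.Z) (N.map col),
      ∀ (Φ : Realization C) (t' : ElList Φ (colourFamily R.M R.Z) (N'.map col))
        (ρ : ℕ → (R.data Φ).M ⊕ (R.data Φ).Z), N'.map ρ = listOf t' →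
          ∃ t, N.map ρ = listOf t ∧ Φ.map σ t'.pure = t.pure := by
  induction h with
  | nil => exact ⟨𝟙 _, fun Φ t' ρ h => ⟨t', h, Φ.map_id _⟩⟩
  | cons a _ ih =>
    obtain ⟨σ, hσ⟩ := ih
    refine ⟨colourFamily R.M R.Z (col a) ◁ σ, fun Φ t' ρ h => ?_⟩
    cases t' with
    | cons b t' =>
      simp only [List.map_cons, listOf, List.cons.injEq] at h
      obtain ⟨t, h1, h2⟩ := hσ Φ t' ρ h.2
      refine ⟨.cons b t, ?_, ?_⟩
      · rw [List.map_cons, listOf, h.1, h1]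
      · rw [ElList.pure, Φ.map_whiskerLeft, h2, ElList.pure]
  | swap a b N =>
    refine ⟨tensorSwap _ [] (N.map col) (col b) (col a), fun Φ t' ρ h => ?_⟩
    match t', h with
    | .cons y (.cons x t'), h =>
      simp only [List.map_cons, listOf, List.cons.injEq] at h
      refine ⟨.cons x (.cons y t'), ?_, ElList.tensorSwap_pure .nil x y t'⟩
      simp only [List.map_cons, listOf, h]
  | trans _ _ ih ih' =>
    obtain ⟨σ, hσ⟩ := ih
    obtain ⟨σ', hσ'⟩ := ih'
    refine ⟨σ' ≫ σ, fun Φ t' ρ h => ?_⟩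
    obtain ⟨t, h1, h2⟩ := hσ' Φ t' ρ h
    obtain ⟨s, h3, h4⟩ := hσ Φ t ρ h1
    exact ⟨s, h3, by rw [Φ.map_comp, h2, h4]⟩

/-- The morphism `f` is the operation of the word `w`, whose inputs are labelled by `N`. -/
def Laws.Represents (hR : R.Laws) (N : List ℕ) {cs : List Colour} {d : Colour} (w : Word)
    (f : tensorList (colourFamily R.M R.Z) cs ⟶ colourFamily R.M R.Z d) : Prop :=
  ∀ (Φ : Realization C) (t : ElList Φ (colourFamily R.M R.Z) cs)
    (ρ : ℕ → (R.data Φ).M ⊕ (R.data Φ).Z), N.map ρ = listOf t →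
      (hR.wordAlgebra Φ).ev ρ d w = ofEl (Φ.map f t.pure)

variable {hR : R.Laws}

theorem Laws.Represents.perm {N N' : List ℕ} {col : ℕ → Colour} {d : Colour} {w : Word}
    {f : tensorList (colourFamily R.M R.Z) (N.map col) ⟶ colourFamily R.M R.Z d}
    (h : hR.Represents N w f) (hN : N.Perm N') :
    ∃ f' : tensorList (colourFamily R.M R.Z) (N'.map col) ⟶ colourFamily R.M R.Z d,
      hR.Represents N' w f' := by
  obtain ⟨σ, hσ⟩ := exists_perm (R := R) col hN
  refine ⟨σ ≫ f, fun Φ t' ρ h' => ?_⟩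
  obtain ⟨t, h1, h2⟩ := hσ Φ t' ρ h'
  rw [h Φ t ρ h1, Φ.map_comp, h2]

theorem map_colour_eq {Φ : Realization C} {ρ : ℕ → (R.data Φ).M ⊕ (R.data Φ).Z} {N : List ℕ}
    {cs : List Colour} {t : ElList Φ (colourFamily R.M R.Z) cs} (h : N.map ρ = listOf t) :
    N.map (fun i => colour (ρ i)) = cs := by
  have := congrArg (List.map colour) h
  rwa [map_colour_listOf, List.map_map] at this

theorem represents_comp {i j p q n l r : ℕ} (hij : i ≠ j) (h : n = p + 1 + q) (h' : r = p + l + q) :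
    hR.Represents (cs := [.closed n, .closed l]) (d := .closed r) [i, j] (compWord i j p q l)
      (R.M n ◁ (ρ_ (R.M l)).hom ≫ R.comp p q h h') := by
  rintro Φ (_ | ⟨a, _ | ⟨b, _ | _⟩⟩) ρ hρ
  simp only [List.map_cons, listOf, ofEl, List.cons.injEq] at hρ
  subst h'
  refine ((hR.wordAlgebra Φ).ev_comp hij hρ.1 hρ.2.1 h).trans ?_
  rw [data_comp p q h rfl]
  simp only [ElList.pure, Φ.map_comp, Φ.map_whiskerLeft, Φ.map_rightUnitor]
  rfl

theorem represents_ract {i p q n l r : ℕ} (h : n = p + 1 + q) (h' : r = p + l + q) :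
    hR.Represents (cs := [.opened n]) (d := .opened r) [i] (ractWord i p q l)
      (R.ract p q h h') := by
  rintro Φ (_ | ⟨a, _ | _⟩) ρ hρ
  simp only [List.map_cons, listOf, ofEl, List.cons.injEq] at hρ
  subst h'
  refine ((hR.wordAlgebra Φ).ev_ract l hρ.1 h).trans ?_
  rw [data_ract p q h rfl]
  rfl

theorem represents_act {col : ℕ → Colour} {i k n : ℕ} {s : List (Option ℕ)} {s' : Slots}
    (hi : some i ∉ s) (hs : s.reduceOption.Nodup)
    (hc : s.map (Option.map col) = s'.map (Option.map .opened)) (h : k = s'.length)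
    (h' : n = s'.total) : hR.Represents (cs := .closed k :: slotColours s') (d := .opened n)
      (i :: s.reduceOption) (actWord col i s)
      (R.M k ◁ (collapse R.M R.Z s').inv ≫ R.act s' h h') := by
  rintro Φ (_ | ⟨a, t⟩) ρ hρ
  simp only [List.map_cons, listOf, ofEl, List.cons.injEq] at hρ
  obtain ⟨e1, e2⟩ := renameWord_actWord hi hs hc
  have hcol : ∀ j, some j ∈ s → colour (ρ j) = col j := by
    have e3 := (map_colour_eq hρ.2).trans e2.symm
    intro j hj
    exact List.map_inj_left.1 e3 j (mem_reduceOption.2 hj)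
  have e : actWord col i s = actWord (fun i => colour (ρ i)) i s := by
    rw [actWord, actWord]
    congr 1
    refine List.map_congr_left fun o ho => ?_
    cases o with
    | none => rfl
    | some j => rw [slotWord, slotWord, hcol j ho]
  have hn : (actWord col i s).count none = n := by
    rw [← count_none_renameWord (i :: s.reduceOption).idxOf, e1]
    exact (isRLStage_act h h').bars
  obtain ⟨u, h1, h2⟩ := exists_collapse t
  have hl : s.length = s'.length := by simpa using congrArg List.length hc
  have hz : s.map (Option.map ρ) = u.toList.map (Option.map .inr) := by
    have key : ∀ {s : List (Option ℕ)} {s' : Slots} (u : SlotList Φ R.Z s'),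
        s.map (Option.map col) = s'.map (Option.map .opened) →
          s.reduceOption.map ρ = u.toList.reduceOption.map .inr →
            s.map (Option.map ρ) = u.toList.map (Option.map .inr) := by
      intro s s' u
      induction u generalizing s with
      | nil => intro h _; cases s with
        | nil => rfl
        | cons => simp at h
      | bar u ih =>
        intro h h'
        cases s with
        | nil => simp at h
        | cons o s => cases o with
          | none => exact congrArg _ (ih (List.cons.inj h).2 h')
          | some j => simp at h
      | cons z u ih =>
        intro h h'
        cases s with
        | nil => simp at h
        | cons o s => cases o with
          | none => simp at h
          | some j =>
            obtain ⟨h3, h4⟩ := List.cons.inj h'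
            rw [List.map_cons, ih (List.cons.inj h).2 h4, Option.map_some, h3]
            rfl
    exact key u hc (hρ.2.trans h2)
  have e4 := (hR.wordAlgebra Φ).ev_act hρ.1 (h.trans hl.symm) hi hs hz
  rw [← e, hn] at e4
  rw [e4, data_act h h']
  simp only [ElList.pure, Φ.map_comp, Φ.map_whiskerLeft, h1]
  rfl

theorem represents_mu (n : ℕ) : hR.Represents (cs := []) (d := .closed n) []
    (List.replicate n none) (R.mu n) := by
  rintro Φ (_ | _) ρ -
  exact (hR.wordAlgebra Φ).ev_mu ρ n

open Function in
/-- The operation of every word is given by a morphism, because the words are generated by the words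
of the structure maps of the pair. -/
theorem Laws.exists_represents (hR : R.Laws) {col : ℕ → Colour} {d : Colour} {w : Word}
    (h : Generated col d w) : ∀ {N : List ℕ}, N.Nodup → (∀ i, some i ∈ w ↔ i ∈ N) →
      ∃ f : tensorList (colourFamily R.M R.Z) (N.map col) ⟶ colourFamily R.M R.Z d,
        hR.Represents N w f := by
  -- the order of the inputs is irrelevant, as the symmetries of `C` permute them
  have perm : ∀ {col : ℕ → Colour} {d : Colour} {w : Word} {N : List ℕ}, N.Nodup →
      (∀ i, some i ∈ w ↔ i ∈ N) →
      (∃ f : tensorList (colourFamily R.M R.Z) (N.map col) ⟶ colourFamily R.M R.Z d,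
        hR.Represents N w f) → ∀ {N' : List ℕ}, N'.Nodup → (∀ i, some i ∈ w ↔ i ∈ N') →
      ∃ f : tensorList (colourFamily R.M R.Z) (N'.map col) ⟶ colourFamily R.M R.Z d,
        hR.Represents N' w f := by
    rintro col d w N h1 h2 ⟨f, hf⟩ N' h3 h4
    exact hf.perm ((List.perm_ext_iff_of_nodup h1 h3).2 fun i => (h2 i).symm.trans (h4 i))
  induction h with
  | congr _ hc ih =>
    intro N h1 h2
    rw [List.map_congr_left fun i hi => hc i ((h2 i).2 hi)]
    exact ih h1 h2
  | @subst col d p x y hx hy hp hd ih ih' =>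
    obtain ⟨h1, h2⟩ := nodup_cons_erase hp
    have hpN := (List.nodup_cons.1 h1).1
    have hpy : some p ∉ y := fun h => hd p h hp
    obtain ⟨f, hf⟩ := ih h1 h2
    obtain ⟨g, hg⟩ := ih' (nodup_letters y) mem_letters
    intro _ m₁ m₂
    refine perm (N := letters y ++ (letters x).erase p) ?_ (fun i => ?_) ?_ m₁ m₂
    · rw [List.nodup_append]
      refine ⟨nodup_letters y, (List.nodup_cons.1 h1).2, fun i hi j hj e => ?_⟩
      subst e
      exact hd i ((mem_letters i).2 hi) ((mem_letters i).2 (List.mem_of_mem_erase hj))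
    · rw [letters_substLetter (hx.valid.count p hp) hy.valid.bars, List.mem_append, ← mem_letters,
        h2, List.mem_cons]
      have h6 : i ∈ (letters x).erase p → i ≠ p := fun h e => hpN (e ▸ h)
      tauto
    · rw [List.map_append]
      refine ⟨tensorAt _ [] _ _ (col p) g ≫ f, fun Φ t ρ hρ => ?_⟩
      obtain ⟨t₁, t₂, rfl⟩ := exists_append _ t
      rw [List.map_append, listOf_append] at hρ
      obtain ⟨h3, h4⟩ := List.append_inj hρ
        (by rw [length_listOf, List.length_map, List.length_map])
      have h5 := hg Φ t₁ ρ h3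
      have h6 := hf Φ (.cons (Φ.map g t₁.pure) t₂) (update ρ p (ofEl (Φ.map g t₁.pure))) (by
        rw [List.map_cons, update_self, listOf, ← h4]
        congr 1
        exact List.map_congr_left fun i hi => update_of_ne (ne_of_mem_of_not_mem hi hpN) _ _)
      have hcy : ∀ i, some i ∈ y → colour (ρ i) = col i := fun i hi =>
        List.map_inj_left.1 (map_colour_eq h3) i ((mem_letters i).1 hi)
      have hcx : ∀ i, i ∈ (letters x).erase p → colour (ρ i) = col i := fun i hi =>
        List.map_inj_left.1 (map_colour_eq h4) i hi
      rw [(hR.wordAlgebra Φ).ev_subst (hy.valid.congr hcy) (hx.valid.congr fun i hi => ?_) hp hd,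
        h5, h6, Φ.map_comp]
      · exact congrArg (fun a => ofEl (Φ.map f a))
          (ElList.tensorAt_pure (pre := []) g .nil t₁ t₂).symm
      · rcases List.mem_cons.1 ((h2 i).1 hi) with rfl | hi'
        · rw [update_self, h5, colour_ofEl]
        · rw [update_of_ne (ne_of_mem_of_not_mem hi' hpN), hcx i hi']
  | mu col n =>
    intro _ m₁ m₂
    exact perm (N := []) (by simp) (by simp [List.mem_replicate])
      ⟨_, represents_mu n⟩ m₁ m₂
  | @comp col i j p q l hij hi hj =>
    intro _ m₁ m₂
    refine perm (N := [i, j]) (by simpa using hij)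
      (fun k => by simp only [List.mem_append, mem_chunk, List.mem_cons]; tauto) ?_ m₁ m₂
    rw [List.map_cons, List.map_cons, hi, hj]
    exact ⟨_, represents_comp hij rfl rfl⟩
  | @act col i s n hi his hs ho hn =>
    intro _ m₁ m₂
    refine perm (N := i :: s.reduceOption)
      (by simpa [List.nodup_cons, mem_reduceOption] using ⟨his, hs⟩)
      (fun j => by simp [mem_actWord, mem_reduceOption]) ?_ m₁ m₂
    have hs' : s.map (Option.map col) =
        (s.map (Option.map fun j => (col j).arity)).map (Option.map .opened) := by
      rw [List.map_map]
      refine List.map_congr_left fun o h => ?_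
      cases o with
      | none => rfl
      | some j =>
        have := ho j h
        simp only [Function.comp_apply, Option.map_some, Option.some.injEq]
        cases hj : col j with
        | closed => rw [hj] at this; cases this
        | opened => rfl
    obtain ⟨e1, e2⟩ := renameWord_actWord his hs hs'
    have hl : s.length = (s.map (Option.map fun j => (col j).arity)).length := by simp
    rw [List.map_cons, hi, e2]
    refine ⟨_, represents_act his hs hs' hl ?_⟩
    rw [← hn, ← count_none_renameWord (i :: s.reduceOption).idxOf, e1]
    exact (isRLStage_act hl rfl).bars
  | @ract col i p q l hi =>
    intro _ m₁ m₂
    refine perm (N := [i]) (by simp) (fun k => by simp [mem_chunk]) ?_ m₁ m₂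
    rw [List.map_cons, hi]
    exact ⟨_, represents_ract rfl rfl⟩

end RawPair

end

/-! ### The algebra of a pair -/

open PairData (colour)

section

theorem exists_map_eq {α : Type*} (a : α) {N : List ℕ} (hN : N.Nodup) {es : List α}
    (h : N.length = es.length) : ∃ ρ : ℕ → α, N.map ρ = es :=
  ⟨fun i => es[N.idxOf i]?.getD a, List.ext_getElem (by simpa using h) fun i h1 h2 => by
    rw [List.getElem_map, hN.idxOf_getElem, List.getElem?_eq_getElem h2, Option.getD_some]⟩

theorem map_colourAt (cs : List Colour) : (List.range cs.length).map (colourAt cs) = cs :=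
  List.ext_getElem (by simp) fun i h1 h2 => by simp [colourAt, h2]

/-- Numbered letters can be given any names. -/
theorem exists_renameWord {cs : List Colour} {d : Colour} {w : Word} (hw : IsRLStage 2 cs d w)
    {N : List ℕ} (hN : N.Nodup) (h : N.length = cs.length) :
    ∃ w', (∀ i, some i ∈ w' ↔ i ∈ N) ∧ renameWord N.idxOf w' = w := by
  obtain ⟨g, hg⟩ := exists_map_eq 0 List.nodup_range
    (show (List.range cs.length).length = N.length by simp [h])
  have h1 := (isRLStage_iff.1 hw).2
  refine ⟨renameWord g w, fun i => ?_, ?_⟩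
  · rw [mem_renameWord, ← hg, List.mem_map]
    simp only [h1, List.mem_range]
  · rw [renameWord_comp]
    refine renameWord_id fun i hi => ?_
    have h2 : i < N.length := by rw [h]; exact (h1 i).1 hi
    have h3 : g i = N[i] := by simp [← hg]
    rw [Function.comp_apply, h3, hN.idxOf_getElem]

variable {C : Type u} [Category.{v} C] [MonoidalCategory C] [SymmetricCategory C]

namespace RawPair

variable {R : RawPair C} {hR : R.Laws}

theorem Laws.Represents.unique [HasInitial C] {N : List ℕ} {cs : List Colour} {d : Colour}
    {w : Word} {f g : tensorList (colourFamily R.M R.Z) cs ⟶ colourFamily R.M R.Z d}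
    (hf : hR.Represents N w f) (hg : hR.Represents N w g) (hN : N.Nodup)
    (h : N.length = cs.length) : f = g :=
  hom_ext_tensorList fun Φ t => by
    obtain ⟨ρ, hρ⟩ := exists_map_eq (Sum.inl (R.data Φ).one) hN
      (h.trans (length_listOf t).symm)
    exact ofEl_inj ((hf Φ t ρ hρ).symm.trans (hg Φ t ρ hρ))

/-- Every word is the operation of a morphism, for all names of its letters at once. -/
theorem Laws.exists_op (hR : R.Laws) {cs : List Colour} {d : Colour} (x : RL2 cs d) :
    ∃ f : tensorList (colourFamily R.M R.Z) cs ⟶ colourFamily R.M R.Z d, ∀ (N : List ℕ) (w : Word),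
      (∀ i, some i ∈ w ↔ i ∈ N) → renameWord N.idxOf w = x.1 → hR.Represents N w f := by
  obtain ⟨h1, h2⟩ := isRLStage_iff.1 x.2
  have h3 := hR.exists_represents h1.generated (N := List.range cs.length) List.nodup_range
    (by simpa using h2)
  rw [map_colourAt] at h3
  obtain ⟨f, hf⟩ := h3
  refine ⟨f, fun N w hN hw Φ t ρ hρ => ?_⟩
  obtain ⟨ρ', hρ'⟩ := exists_map_eq (ρ 0) List.nodup_range
    (show (List.range cs.length).length = (listOf t).length by
      rw [List.length_range, length_listOf])
  rw [← hf Φ t ρ' hρ', ← hw]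
  refine Eq.trans ?_ (SetPair.eval_rename (P := hR.setPair Φ) (injLetters_idxOf hN)).symm
  refine SetPair.eval_congr (P := hR.setPair Φ) fun i hi => ?_
  have h4 := (List.idxOf_lt_length_of_mem ((hN i).1 hi))
  have h5 := hρ.trans hρ'.symm
  have h6 := congrArg (fun l => l[N.idxOf i]?) h5
  have h7 : N.idxOf i < cs.length := by
    have := congrArg List.length h5
    simp only [List.length_map, List.length_range] at this
    omega
  rw [List.getElem?_map, List.getElem?_map, List.getElem?_idxOf ((hN i).1 hi),
    List.getElem?_range h7] at h6
  exact Option.some.inj h6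

/-- The operation of an element of `RL_2` on a pair. -/
noncomputable def Laws.op (hR : R.Laws) {cs : List Colour} {d : Colour} (x : RL2 cs d) :
    tensorList (colourFamily R.M R.Z) cs ⟶ colourFamily R.M R.Z d :=
  (hR.exists_op x).choose

theorem Laws.represents_op (hR : R.Laws) {cs : List Colour} {d : Colour} (x : RL2 cs d)
    {N : List ℕ} {w : Word} (hN : ∀ i, some i ∈ w ↔ i ∈ N) (hw : renameWord N.idxOf w = x.1) :
    hR.Represents N w (hR.op x) := (hR.exists_op x).choose_spec N w hN hw

theorem Laws.Represents.valid {N : List ℕ} {Φ : Realization C} {cs : List Colour}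
    {t : ElList Φ (colourFamily R.M R.Z) cs} {ρ : ℕ → (R.data Φ).M ⊕ (R.data Φ).Z}
    (hρ : N.map ρ = listOf t) {d : Colour} (x : RL2 cs d) {w : Word} (hd : N.Nodup)
    (hN : ∀ i, some i ∈ w ↔ i ∈ N) (hw : renameWord N.idxOf w = x.1) :
    Valid (fun i => colour (ρ i)) d w := by
  rw [← valid_iff_isRLStage hN hd, hw, map_colour_eq hρ]
  exact x.2

variable [HasInitial C]

theorem Laws.op_id (hR : R.Laws) (c : Colour) : hR.op (RL2.id c) = (ρ_ _).hom := by
  refine (hR.represents_op (RL2.id c) (N := [0]) (w := idWord c.arity) (fun i => ?_) ?_).unique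
    (N := [0]) ?_ (by simp) rfl
  · rw [idWord_eq, mem_chunk, List.mem_singleton]
  · change renameWord _ (idWord c.arity) = idWord c.arity
    rw [idWord_eq, renameWord_corolla, List.idxOf_cons_self]
  · rintro Φ (_ | ⟨a, _ | _⟩) ρ hρ
    simp only [List.map_cons, listOf, List.cons.injEq] at hρ
    rw [ElList.pure, ElList.pure, Φ.map_rightUnitor, ← hρ.1, idWord_eq]
    have := (hR.wordAlgebra Φ).ev_corolla ρ 0
    rwa [hρ.1, colour_ofEl, ← hρ.1] at this

theorem Laws.op_swap (hR : R.Laws) {pre post : List Colour} {a b d : Colour}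
    (x : RL2 (pre ++ a :: b :: post) d) :
    hR.op x.swap = tensorSwap _ pre post a b ≫ hR.op x := by
  obtain ⟨Q, k, l, S, hd, hQ, hS⟩ : ∃ Q k l S, (Q ++ k :: l :: S : List ℕ).Nodup ∧
      Q.length = pre.length ∧ S.length = post.length := by
    refine ⟨List.range pre.length, pre.length, pre.length + 1,
      List.range' (pre.length + 2) post.length, ?_, by simp, by simp⟩
    simp only [List.nodup_append, List.nodup_cons, List.nodup_range,
      List.mem_range, List.mem_range'_1, List.mem_cons, true_and]
    refine ⟨⟨by omega, by omega, List.nodup_range'⟩, fun i hi j hj => by omega⟩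
  obtain ⟨w, h1, h2⟩ := exists_renameWord x.2 hd (by simp [hQ, hS])
  have h3 : (Q ++ k :: l :: S).Perm (Q ++ l :: k :: S) := (List.Perm.swap l k S).append_left Q
  refine (hR.represents_op x.swap (N := Q ++ l :: k :: S) (w := w)
    (fun i => (h1 i).trans h3.mem_iff) ?_).unique ?_ (h3.nodup_iff.1 hd) (by simp [hQ, hS])
  · rw [RL2Algebra.swapWord_renameWord hd fun i hi => (h1 i).1 hi, h2, hQ]
    rfl
  · intro Φ t ρ hρ
    obtain ⟨t₁, t, rfl⟩ := exists_append pre t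
    match t, hρ with
    | .cons y (.cons z t₂), hρ =>
      rw [Φ.map_comp, ElList.tensorSwap_pure]
      refine hR.represents_op x h1 h2 Φ _ ρ ?_
      rw [listOf_append, List.map_append] at hρ ⊢
      obtain ⟨e1, e2⟩ := List.append_inj hρ (by rw [length_listOf, List.length_map, hQ])
      simp only [List.map_cons, listOf, List.cons.injEq] at e2
      simp only [e1, List.map_cons, listOf, e2]

open Function in
/-- The associativity axiom for the algebra of a pair: the two morphisms have the same values on
elements, because the evaluation of words respects substitution. The letters are renamed so that
the words have no common ones. -/
theorem Laws.op_subst (hR : R.Laws) {pre mid post : List Colour} {c d : Colour}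
    (x : RL2 (pre ++ c :: post) d) (y : RL2 mid c) :
    hR.op (x.subst y) = tensorAt _ pre mid post c (hR.op y) ≫ hR.op x := by
  -- names for the inputs of the composite, and for the letter that is replaced
  obtain ⟨Q, N, S, k, hd, hk, hQ, hN, hS⟩ : ∃ (Q N S : List ℕ) (k : ℕ),
      (Q ++ (N ++ S)).Nodup ∧ k ∉ Q ++ (N ++ S) ∧
        Q.length = pre.length ∧ N.length = mid.length ∧ S.length = post.length := by
    refine ⟨List.range pre.length, List.range' pre.length mid.length,
      List.range' (pre.length + mid.length) post.length, pre.length + mid.length + post.length,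
      ?_, ?_, by simp, by simp, by simp⟩ <;>
    simp [List.nodup_append, List.nodup_range, List.nodup_range', List.mem_range,
      List.mem_range'_1] <;> omega
  simp only [List.mem_append, not_or] at hk
  simp only [List.nodup_append, List.mem_append] at hd
  have hdx : (Q ++ k :: S).Nodup := by
    simp only [List.nodup_append, List.nodup_cons, List.mem_cons]
    refine ⟨hd.1, ⟨hk.2.2, hd.2.1.2.1⟩, ?_⟩
    rintro i hi j (rfl | hj)
    · exact ne_of_mem_of_not_mem hi hk.1
    · exact hd.2.2 i hi j (Or.inr hj)
  obtain ⟨x', hx1, hx2⟩ := exists_renameWord x.2 hdx (by simp [hQ, hS])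
  obtain ⟨y', hy1, hy2⟩ := exists_renameWord y.2 hd.2.1.1 hN
  have hyx : DisjointLetters y' x' := by
    intro i hi hi'
    have hiN := (hy1 i).1 hi
    rcases List.mem_append.1 ((hx1 i).1 hi') with h | h
    · exact hd.2.2 i h i (Or.inl hiN) rfl
    · rcases List.mem_cons.1 h with rfl | h
      · exact hk.2.1 hiN
      · exact hd.2.1.2.2 i hiN i h rfl
  have hkx : some k ∈ x' := (hx1 k).2 (by simp)
  have hcard : x'.count (some k) = c.arity + 1 := by
    have h1 := count_renameWord (f := (Q ++ k :: S).idxOf) (w := x') (i := k) fun j hj e =>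
      injLetters_idxOf hx1 _ _ hj hkx e
    rw [hx2, x.2.letters, List.idxOf_append, if_neg hk.1, List.idxOf_cons_self, zero_add, hQ] at h1
    rw [← h1]
    simp
  have hbars : y'.count none = c.arity := by
    rw [← count_none_renameWord N.idxOf, hy2, y.2.bars]
  refine (hR.represents_op (x.subst y) (N := Q ++ (N ++ S)) (w := substLetter k x' y')
    (fun i => ?_) ?_).unique ?_ (by simp only [List.nodup_append, List.mem_append]; exact hd)
    (by simp [hQ, hN, hS])
  · rw [letters_substLetter hcard hbars, hx1, hy1]
    have h1 : i ∈ Q → i ≠ k := fun h => ne_of_mem_of_not_mem h hk.1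
    have h2 : i ∈ S → i ≠ k := fun h => ne_of_mem_of_not_mem h hk.2.2
    simp only [List.mem_append, List.mem_cons]
    tauto
  · rw [renameWord_substLetter hy1 hyx hk.1 fun i hi hi' => hd.2.2 i hi' i (Or.inl hi) rfl, hx2,
      hy2, hQ, hN]
    rfl
  · intro Φ t ρ hρ
    obtain ⟨t₁, t, rfl⟩ := exists_append pre t
    obtain ⟨t₂, t₃, rfl⟩ := exists_append mid t
    rw [Φ.map_comp, ElList.tensorAt_pure]
    simp only [listOf_append, List.map_append] at hρ
    obtain ⟨e1, e2⟩ := List.append_inj hρ (by rw [length_listOf, List.length_map, hQ])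
    obtain ⟨e2, e3⟩ := List.append_inj e2 (by rw [length_listOf, List.length_map, hN])
    have h5 := hR.represents_op y hy1 hy2 Φ t₂ ρ e2
    have h6 : (Q ++ k :: S).map (update ρ k (ofEl (Φ.map (hR.op y) t₂.pure))) =
        listOf (t₁.append (.cons (Φ.map (hR.op y) t₂.pure) t₃)) := by
      have h7 : ∀ {l : List ℕ} (a), k ∉ l → l.map (update ρ k a) = l.map ρ := fun a h =>
        List.map_congr_left fun i hi => update_of_ne (ne_of_mem_of_not_mem hi h) _ _
      rw [List.map_append, List.map_cons, h7 _ hk.1, h7 _ hk.2.2, update_self, listOf_append,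
        listOf, e1, e3]
    have h8 := Laws.Represents.valid h6 x hdx hx1 hx2
    rw [← h5] at h8
    rw [(hR.wordAlgebra Φ).ev_subst (Laws.Represents.valid e2 y hd.2.1.1 hy1 hy2) h8 hkx hyx, h5]
    exact hR.represents_op x hx1 hx2 Φ _ _ h6

/-! #### The operations of the words of the generators are the structure maps -/

theorem Laws.op_bars (hR : R.Laws) (n : ℕ) :
    hR.op (cs := []) (d := .closed n) ⟨_, isRLStage_bars n⟩ = R.mu n :=
  (hR.represents_op (d := .closed n) ⟨_, isRLStage_bars n⟩ (N := []) (by simp [List.mem_replicate])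
    (renameWord_bars _ n)).unique (represents_mu n) (by simp) rfl

theorem Laws.op_comp (hR : R.Laws) {p q n l r : ℕ} (h : n = p + 1 + q) (h' : r = p + l + q) :
    hR.op (cs := [.closed n, .closed l]) ⟨_, isRLStage_comp h h'⟩ =
      R.M n ◁ (ρ_ (R.M l)).hom ≫ R.comp p q h h' :=
  (hR.represents_op ⟨_, isRLStage_comp h h'⟩ (N := [0, 1])
    (fun k => by simp only [List.mem_append, mem_chunk, List.mem_cons]; tauto)
    (renameWord_id fun i hi => by
      simp only [List.mem_append, mem_chunk] at hi
      obtain rfl | rfl : i = 0 ∨ i = 1 := by tauto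
      all_goals rfl)).unique
    (represents_comp (by simp) h h') (by simp) rfl

theorem Laws.op_ract (hR : R.Laws) {p q n l r : ℕ} (h : n = p + 1 + q) (h' : r = p + l + q) :
    hR.op (cs := [.opened n]) (d := .opened r) ⟨_, isRLStage_ract h h'⟩ = R.ract p q h h' :=
  (hR.represents_op (d := .opened r) ⟨_, isRLStage_ract h h'⟩ (N := [0])
    (fun k => by simp [mem_chunk])
    (renameWord_id fun i hi => by
      have : i = 0 := by simpa [mem_chunk] using hi
      rw [this]
      rfl)).unique (represents_ract h h') (by simp) rfl

theorem Laws.op_act (hR : R.Laws) {s : Slots} {k n : ℕ} (h : k = s.length) (h' : n = s.total) :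
    hR.op (cs := .closed k :: slotColours s) (d := .opened n) ⟨_, isRLStage_act h h'⟩ =
      R.M k ◁ (collapse R.M R.Z s).inv ≫ R.act s h h' := by
  obtain ⟨col, s', h1, h2, h3, h4⟩ := WordAlgebra.exists_names Colour.opened s
    (fun _ => Colour.closed k) 1
  have h5 : some 0 ∉ s' := fun h => absurd (h2 0 h) (by simp)
  obtain ⟨h6, h7⟩ := renameWord_actWord h5 h3 h4
  exact (hR.represents_op (d := .opened n) ⟨_, isRLStage_act h h'⟩ (N := 0 :: s'.reduceOption)
    (fun j => by simp [mem_actWord, mem_reduceOption]) h6).unique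
    (represents_act h5 h3 h4 h h')
    (by simpa [List.nodup_cons, mem_reduceOption] using ⟨h5, h3⟩) (by simp [← h7])

end RawPair

/-! ### The action maps of the algebra of a pair -/

section Closed

variable [MonoidalClosed C] [HasColimits C]

/-- The action map with given components. -/
noncomputable def actOf {X : Colour → C} {cs : List Colour} {d : Colour}
    (f : RL2 cs d → (tensorList X cs ⟶ X d)) : RL2Obj C cs d ⊗ tensorList X cs ⟶ X d :=
  (β_ _ _).hom ≫ MonoidalClosed.uncurry
    (Sigma.desc fun x => MonoidalClosed.curry ((ρ_ (tensorList X cs)).hom ≫ f x))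

/-- As `C` is closed, the tensor product preserves coproducts. -/
theorem hom_ext_sigma {ι : Type} {A B : C} {f g : (∐ fun _ : ι => 𝟙_ C) ⊗ A ⟶ B}
    (h : ∀ x : ι, (λ_ A).inv ≫ Sigma.ι (fun _ : ι => 𝟙_ C) x ▷ A ≫ f =
      (λ_ A).inv ≫ Sigma.ι (fun _ : ι => 𝟙_ C) x ▷ A ≫ g) : f = g := by
  rw [← cancel_epi (β_ A _).hom]
  refine MonoidalClosed.curry_injective (Sigma.hom_ext _ _ fun x => ?_)
  rw [← MonoidalClosed.curry_natural_left, ← MonoidalClosed.curry_natural_left,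
    ← Category.assoc, ← Category.assoc, BraidedCategory.braiding_naturality_right, Category.assoc,
    Category.assoc, (cancel_epi _).1 (h x)]

theorem hom_ext_components {X : Colour → C} {cs : List Colour} {d : Colour}
    {f g : RL2Obj C cs d ⊗ tensorList X cs ⟶ X d}
    (h : ∀ x : RL2 cs d, actionAt f x = actionAt g x) : f = g :=
  hom_ext_sigma h

theorem actionAt_actOf {X : Colour → C} {cs : List Colour} {d : Colour}
    (f : RL2 cs d → (tensorList X cs ⟶ X d)) (x : RL2 cs d) : actionAt (actOf f) x = f x := by
  unfold actionAt actOf RL2Obj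
  rw [BraidedCategory.braiding_naturality_left_assoc, ← MonoidalClosed.uncurry_natural_left,
    Sigma.ι_desc, MonoidalClosed.uncurry_curry, ← Category.assoc, ← Category.assoc]
  simp

/-- The algebra of a pair. -/
noncomputable def RawPair.Laws.toAlgebra {R : RawPair C} (hR : R.Laws) : RL2Algebra C where
  closedPart := R.M
  openPart := R.Z
  act _ _ := actOf hR.op
  act_id c := by rw [actionAt_actOf, hR.op_id]
  act_subst pre mid post c d x y := by simp only [actionAt_actOf, hR.op_subst]
  act_swap pre post a b d x := by simp only [actionAt_actOf, hR.op_swap]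

theorem RawPair.Laws.op_toAlgebra {R : RawPair C} (hR : R.Laws) {cs : List Colour} {d : Colour}
    (x : RL2 cs d) : hR.toAlgebra.op x = hR.op x := actionAt_actOf _ x

/-- The pair of the algebra of a pair has the original structure maps, because the words of the
generators act through them. -/
theorem RawPair.Laws.raw_toAlgebra {R : RawPair C} (hR : R.Laws) : hR.toAlgebra.raw = R := by
  have h1 : hR.toAlgebra.raw.comp = @RawPair.comp _ _ _ R := by
    funext p q n l r h h'
    refine Eq.trans (congrArg (R.M n ◁ (ρ_ (R.M l)).inv ≫ ·)
      ((hR.op_toAlgebra _).trans (hR.op_comp h h'))) ?_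
    exact (MonoidalCategory.whiskerLeft_inv_hom_assoc _ _ _)
  have h2 : hR.toAlgebra.raw.act = @RawPair.act _ _ _ R := by
    funext s k n h h'
    refine Eq.trans (congrArg (R.M k ◁ (collapse R.M R.Z s).hom ≫ ·)
      ((hR.op_toAlgebra _).trans (hR.op_act h h'))) ?_
    exact (MonoidalCategory.whiskerLeft_hom_inv_assoc _ _ _)
  have h3 : hR.toAlgebra.raw.ract = @RawPair.ract _ _ _ R := by
    funext p q n l r h h'
    exact (hR.op_toAlgebra _).trans (hR.op_ract h h')
  have h4 : hR.toAlgebra.raw.mu = R.mu := by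
    funext n
    exact (hR.op_toAlgebra _).trans (hR.op_bars n)
  have h5 : hR.toAlgebra.raw.one = R.one := by
    exact (hR.op_toAlgebra _).trans
      ((hR.op_bars 1).trans ((Category.id_comp _).symm.trans hR.mu_one))
  obtain ⟨M, Z, one, mu, comp, act, ract⟩ := R
  change RawPair.mk M Z hR.toAlgebra.raw.one hR.toAlgebra.raw.mu hR.toAlgebra.raw.comp
    hR.toAlgebra.raw.act hR.toAlgebra.raw.ract = _
  rw [h1, h2, h3, h4, h5]

end Closed

end

/-! ### Morphisms -/

open PairData (colour)

section

variable {C : Type u} [Category.{v} C] [MonoidalCategory C]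

theorem unitSlots_tensorMap {Z Z' : ℕ → C} (g : ∀ n, Z n ⟶ Z' n) (n : ℕ) :
    unitSlots Z n ≫ tensorMap (slotMap g) (List.replicate n none) = unitSlots Z' n := by
  induction n with
  | zero => exact Category.id_comp _
  | succ n ih =>
    rw [unitSlots, unitSlots, ← ih]
    change _ ≫ (𝟙 (𝟙_ C) ⊗ₘ tensorMap (slotMap g) (List.replicate n none)) = _
    simp

theorem whiskerLeft_tensorHom_comp {A A' B B' D D' E : C} {f : A ⟶ A'} {i : B ⟶ D} {g : D ⟶ D'}
    {g' : B ⟶ B'} {i' : B' ⟶ D'} (h : i ≫ g = g' ≫ i') (k : A' ⊗ D' ⟶ E) :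
    A ◁ i ≫ (f ⊗ₘ g) ≫ k = (f ⊗ₘ g') ≫ A' ◁ i' ≫ k := by
  rw [← id_tensorHom, ← id_tensorHom, tensorHom_comp_tensorHom_assoc,
    tensorHom_comp_tensorHom_assoc, h, Category.id_comp, Category.comp_id]

theorem collapse_naturality {M Z M' Z' : ℕ → C} (f : ∀ n, M n ⟶ M' n) (g : ∀ n, Z n ⟶ Z' n) :
    ∀ s : Slots, (collapse M Z s).hom ≫ tensorMap (colourMap f g) (slotColours s) =
      tensorMap (slotMap g) s ≫ (collapse M' Z' s).hom
  | [] => (Category.id_comp _).trans (Category.comp_id _).symm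
  | none :: s => by
    have h := collapse_naturality f g s
    change ((λ_ _).hom ≫ (collapse M Z s).hom) ≫ _ =
      (𝟙 (𝟙_ C) ⊗ₘ tensorMap (slotMap g) s) ≫ (λ_ _).hom ≫ (collapse M' Z' s).hom
    rw [Category.assoc, h]
    simp
  | some l :: s => by
    have h := collapse_naturality f g s
    change Z l ◁ (collapse M Z s).hom ≫ (g l ⊗ₘ tensorMap (colourMap f g) (slotColours s)) =
      (g l ⊗ₘ tensorMap (slotMap g) s) ≫ Z' l ◁ (collapse M' Z' s).hom
    rw [← id_tensorHom, ← id_tensorHom, tensorHom_comp_tensorHom, tensorHom_comp_tensorHom, h,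
      Category.id_comp, Category.comp_id]

variable [SymmetricCategory C]

theorem RL2.mem_range {cs : List Colour} {d : Colour} (x : RL2 cs d) :
    (∀ i, some i ∈ x.1 ↔ i ∈ List.range cs.length) ∧
      renameWord (List.range cs.length).idxOf x.1 = x.1 := by
  have hN := (isRLStage_iff.1 x.2).2
  refine ⟨by simpa using hN, renameWord_id fun i hi => ?_⟩
  have h := List.nodup_range.idxOf_getElem (xs := List.range cs.length) i
    (by simpa using (hN i).1 hi)
  rwa [List.getElem_range] at h

namespace RawPair

/-- A morphism of pairs, without the compatibility with the maps `ι`, which follows from the one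
with the actions. -/
structure Hom (R R' : RawPair C) where
  mapM : ∀ n, R.M n ⟶ R'.M n
  mapZ : ∀ n, R.Z n ⟶ R'.Z n
  mu_comp : ∀ n, R.mu n ≫ mapM n = R'.mu n
  comp_comp : ∀ (p q : ℕ) {n l r : ℕ} (h : n = p + 1 + q) (h' : r = p + l + q),
    R.comp p q h h' ≫ mapM r = (mapM n ⊗ₘ mapM l) ≫ R'.comp p q h h'
  act_comp : ∀ (s : Slots) {k n : ℕ} (h : k = s.length) (h' : n = s.total),
    R.act s h h' ≫ mapZ n = (mapM k ⊗ₘ tensorMap (slotMap mapZ) s) ≫ R'.act s h h'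
  ract_comp : ∀ (p q : ℕ) {n l r : ℕ} (h : n = p + 1 + q) (h' : r = p + l + q),
    R.ract p q h h' ≫ mapZ r = mapZ n ▷ 𝟙_ C ≫ R'.ract p q h h'

variable {R R' : RawPair C}

/-- The morphism of pairs in sets that a morphism of pairs induces on elements. -/
@[reducible]
def Hom.data (φ : R.Hom R') (Φ : Realization C) : (R.data Φ).Hom (R'.data Φ) where
  mapM x := ⟨x.1, Φ.map (φ.mapM x.1) x.2⟩
  mapZ z := ⟨z.1, Φ.map (φ.mapZ z.1) z.2⟩
  ar_map _ := rfl
  arZ_map _ := rfl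
  mu_map n := by
    rw [← Φ.map_comp, φ.mu_comp]
  comp_map := by
    rintro ⟨n, a⟩ p ⟨l, b⟩ h
    have h' : n = p + 1 + (n - 1 - p) := by
      change p < n at h
      omega
    rw [data_comp p _ h' rfl, data_comp p _ h' rfl]
    simp only [← Φ.map_tensor, ← Φ.map_comp, φ.comp_comp]
  act_map := by
    rintro ⟨k, a⟩ zs h
    obtain ⟨s, t, rfl⟩ := SlotList.exists_toList zs
    have hk : k = s.length := by
      rw [← t.length_toList]
      exact h.symm
    rw [← SlotList.toList_map, data_act hk rfl, data_act hk rfl]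
    simp only [SlotList.toEl_map, ← ElList.tensorMap_pure, ← Φ.map_tensor, ← Φ.map_comp, φ.act_comp]
  ract_map := by
    rintro ⟨n, a⟩ p l h
    have h' : n = p + 1 + (n - 1 - p) := by
      change p < n at h
      omega
    rw [data_ract p _ h' rfl, data_ract p _ h' rfl]
    simp only [← Φ.map_whiskerRight, ← Φ.map_comp, φ.ract_comp]

theorem ofEl_map (φ : R.Hom R') (Φ : Realization C) : ∀ {c : Colour}
    (a : Φ.el (colourFamily R.M R.Z c)), ofEl (R := R') (Φ.map (colourMap φ.mapM φ.mapZ c) a) =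
      Sum.map (φ.data Φ).mapM (φ.data Φ).mapZ (ofEl a)
  | .closed _, _ => rfl
  | .opened _, _ => rfl

theorem listOf_map (φ : R.Hom R') {Φ : Realization C} : ∀ {cs : List Colour}
    (t : ElList Φ (colourFamily R.M R.Z) cs),
      listOf (R := R') (t.map (colourMap φ.mapM φ.mapZ)) =
        (listOf t).map (Sum.map (φ.data Φ).mapM (φ.data Φ).mapZ)
  | _, .nil => rfl
  | _, .cons a t => congrArg₂ List.cons (ofEl_map φ Φ a) (listOf_map φ t)

variable [HasInitial C]

/-- Morphisms of pairs are compatible with all operations. -/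
theorem Hom.op_comp (φ : R.Hom R') (hR : R.Laws) (hR' : R'.Laws) {cs : List Colour} {d : Colour}
    (x : RL2 cs d) :
    hR.op x ≫ colourMap φ.mapM φ.mapZ d = tensorMap (colourMap φ.mapM φ.mapZ) cs ≫ hR'.op x :=
  hom_ext_tensorList fun Φ t => by
    obtain ⟨ρ, hρ⟩ := exists_map_eq (Sum.inl (R.data Φ).one) List.nodup_range
      (show (List.range cs.length).length = (listOf t).length by
        rw [List.length_range, length_listOf])
    obtain ⟨hN, hw⟩ := x.mem_range
    have e1 := hR.represents_op x hN hw Φ t ρ hρ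
    have e2 := hR'.represents_op x hN hw Φ (t.map (colourMap φ.mapM φ.mapZ))
      (Sum.map (φ.data Φ).mapM (φ.data Φ).mapZ ∘ ρ) (by rw [listOf_map, ← hρ, List.map_map])
    have e3 := WordAlgebra.map_ev (hR.wordAlgebra Φ) (hR'.wordAlgebra Φ) (φ.data Φ)
      (Laws.Represents.valid hρ x List.nodup_range hN hw)
    rw [Φ.map_comp, Φ.map_comp, ElList.tensorMap_pure]
    refine ofEl_inj (R := R') ?_
    rw [ofEl_map, ← e1, e3, e2]

/-- The morphism of `PairE C` with given components. It is compatible with the maps `ι`, as these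
are the actions on no elements. -/
def Hom.toPairE (φ : R.Hom R') (hR : R.Laws) (hR' : R'.Laws) : hR.toPairE ⟶ hR'.toPairE where
  operadMap :=
    { map := φ.mapM
      one_map := by
        have h := φ.mu_comp 1
        rw [← Category.id_comp (R.mu 1), ← Category.id_comp (R'.mu 1), hR.mu_one, hR'.mu_one] at h
        exact h
      comp_map := fun p q n l r h h' => φ.comp_comp p q h h' }
  familyMap := φ.mapZ
  mult_comp := NSOperad.Hom.ext (funext φ.mu_comp)
  left_comp s _ _ h h' := φ.act_comp s h h'
  incl_comp n := by
    change R.incl n ≫ φ.mapZ n = φ.mapM n ≫ R'.incl n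
    rw [incl, incl, Category.assoc, Category.assoc, φ.act_comp, ← unitSlots_tensorMap φ.mapZ]
    rw [MonoidalCategory.tensorHom_def, Category.assoc, whiskerLeft_comp, Category.assoc,
      whisker_exchange_assoc, ← rightUnitor_inv_naturality_assoc]
  right_comp p q _ _ _ h h' := φ.ract_comp p q h h'

end RawPair

/-- The structure of a morphism of pairs. -/
@[reducible]
def PairE.Hom.raw {X Y : PairE C} (f : X ⟶ Y) : X.raw.Hom Y.raw where
  mapM := (PairE.Hom.operadMap f).map
  mapZ := PairE.Hom.familyMap f
  mu_comp n := congrArg (fun g => NSOperad.Hom.map g n) (PairE.Hom.mult_comp f)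
  comp_comp p q _ _ _ h h' := (PairE.Hom.operadMap f).comp_map p q _ _ _ h h'
  act_comp s _ _ h h' := PairE.Hom.left_comp f s _ _ h h'
  ract_comp p q _ _ _ h h' := PairE.Hom.right_comp f p q _ _ _ h h'

end

/-! ### The isomorphism of categories -/

section

variable {C : Type u} [Category.{v} C] [MonoidalCategory C] [HasColimits C]

/-- A square of actions commutes if the squares of their components do. -/
theorem actionAt_comp {X Y : Colour → C} {cs : List Colour} {d : Colour}
    {a : RL2Obj C cs d ⊗ tensorList X cs ⟶ X d} {b : RL2Obj C cs d ⊗ tensorList Y cs ⟶ Y d}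
    {f : tensorList X cs ⟶ tensorList Y cs} {g : X d ⟶ Y d} (h : a ≫ g = RL2Obj C cs d ◁ f ≫ b)
    (x : RL2 cs d) : actionAt a x ≫ g = f ≫ actionAt b x := by
  unfold actionAt
  unfold RL2Obj at *
  rw [Category.assoc, Category.assoc, h, ← whisker_exchange_assoc, leftUnitor_inv_naturality_assoc]

variable [SymmetricCategory C]

theorem comp_eq_of_actionAt [MonoidalClosed C] {X Y : Colour → C} {cs : List Colour} {d : Colour}
    {a : RL2Obj C cs d ⊗ tensorList X cs ⟶ X d} {b : RL2Obj C cs d ⊗ tensorList Y cs ⟶ Y d}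
    {f : tensorList X cs ⟶ tensorList Y cs} {g : X d ⟶ Y d}
    (h : ∀ x : RL2 cs d, actionAt a x ≫ g = f ≫ actionAt b x) :
    a ≫ g = RL2Obj C cs d ◁ f ≫ b := by
  refine hom_ext_sigma fun x => ?_
  have := h x
  unfold actionAt at this
  unfold RL2Obj at *
  rw [Category.assoc, Category.assoc] at this
  rwa [← whisker_exchange_assoc, ← leftUnitor_inv_naturality_assoc]

theorem RL2Algebra.Hom.op_comp {X Y : RL2Algebra C} (f : X ⟶ Y) {cs : List Colour} {d : Colour}
    (x : RL2 cs d) :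
    X.op x ≫ colourMap (RL2Algebra.Hom.closedMap f) (RL2Algebra.Hom.openMap f) d =
      tensorMap (colourMap (RL2Algebra.Hom.closedMap f) (RL2Algebra.Hom.openMap f)) cs ≫ Y.op x :=
  actionAt_comp (RL2Algebra.Hom.act_comp f cs d) x

/-- The morphism of pairs that is given by a morphism of algebras. -/
@[reducible]
def RL2Algebra.Hom.raw {X Y : RL2Algebra C} (f : X ⟶ Y) : X.raw.Hom Y.raw where
  mapM := RL2Algebra.Hom.closedMap f
  mapZ := RL2Algebra.Hom.openMap f
  mu_comp n := (RL2Algebra.Hom.op_comp f _).trans (Category.id_comp _)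
  comp_comp p q n l r h h' := by
    have e := RL2Algebra.Hom.op_comp f ⟨_, isRLStage_comp h h'⟩
    rw [Category.assoc]
    refine (congrArg (_ ≫ ·) e).trans ?_
    refine whiskerLeft_tensorHom_comp ?_ _
    exact (congrArg (_ ≫ ·) (tensorHom_id _ _)).trans (rightUnitor_inv_naturality _).symm
  act_comp s _ _ h h' := by
    have e := RL2Algebra.Hom.op_comp f (d := .opened _) ⟨_, isRLStage_act h h'⟩
    rw [Category.assoc]
    refine (congrArg (_ ≫ ·) e).trans ?_
    exact whiskerLeft_tensorHom_comp (collapse_naturality _ _ s) _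
  ract_comp p q n l r h h' := by
    refine (RL2Algebra.Hom.op_comp f (d := .opened _) ⟨_, isRLStage_ract h h'⟩).trans ?_
    change (_ ⊗ₘ 𝟙 (𝟙_ C)) ≫ _ = _
    rw [tensorHom_id]
    rfl

/-- The operations of an algebra are those of its pair: on elements, both respect substitution and
agree on the generators. -/
theorem RL2Algebra.op_laws (X : RL2Algebra C) {cs : List Colour} {d : Colour} (x : RL2 cs d) :
    X.laws.op x = X.op x :=
  hom_ext_tensorList fun Φ t => by
    obtain ⟨ρ, hρ⟩ := exists_map_eq (Sum.inl (X.raw.data Φ).one) List.nodup_range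
      (show (List.range cs.length).length = (RawPair.listOf t).length by
        rw [List.length_range, RawPair.length_listOf])
    obtain ⟨hN, hw⟩ := x.mem_range
    have hv := RawPair.Laws.Represents.valid hρ x List.nodup_range hN hw
    have e1 := X.laws.represents_op x hN hw Φ t ρ hρ
    have e2 : X.ev Φ ρ d x.1 = _ := RL2Algebra.ev_eq_val hv hN List.nodup_range
    have e3 := WordAlgebra.ev_eq (X.laws.wordAlgebra Φ) (X.wordAlgebra Φ) hv
    rw [hw, hρ, RL2Algebra.val_listOf t x.2] at e2
    exact RawPair.ofEl_inj (e1.symm.trans (e3.trans e2))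

section Closed

variable [MonoidalClosed C]

/-- The functor from algebras to pairs. -/
noncomputable def toPair (C : Type u) [Category.{v} C] [MonoidalCategory C] [SymmetricCategory C]
    [HasColimits C] : RL2Algebra C ⥤ PairE C where
  obj X := X.laws.toPairE
  map f := (RL2Algebra.Hom.raw f).toPairE _ _
  map_id _ := rfl
  map_comp _ _ := rfl

/-- The morphism of algebras that is given by a morphism of pairs. -/
noncomputable def RawPair.Hom.toAlgebra {R R' : RawPair C} (φ : R.Hom R') (hR : R.Laws)
    (hR' : R'.Laws) : hR.toAlgebra ⟶ hR'.toAlgebra where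
  closedMap := φ.mapM
  openMap := φ.mapZ
  act_comp cs d := comp_eq_of_actionAt fun x => by
    have e := φ.op_comp hR hR' x
    rw [← hR.op_toAlgebra, ← hR'.op_toAlgebra] at e
    exact e

variable (C) in
/-- The functor from pairs to algebras. -/
noncomputable def toAlgebra : PairE C ⥤ RL2Algebra C where
  obj X := X.laws.toAlgebra
  map f := (PairE.Hom.raw f).toAlgebra _ _
  map_id _ := rfl
  map_comp _ _ := rfl

theorem toAlgebra_obj_toPair_obj (X : RL2Algebra C) : (toAlgebra C).obj ((toPair C).obj X) = X := by
  have h : X.laws.toAlgebra.act = X.act := by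
    funext cs d
    exact hom_ext_components fun x => (X.laws.op_toAlgebra x).trans (X.op_laws x)
  have key : ∀ (act : ∀ (cs : List Colour) (d : Colour),
      RL2Obj C cs d ⊗ tensorList (colourFamily X.closedPart X.openPart) cs ⟶
        colourFamily X.closedPart X.openPart d) h₁ h₂ h₃, act = X.act →
      RL2Algebra.mk X.closedPart X.openPart act h₁ h₂ h₃ = X := by
    rintro _ _ _ _ rfl
    rfl
  exact key _ _ _ _ h

theorem toPair_obj_toAlgebra_obj (X : PairE C) : (toPair C).obj ((toAlgebra C).obj X) = X := by
  have key : ∀ {R : RawPair C} (hR : R.Laws), R = X.raw → hR.toPairE = X.laws.toPairE := by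
    rintro _ hR rfl
    rfl
  exact (key _ X.laws.raw_toAlgebra).trans X.toPairE_raw

instance : (RL2Algebra.forget C).Faithful where
  map_injective h := RL2Algebra.Hom.ext (congrArg Prod.fst h) (congrArg Prod.snd h)

end Closed

end

section

variable (C : Type u) [Category.{v} C] [MonoidalCategory C] [SymmetricCategory C]

instance : (PairE.forget C).Faithful where
  map_injective h := PairE.Hom.ext (NSOperad.Hom.ext (congrArg Prod.fst h)) (congrArg Prod.snd h)

variable [MonoidalClosed C] [HasColimits C]

theorem toPair_comp_toAlgebra : toPair C ⋙ toAlgebra C = 𝟭 (RL2Algebra C) :=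
  -- the `eqToHom`s become identities of the underlying families of objects
  CategoryTheory.Functor.ext toAlgebra_obj_toPair_obj
      fun X Y f => (RL2Algebra.forget C).map_injective <| by
    rw [Functor.map_comp, Functor.map_comp, eqToHom_map, eqToHom_map]
    exact ((Category.id_comp _).trans (Category.comp_id _)).symm

theorem toAlgebra_comp_toPair : toAlgebra C ⋙ toPair C = 𝟭 (PairE C) :=
  CategoryTheory.Functor.ext toPair_obj_toAlgebra_obj
      fun X Y f => (PairE.forget C).map_injective <| by
    rw [Functor.map_comp, Functor.map_comp, eqToHom_map, eqToHom_map]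
    exact ((Category.id_comp _).trans (Category.comp_id _)).symm

end

end SwissCheese

theorem mainTheorem7 (C : Type u) [Category.{v} C] [MonoidalCategory C] [SymmetricCategory C]
    [MonoidalClosed C] [HasColimits C] [HasZeroObject C] :
    ∃ (F : SwissCheese.RL2Algebra C ⥤ SwissCheese.PairE C)
      (G : SwissCheese.PairE C ⥤ SwissCheese.RL2Algebra C),
      F ⋙ G = 𝟭 (SwissCheese.RL2Algebra C) ∧ G ⋙ F = 𝟭 (SwissCheese.PairE C) ∧
        F ⋙ SwissCheese.PairE.forget C = SwissCheese.RL2Algebra.forget C :=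
  ⟨SwissCheese.toPair C, SwissCheese.toAlgebra C, SwissCheese.toPair_comp_toAlgebra C,
    SwissCheese.toAlgebra_comp_toPair C, rfl⟩
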